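/- Let $M$ be a compact smooth Riemannian manifold without boundary, $\mathscr X^1(M)$ the space of $C^1$ vector fields with the $C^1$ topology, and for $Y\in\mathscr X^1(M)$ let $\phi_t=\phi_{Y,t}$ be its flow and ${\rm Sing}(Y)$ its set of zeros. A zero $\sigma$ is hyperbolic if $DY(\sigma)$ has no eigenvalue on the imaginary axis; $T_\sigma M=E^s\oplus E^u$ is the hyperbolic splitting and $v=v^s+v^u$. For $C,\lambda>0$, a norm $|\cdot|$ on $T_\sigma M$ is called $(C,\lambda)$-adapted if it is equivalent to the Riemannian norm with constant $C$ (each of the two norms is at most $C$ times the other) and $|e^{tDY(\sigma)}a|\le e^{-\lambda t}|a|$, $|e^{-tDY(\sigma)}b|\le e^{-\lambda t}|b|$ for $a\in E^s$, $b\in E^u$, $t\ge 0$. Write $\|v\|_\infty=\max(|v^s|,|v^u|)$. **Construction.** Fix adapted norms at the singularities of $Y$ and numbers $r,L_0,K_1,L,\beta>0$, $n_0\in\mathbb N$. For $\sigma\in{\rm Sing}(Y)$ let $B_\rho(\sigma)=\exp_\sigma\{\|v\|_\infty<\rho\}$, $D_\sigma=\exp_\sigma\{\|v\|_\infty\le r,\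 |v^s|=|v^u|\}$, $D_n=D_\sigma\cap(B_{e^{-n}}(\sigma)\setminus B_{e^{-(n+1)}}(\sigma))$, and let $t_x^{\pm}=\inf\{\tau>0:\phi_{\pm\tau}(x)\in\partial B_r(\sigma)\}$ for $x\in D_n$. Put $$O^N(\sigma)=\bigcup_{n>N}\bigcup_{x\in D_n}\phi_{[-t_x^-,t_x^+]}(x),\quad O(\sigma)=O^{n_0}(\sigma),\quad C_n=\phi_{[0,1)}(D_n),$$ $$B^-(\sigma)=O(\sigma)\cap\exp_\sigma\{\|v\|_\infty\le r,\ |v^s|>|v^u|\},\quad B^+(\sigma)=O(\sigma)\setminus\Big(B^-(\sigma)\cup\bigcup_{n>n_0}C_n\Big).$$ For $n>n_0$ let $r_n=\beta L^{-K_1n}L_0e^{-(n+1)}$, let $E_n$ be an $r_n$-separated subset of $\overline{D_n}$ of maximal cardinality, and let $\tilde{\mathscr B}_n$ be a finite measurable partition of $D_n$ such that for each $B\in\tilde{\mathscr B}_n$ there is $x\in E_n$ with $B(x,r_n/2)\cap D_n\subset B\subset \overline B(x,r_n)\cap D_n$. Let $\mathscr B_n=\{\phi_{[0,1)}(B):B\in\tilde{\mathscr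 B}_n\}$ and $$\mathscr A_\sigma=\bigcup_{n>n_0}\mathscr B_n\cup\{B^-(\sigma),B^+(\sigma),O(\sigma)^c\},\qquad \mathscr A_{0,\sigma,N}=\bigcup_{n_0<n\le N}\mathscr B_n\cup\{B^-(\sigma),B^+(\sigma),O(\sigma)^c\}\cup\Big\{\bigcup_{m>N}C_m\Big\}.$$ Let $C_{reg}$ be the closure of $M\setminus\bigcup_\sigma(\overline{O(\sigma)}\cup B_{e^{-(n_0+1)}}(\sigma))$ and let $\mathscr A_{reg}$ be a finite measurable partition of $C_{reg}$ each of whose elements lies in one of the sets $\phi_{(-1/4,1/4)}(\exp_x\{v\perp Y(x):\ \|v\|<\tfrac{\beta}{2L}\|Y(x)\|\})$, $x\in C_{reg}$, where $\|\cdot\|$ is the Riemannian norm; complete it by $M\setminus C_{reg}$ to a partition of $M$. Finally let $$\mathscr A=\mathscr A_{reg}\vee\bigvee_{\sigma}\mathscr A_\sigma,\qquad \mathscr A_{0,N}=\mathscr A_{reg}\vee\bigvee_{\sigma}\mathscr A_{0,\sigma,N}.$$ **Theorem.** Let $X\in\mathscr X^1(M)$ have only hyperbolic singularities and let $C,\lambda>0$.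 There are a $C^1$ neighborhood $\mathcal U$ of $X$, constants $r_1>0$, $0<L_0<L_1$, $0<K_0<K_1$ and numbers $n_{\min}(r)\in\mathbb N$ such that every $Y\in\mathcal U$ has only finitely many singularities, all hyperbolic, and for every $Y\in\mathcal U$, $\sigma\in{\rm Sing}(Y)$ and every $(C,\lambda)$-adapted norm at $\sigma$: * $L_0\,d(x,\sigma)\le\|Y(x)\|\le L_1\,d(x,\sigma)$ for $x\in\overline{B_{r_1}(\sigma)}$; * $t_x^\pm\in[K_0n,K_1n]$ for all $0<r\le r_1$, $n>n_{\min}(r)$ and $x\in D_n$. Moreover, for every $L>1$ (in particular for $L=N_0>1$, the maximum of the constants of the scaled tubular neighborhood theorem for $X$ and $-X$ and of a bound of the time-one scaled linear Poincaré flow near $X$) there is $L_2>0$ such that for all $0<r\le r_1$, $n_0\ge n_{\min}(r)$ and $\beta>0$ there is a function $u:\mathbb N\to\mathbb R$ with $u(N)\to0$ as $N\to\infty$ and the following property. For every $Y\in\mathcal U$, all $(C,\lambda)$-adapted norms at the singularities of $Y$, all partitions $\mathscr A,\mathscr A_{0,N}$ constructed as above for $Y$ and the numbers $r,n_0,L_0,K_1,L,\beta$,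 every probability measure $\mu$ invariant under the flow of $Y$, and every $N>n_0$, the partition $\mathscr A_{0,N}$ is finite, $h_\mu(\phi_1,\mathscr A)<\infty$, and $$h_\mu(\phi_1,\mathscr A)-L_2\sum_{\sigma\in{\rm Sing}(Y)}\mu(O^N(\sigma))-u(N)\le h_\mu(\phi_1,\mathscr A_{0,N})\le h_\mu(\phi_1,\mathscr A).$$ -/

import Mathlib

open Set Filter Topology MeasureTheory Manifold Bundle
open scoped ENNReal ContDiff

noncomputable section

namespace SingularFlow

/-! ### Entropy of countable partitions

A partition is represented by the set of its elements; empty elements are harmless. -/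

section Entropy

variable {M : Type*}

/-- `H_μ(P) = - ∑_{A ∈ P} μ(A) log μ(A)`, with values in `[0, ∞]`. -/
def partEntropy [MeasurableSpace M] (μ : Measure M) (P : Set (Set M)) : ℝ≥0∞ :=
  ∑' A : P, ENNReal.ofReal (Real.negMulLog (μ.real (A : Set M)))

/-- The join `⋁_{i ∈ S} P i`. -/
def joinFamily {ι : Type*} (S : Set ι) (P : ι → Set (Set M)) : Set (Set M) :=
  {A | ∃ f : ι → Set M, (∀ i ∈ S, f i ∈ P i) ∧ A = ⋂ i ∈ S, f i}

/-- The join `P ∨ Q`. -/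
def joinTwo (P Q : Set (Set M)) : Set (Set M) := image2 (· ∩ ·) P Q

/-- The join `⋁_{j = 0}^{n - 1} f^{-j} P`. -/
def dynJoin (f : M → M) (P : Set (Set M)) (n : ℕ) : Set (Set M) :=
  joinFamily (Iio n) fun j => (fun A => f^[j] ⁻¹' A) '' P

/-- `h_μ(f, P) = lim_n (1 / n) H_μ(⋁_{j < n} f^{-j} P)`. (For an invariant probability measure and
a partition of finite entropy the limit exists, so that the upper limit is the limit.) -/
def dynEntropy [MeasurableSpace M] (μ : Measure M) (f : M → M) (P : Set (Set M)) : ℝ≥0∞ :=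
  limsup (fun n : ℕ => partEntropy μ (dynJoin f P n) / n) atTop

/-- `P` is a finite measurable partition of the set `S`. -/
def IsFinPartition [MeasurableSpace M] (P : Set (Set M)) (S : Set M) : Prop :=
  P.Finite ∧ (∀ A ∈ P, MeasurableSet A) ∧ P.PairwiseDisjoint id ∧ ⋃₀ P = S

/-- Distinct points of `F` are at distance larger than `ρ`. -/
def IsSep [EMetricSpace M] (ρ : ℝ) (F : Finset M) : Prop :=
  ∀ x ∈ F, ∀ y ∈ F, x ≠ y → ENNReal.ofReal ρ < edist x y

/-- `F` is a `ρ`-separated subset of `S` with maximal cardinality. -/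
def IsMaxSep [EMetricSpace M] (ρ : ℝ) (S : Set M) (F : Finset M) : Prop :=
  (F : Set M) ⊆ S ∧ IsSep ρ F ∧
    ∀ G : Finset M, (G : Set M) ⊆ S → IsSep ρ G → G.card ≤ F.card

end Entropy

/-! ### Linear hyperbolicity -/

section Linear

variable {d : ℕ}

/-- The space of vectors `v` with `e^{tA} v → 0` as `t → +∞`. -/
def stableSpace (A : EuclideanSpace ℝ (Fin d) →L[ℝ] EuclideanSpace ℝ (Fin d)) :
    Submodule ℝ (EuclideanSpace ℝ (Fin d)) where
  carrier := {v | Tendsto (fun t : ℝ => NormedSpace.exp (t • A) v) atTop (𝓝 0)}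
  add_mem' := by
    intro v w hv hw
    simpa using Tendsto.add (x := atTop) hv hw
  zero_mem' := by simp
  smul_mem' := by
    intro c v hv
    simpa using Tendsto.const_smul (l := atTop) hv c

/-- The space of vectors `v` with `e^{-tA} v → 0` as `t → +∞`. -/
def unstableSpace (A : EuclideanSpace ℝ (Fin d) →L[ℝ] EuclideanSpace ℝ (Fin d)) :
    Submodule ℝ (EuclideanSpace ℝ (Fin d)) := stableSpace (-A)

/-- `A` has no complex eigenvalue on the imaginary axis. -/
def IsHyperbolicMap (A : EuclideanSpace ℝ (Fin d) →L[ℝ] EuclideanSpace ℝ (Fin d)) : Prop :=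
  ∀ z : ℂ, Polynomial.aeval z
    (A : EuclideanSpace ℝ (Fin d) →ₗ[ℝ] EuclideanSpace ℝ (Fin d)).charpoly = 0 → z.re ≠ 0

end Linear

section Manifold

variable (d : ℕ) (M : Type*) [EMetricSpace M] [ChartedSpace (EuclideanSpace ℝ (Fin d)) M]
  [IsManifold (𝓡 d) ∞ M]

/-- The space `𝒳¹(M)` of `C^1` vector fields. -/
abbrev VField : Type _ :=
  ContMDiffSection (𝓡 d) (EuclideanSpace ℝ (Fin d)) 1 (fun x : M => TangentSpace (𝓡 d) x)

variable {d M}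

/-- The expression of the vector field `X` in the chart at `x₀`. -/
def inChart (X : VField d M) (x₀ : M) (z : EuclideanSpace ℝ (Fin d)) :
    EuclideanSpace ℝ (Fin d) :=
  mfderiv (𝓡 d) 𝓘(ℝ, EuclideanSpace ℝ (Fin d)) (extChartAt (𝓡 d) x₀)
    ((extChartAt (𝓡 d) x₀).symm z) (X ((extChartAt (𝓡 d) x₀).symm z))

/-- The vector fields that are `ε`-close to `X`, together with their first derivatives, on the
set `K` in the chart at `x₀`. -/
def c1Nhd (X : VField d M) (x₀ : M) (K : Set (EuclideanSpace ℝ (Fin d))) (ε : ℝ) :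
    Set (VField d M) :=
  {Y | ∀ z ∈ K, ‖inChart Y x₀ z - inChart X x₀ z‖ < ε ∧
    ‖fderiv ℝ (inChart Y x₀) z - fderiv ℝ (inChart X x₀) z‖ < ε}

/-- The `C^1` topology on vector fields: uniform convergence of the components and of their first
derivatives on compact subsets of charts. -/
instance c1Topology : TopologicalSpace (VField d M) :=
  TopologicalSpace.generateFrom
    {V | ∃ (X : VField d M) (x₀ : M) (K : Set (EuclideanSpace ℝ (Fin d))) (ε : ℝ),
      IsCompact K ∧ K ⊆ (extChartAt (𝓡 d) x₀).target ∧ 0 < ε ∧ V = c1Nhd X x₀ K ε}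

open Classical in
/-- The flow `φ_t` of `X`: `t ↦ flow X t x` is the integral curve of `X` through `x` (it exists
and is unique when `M` is compact). -/
def flow (X : VField d M) (t : ℝ) (x : M) : M :=
  if h : ∃ γ : ℝ → M, γ 0 = x ∧ IsMIntegralCurve (I := 𝓡 d) γ (fun y => X y)
  then h.choose t else x

/-- The set of singularities of `X`. -/
def sing (X : VField d M) : Set M := {x | X x = 0}

/-- The derivative of `X` at a singularity `σ`, as an endomorphism of `T_σ M` (Mathlib identifies
`T_σ M` with the model space through the chart at `σ`). -/
def linearPart (X : VField d M) (σ : M) :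
    EuclideanSpace ℝ (Fin d) →L[ℝ] EuclideanSpace ℝ (Fin d) :=
  fderiv ℝ (inChart X σ) (extChartAt (𝓡 d) σ σ)

/-- The stable subspace `E^s` of `T_σ M`. -/
def Es (X : VField d M) (σ : M) : Submodule ℝ (EuclideanSpace ℝ (Fin d)) :=
  stableSpace (linearPart X σ)

/-- The unstable subspace `E^u` of `T_σ M`. -/
def Eu (X : VField d M) (σ : M) : Submodule ℝ (EuclideanSpace ℝ (Fin d)) :=
  unstableSpace (linearPart X σ)

/-- Every singularity of `X` is hyperbolic. -/
def AllHyperbolic (X : VField d M) : Prop := ∀ σ ∈ sing X, IsHyperbolicMap (linearPart X σ)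

/-- An invariant measure of the flow of `X`. -/
def IsInvariant [MeasurableSpace M] (X : VField d M) (μ : Measure M) : Prop :=
  ∀ t : ℝ, MeasurePreserving (flow X t) μ μ

/-- `φ_{[0,1)}(S)`. -/
def flowOut (X : VField d M) (S : Set M) : Set M := image2 (flow X) (Ico 0 1) S

end Manifold

section Riemannian

variable {d : ℕ} {M : Type*} [EMetricSpace M] [ChartedSpace (EuclideanSpace ℝ (Fin d)) M]
  [IsManifold (𝓡 d) ∞ M] [RiemannianBundle (fun x : M => TangentSpace (𝓡 d) x)]

/-! ### Geodesics and the exponential map -/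

/-- The Riemannian metric in the chart at `x₀`: the inner product `g_z(u, w)`. -/
def metricInChart (x₀ : M) (z u w : EuclideanSpace ℝ (Fin d)) : ℝ :=
  inner ℝ
    (mfderiv 𝓘(ℝ, EuclideanSpace ℝ (Fin d)) (𝓡 d) (extChartAt (𝓡 d) x₀).symm z u)
    (mfderiv 𝓘(ℝ, EuclideanSpace ℝ (Fin d)) (𝓡 d) (extChartAt (𝓡 d) x₀).symm z w)

variable (d) in
/-- `c` is a geodesic: a smooth solution of the Euler-Lagrange equation of the energy
`∫ g_y(y', y') / 2`, that is, `(g_y(y', w))' = (1 / 2) (∂_w g)_y(y', y')` in charts for all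
constant vectors `w`. -/
def IsGeodesic (c : ℝ → M) : Prop :=
  ContMDiff 𝓘(ℝ, ℝ) (𝓡 d) ∞ c ∧
  ∀ (t : ℝ) (y : ℝ → EuclideanSpace ℝ (Fin d)), (y = fun s => extChartAt (𝓡 d) (c t) (c s)) →
    ∀ w : EuclideanSpace ℝ (Fin d),
      HasDerivAt (fun s => metricInChart (c t) (y s) (deriv y s) w)
        (1 / 2 * fderiv ℝ (fun z => metricInChart (c t) z (deriv y t) (deriv y t)) (y t) w) t

open Classical in
/-- The Riemannian exponential map `exp_x(v) = c(1)`, where `c` is the geodesic with `c(0) = x`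
and `c'(0) = v` (it exists and is unique when `M` is compact). -/
def expMap (x : M) (v : EuclideanSpace ℝ (Fin d)) : M :=
  if h : ∃ c : ℝ → M, IsGeodesic d c ∧ c 0 = x ∧
      deriv (fun s => extChartAt (𝓡 d) x (c s)) 0 = v
  then h.choose 1 else x

/-- The Riemannian norm on `T_x M`. -/
def rnorm (x : M) (v : TangentSpace (𝓡 d) x) : ℝ := ‖v‖

/-- The speed `|X(x)|`. -/
def speed (X : VField d M) (x : M) : ℝ := ‖X x‖

/-- The normal disc `N_x(ρ) = exp_x {v ∈ T_x M : v ⟂ X(x), |v| < ρ}`. -/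
def normalDisc (X : VField d M) (x : M) (ρ : ℝ) : Set M :=
  {y | ∃ v : TangentSpace (𝓡 d) x, inner ℝ v (X x) = 0 ∧ ‖v‖ < ρ ∧ y = expMap x v}

/-! ### Near a singularity

Below `p` is a norm on `T_σ M`; the components of `v ∈ T_σ M` along `E^s` and `E^u` are denoted by
`a` and `b`, and `max (p a) (p b)` is the box norm of `v`. -/

/-- `p` is a norm on `T_σ M`, equivalent to the Riemannian one with constant `C`, for which the
linearised flow contracts `E^s` in positive time and `E^u` in negative time with rate `lam`. -/
def IsAdapted (C lam : ℝ) (X : VField d M) (σ : M)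
    (p : Seminorm ℝ (EuclideanSpace ℝ (Fin d))) : Prop :=
  (∀ v, p v ≤ C * rnorm σ v ∧ rnorm σ v ≤ C * p v) ∧
  (∀ a ∈ Es X σ, ∀ t : ℝ, 0 ≤ t →
    p (NormedSpace.exp (t • linearPart X σ) a) ≤ Real.exp (-lam * t) * p a) ∧
  (∀ b ∈ Eu X σ, ∀ t : ℝ, 0 ≤ t →
    p (NormedSpace.exp (-t • linearPart X σ) b) ≤ Real.exp (-lam * t) * p b)

/-- The image under `exp_σ` of the vectors whose components satisfy `Q`. -/
def expSet (X : VField d M) (σ : M)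
    (Q : EuclideanSpace ℝ (Fin d) → EuclideanSpace ℝ (Fin d) → Prop) : Set M :=
  {x | ∃ a ∈ Es X σ, ∃ b ∈ Eu X σ, Q a b ∧ x = expMap σ (a + b)}

/-- The box `B_r(σ)`. -/
def box (X : VField d M) (σ : M) (p : Seminorm ℝ (EuclideanSpace ℝ (Fin d))) (r : ℝ) : Set M :=
  expSet X σ fun a b => max (p a) (p b) < r

/-- The cross section `D_σ = exp_σ {v : |v| ≤ r, |v^s| = |v^u|}`. -/
def crossSection (X : VField d M) (σ : M) (p : Seminorm ℝ (EuclideanSpace ℝ (Fin d))) (r : ℝ) :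
    Set M :=
  expSet X σ fun a b => max (p a) (p b) ≤ r ∧ p a = p b

/-- The layer `D_n = D_σ ∩ (B_{e^{-n}}(σ) \ B_{e^{-(n+1)}}(σ))`. -/
def layer (X : VField d M) (σ : M) (p : Seminorm ℝ (EuclideanSpace ℝ (Fin d))) (r : ℝ) (n : ℕ) :
    Set M :=
  crossSection X σ p r ∩
    (box X σ p (Real.exp (-(n : ℝ))) \ box X σ p (Real.exp (-((n : ℝ) + 1))))

/-- `t^+_x`, the first positive time at which the orbit of `x` meets `∂ B_r(σ)`. -/
def tPlus (X : VField d M) (σ : M) (p : Seminorm ℝ (EuclideanSpace ℝ (Fin d))) (r : ℝ) (x : M) :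
    ℝ :=
  sInf {τ | 0 < τ ∧ flow X τ x ∈ frontier (box X σ p r)}

/-- `t^-_x`, the same for the backward orbit. -/
def tMinus (X : VField d M) (σ : M) (p : Seminorm ℝ (EuclideanSpace ℝ (Fin d))) (r : ℝ) (x : M) :
    ℝ :=
  sInf {τ | 0 < τ ∧ flow X (-τ) x ∈ frontier (box X σ p r)}

/-- `O^N(σ) = ⋃_{n > N} ⋃_{x ∈ D_n} φ_{[-t^-_x, t^+_x]}(x)`; moreover `O(σ) = O^{n₀}(σ)`. -/
def orbitRegion (X : VField d M) (σ : M) (p : Seminorm ℝ (EuclideanSpace ℝ (Fin d))) (r : ℝ)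
    (N : ℕ) : Set M :=
  ⋃ n > N, ⋃ x ∈ layer X σ p r n,
    (fun t => flow X t x) '' Icc (-tMinus X σ p r x) (tPlus X σ p r x)

/-- The cell `C_n = φ_{[0,1)}(D_n)`. -/
def cell (X : VField d M) (σ : M) (p : Seminorm ℝ (EuclideanSpace ℝ (Fin d))) (r : ℝ) (n : ℕ) :
    Set M := flowOut X (layer X σ p r n)

/-- `B^-(σ)`, the part of `O(σ)` that lies before the cross section. -/
def regionMinus (X : VField d M) (σ : M) (p : Seminorm ℝ (EuclideanSpace ℝ (Fin d))) (r : ℝ)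
    (n₀ : ℕ) : Set M :=
  orbitRegion X σ p r n₀ ∩ expSet X σ fun a b => max (p a) (p b) ≤ r ∧ p b < p a

/-- `B^+(σ)`, the part of `O(σ)` that lies after the cells `C_n`. -/
def regionPlus (X : VField d M) (σ : M) (p : Seminorm ℝ (EuclideanSpace ℝ (Fin d))) (r : ℝ)
    (n₀ : ℕ) : Set M :=
  orbitRegion X σ p r n₀ \ (regionMinus X σ p r n₀ ∪ ⋃ n > n₀, cell X σ p r n)

/-! ### The partitions -/

/-- The numbers entering the construction: the size `r` of the boxes, the first index `n₀`,
the constants `L₀`, `K₁` of the flow near the singularities, and the constants `L`, `β`. -/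
structure Params where
  r : ℝ
  n₀ : ℕ
  L₀ : ℝ
  K₁ : ℝ
  L : ℝ
  β : ℝ

/-- The radius `r_n = β L^{-K₁ n} L₀ e^{-(n+1)}`. -/
def Params.radius (c : Params) (n : ℕ) : ℝ :=
  c.β * c.L ^ (-(c.K₁ * n)) * c.L₀ * Real.exp (-((n : ℝ) + 1))

/-- `C_reg`, the closure of the complement of the sets `Cl(O(σ))`. The box of size `e^{-(n₀+1)}`
is contained in `Cl(O(σ))` unless `σ` is a sink or a source; in that case `O(σ)` is empty and the
box keeps `C_reg` away from `σ`. -/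
def Creg (X : VField d M) (p : M → Seminorm ℝ (EuclideanSpace ℝ (Fin d))) (c : Params) : Set M :=
  closure (⋃ σ ∈ sing X, (closure (orbitRegion X σ (p σ) c.r c.n₀) ∪
    box X σ (p σ) (Real.exp (-((c.n₀ : ℝ) + 1)))))ᶜ

/-- The flow box `B(x) = φ_{(-1/4, 1/4)}(N_x(β |X(x)| / (2 L)))`. -/
def flowBox (X : VField d M) (c : Params) (x : M) : Set M :=
  image2 (flow X) (Ioo (-(1 / 4)) (1 / 4)) (normalDisc X x (c.β / (2 * c.L) * speed X x))

/-- The choices made in the construction of `𝒜`: for every singularity `σ` and `n > n₀`, a maximal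
`r_n`-separated set `E_n` in `Cl(D_n)` and a finite partition `slab σ n` of `D_n` each of whose
elements `B` satisfies `B_{r_n/2}(x) ∩ D_n ⊆ B ⊆ B_{r_n}(x) ∩ D_n` for some `x ∈ E_n`; and a finite
partition `reg` of `C_reg` subordinate to the covering by the flow boxes `B(x)`, `x ∈ C_reg`. -/
structure Choices [MeasurableSpace M] (X : VField d M)
    (p : M → Seminorm ℝ (EuclideanSpace ℝ (Fin d))) (c : Params) where
  net : M → ℕ → Finset M
  net_max : ∀ σ ∈ sing X, ∀ n > c.n₀,
    IsMaxSep (c.radius n) (closure (layer X σ (p σ) c.r n)) (net σ n)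
  slab : M → ℕ → Set (Set M)
  slab_part : ∀ σ ∈ sing X, ∀ n > c.n₀, IsFinPartition (slab σ n) (layer X σ (p σ) c.r n)
  slab_ball : ∀ σ ∈ sing X, ∀ n > c.n₀, ∀ B ∈ slab σ n, ∃ x ∈ net σ n,
    {y | edist y x < ENNReal.ofReal (c.radius n / 2)} ∩ layer X σ (p σ) c.r n ⊆ B ∧
      B ⊆ {y | edist y x ≤ ENNReal.ofReal (c.radius n)} ∩ layer X σ (p σ) c.r n
  reg : Set (Set M)
  reg_part : IsFinPartition reg (Creg X p c)
  reg_sub : ∀ A ∈ reg, ∃ x ∈ Creg X p c, A ⊆ flowBox X c x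

section Partitions

variable [MeasurableSpace M] {X : VField d M} {p : M → Seminorm ℝ (EuclideanSpace ℝ (Fin d))}
  {c : Params}

/-- The partition `ℬ_n` of `C_n`. -/
def Choices.cells (S : Choices X p c) (σ : M) (n : ℕ) : Set (Set M) := flowOut X '' S.slab σ n

/-- The elements `B^-(σ)`, `B^+(σ)` and the complement of `O(σ)`. -/
def outerCells (X : VField d M) (p : M → Seminorm ℝ (EuclideanSpace ℝ (Fin d))) (c : Params)
    (σ : M) : Set (Set M) :=
  {regionMinus X σ (p σ) c.r c.n₀, regionPlus X σ (p σ) c.r c.n₀,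
    (orbitRegion X σ (p σ) c.r c.n₀)ᶜ}

/-- The countable partition `𝒜_σ`. -/
def Choices.localPart (S : Choices X p c) (σ : M) : Set (Set M) :=
  (⋃ n > c.n₀, S.cells σ n) ∪ outerCells X p c σ

/-- The finite partition `𝒜_{σ,N}`: all elements in the cells `C_m`, `m > N`, are merged. -/
def Choices.localPartN (S : Choices X p c) (N : ℕ) (σ : M) : Set (Set M) :=
  (⋃ n ∈ Ioc c.n₀ N, S.cells σ n) ∪ outerCells X p c σ ∪ {⋃ m > N, cell X σ (p σ) c.r m}

/-- `𝒜_reg`, completed by the complement of `C_reg` to a partition of `M`. -/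
def Choices.regPart (S : Choices X p c) : Set (Set M) := insert (Creg X p c)ᶜ S.reg

/-- The partition `𝒜 = 𝒜_reg ∨ ⋁_σ 𝒜_σ`. -/
def Choices.part (S : Choices X p c) : Set (Set M) :=
  joinTwo S.regPart (joinFamily (sing X) S.localPart)

/-- The finite partition `𝒜_{0,N} = 𝒜_reg ∨ ⋁_σ 𝒜_{σ,N}`. -/
def Choices.partN (S : Choices X p c) (N : ℕ) : Set (Set M) :=
  joinTwo S.regPart (joinFamily (sing X) (S.localPartN N))

end Partitions

end Riemannian

end SingularFlow

end

/-! The partitions $\mathscr A$ and $\mathscr A_{0,N}$ differ only at the cells of $C_m$, $m>N$,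
which are merged into one element at each singularity. Such a merge costs little entropy. If one
partition determines another outside of a set of merged elements, then joining them adds at most the
sum of $-\mu\log\mu$ over the merged elements (`fiberEnt_prod_le`, from $\log x\le x-1$). By
invariance every iterate pays the same price, so the dynamical entropy drops by at most
$\sum_\sigma\sum_{A}-\mu(A)\log\mu(A)$, with $A$ running over the tail cells (`dynEntropy_merge`).
It remains to bound this tail sum.

Two facts do so. The number of cells in $C_m$ is at most $e^{A_1m+A_0}$, because an $r_m$-separated
set in a $d$-dimensional box has at most polynomially many points in $1/r_m$ and $r_m$ decays
exponentially (`Choices.ncard_slab_le_exp`). The measures of the $C_m$ are small: an orbit starting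
in $D_m$ stays in the box for a time at least $K_0m$, so the first $\lfloor K_0m\rfloor$ images of
$C_m$ under the time-one map are disjoint subsets of $O^N$ of equal measure, and $\sum_{m>N}\lfloor
K_0m\rfloor\mu(C_m)\le\mu(O^N)$ (`SaddleBox.tower`). The tangent line bound $-x\log x\le
ax+e^{-a-1}$, with $a$ affine in $m$, bounds the entropy of the cells of $C_m$ by
$(A_1m+A_0+m)\mu(C_m)+e^{-m-1}$. The part proportional to $m$ sums to $L_2\,\mu(O^N)$; the constant
$A_0$, which carries the dependence on $\beta$, is divided by $N$ and goes into $u(N)$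
(`Choices.tail_entropy_le`).

The exit times and the disjointness come from a cone argument. In exponential coordinates the flow
near $\sigma$ is a small perturbation of its linear part, so the adapted norms of the stable and
unstable components satisfy one-sided differential inequalities (`IsSplitting.coneCurve`). After
crossing $|v^s|=|v^u|$ the unstable component dominates and grows exponentially, between two fixed
rates (`ConeCurve.lt`, `ConeCurve.growth_lower`, `ConeCurve.growth_upper`). Hence the exit times are
comparable with $n$ (`ExitBox.exitTime_layer`), and an orbit segment in the box meets the section
only once (`SaddleBox.injOn`). This injectivity also gives the measurability of the cells, as
injective continuous images of Borel sets.

All constants must be uniform in $Y$ and in the adapted norm. They are read in a fixed chart at a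
point of $M$, where the exponential map is close to the identity (`expMap_near_identity`) and the
derivative of $Y$ is close to that of $X$; the projections onto $E^s$ and $E^u$ are bounded in terms
of $\lambda$ and a norm bound alone (`projBound`). Compactness of $M$ then passes from one chart to
all of $M$ (`exists_localModel`, `exists_globalModel`). -/

noncomputable section

namespace SingularFlow

set_option linter.unusedSectionVars false

/-! ### Entropy of countable partitions and the cost of merging elements -/

section FiberEntropy

variable {M ι κ ρ : Type*}

/-- The entropy of the partition of `M` into the fibers of `ξ`. -/
def fiberEnt [MeasurableSpace M] (μ : Measure M) (ξ : M → ι) : ℝ≥0∞ :=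
  ∑' i, ENNReal.ofReal (Real.negMulLog (μ.real (ξ ⁻¹' {i})))

/-- The nonempty elements of `P` are the nonempty fibers of `ξ`. -/
def Represents (P : Set (Set M)) (ξ : M → ι) : Prop :=
  ∀ A : Set M, A.Nonempty → (A ∈ P ↔ ∃ i, A = ξ ⁻¹' {i})

theorem Represents.partEntropy_eq [MeasurableSpace M] (μ : Measure M) {P : Set (Set M)} {ξ : M → ι}
    (h : Represents P ξ) : partEntropy μ P = fiberEnt μ ξ := by
  have hne : ∀ A : Set M, ENNReal.ofReal (Real.negMulLog (μ.real A)) ≠ 0 → A.Nonempty := by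
    intro A hA
    by_contra hc
    rw [not_nonempty_iff_eq_empty.1 hc] at hA
    simp at hA
  refine tsum_eq_tsum_of_ne_zero_bij
    (fun i => ⟨ξ ⁻¹' {i.1}, (h _ (hne _ i.2)).2 ⟨i.1, rfl⟩⟩) ?_ ?_ fun _ => rfl
  · intro i j hij
    obtain ⟨x, hx⟩ := hne _ i.2
    have h1 : ξ ⁻¹' {i.1} = ξ ⁻¹' {j.1} := congrArg Subtype.val hij
    have h2 : x ∈ ξ ⁻¹' {j.1} := h1 ▸ hx
    exact Subtype.ext (hx.symm.trans h2)
  · rintro ⟨A, hA⟩ hAs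
    obtain ⟨i, rfl⟩ := (h A (hne A hAs)).1 hA
    exact ⟨⟨i, hAs⟩, rfl⟩

theorem Represents.join_family {S : Set κ} {P : κ → Set (Set M)} {ξ : κ → M → ι}
    (h : ∀ i ∈ S, Represents (P i) (ξ i)) :
    Represents (joinFamily S P) (fun x (i : S) => ξ i x) := by
  intro A hA
  constructor
  · rintro ⟨f, hf, rfl⟩
    obtain ⟨x, hx⟩ := hA
    simp only [mem_iInter] at hx
    refine ⟨fun i => ξ i x, ?_⟩
    have : ∀ i ∈ S, f i = ξ i ⁻¹' {ξ i x} := fun i hi => by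
      obtain ⟨k, hk⟩ := ((h i hi) _ ⟨x, hx i hi⟩).1 (hf i hi)
      have h1 : x ∈ ξ i ⁻¹' {k} := hk ▸ hx i hi
      rw [hk, show ξ i x = k from h1]
    ext y
    simp only [mem_iInter, mem_preimage, mem_singleton_iff, funext_iff, Subtype.forall]
    refine forall₂_congr fun i hi => ?_
    rw [this i hi]
    rfl
  · rintro ⟨k, rfl⟩
    obtain ⟨x, hx⟩ := hA
    have hx' : ∀ i : S, ξ i x = k i := fun i => congrFun hx i
    refine ⟨fun i => ξ i ⁻¹' {ξ i x}, fun i hi =>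
      ((h i hi) (ξ i ⁻¹' {ξ i x}) ⟨x, rfl⟩).2 ⟨_, rfl⟩, ?_⟩
    ext y
    simp only [mem_iInter, mem_preimage, mem_singleton_iff, funext_iff, Subtype.forall]
    exact forall₂_congr fun i hi => by rw [← hx' ⟨i, hi⟩]

theorem Represents.join_two {P Q : Set (Set M)} {ξ : M → ι} {ζ : M → κ} (hP : Represents P ξ)
    (hQ : Represents Q ζ) : Represents (joinTwo P Q) (fun x => (ξ x, ζ x)) := by
  intro A hA
  constructor
  · rintro ⟨B, hB, C, hC, rfl⟩
    obtain ⟨i, rfl⟩ := (hP B hA.left).1 hB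
    obtain ⟨k, rfl⟩ := (hQ C hA.right).1 hC
    exact ⟨(i, k), by ext; simp⟩
  · rintro ⟨⟨i, k⟩, rfl⟩
    have e : (fun x => (ξ x, ζ x)) ⁻¹' {(i, k)} = ξ ⁻¹' {i} ∩ ζ ⁻¹' {k} := by ext; simp
    rw [e] at hA ⊢
    exact ⟨_, (hP _ hA.left).2 ⟨i, rfl⟩, _, (hQ _ hA.right).2 ⟨k, rfl⟩, rfl⟩

theorem Represents.comp {P : Set (Set M)} {ξ : M → ι} (h : Represents P ξ) (f : M → M) :
    Represents ((fun A => f ⁻¹' A) '' P) (fun x => ξ (f x)) := by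
  intro A hA
  constructor
  · rintro ⟨B, hB, rfl⟩
    obtain ⟨x, hx⟩ := hA
    obtain ⟨i, rfl⟩ := (h B ⟨f x, hx⟩).1 hB
    exact ⟨i, rfl⟩
  · rintro ⟨i, rfl⟩
    obtain ⟨x, hx⟩ := hA
    exact ⟨ξ ⁻¹' {i}, (h (ξ ⁻¹' {i}) ⟨f x, hx⟩).2 ⟨i, rfl⟩, rfl⟩

theorem Represents.dyn_join {P : Set (Set M)} {ξ : M → ι} (h : Represents P ξ) (f : M → M) (n : ℕ) :
    Represents (dynJoin f P n) (fun x (j : Iio n) => ξ (f^[j] x)) :=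
  Represents.join_family (ξ := fun j x => ξ (f^[j] x)) fun j _ => h.comp f^[j]

/-- Labels replace sets of sets from here on: joins become tuples of labels and $f^{-1}$ becomes
composition, so that refinement is a statement about equality of labels. -/
theorem exists_represents {P : Set (Set M)} (hc : P.Countable) (hd : P.PairwiseDisjoint id)
    (hu : ⋃₀ P = univ) : ∃ ξ : M → ℕ, Represents P ξ := by
  obtain ⟨e, he⟩ := countable_iff_exists_injOn.1 hc
  have hx : ∀ x : M, ∃ A ∈ P, x ∈ A := fun x => mem_sUnion.1 (hu ▸ mem_univ x)
  choose α hαP hα using hx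
  have key : ∀ A ∈ P, ∀ x, e (α x) = e A ↔ x ∈ A := fun A hA x => by
    constructor
    · intro h
      exact he (hαP x) hA h ▸ hα x
    · intro h
      by_contra hne
      exact (hd (hαP x) hA fun h' => hne (by rw [h'])).le_bot ⟨hα x, h⟩
  refine ⟨fun x => e (α x), fun A hA => ⟨fun h => ⟨e A, ?_⟩, ?_⟩⟩
  · ext x
    exact (key A h x).symm
  · rintro ⟨i, rfl⟩
    obtain ⟨x, rfl⟩ := hA
    convert hαP x
    ext y
    exact key _ (hαP x) y

variable [MeasurableSpace M] {μ : Measure M}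

theorem ofReal_negMulLog (p : ℝ) (hp : 0 ≤ p) :
    ENNReal.ofReal (Real.negMulLog p) = ENNReal.ofReal p * ENNReal.ofReal (-Real.log p) := by
  rw [← ENNReal.ofReal_mul hp, Real.negMulLog, neg_mul, mul_neg]

theorem fiberEnt_eq [IsFiniteMeasure μ] (ξ : M → ι) : fiberEnt μ ξ =
    ∑' i, μ (ξ ⁻¹' {i}) * ENNReal.ofReal (-Real.log (μ.real (ξ ⁻¹' {i}))) :=
  tsum_congr fun i => by rw [ofReal_negMulLog _ measureReal_nonneg, ofReal_measureReal]

theorem measure_eq_tsum_fiber [Countable ι] {ξ : M → ι} (hξ : ∀ i, MeasurableSet (ξ ⁻¹' {i}))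
    (A : Set M) : μ A = ∑' i, μ (A ∩ ξ ⁻¹' {i}) := by
  have h1 : ∑' i, μ (A ∩ ξ ⁻¹' {i}) = ∑' i, μ.restrict A (ξ ⁻¹' {i}) :=
    tsum_congr fun i => by rw [Measure.restrict_apply (hξ i), inter_comm]
  rw [h1, ← measure_iUnion (fun i j hij => ?_) hξ]
  · rw [← preimage_iUnion, iUnion_of_singleton, preimage_univ, Measure.restrict_apply_univ]
  · exact Disjoint.preimage _ (by simpa using hij)

theorem neg_log_nonneg [IsProbabilityMeasure μ] (A : Set M) : 0 ≤ -Real.log (μ.real A) :=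
  neg_nonneg.2 (Real.log_nonpos measureReal_nonneg measureReal_le_one)

/-- Split each atom of `η` into the atoms of `ξ` that it contains; $-\log\mu$ only grows on passing
to the smaller atom. -/
theorem fiberEnt_mono [IsProbabilityMeasure μ] [Countable ι] [Countable κ] {ξ : M → ι} {η : M → κ}
    (hξ : ∀ i, MeasurableSet (ξ ⁻¹' {i})) (hη : ∀ i, MeasurableSet (η ⁻¹' {i}))
    (h : ∀ x y, ξ x = ξ y → η x = η y) : fiberEnt μ η ≤ fiberEnt μ ξ := by
  rw [fiberEnt_eq, fiberEnt_eq]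
  calc ∑' k, μ (η ⁻¹' {k}) * ENNReal.ofReal (-Real.log (μ.real (η ⁻¹' {k})))
      = ∑' k, ∑' i, μ (η ⁻¹' {k} ∩ ξ ⁻¹' {i}) *
          ENNReal.ofReal (-Real.log (μ.real (η ⁻¹' {k}))) :=
        tsum_congr fun k => by rw [measure_eq_tsum_fiber hξ, ENNReal.tsum_mul_right]
    _ ≤ ∑' k, ∑' i, μ (ξ ⁻¹' {i} ∩ η ⁻¹' {k}) *
          ENNReal.ofReal (-Real.log (μ.real (ξ ⁻¹' {i}))) := by
        refine ENNReal.tsum_le_tsum fun k => ENNReal.tsum_le_tsum fun i => ?_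
        rw [inter_comm]
        by_cases h0 : μ (ξ ⁻¹' {i} ∩ η ⁻¹' {k}) = 0
        · simp [h0]
        refine mul_le_mul_right (ENNReal.ofReal_le_ofReal (neg_le_neg (Real.log_le_log ?_
          (measureReal_mono ?_)))) _
        · have : μ.real (ξ ⁻¹' {i}) ≠ 0 := fun h' => h0 (measure_mono_null inter_subset_left
            ((measureReal_eq_zero_iff).1 h'))
          exact lt_of_le_of_ne measureReal_nonneg this.symm
        · obtain ⟨x, hx, hx'⟩ := nonempty_of_measure_ne_zero h0
          intro y hy
          exact (h y x (hy.trans hx.symm)).trans hx'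
    _ = _ := by
        rw [ENNReal.tsum_comm]
        exact tsum_congr fun i => by
          rw [ENNReal.tsum_mul_right, ← measure_eq_tsum_fiber hη]

theorem tsum_indicator_fiber [Countable ι] {g : M → ι} (hg : ∀ i, MeasurableSet (g ⁻¹' {i}))
    (V : Set ι) : ∑' i, V.indicator (fun i => μ (g ⁻¹' {i})) i = μ (g ⁻¹' V) := by
  rw [measure_eq_tsum_fiber hg]
  refine tsum_congr fun i => ?_
  by_cases hi : i ∈ V
  · rw [indicator_of_mem hi, inter_eq_right.2 (preimage_mono (singleton_subset_iff.2 hi))]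
  · rw [indicator_of_notMem hi]
    have : g ⁻¹' V ∩ g ⁻¹' {i} = ∅ := by
      rw [← preimage_inter, inter_singleton_eq_empty.2 hi, preimage_empty]
    rw [this, measure_empty]

/-- The entropy added by `ξ` when `ξ` is determined by `ζ` outside of the fibers over `τ`. -/
theorem fiberEnt_prod_le [IsProbabilityMeasure μ] [Countable ι] [Countable ρ] {ζ : M → ρ}
    {ξ : M → ι} (hζ : ∀ i, MeasurableSet (ζ ⁻¹' {i})) (hξ : ∀ i, MeasurableSet (ξ ⁻¹' {i}))
    (τ : Set ι) (h : ∀ x y, ζ x = ζ y → ξ x = ξ y ∨ (ξ x ∈ τ ∧ ξ y ∈ τ)) :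
    fiberEnt μ (fun x => (ζ x, ξ x)) ≤ fiberEnt μ ζ +
      ∑' i, τ.indicator (fun i => ENNReal.ofReal (Real.negMulLog (μ.real (ξ ⁻¹' {i})))) i := by
  classical
  -- `Z` collects the labels of `ζ` whose fiber meets the merged region. By `h` such a fiber lies
  -- entirely inside that region, so $\zeta^{-1}(Z)=\xi^{-1}(\tau)$.
  set Z : Set ρ := {q | ∃ x, ζ x = q ∧ ξ x ∈ τ} with hZ
  set L : Set M → ℝ≥0∞ := fun A => ENNReal.ofReal (-Real.log (μ.real A)) with hL
  have hpre : ∀ q i, (fun x => (ζ x, ξ x)) ⁻¹' {(q, i)} = ζ ⁻¹' {q} ∩ ξ ⁻¹' {i} := fun q i => by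
    ext; simp
  have hTZ : ζ ⁻¹' Z = ξ ⁻¹' τ := by
    ext x
    constructor
    · rintro ⟨y, hy, hyτ⟩
      rcases h y x hy with h1 | h1
      · show ξ x ∈ τ
        rwa [← h1]
      · exact h1.2
    · exact fun hx => ⟨x, rfl, hx⟩
  -- The inequality on one atom, with all terms moved to the side where they are positive, since
  -- subtraction in `ℝ≥0∞` truncates. The extra $\mu$ on the left sums to 1, and the last two terms
  -- on the right sum to at most 1, so they cancel at the end.
  have hterm : ∀ q i, μ (ζ ⁻¹' {q} ∩ ξ ⁻¹' {i}) * L (ζ ⁻¹' {q} ∩ ξ ⁻¹' {i}) +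
      μ (ζ ⁻¹' {q} ∩ ξ ⁻¹' {i}) ≤ μ (ζ ⁻¹' {q} ∩ ξ ⁻¹' {i}) * L (ζ ⁻¹' {q}) +
      τ.indicator (fun i => μ (ζ ⁻¹' {q} ∩ ξ ⁻¹' {i}) * L (ξ ⁻¹' {i})) i +
      Z.indicator (fun q => μ (ζ ⁻¹' {q})) q * τ.indicator (fun i => μ (ξ ⁻¹' {i})) i +
      Zᶜ.indicator (fun q => μ (ζ ⁻¹' {q} ∩ ξ ⁻¹' {i})) q := by
    intro q i
    by_cases h0 : μ (ζ ⁻¹' {q} ∩ ξ ⁻¹' {i}) = 0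
    · simp [h0]
    obtain ⟨x, hxq, hxi⟩ := nonempty_of_measure_ne_zero h0
    by_cases hi : i ∈ τ
    · have hq : q ∈ Z := ⟨x, hxq, by rwa [show ξ x = i from hxi]⟩
      rw [indicator_of_mem hi, indicator_of_mem hi, indicator_of_mem hq,
        indicator_of_notMem (show q ∉ Zᶜ from fun hq' => hq' hq), add_zero]
      set a := μ.real (ζ ⁻¹' {q} ∩ ξ ⁻¹' {i}) with ha
      have hae : μ (ζ ⁻¹' {q} ∩ ξ ⁻¹' {i}) = ENNReal.ofReal a := by rw [ofReal_measureReal]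
      have hapos : 0 < a := by
        rw [hae] at h0
        simpa using h0
      have hb : a ≤ μ.real (ζ ⁻¹' {q}) := measureReal_mono inter_subset_left
      have hc : a ≤ μ.real (ξ ⁻¹' {i}) := measureReal_mono inter_subset_right
      rw [hae, ← ofReal_measureReal (μ := μ) (s := ζ ⁻¹' {q}),
        ← ofReal_measureReal (μ := μ) (s := ξ ⁻¹' {i})]
      simp only [hL]
      rw [← ENNReal.ofReal_mul hapos.le, ← ENNReal.ofReal_mul hapos.le,
        ← ENNReal.ofReal_mul hapos.le, ← ENNReal.ofReal_mul measureReal_nonneg,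
        ← ENNReal.ofReal_add (mul_nonneg hapos.le (neg_log_nonneg _)) hapos.le,
        ← ENNReal.ofReal_add (mul_nonneg hapos.le (neg_log_nonneg _))
          (mul_nonneg hapos.le (neg_log_nonneg _)),
        ← ENNReal.ofReal_add (add_nonneg (mul_nonneg hapos.le (neg_log_nonneg _))
          (mul_nonneg hapos.le (neg_log_nonneg _)))
          (mul_nonneg measureReal_nonneg measureReal_nonneg)]
      refine ENNReal.ofReal_le_ofReal ?_
      have hbp := hapos.trans_le hb
      have hcp := hapos.trans_le hc
      -- $\log x\le x-1$ at $x=\mu(B)\mu(C)/\mu(B\cap C)$, multiplied by $\mu(B\cap C)$.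
      have hlog := Real.log_le_sub_one_of_pos
        (show 0 < μ.real (ζ ⁻¹' {q}) * μ.real (ξ ⁻¹' {i}) / a by positivity)
      rw [Real.log_div (by positivity) hapos.ne', Real.log_mul hbp.ne' hcp.ne'] at hlog
      have := mul_le_mul_of_nonneg_left hlog hapos.le
      rw [mul_sub, mul_sub, mul_div_cancel₀ _ hapos.ne'] at this
      nlinarith
    -- Outside of `τ` the label of `ζ` determines that of `ξ`: the atom of the join is a full fiber
    -- of `ζ` and nothing is added.
    · have hq : q ∉ Z := by
        rintro ⟨y, hy, hyτ⟩
        rcases h y x (hy.trans hxq.symm) with h1 | h1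
        · exact hi ((h1.trans hxi) ▸ hyτ)
        · exact hi ((show ξ x = i from hxi) ▸ h1.2)
      have he : ζ ⁻¹' {q} ∩ ξ ⁻¹' {i} = ζ ⁻¹' {q} := by
        refine inter_eq_left.2 fun y hy => ?_
        rcases h y x (hy.trans hxq.symm) with h1 | h1
        · exact h1.trans hxi
        · exact absurd ((show ξ x = i from hxi) ▸ h1.2) hi
      rw [indicator_of_notMem hi, indicator_of_notMem hi, indicator_of_mem (show q ∈ Zᶜ from hq), he]
      simp
  have hsum := ENNReal.tsum_le_tsum fun q => ENNReal.tsum_le_tsum fun i => hterm q i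
  simp only [ENNReal.tsum_add] at hsum
  have e1 : ∑' q, ∑' i, μ (ζ ⁻¹' {q} ∩ ξ ⁻¹' {i}) = 1 := by
    simp only [← measure_eq_tsum_fiber hξ]
    have := measure_eq_tsum_fiber (μ := μ) hζ univ
    simp only [univ_inter, measure_univ] at this
    exact this.symm
  have e2 : ∑' q, ∑' i, μ (ζ ⁻¹' {q} ∩ ξ ⁻¹' {i}) * L (ζ ⁻¹' {q}) = fiberEnt μ ζ := by
    rw [fiberEnt_eq]
    exact tsum_congr fun q => by rw [ENNReal.tsum_mul_right, ← measure_eq_tsum_fiber hξ]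
  have e3 : ∑' q, ∑' i, τ.indicator (fun i => μ (ζ ⁻¹' {q} ∩ ξ ⁻¹' {i}) * L (ξ ⁻¹' {i})) i =
      ∑' i, τ.indicator (fun i => ENNReal.ofReal (Real.negMulLog (μ.real (ξ ⁻¹' {i})))) i := by
    rw [ENNReal.tsum_comm]
    refine tsum_congr fun i => ?_
    by_cases hi : i ∈ τ
    · simp only [indicator_of_mem hi]
      rw [ENNReal.tsum_mul_right, ofReal_negMulLog _ measureReal_nonneg, ofReal_measureReal]
      simp only [inter_comm (ζ ⁻¹' _)]
      rw [← measure_eq_tsum_fiber hζ]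
    · simp [indicator_of_notMem hi]
  have e4 : ∑' q, ∑' i, Z.indicator (fun q => μ (ζ ⁻¹' {q})) q *
      τ.indicator (fun i => μ (ξ ⁻¹' {i})) i = μ (ξ ⁻¹' τ) * μ (ξ ⁻¹' τ) := by
    simp only [ENNReal.tsum_mul_left, ENNReal.tsum_mul_right]
    rw [tsum_indicator_fiber hξ, tsum_indicator_fiber hζ, hTZ]
  have e5 : ∑' q, ∑' i, Zᶜ.indicator (fun q => μ (ζ ⁻¹' {q} ∩ ξ ⁻¹' {i})) q =
      μ (ζ ⁻¹' Zᶜ) := by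
    rw [← tsum_indicator_fiber hζ]
    refine tsum_congr fun q => ?_
    by_cases hq : q ∈ Zᶜ
    · simp only [indicator_of_mem hq, ← measure_eq_tsum_fiber hξ]
    · simp only [indicator_of_notMem hq, tsum_zero]
  have hm : MeasurableSet (ζ ⁻¹' Z) := by
    have : ζ ⁻¹' Z = ⋃ q ∈ Z, ζ ⁻¹' {q} := by ext; simp
    rw [this]
    exact MeasurableSet.biUnion (to_countable Z) fun q _ => hζ q
  -- With $t$ the mass of the merged region this is $t^2+(1-t)\le1$.
  have hsplit : μ (ξ ⁻¹' τ) * μ (ξ ⁻¹' τ) + μ (ζ ⁻¹' Zᶜ) ≤ 1 := by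
    rw [← hTZ, preimage_compl]
    calc _ ≤ μ (ζ ⁻¹' Z) * 1 + μ (ζ ⁻¹' Z)ᶜ := by gcongr; exact prob_le_one
      _ = 1 := by rw [mul_one, measure_add_measure_compl hm, measure_univ]
  rw [e1, e2, e3, e4, e5] at hsum
  have e0 : fiberEnt μ (fun x => (ζ x, ξ x)) =
      ∑' q, ∑' i, μ (ζ ⁻¹' {q} ∩ ξ ⁻¹' {i}) * L (ζ ⁻¹' {q} ∩ ξ ⁻¹' {i}) := by
    rw [fiberEnt_eq, ENNReal.tsum_prod']
    simp only [hpre, hL]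
  rw [e0]
  refine (ENNReal.add_le_add_iff_right ENNReal.one_ne_top).1 (hsum.trans ?_)
  rw [add_assoc]
  gcongr

theorem measurableSet_fiber_pi {S : Type*} [Countable S] {ξ : S → M → ι}
    (h : ∀ s i, MeasurableSet (ξ s ⁻¹' {i})) (k : S → ι) :
    MeasurableSet ((fun x s => ξ s x) ⁻¹' {k}) := by
  have : (fun x s => ξ s x) ⁻¹' {k} = ⋂ s, ξ s ⁻¹' {k s} := by
    ext x
    simp [funext_iff]
  rw [this]
  exact MeasurableSet.iInter fun s => h s _

theorem measurableSet_fiber_prod {ζ : M → ρ} {ξ : M → ι} (hζ : ∀ i, MeasurableSet (ζ ⁻¹' {i}))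
    (hξ : ∀ i, MeasurableSet (ξ ⁻¹' {i})) (k : ρ × ι) :
    MeasurableSet ((fun x => (ζ x, ξ x)) ⁻¹' {k}) := by
  have : (fun x => (ζ x, ξ x)) ⁻¹' {k} = ζ ⁻¹' {k.1} ∩ ξ ⁻¹' {k.2} := by
    ext x
    simp [Prod.ext_iff]
  rw [this]
  exact (hζ _).inter (hξ _)

/-- The labels are added one at a time by `fiberEnt_prod_le`. The base `ζ` enriched by earlier
labels still determines the next one outside of its merged set. -/
theorem fiberEnt_family_le [IsProbabilityMeasure μ] {κ : Type*} [Finite κ] [Countable ρ] {ζ : M → ρ}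
    {ξ : κ → M → ℕ} (hζ : ∀ i, MeasurableSet (ζ ⁻¹' {i}))
    (hξ : ∀ a i, MeasurableSet (ξ a ⁻¹' {i})) (τ : κ → Set ℕ)
    (h : ∀ a x y, ζ x = ζ y → ξ a x = ξ a y ∨ (ξ a x ∈ τ a ∧ ξ a y ∈ τ a)) (F : Finset κ) :
    fiberEnt μ (fun x => (ζ x, fun a : F => ξ a x)) ≤ fiberEnt μ ζ +
      ∑ a ∈ F, ∑' i, (τ a).indicator
        (fun i => ENNReal.ofReal (Real.negMulLog (μ.real (ξ a ⁻¹' {i})))) i := by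
  classical
  induction F using Finset.cons_induction with
  | empty =>
    simp only [Finset.sum_empty, add_zero]
    exact fiberEnt_mono hζ (measurableSet_fiber_prod hζ (measurableSet_fiber_pi fun a => hξ a))
      fun x y hxy => Prod.ext hxy (funext fun a => absurd a.2 (Finset.notMem_empty _))
  | cons a F ha ih =>
    have hm := measurableSet_fiber_prod hζ (measurableSet_fiber_pi fun a : F => hξ a)
    have h1 := fiberEnt_prod_le (μ := μ) hm (hξ a) (τ a)
      (fun x y hxy => h a x y (congrArg Prod.fst hxy))
    refine (fiberEnt_mono (measurableSet_fiber_prod hm (hξ a)) (measurableSet_fiber_prod hζ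
      (measurableSet_fiber_pi fun a : Finset.cons a F ha => hξ a)) fun x y hxy => ?_).trans (h1.trans ?_)
    · simp only [Prod.mk.injEq] at hxy ⊢
      refine ⟨hxy.1.1, funext fun b => ?_⟩
      rcases Finset.mem_cons.1 b.2 with hb | hb
      · rw [hb]
        exact hxy.2
      · exact congrFun hxy.1.2 ⟨b, hb⟩
    · rw [Finset.sum_cons, add_comm (∑' i, _), ← add_assoc]
      gcongr

/-- The label at time $j$ has the same distribution as at time 0, so each of the $n$ times costs the
same. -/
theorem fiberEnt_orbit_le [IsProbabilityMeasure μ] [Countable ρ] {K : Type*} [Fintype K] {f : M → M}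
    (hf : MeasurePreserving f μ μ) {ζ : M → ρ} {ξ : K → M → ℕ} (n : ℕ)
    (hζ : ∀ i, MeasurableSet (ζ ⁻¹' {i})) (hξ : ∀ a i, MeasurableSet (ξ a ⁻¹' {i}))
    (τ : K → Set ℕ) (h : ∀ (j : Iio n) a x y, ζ x = ζ y →
      ξ a (f^[j] x) = ξ a (f^[j] y) ∨ (ξ a (f^[j] x) ∈ τ a ∧ ξ a (f^[j] y) ∈ τ a)) :
    fiberEnt μ (fun x => (ζ x, fun a : Iio n × K => ξ a.2 (f^[a.1] x))) ≤ fiberEnt μ ζ +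
      n * ∑ a, ∑' i, (τ a).indicator
        (fun i => ENNReal.ofReal (Real.negMulLog (μ.real (ξ a ⁻¹' {i})))) i := by
  have hm : ∀ (a : Iio n × K) i, MeasurableSet ((fun x => ξ a.2 (f^[a.1] x)) ⁻¹' {i}) :=
    fun a i => (hf.iterate a.1).measurable (hξ a.2 i)
  have key := fiberEnt_family_le (μ := μ) (κ := Iio n × K) (ξ := fun a x => ξ a.2 (f^[a.1] x)) hζ hm
    (fun a => τ a.2) (fun a => h a.1 a.2) Finset.univ
  refine (fiberEnt_mono (measurableSet_fiber_prod hζ (measurableSet_fiber_pi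
    fun a : (Finset.univ : Finset (Iio n × K)) => hm a))
    (measurableSet_fiber_prod hζ (measurableSet_fiber_pi hm)) fun x y hxy => ?_).trans
    (key.trans_eq ?_)
  · simp only [Prod.mk.injEq] at hxy ⊢
    exact ⟨hxy.1, funext fun a => congrFun hxy.2 ⟨a, Finset.mem_univ a⟩⟩
  · congr 1
    have hpres : ∀ (a : Iio n × K) i, μ.real ((fun x => ξ a.2 (f^[a.1] x)) ⁻¹' {i}) =
        μ.real (ξ a.2 ⁻¹' {i}) := fun a i => by
      have := (hf.iterate a.1).measure_preimage (hξ a.2 i).nullMeasurableSet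
      exact congrArg ENNReal.toReal this
    simp only [hpres]
    rw [Fintype.sum_prod_type]
    simp

theorem limsup_div_le {u v : ℕ → ℝ≥0∞} {R : ℝ≥0∞} (h : ∀ n : ℕ, u n ≤ v n + n * R) :
    limsup (fun n : ℕ => u n / n) atTop ≤ limsup (fun n : ℕ => v n / n) atTop + R := by
  have h1 : limsup (fun n : ℕ => u n / n) atTop ≤ limsup (fun n : ℕ => v n / n + R) atTop := by
    refine limsup_le_limsup (Eventually.of_forall fun n => ?_)
    calc u n / n ≤ (v n + n * R) / n := ENNReal.div_le_div_right (h n) _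
      _ = v n / n + n * R / n := ENNReal.add_div
      _ ≤ v n / n + R := by
        gcongr
        exact ENNReal.div_le_of_le_mul (by rw [mul_comm])
  exact h1.trans_eq (limsup_add_const atTop _ R (by isBoundedDefault) (by isBoundedDefault))

theorem partEntropy_ne_top {P : Set (Set M)} (h : P.Finite) : partEntropy μ P ≠ ⊤ := by
  have := h.fintype
  rw [partEntropy, tsum_fintype]
  exact ENNReal.sum_ne_top.2 fun _ _ => ENNReal.ofReal_ne_top

theorem Represents.measurableSet_fiber {P : Set (Set M)} {ξ : M → ι} (h : Represents P ξ)
    (hm : ∀ A ∈ P, MeasurableSet A) (i : ι) : MeasurableSet (ξ ⁻¹' {i}) := by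
  rcases (ξ ⁻¹' {i}).eq_empty_or_nonempty with he | hne
  · rw [he]
    exact MeasurableSet.empty
  · exact hm _ ((h _ hne).2 ⟨i, rfl⟩)

/-- A countable measurable partition of the space. -/
structure IsCountablePartition (P : Set (Set M)) : Prop where
  countable : P.Countable
  measurable : ∀ A ∈ P, MeasurableSet A
  disjoint : P.PairwiseDisjoint id
  sUnion : ⋃₀ P = univ

/-- Merging the elements in `T σ` of the partitions `F σ ∪ T σ` in a join. -/
theorem dynEntropy_merge [IsProbabilityMeasure μ] {K : Type*} {f : M → M}
    (hf : MeasurePreserving f μ μ) {S : Set K} (hS : S.Finite) {R : Set (Set M)}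
    (hR : IsCountablePartition R) (hRf : R.Finite) {F T : K → Set (Set M)}
    (hF : ∀ s ∈ S, (F s).Finite) (hP : ∀ s ∈ S, IsCountablePartition (F s ∪ T s))
    (hFT : ∀ s ∈ S, ∀ A ∈ F s, ∀ B ∈ T s, Disjoint A B) :
    dynEntropy μ f (joinTwo R (joinFamily S fun s => F s ∪ {⋃₀ T s})) ≠ ⊤ ∧
    dynEntropy μ f (joinTwo R (joinFamily S fun s => F s ∪ {⋃₀ T s})) ≤
      dynEntropy μ f (joinTwo R (joinFamily S fun s => F s ∪ T s)) ∧
    dynEntropy μ f (joinTwo R (joinFamily S fun s => F s ∪ T s)) ≤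
      dynEntropy μ f (joinTwo R (joinFamily S fun s => F s ∪ {⋃₀ T s})) +
        ∑ s ∈ hS.toFinset, ∑' A : T s, ENNReal.ofReal (Real.negMulLog (μ.real (A : Set M))) := by
  have hSF := hS.fintype
  have hTm : ∀ s ∈ S, MeasurableSet (⋃₀ T s) := fun s hs =>
    MeasurableSet.sUnion ((hP s hs).countable.mono subset_union_right)
      fun A hA => (hP s hs).measurable A (Or.inr hA)
  have hQ : ∀ s ∈ S, IsCountablePartition (F s ∪ {⋃₀ T s}) := fun s hs => by
    refine ⟨((hF s hs).union (finite_singleton _)).countable, ?_, ?_, ?_⟩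
    · rintro A (hA | rfl)
      · exact (hP s hs).measurable A (Or.inl hA)
      · exact hTm s hs
    · rintro A (hA | rfl) B (hB | rfl) hAB
      · exact (hP s hs).disjoint (Or.inl hA) (Or.inl hB) hAB
      · exact disjoint_sUnion_right.2 fun C hC => hFT s hs A hA C hC
      · exact disjoint_sUnion_left.2 fun C hC => (hFT s hs B hB C hC).symm
      · exact absurd rfl hAB
    · rw [← (hP s hs).sUnion, sUnion_union, sUnion_union, sUnion_singleton]
  obtain ⟨ξ₀, hξ₀⟩ := exists_represents hR.countable hR.disjoint hR.sUnion
  have hξ : ∀ s : S, ∃ ξ : M → ℕ, Represents (F s ∪ T s) ξ := fun s =>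
    exists_represents (hP s s.2).countable (hP s s.2).disjoint (hP s s.2).sUnion
  have hη : ∀ s : S, ∃ ξ : M → ℕ, Represents (F s ∪ {⋃₀ T s}) ξ := fun s =>
    exists_represents (hQ s s.2).countable (hQ s s.2).disjoint (hQ s s.2).sUnion
  choose ξ hξ using hξ
  choose η hη using hη
  classical
  -- Labellings are extended by a dummy value outside of `S`, because `Represents.join_family` takes
  -- a family indexed by all of `K`.
  let ξ' : K → M → ℕ := fun k => if h : k ∈ S then ξ ⟨k, h⟩ else fun _ => 0
  let η' : K → M → ℕ := fun k => if h : k ∈ S then η ⟨k, h⟩ else fun _ => 0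
  have hξ' : ∀ k ∈ S, Represents (F k ∪ T k) (ξ' k) := fun k hk => by
    simpa only [ξ', dif_pos hk] using hξ ⟨k, hk⟩
  have hη' : ∀ k ∈ S, Represents (F k ∪ {⋃₀ T k}) (η' k) := fun k hk => by
    simpa only [η', dif_pos hk] using hη ⟨k, hk⟩
  have mξ₀ := hξ₀.measurableSet_fiber hR.measurable
  have mξ : ∀ (s : S) i, MeasurableSet (ξ' s ⁻¹' {i}) := fun s =>
    (hξ' s s.2).measurableSet_fiber (hP s s.2).measurable
  have mη : ∀ (s : S) i, MeasurableSet (η' s ⁻¹' {i}) := fun s =>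
    (hη' s s.2).measurableSet_fiber (hQ s s.2).measurable
  let ξB : M → ℕ × (S → ℕ) := fun x => (ξ₀ x, fun s : S => ξ' s x)
  let ηB : M → ℕ × (S → ℕ) := fun x => (ξ₀ x, fun s : S => η' s x)
  have hξB : Represents (joinTwo R (joinFamily S fun s => F s ∪ T s)) ξB :=
    hξ₀.join_two (Represents.join_family hξ')
  have hηB : Represents (joinTwo R (joinFamily S fun s => F s ∪ {⋃₀ T s})) ηB :=
    hξ₀.join_two (Represents.join_family hη')
  have mξB : ∀ i, MeasurableSet (ξB ⁻¹' {i}) :=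
    measurableSet_fiber_prod mξ₀ (measurableSet_fiber_pi mξ)
  have mηB : ∀ i, MeasurableSet (ηB ⁻¹' {i}) :=
    measurableSet_fiber_prod mξ₀ (measurableSet_fiber_pi mη)
  have mξn : ∀ (n : ℕ) i, MeasurableSet ((fun x (j : Iio n) => ξB (f^[j] x)) ⁻¹' {i}) := fun n =>
    measurableSet_fiber_pi fun j i => (hf.iterate j).measurable (mξB i)
  have mηn : ∀ (n : ℕ) i, MeasurableSet ((fun x (j : Iio n) => ηB (f^[j] x)) ⁻¹' {i}) := fun n =>
    measurableSet_fiber_pi fun j i => (hf.iterate j).measurable (mηB i)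
  have eP : ∀ n, partEntropy μ (dynJoin f (joinTwo R (joinFamily S fun s => F s ∪ T s)) n) =
      fiberEnt μ (fun x (j : Iio n) => ξB (f^[j] x)) := fun n => (hξB.dyn_join f n).partEntropy_eq μ
  have eQ : ∀ n, partEntropy μ (dynJoin f (joinTwo R (joinFamily S fun s => F s ∪ {⋃₀ T s})) n) =
      fiberEnt μ (fun x (j : Iio n) => ηB (f^[j] x)) := fun n => (hηB.dyn_join f n).partEntropy_eq μ
  have hfib : ∀ (s : S) x, ξ' s ⁻¹' {ξ' s x} ∈ F s ∪ T s := fun s x =>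
    (hξ' s s.2 (ξ' s ⁻¹' {ξ' s x}) ⟨x, rfl⟩).2 ⟨_, rfl⟩
  have hfib' : ∀ (s : S) x, η' s ⁻¹' {η' s x} ∈ F s ∪ {⋃₀ T s} := fun s x =>
    (hη' s s.2 (η' s ⁻¹' {η' s x}) ⟨x, rfl⟩).2 ⟨_, rfl⟩
  have same : ∀ (s : S) (A : Set M), A ∈ F s ∪ {⋃₀ T s} → ∀ x ∈ A, ∀ y ∈ A, η' s x = η' s y := by
    intro s A hA x hx y hy
    obtain ⟨i, rfl⟩ := (hη' s s.2 A ⟨x, hx⟩).1 hA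
    exact (show η' s x = i from hx).trans (show η' s y = i from hy).symm
  have same' : ∀ (s : S) (A : Set M), A ∈ F s ∪ T s → ∀ x ∈ A, A = ξ' s ⁻¹' {ξ' s x} := by
    intro s A hA x hx
    obtain ⟨i, rfl⟩ := (hξ' s s.2 A ⟨x, hx⟩).1 hA
    rw [show ξ' s x = i from hx]
  -- The labels that are lost in the merge. The merged label `η'` determines `ξ'` except inside `⋃₀
  -- T s`, where both labels lie in `τ`.
  let τ : S → Set ℕ := fun s => {i | ξ' s ⁻¹' {i} ∈ T s}
  have hmono : ∀ (s : S) x y, ξ' s x = ξ' s y → η' s x = η' s y := by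
    intro s x y hxy
    rcases hfib s x with h | h
    · exact same s _ (Or.inl h) x rfl y hxy.symm
    · exact same s _ (Or.inr rfl) x ⟨_, h, rfl⟩ y ⟨_, h, hxy.symm⟩
  have hdet : ∀ (s : S) x y, η' s x = η' s y → ξ' s x = ξ' s y ∨ (ξ' s x ∈ τ s ∧ ξ' s y ∈ τ s) := by
    intro s x y hxy
    rcases hfib' s x with h | h
    · left
      have h1 := same' s _ (Or.inl h) x rfl
      have h2 : y ∈ η' s ⁻¹' {η' s x} := hxy.symm
      rw [h1] at h2
      exact h2.symm
    · right
      rw [mem_singleton_iff] at h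
      have hx : x ∈ ⋃₀ T s := h ▸ (rfl : η' s x = η' s x)
      have hy : y ∈ ⋃₀ T s := h ▸ (hxy.symm : η' s y = η' s x)
      obtain ⟨A, hA, hxA⟩ := hx
      obtain ⟨B, hB, hyB⟩ := hy
      exact ⟨show ξ' s ⁻¹' {ξ' s x} ∈ T s from same' s A (Or.inr hA) x hxA ▸ hA,
        show ξ' s ⁻¹' {ξ' s y} ∈ T s from same' s B (Or.inr hB) y hyB ▸ hB⟩
  have hsupp : ∀ (s : S) i, i ∈ Function.support ((τ s).indicator (fun i => ENNReal.ofReal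
      (Real.negMulLog (μ.real (ξ' s ⁻¹' {i}))))) → i ∈ τ s :=
    fun s i hi => mem_of_indicator_ne_zero hi
  have htail : ∀ s : S, ∑' i, (τ s).indicator
      (fun i => ENNReal.ofReal (Real.negMulLog (μ.real (ξ' s ⁻¹' {i})))) i ≤
      ∑' A : T s, ENNReal.ofReal (Real.negMulLog (μ.real (A : Set M))) := by
    intro s
    -- Labels with a nonzero term correspond to nonempty elements of `T s`; the remaining elements
    -- can only increase the right-hand side.
    refine (tsum_eq_tsum_of_ne_zero_bij (f := fun A : {A : T s | (A : Set M).Nonempty} =>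
      ENNReal.ofReal (Real.negMulLog (μ.real (A.1 : Set M))))
      (g := (τ s).indicator (fun i => ENNReal.ofReal (Real.negMulLog (μ.real (ξ' s ⁻¹' {i})))))
      (fun i => ⟨⟨ξ' s ⁻¹' {i.1}, hsupp s i.1 i.2⟩, ?_⟩) ?_ ?_ ?_).symm.trans_le
      (ENNReal.tsum_comp_le_tsum_of_injective Subtype.val_injective _)
    · obtain ⟨i, hi⟩ := i
      by_contra hc
      rw [mem_ofPred_eq, not_nonempty_iff_eq_empty] at hc
      refine hi ?_
      simp only at hc
      rw [indicator_of_mem (hsupp s _ hi), hc]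
      simp
    · intro i j hij
      have h1 : ξ' s ⁻¹' {i.1} = ξ' s ⁻¹' {j.1} := congrArg (fun A => (A.1 : Set M)) hij
      have h0 := i.2
      rw [Function.mem_support, indicator_of_mem (hsupp s _ i.2)] at h0
      have hne : (ξ' s ⁻¹' {i.1}).Nonempty := by
        by_contra hc
        rw [not_nonempty_iff_eq_empty.1 hc] at h0
        simp at h0
      obtain ⟨x, hx⟩ := hne
      have h2 : x ∈ ξ' s ⁻¹' {j.1} := h1 ▸ hx
      exact Subtype.ext (hx.symm.trans h2)
    · rintro ⟨⟨A, hA⟩, x, hx⟩ hs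
      have h1 := same' s A (Or.inr hA) x hx
      have hτ : ξ' s x ∈ τ s := by
        change ξ' s ⁻¹' {ξ' s x} ∈ T s
        rwa [← h1]
      refine ⟨⟨ξ' s x, ?_⟩, ?_⟩
      · rw [Function.mem_support, indicator_of_mem hτ, ← h1]
        exact hs
      · exact Subtype.ext (Subtype.ext h1.symm)
    · intro i
      rw [indicator_of_mem (hsupp s _ i.2)]
  refine ⟨?_, ?_, ?_⟩
  · rw [dynEntropy]
    -- Finiteness: the orbit bound is applied with a trivial base and every label counted as merged,
    -- which gives $n$ times the sum of the finitely many finite entropies of `R` (index `none`) and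
    -- of the merged partitions.
    let g : Option S → M → ℕ := fun o => o.elim ξ₀ fun s => η' s
    have mg : ∀ o i, MeasurableSet (g o ⁻¹' {i}) := fun o => by
      cases o with
      | none => exact mξ₀
      | some s => exact mη s
    have hg : ∀ o, fiberEnt μ (g o) ≠ ⊤ := fun o => by
      cases o with
      | none =>
        show fiberEnt μ ξ₀ ≠ ⊤
        rw [← hξ₀.partEntropy_eq]
        exact partEntropy_ne_top hRf
      | some s =>
        show fiberEnt μ (η' s) ≠ ⊤
        rw [← (hη' s s.2).partEntropy_eq]
        exact partEntropy_ne_top ((hF s s.2).union (finite_singleton _))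
    have hb : ∀ n : ℕ, partEntropy μ
        (dynJoin f (joinTwo R (joinFamily S fun s => F s ∪ {⋃₀ T s})) n) ≤
        0 + n * ∑ o, fiberEnt μ (g o) := fun n => by
      rw [eQ n]
      have h1 := fiberEnt_orbit_le hf (ζ := fun _ : M => ()) (ξ := g) n
        (fun i => by simp) mg (fun _ => univ) (fun j a x y _ => Or.inr ⟨mem_univ _, mem_univ _⟩)
      have h0 : fiberEnt μ (fun _ : M => ()) = 0 := by simp [fiberEnt]
      rw [h0] at h1
      simp only [indicator_univ] at h1
      refine (fiberEnt_mono (measurableSet_fiber_prod (ζ := fun _ : M => ()) (fun i => by simp)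
        (measurableSet_fiber_pi (ξ := fun (a : Iio n × Option S) x => g a.2 (f^[a.1] x))
        fun a i => (hf.iterate a.1).measurable (mg a.2 i))) (mηn n)
        fun x y hxy => ?_).trans h1
      simp only [Prod.mk.injEq, true_and] at hxy
      refine funext fun j => Prod.ext (congrFun hxy (j, none)) (funext fun s => ?_)
      exact congrFun hxy (j, some s)
    refine ne_top_of_le_ne_top ?_ (limsup_div_le hb)
    simp only [ENNReal.zero_div, limsup_const, zero_add]
    exact ENNReal.sum_ne_top.2 fun o _ => hg o
  · refine limsup_le_limsup (Eventually.of_forall fun n => ENNReal.div_le_div_right ?_ _)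
    rw [eP, eQ]
    refine fiberEnt_mono (mξn n) (mηn n) fun x y hxy => funext fun j => ?_
    have := congrFun hxy j
    simp only [ξB, Prod.mk.injEq] at this
    exact Prod.ext this.1 (funext fun s => hmono s _ _ (congrFun this.2 s))
  · refine limsup_div_le fun n => ?_
    rw [eP, eQ]
    have h1 := fiberEnt_orbit_le hf (ζ := fun x (j : Iio n) => ηB (f^[j] x))
      (ξ := fun (s : S) => ξ' s) n (mηn n) mξ τ (fun j s x y hxy => hdet s _ _ (by
        have := congrFun hxy j
        simp only [ηB, Prod.mk.injEq] at this
        exact congrFun this.2 s))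
    refine (fiberEnt_mono (measurableSet_fiber_prod (mηn n) (measurableSet_fiber_pi
        (ξ := fun (a : Iio n × S) x => ξ' a.2 (f^[a.1] x))
        fun a i => (hf.iterate a.1).measurable (mξ a.2 i))) (mξn n)
        fun x y hxy => ?_).trans (h1.trans ?_)
    · simp only [Prod.mk.injEq] at hxy
      refine funext fun j => Prod.ext ?_ (funext fun s => congrFun hxy.2 (j, s))
      have := congrFun hxy.1 j
      simp only [ηB, Prod.mk.injEq] at this
      exact this.1
    · gcongr
      refine (Finset.sum_le_sum fun s _ => htail s).trans_eq ?_
      exact (Finset.sum_subtype _ (fun x => by simp) (fun s => ∑' A : T s,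
        ENNReal.ofReal (Real.negMulLog (μ.real (A : Set M))))).symm

end FiberEntropy

/-! ### Vector fields and the metric in charts -/

section ChartCalculus

variable {d : ℕ} {M : Type*} [EMetricSpace M] [ChartedSpace (EuclideanSpace ℝ (Fin d)) M]
  [IsManifold (𝓡 d) ∞ M]

/-- The coordinate change between the charts at `x₀` and `x₁`. -/
def chartChange (d : ℕ) {M : Type*} [EMetricSpace M] [ChartedSpace (EuclideanSpace ℝ (Fin d)) M]
    (x₀ x₁ : M) (z : EuclideanSpace ℝ (Fin d)) : EuclideanSpace ℝ (Fin d) :=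
  extChartAt (𝓡 d) x₁ ((extChartAt (𝓡 d) x₀).symm z)

/-- The domain of `chartChange d x₀ x₁`. -/
def chartOverlap (d : ℕ) {M : Type*} [EMetricSpace M] [ChartedSpace (EuclideanSpace ℝ (Fin d)) M]
    (x₀ x₁ : M) : Set (EuclideanSpace ℝ (Fin d)) :=
  (extChartAt (𝓡 d) x₀).target ∩ (extChartAt (𝓡 d) x₀).symm ⁻¹' (extChartAt (𝓡 d) x₁).source

omit [IsManifold (𝓡 d) ∞ M] in
theorem isOpen_chartOverlap (x₀ x₁ : M) : IsOpen (chartOverlap d x₀ x₁) :=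
  (continuousOn_extChartAt_symm x₀).isOpen_inter_preimage (isOpen_extChartAt_target x₀)
    (isOpen_extChartAt_source x₁)

theorem contDiffOn_chartChange (x₀ x₁ : M) :
    ContDiffOn ℝ ∞ (chartChange d x₀ x₁) (chartOverlap d x₀ x₁) := by
  rw [← contMDiffOn_iff_contDiffOn]
  refine (contMDiffOn_extChartAt (I := 𝓡 d) (n := ∞) (x := x₁)).comp
    ((contMDiffOn_extChartAt_symm (I := 𝓡 d) (n := ∞) x₀).mono inter_subset_left) fun z hz => ?_
  simpa using hz.2

theorem hasFDerivAt_chartChange {x₀ x₁ : M} {z : EuclideanSpace ℝ (Fin d)}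
    (hz : z ∈ chartOverlap d x₀ x₁) :
    HasFDerivAt (chartChange d x₀ x₁) (fderiv ℝ (chartChange d x₀ x₁) z) z :=
  (((contDiffOn_chartChange x₀ x₁).contDiffAt
    ((isOpen_chartOverlap x₀ x₁).mem_nhds hz)).differentiableAt (by simp)).hasFDerivAt

omit [IsManifold (𝓡 d) ∞ M] in
theorem chartChange_mem {x₀ x₁ : M} {z : EuclideanSpace ℝ (Fin d)}
    (hz : z ∈ chartOverlap d x₀ x₁) : chartChange d x₀ x₁ z ∈ chartOverlap d x₁ x₀ := by
  refine ⟨(extChartAt (𝓡 d) x₁).map_source hz.2, ?_⟩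
  simp only [mem_preimage, chartChange]
  rw [(extChartAt (𝓡 d) x₁).left_inv hz.2]
  exact (extChartAt (𝓡 d) x₀).map_target hz.1

omit [IsManifold (𝓡 d) ∞ M] in
theorem symm_chartChange {x₀ x₁ : M} {z : EuclideanSpace ℝ (Fin d)}
    (hz : z ∈ chartOverlap d x₀ x₁) :
    (extChartAt (𝓡 d) x₁).symm (chartChange d x₀ x₁ z) = (extChartAt (𝓡 d) x₀).symm z :=
  (extChartAt (𝓡 d) x₁).left_inv hz.2

/-- The derivative at `x` of the chart at `x₀`. -/
def chartFwd (d : ℕ) {M : Type*} [EMetricSpace M] [ChartedSpace (EuclideanSpace ℝ (Fin d)) M]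
    (x₀ x : M) : EuclideanSpace ℝ (Fin d) →L[ℝ] EuclideanSpace ℝ (Fin d) :=
  mfderiv (𝓡 d) 𝓘(ℝ, EuclideanSpace ℝ (Fin d)) (extChartAt (𝓡 d) x₀) x

/-- The derivative at `z` of the inverse of the chart at `x₀`. -/
def chartBwd (d : ℕ) {M : Type*} [EMetricSpace M] [ChartedSpace (EuclideanSpace ℝ (Fin d)) M]
    (x₀ : M) (z : EuclideanSpace ℝ (Fin d)) :
    EuclideanSpace ℝ (Fin d) →L[ℝ] EuclideanSpace ℝ (Fin d) :=
  mfderiv 𝓘(ℝ, EuclideanSpace ℝ (Fin d)) (𝓡 d) (extChartAt (𝓡 d) x₀).symm z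

/-- A vector field in the canonical identification of the tangent spaces. -/
def rawField (Y : VField d M) (x : M) : EuclideanSpace ℝ (Fin d) := Y x

theorem inChart_def (Y : VField d M) (x₀ : M) (z : EuclideanSpace ℝ (Fin d)) :
    inChart Y x₀ z = chartFwd d x₀ ((extChartAt (𝓡 d) x₀).symm z)
      (rawField Y ((extChartAt (𝓡 d) x₀).symm z)) := rfl

theorem hasMFDerivAt_symm {x₀ : M} {z : EuclideanSpace ℝ (Fin d)}
    (hz : z ∈ (extChartAt (𝓡 d) x₀).target) :
    HasMFDerivAt 𝓘(ℝ, EuclideanSpace ℝ (Fin d)) (𝓡 d) (extChartAt (𝓡 d) x₀).symm z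
      (chartBwd d x₀ z) := by
  have := mdifferentiableWithinAt_extChartAt_symm (I := 𝓡 d) hz
  rw [ModelWithCorners.range_eq_univ, mdifferentiableWithinAt_univ] at this
  exact this.hasMFDerivAt

theorem hasMFDerivAt_chart {x₀ x : M} (hx : x ∈ (extChartAt (𝓡 d) x₀).source) :
    HasMFDerivAt (𝓡 d) 𝓘(ℝ, EuclideanSpace ℝ (Fin d)) (extChartAt (𝓡 d) x₀) x
      (chartFwd d x₀ x) :=
  (mdifferentiableAt_extChartAt (by simpa using hx)).hasMFDerivAt

theorem chartBwd_chartFwd {x₀ x : M} (hx : x ∈ (extChartAt (𝓡 d) x₀).source)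
    (v : EuclideanSpace ℝ (Fin d)) :
    chartBwd d x₀ (extChartAt (𝓡 d) x₀ x) (chartFwd d x₀ x v) = v := by
  have := mfderivWithin_extChartAt_symm_comp_mfderiv_extChartAt' (I := 𝓡 d) hx
  rw [ModelWithCorners.range_eq_univ, mfderivWithin_univ] at this
  exact congr($this v)

theorem chartFwd_chartBwd {x₀ : M} {z : EuclideanSpace ℝ (Fin d)}
    (hz : z ∈ (extChartAt (𝓡 d) x₀).target) (v : EuclideanSpace ℝ (Fin d)) :
    chartFwd d x₀ ((extChartAt (𝓡 d) x₀).symm z) (chartBwd d x₀ z v) = v := by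
  have := mfderiv_extChartAt_comp_mfderivWithin_extChartAt_symm (I := 𝓡 d) hz
  rw [ModelWithCorners.range_eq_univ, mfderivWithin_univ] at this
  exact congr($this v)

theorem chartBwd_chartFwd' {x₀ : M} {z : EuclideanSpace ℝ (Fin d)}
    (hz : z ∈ (extChartAt (𝓡 d) x₀).target) (v : EuclideanSpace ℝ (Fin d)) :
    chartBwd d x₀ z (chartFwd d x₀ ((extChartAt (𝓡 d) x₀).symm z) v) = v := by
  have := chartBwd_chartFwd ((extChartAt (𝓡 d) x₀).map_target hz) v
  rwa [(extChartAt (𝓡 d) x₀).right_inv hz] at this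

theorem chartBwd_self (x : M) (v : EuclideanSpace ℝ (Fin d)) :
    chartBwd d x (extChartAt (𝓡 d) x x) v = v := by
  have := mfderivWithin_range_extChartAt_symm (I := 𝓡 d) (x := x)
  rw [ModelWithCorners.range_eq_univ, mfderivWithin_univ] at this
  exact congr($this v)

theorem fderiv_chartChange {x₀ x₁ : M} {z : EuclideanSpace ℝ (Fin d)}
    (hz : z ∈ chartOverlap d x₀ x₁) :
    fderiv ℝ (chartChange d x₀ x₁) z =
      (chartFwd d x₁ ((extChartAt (𝓡 d) x₀).symm z)).comp (chartBwd d x₀ z) := by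
  have h := (hasMFDerivAt_chart (d := d) (x₀ := x₁) hz.2).comp z (hasMFDerivAt_symm hz.1)
  have h2 : HasFDerivAt (chartChange d x₀ x₁)
    ((chartFwd d x₁ ((extChartAt (𝓡 d) x₀).symm z)).comp (chartBwd d x₀ z)) z :=
    hasMFDerivAt_iff_hasFDerivAt.1 h
  exact h2.fderiv

theorem chartBwd_eq {x₀ x₁ : M} {z : EuclideanSpace ℝ (Fin d)}
    (hz : z ∈ chartOverlap d x₀ x₁) (v : EuclideanSpace ℝ (Fin d)) :
    chartBwd d x₀ z v = chartBwd d x₁ (chartChange d x₀ x₁ z)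
      (fderiv ℝ (chartChange d x₀ x₁) z v) := by
  rw [fderiv_chartChange hz]
  exact (chartBwd_chartFwd (d := d) hz.2 _).symm

theorem inChart_chartChange (Y : VField d M) {x₀ x₁ : M} {z : EuclideanSpace ℝ (Fin d)}
    (hz : z ∈ chartOverlap d x₀ x₁) :
    inChart Y x₁ (chartChange d x₀ x₁ z) =
      fderiv ℝ (chartChange d x₀ x₁) z (inChart Y x₀ z) := by
  rw [fderiv_chartChange hz, inChart_def, inChart_def, symm_chartChange hz,
    ContinuousLinearMap.comp_apply, chartBwd_chartFwd' hz.1]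

theorem inChart_eq_zero_iff (Y : VField d M) {x₀ : M} {z : EuclideanSpace ℝ (Fin d)}
    (hz : z ∈ (extChartAt (𝓡 d) x₀).target) :
    inChart Y x₀ z = 0 ↔ (extChartAt (𝓡 d) x₀).symm z ∈ sing Y := by
  rw [inChart_def]
  constructor
  · intro h
    have := chartBwd_chartFwd' hz (rawField Y ((extChartAt (𝓡 d) x₀).symm z))
    rw [h, map_zero] at this
    exact this.symm
  · intro h
    have h' : rawField Y ((extChartAt (𝓡 d) x₀).symm z) = 0 := h
    rw [h', map_zero]

/-- Smoothness of sections and of the metric is defined through bundle trivializations. This turns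
it into smoothness of coordinate expressions. -/
theorem chartFwd_eq_trivialization {x₀ x : M} (hx : x ∈ (extChartAt (𝓡 d) x₀).source)
    (v : TangentSpace (𝓡 d) x) :
    (trivializationAt (EuclideanSpace ℝ (Fin d)) (fun x : M => TangentSpace (𝓡 d) x) x₀ ⟨x, v⟩).2 =
      chartFwd d x₀ x v := by
  rw [extChartAt_source] at hx
  have h3 := TangentBundle.continuousLinearMapAt_trivializationAt (I := 𝓡 d) hx
  have h4 : (trivializationAt (EuclideanSpace ℝ (Fin d))
    (fun x : M => TangentSpace (𝓡 d) x) x₀).continuousLinearMapAt ℝ x v = chartFwd d x₀ x v :=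
    congr($h3 v)
  rw [← h4, Trivialization.continuousLinearMapAt_apply, Trivialization.linearMapAt_apply, if_pos]
  simpa using hx

theorem contDiffOn_inChart (Y : VField d M) (x₀ : M) :
    ContDiffOn ℝ 1 (inChart Y x₀) (extChartAt (𝓡 d) x₀).target := by
  have h1 := Y.contMDiff.contMDiffOn (s := (trivializationAt (EuclideanSpace ℝ (Fin d))
    (fun x : M => TangentSpace (𝓡 d) x) x₀).baseSet)
  rw [Trivialization.contMDiffOn_section_baseSet_iff] at h1
  rw [← contMDiffOn_iff_contDiffOn]
  have h2 := h1.comp ((contMDiffOn_extChartAt_symm (I := 𝓡 d) (n := 1) x₀))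
    (fun z hz => by
      have := (extChartAt (𝓡 d) x₀).map_target hz
      simpa using this)
  exact h2.congr fun z hz =>
    (chartFwd_eq_trivialization ((extChartAt (𝓡 d) x₀).map_target hz) _).symm

/-- Integral curves in charts. -/
theorem hasDerivAt_chart {Y : VField d M} {γ : ℝ → M} {t : ℝ} {x₀ : M}
    (h : HasMFDerivAt 𝓘(ℝ, ℝ) (𝓡 d) γ t ((1 : ℝ →L[ℝ] ℝ).smulRight (Y (γ t))))
    (ht : γ t ∈ (extChartAt (𝓡 d) x₀).source) :
    HasDerivAt (fun s => extChartAt (𝓡 d) x₀ (γ s))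
      (inChart Y x₀ (extChartAt (𝓡 d) x₀ (γ t))) t := by
  have h1 : HasFDerivAt (fun s => extChartAt (𝓡 d) x₀ (γ s)) ((chartFwd d x₀ (γ t)).comp
    ((1 : ℝ →L[ℝ] ℝ).smulRight (rawField Y (γ t)))) t :=
    hasMFDerivAt_iff_hasFDerivAt.1 ((hasMFDerivAt_chart (d := d) ht).comp t h)
  refine h1.hasDerivAt.congr_deriv ?_
  rw [inChart_def, (extChartAt (𝓡 d) x₀).left_inv ht]
  simp

/-- Solutions in charts are integral curves. -/
theorem hasMFDerivAt_of_chart {Y : VField d M} {y : ℝ → EuclideanSpace ℝ (Fin d)} {t : ℝ} {x₀ : M}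
    (h : HasDerivAt y (inChart Y x₀ (y t)) t)
    (ht : y t ∈ (extChartAt (𝓡 d) x₀).target) :
    HasMFDerivAt 𝓘(ℝ, ℝ) (𝓡 d) (fun s => (extChartAt (𝓡 d) x₀).symm (y s)) t
      ((1 : ℝ →L[ℝ] ℝ).smulRight (Y ((extChartAt (𝓡 d) x₀).symm (y t)))) := by
  have h1 := (hasMFDerivAt_symm (d := d) ht).comp t h.hasFDerivAt.hasMFDerivAt
  have h2 : (chartBwd d x₀ (y t)).comp (ContinuousLinearMap.toSpanSingleton ℝ (inChart Y x₀ (y t)))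
    = ((1 : ℝ →L[ℝ] ℝ).smulRight (rawField Y ((extChartAt (𝓡 d) x₀).symm (y t)))) := by
    ext1
    rw [ContinuousLinearMap.comp_apply, inChart_def]
    simpa using chartBwd_chartFwd' ht _
  exact h1.congr_mfderiv h2

section Metric

variable [RiemannianBundle (fun x : M => TangentSpace (𝓡 d) x)]

/-- The inner product on `T_x M` in the canonical identification with the model space. -/
def rawInner (x : M) (u w : EuclideanSpace ℝ (Fin d)) : ℝ :=
  inner ℝ (show TangentSpace (𝓡 d) x from u) (show TangentSpace (𝓡 d) x from w)

omit [IsManifold (𝓡 d) ∞ M] in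
theorem metricInChart_def (x₀ : M) (z u w : EuclideanSpace ℝ (Fin d)) :
    metricInChart x₀ z u w = rawInner ((extChartAt (𝓡 d) x₀).symm z) (chartBwd d x₀ z u)
      (chartBwd d x₀ z w) := rfl

omit [IsManifold (𝓡 d) ∞ M] in
theorem rawInner_self (x : M) (u : EuclideanSpace ℝ (Fin d)) :
    rawInner x u u = rnorm x u ^ 2 :=
  real_inner_self_eq_norm_sq (F := TangentSpace (𝓡 d) x) _

omit [IsManifold (𝓡 d) ∞ M] in
theorem rawInner_comm (x : M) (u w : EuclideanSpace ℝ (Fin d)) :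
    rawInner x u w = rawInner x w u :=
  real_inner_comm (F := TangentSpace (𝓡 d) x) _ _

omit [IsManifold (𝓡 d) ∞ M] in
theorem rawInner_add_left (x : M) (u v w : EuclideanSpace ℝ (Fin d)) :
    rawInner x (u + v) w = rawInner x u w + rawInner x v w :=
  inner_add_left (E := TangentSpace (𝓡 d) x) _ _ _

omit [IsManifold (𝓡 d) ∞ M] in
theorem rawInner_smul_left (x : M) (a : ℝ) (u w : EuclideanSpace ℝ (Fin d)) :
    rawInner x (a • u) w = a * rawInner x u w :=
  real_inner_smul_left (F := TangentSpace (𝓡 d) x) _ _ _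

omit [IsManifold (𝓡 d) ∞ M] in
theorem rawInner_self_pos (x : M) {u : EuclideanSpace ℝ (Fin d)} (hu : u ≠ 0) :
    0 < rawInner x u u :=
  real_inner_self_pos (F := TangentSpace (𝓡 d) x).2 hu

omit [IsManifold (𝓡 d) ∞ M] in
theorem rnorm_nonneg (x : M) (u : EuclideanSpace ℝ (Fin d)) : 0 ≤ rnorm x u :=
  norm_nonneg (E := TangentSpace (𝓡 d) x) _

theorem speed_eq (Y : VField d M) (x : M) : speed Y x = rnorm x (rawField Y x) := rfl

theorem metricInChart_chartChange {x₀ x₁ : M} {z : EuclideanSpace ℝ (Fin d)}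
    (hz : z ∈ chartOverlap d x₀ x₁) (u w : EuclideanSpace ℝ (Fin d)) :
    metricInChart x₀ z u w = metricInChart x₁ (chartChange d x₀ x₁ z)
      (fderiv ℝ (chartChange d x₀ x₁) z u) (fderiv ℝ (chartChange d x₀ x₁) z w) := by
  rw [metricInChart_def, metricInChart_def, chartBwd_eq hz, chartBwd_eq hz, symm_chartChange hz]

theorem metricInChart_self {x₀ x : M} (hx : x ∈ (extChartAt (𝓡 d) x₀).source)
    (u w : EuclideanSpace ℝ (Fin d)) :
    metricInChart x₀ (extChartAt (𝓡 d) x₀ x) (chartFwd d x₀ x u) (chartFwd d x₀ x w) =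
      rawInner x u w := by
  rw [metricInChart_def, chartBwd_chartFwd hx, chartBwd_chartFwd hx,
    (extChartAt (𝓡 d) x₀).left_inv hx]

theorem metricInChart_pos {x₀ : M} {z : EuclideanSpace ℝ (Fin d)}
    (hz : z ∈ (extChartAt (𝓡 d) x₀).target) {u : EuclideanSpace ℝ (Fin d)} (hu : u ≠ 0) :
    0 < metricInChart x₀ z u u := by
  rw [metricInChart_def]
  apply rawInner_self_pos
  intro h
  apply hu
  rw [← chartFwd_chartBwd hz u, h, map_zero]

theorem contDiffOn_metricInChart [IsContMDiffRiemannianBundle (𝓡 d) ∞ (EuclideanSpace ℝ (Fin d))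
      (fun x : M => TangentSpace (𝓡 d) x)] (x₀ : M) (u w : EuclideanSpace ℝ (Fin d)) :
    ContDiffOn ℝ ∞ (fun z => metricInChart x₀ z u w) (extChartAt (𝓡 d) x₀).target := by
  -- The coordinate field with constant components `u` is a smooth section along the inverse chart;
  -- the metric coefficients are inner products of two of them.
  have key : ∀ u : EuclideanSpace ℝ (Fin d), ContMDiffOn 𝓘(ℝ, EuclideanSpace ℝ (Fin d))
      ((𝓡 d).prod 𝓘(ℝ, EuclideanSpace ℝ (Fin d))) ∞
      (fun z => (⟨(extChartAt (𝓡 d) x₀).symm z, chartBwd d x₀ z u⟩ :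
        TotalSpace (EuclideanSpace ℝ (Fin d)) (fun x : M => TangentSpace (𝓡 d) x)))
      (extChartAt (𝓡 d) x₀).target := by
    intro u
    rw [(trivializationAt (EuclideanSpace ℝ (Fin d))
      (fun x : M => TangentSpace (𝓡 d) x) x₀).contMDiffOn_iff]
    · refine ⟨contMDiffOn_extChartAt_symm x₀, (contMDiffOn_const (c := u)).congr fun z hz => ?_⟩
      exact (chartFwd_eq_trivialization ((extChartAt (𝓡 d) x₀).map_target hz) _).trans
        (chartFwd_chartBwd hz u)
    · intro z hz
      have := (extChartAt (𝓡 d) x₀).map_target hz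
      rw [extChartAt_source] at this
      rw [Trivialization.mem_source]
      simpa using this
  rw [← contMDiffOn_iff_contDiffOn]
  exact ContMDiffOn.inner_bundle (key u) (key w)

end Metric

end ChartCalculus

/-! ### The global continuous flow of a vector field -/

section Flow

variable {d : ℕ} {M : Type*} [EMetricSpace M] [ChartedSpace (EuclideanSpace ℝ (Fin d)) M]
  [IsManifold (𝓡 d) ∞ M]

theorem exists_localFlow (Y : VField d M) (x₀ : M) :
    ∃ ε > (0 : ℝ), ∃ V ∈ 𝓝 x₀, ∃ α : M × ℝ → M, ContinuousOn α (V ×ˢ Ioo (-ε) ε) ∧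
      ∀ x ∈ V, α (x, 0) = x ∧ IsMIntegralCurveOn (I := 𝓡 d) (fun t => α (x, t)) (fun y => Y y)
        (Ioo (-ε) ε) := by
  set φ := extChartAt (𝓡 d) x₀ with hφ
  have hopen : IsOpen φ.target := isOpen_extChartAt_target x₀
  have hmem : φ x₀ ∈ φ.target := mem_extChartAt_target x₀
  have hf : ContDiffAt ℝ 1 (inChart Y x₀) (φ x₀) :=
    (contDiffOn_inChart Y x₀).contDiffAt (hopen.mem_nhds hmem)
  obtain ⟨ε, hε, a, r, L, K, hr, hPL⟩ := IsPicardLindelof.of_contDiffAt_one hf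
  obtain ⟨α, hα, hαc⟩ :=
    (hPL 0).exists_forall_mem_closedBall_eq_hasDerivWithinAt_continuousOn
  simp only [zero_sub, zero_add] at hα hαc
  have h0 : α (φ x₀, 0) = φ x₀ := (hα _ (Metric.mem_closedBall_self r.2)).1
  have hnhds : Metric.closedBall (φ x₀) r ×ˢ Icc (-ε) ε ∈ 𝓝 (φ x₀, (0 : ℝ)) :=
    prod_mem_nhds (Metric.closedBall_mem_nhds _ hr) (Icc_mem_nhds (by linarith) hε)
  have hca : ContinuousAt α (φ x₀, 0) := hαc.continuousAt hnhds
  -- Picard–Lindelöf gives solutions of the coordinate equation that may leave the chart; by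
  -- continuity they stay in its target for initial points near `x₀` and small times.
  have hpre : α ⁻¹' φ.target ∩ Metric.closedBall (φ x₀) r ×ˢ Icc (-ε) ε ∈ 𝓝 (φ x₀, (0 : ℝ)) :=
    inter_mem (hca.preimage_mem_nhds (by rw [h0]; exact hopen.mem_nhds hmem)) hnhds
  obtain ⟨U, hU, W, hW, hUW⟩ := mem_nhds_prod_iff.1 hpre
  obtain ⟨ε', hε', hW'⟩ := Metric.mem_nhds_iff.1 hW
  rw [Real.ball_eq_Ioo, zero_sub, zero_add] at hW'
  have hUW' : ∀ z ∈ U, ∀ t ∈ Ioo (-ε') ε', α (z, t) ∈ φ.target ∧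
      z ∈ Metric.closedBall (φ x₀) r ∧ t ∈ Icc (-ε) ε := fun z hz t ht => by
    have := hUW (mk_mem_prod hz (hW' ht))
    exact ⟨this.1, this.2.1, this.2.2⟩
  have hφc : ContinuousOn φ φ.source := continuousOn_extChartAt x₀
  refine ⟨min ε ε', lt_min hε hε', φ.source ∩ φ ⁻¹' U,
    inter_mem (extChartAt_source_mem_nhds x₀) ((continuousAt_extChartAt x₀).preimage_mem_nhds hU),
    fun p => φ.symm (α (φ p.1, p.2)), ?_, ?_⟩
  · refine (continuousOn_extChartAt_symm x₀).comp (hαc.comp ?_ ?_) ?_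
    · exact (hφc.comp continuousOn_fst fun p hp => hp.1.1).prodMk continuousOn_snd
    · intro p hp
      have := hUW' _ hp.1.2 p.2 ⟨by linarith [hp.2.1, min_le_right ε ε'],
        by linarith [hp.2.2, min_le_right ε ε']⟩
      exact ⟨this.2.1, this.2.2⟩
    · intro p hp
      exact (hUW' _ hp.1.2 p.2 ⟨by linarith [hp.2.1, min_le_right ε ε'],
        by linarith [hp.2.2, min_le_right ε ε']⟩).1
  · intro x hx
    have h00 := (hUW' _ hx.2 0 ⟨by linarith, hε'⟩).2.1
    refine ⟨?_, fun t ht => ?_⟩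
    · simp only
      rw [(hα _ h00).1, φ.left_inv hx.1]
    · have ht1 : t ∈ Ioo (-ε) ε := ⟨by linarith [ht.1, min_le_left ε ε'],
        by linarith [ht.2, min_le_left ε ε']⟩
      have ht2 : t ∈ Ioo (-ε') ε' := ⟨by linarith [ht.1, min_le_right ε ε'],
        by linarith [ht.2, min_le_right ε ε']⟩
      have hd := ((hα _ h00).2 t (Ioo_subset_Icc_self ht1)).hasDerivAt (Icc_mem_nhds ht1.1 ht1.2)
      exact (hasMFDerivAt_of_chart hd (hUW' _ hx.2 t ht2).1).hasMFDerivWithinAt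

variable [CompactSpace M]

theorem exists_uniform_localFlow (Y : VField d M) :
    ∃ ε > (0 : ℝ), ∀ x₀ : M, ∃ V ∈ 𝓝 x₀, ∃ α : M × ℝ → M, ContinuousOn α (V ×ˢ Ioo (-ε) ε) ∧
      ∀ x ∈ V, α (x, 0) = x ∧ IsMIntegralCurveOn (I := 𝓡 d) (fun t => α (x, t)) (fun y => Y y)
        (Ioo (-ε) ε) := by
  choose ε hε V hV α hα using exists_localFlow Y
  obtain ⟨t, -, ht⟩ := isCompact_univ.elim_nhds_subcover (fun x => interior (V x))
    (fun x _ => interior_mem_nhds.2 (hV x))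
  obtain ⟨e, he, het⟩ : ∃ e > 0, ∀ x ∈ t, e ≤ ε x := by
    rcases t.eq_empty_or_nonempty with rfl | hne
    · exact ⟨1, one_pos, by simp⟩
    · exact ⟨t.inf' hne ε, (Finset.lt_inf'_iff hne).2 fun x _ => hε x,
        fun x hx => Finset.inf'_le ε hx⟩
  refine ⟨e, he, fun x₀ => ?_⟩
  obtain ⟨x, hx, hxV⟩ := mem_iUnion₂.1 (ht (mem_univ x₀))
  have hsub : Ioo (-e) e ⊆ Ioo (-ε x) (ε x) := Ioo_subset_Ioo (by linarith [het x hx]) (het x hx)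
  exact ⟨V x, mem_interior_iff_mem_nhds.1 hxV, α x,
    (hα x).1.mono (prod_mono_right hsub), fun y hy =>
      ⟨((hα x).2 y hy).1, ((hα x).2 y hy).2.mono hsub⟩⟩

theorem exists_integralCurve (Y : VField d M) (x : M) :
    ∃ γ : ℝ → M, γ 0 = x ∧ IsMIntegralCurve (I := 𝓡 d) γ (fun y => Y y) := by
  obtain ⟨ε, hε, h⟩ := exists_uniform_localFlow Y
  refine exists_isMIntegralCurve_of_isMIntegralCurveOn Y.contMDiff hε (fun x => ?_) x
  obtain ⟨V, hV, α, -, hα⟩ := h x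
  exact ⟨fun t => α (x, t), hα x (mem_of_mem_nhds hV)⟩

theorem flow_zero (Y : VField d M) (x : M) : flow Y 0 x = x := by
  rw [flow, dif_pos (exists_integralCurve Y x)]
  exact (exists_integralCurve Y x).choose_spec.1

theorem flow_isMIntegralCurve (Y : VField d M) (x : M) :
    IsMIntegralCurve (I := 𝓡 d) (fun t => flow Y t x) (fun y => Y y) := by
  have : (fun t => flow Y t x) = (exists_integralCurve Y x).choose := by
    ext t
    rw [flow, dif_pos (exists_integralCurve Y x)]
  rw [this]
  exact (exists_integralCurve Y x).choose_spec.2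

theorem flow_eq_of_isMIntegralCurve (Y : VField d M) {γ : ℝ → M}
    (h : IsMIntegralCurve (I := 𝓡 d) γ (fun y => Y y)) (t : ℝ) : flow Y t (γ 0) = γ t :=
  congrFun (isMIntegralCurve_Ioo_eq_of_contMDiff_boundaryless (t₀ := 0) Y.contMDiff
    (flow_isMIntegralCurve Y (γ 0)) h (flow_zero Y _)) t

theorem flow_add (Y : VField d M) (s t : ℝ) (x : M) :
    flow Y (s + t) x = flow Y s (flow Y t x) := by
  have := flow_eq_of_isMIntegralCurve Y ((flow_isMIntegralCurve Y x).comp_add t) s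
  simpa using this.symm

theorem flow_sing (Y : VField d M) {σ : M} (hσ : σ ∈ sing Y) (t : ℝ) : flow Y t σ = σ :=
  flow_eq_of_isMIntegralCurve Y (γ := fun _ => σ) (isMIntegralCurve_const hσ) t

theorem continuous_flow_time (Y : VField d M) (x : M) : Continuous fun t => flow Y t x :=
  (flow_isMIntegralCurve Y x).continuous

/-- The flow is jointly continuous. -/
theorem continuous_flow (Y : VField d M) : Continuous fun p : ℝ × M => flow Y p.1 p.2 := by
  obtain ⟨ε, hε, h⟩ := exists_uniform_localFlow Y
  have hloc : ∀ t ∈ Ioo (-ε) ε, ∀ x, ContinuousAt (fun p : ℝ × M => flow Y p.1 p.2) (t, x) := by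
    intro t ht x
    obtain ⟨V, hV, α, hαc, hα⟩ := h x
    have heq : ∀ y ∈ V, ∀ s ∈ Ioo (-ε) ε, flow Y s y = α (y, s) := fun y hy =>
      isMIntegralCurveOn_Ioo_eqOn_of_contMDiff_boundaryless (t₀ := 0) ⟨by linarith, hε⟩ Y.contMDiff
        ((flow_isMIntegralCurve Y y).isMIntegralCurveOn _) (hα y hy).2
        (by rw [flow_zero, (hα y hy).1])
    have hc : ContinuousAt α (x, t) :=
      hαc.continuousAt (prod_mem_nhds hV (Ioo_mem_nhds ht.1 ht.2))
    have hc' : ContinuousAt (fun p : ℝ × M => α (p.2, p.1)) (t, x) :=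
      ContinuousAt.comp (f := fun p : ℝ × M => (p.2, p.1)) (x := (t, x)) hc
        (continuous_swap.continuousAt)
    refine hc'.congr ?_
    filter_upwards [prod_mem_nhds (Ioo_mem_nhds ht.1 ht.2) hV] with p hp
    exact (heq p.2 hp.2 p.1 hp.1).symm
  -- Long times are reached by iteration: $\phi_{nt}$ is the $n$-fold iterate of $\phi_t$, and any
  -- time is $n(t/n)$ with $|t/n|<\varepsilon$.
  have hn : ∀ n : ℕ, ∀ t, |t| < ε → ∀ x,
      ContinuousAt (fun p : ℝ × M => flow Y (n * p.1) p.2) (t, x) := by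
    intro n t ht x
    induction n with
    | zero => simpa [flow_zero] using continuousAt_snd
    | succ n ih =>
      have : (fun p : ℝ × M => flow Y ((n + 1 : ℕ) * p.1) p.2) =
          fun p : ℝ × M => flow Y p.1 (flow Y (n * p.1) p.2) := by
        ext p
        rw [← flow_add]
        congr 1
        push_cast
        ring
      rw [this]
      exact ContinuousAt.comp (g := fun p : ℝ × M => flow Y p.1 p.2)
        (f := fun p : ℝ × M => (p.1, flow Y (n * p.1) p.2)) (x := (t, x))
        (hloc t (abs_lt.1 ht) _) (continuousAt_fst.prodMk ih)
  rw [continuous_iff_continuousAt]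
  rintro ⟨t, x⟩
  obtain ⟨n, hnt⟩ := exists_nat_gt (|t| / ε)
  have hn0 : (0 : ℝ) < n := lt_of_le_of_lt (by positivity) hnt
  have h1 := hn n (t / n) (by
    rw [abs_div, abs_of_pos hn0, div_lt_iff₀ hn0]
    rw [div_lt_iff₀ hε] at hnt
    linarith) x
  have h2 : ContinuousAt (fun p : ℝ × M => (p.1 / n, p.2)) (t, x) := by fun_prop
  have h3 := ContinuousAt.comp (f := fun p : ℝ × M => (p.1 / n, p.2)) (x := (t, x)) h1 h2
  refine h3.congr (Eventually.of_forall fun p => ?_)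
  simp only [Function.comp]
  rw [mul_div_cancel₀ _ hn0.ne']

end Flow

/-! ### The geodesic equation and its coordinate invariance -/

section EulerLagrange

variable {E : Type*} [NormedAddCommGroup E] [NormedSpace ℝ E]

set_option synthInstance.maxHeartbeats 400000

instance normedAddCommGroupDual : NormedAddCommGroup (E →L[ℝ] ℝ) := inferInstance

instance normedSpaceDual : NormedSpace ℝ (E →L[ℝ] ℝ) := inferInstance

instance normedAddCommGroupBilin : NormedAddCommGroup (E →L[ℝ] E →L[ℝ] ℝ) := inferInstance

instance normedSpaceBilin : NormedSpace ℝ (E →L[ℝ] E →L[ℝ] ℝ) := inferInstance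

instance normedAddCommGroupTrilin : NormedAddCommGroup (E →L[ℝ] E →L[ℝ] E →L[ℝ] ℝ) :=
  inferInstance

instance normedSpaceTrilin : NormedSpace ℝ (E →L[ℝ] E →L[ℝ] E →L[ℝ] ℝ) := inferInstance

instance normedAddCommGroupDualHom : NormedAddCommGroup ((E →L[ℝ] ℝ) →L[ℝ] E) := inferInstance

instance normedSpaceDualHom : NormedSpace ℝ ((E →L[ℝ] ℝ) →L[ℝ] E) := inferInstance

/-- The Euler-Lagrange equation in terms of the acceleration. -/
theorem eulerLagrange_iff {G : E → E →L[ℝ] E →L[ℝ] ℝ} {y : ℝ → E} {t : ℝ} {a : E}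
    (hG : DifferentiableAt ℝ G (y t)) (hy : DifferentiableAt ℝ y t)
    (hy' : HasDerivAt (deriv y) a t) :
    (∀ w, HasDerivAt (fun s => G (y s) (deriv y s) w)
        (1 / 2 * fderiv ℝ (fun z => G z (deriv y t) (deriv y t)) (y t) w) t) ↔
      ∀ w, G (y t) a w = 1 / 2 * fderiv ℝ G (y t) w (deriv y t) (deriv y t) -
        fderiv ℝ G (y t) (deriv y t) (deriv y t) w := by
  have h1 : HasDerivAt (fun s => G (y s)) (fderiv ℝ G (y t) (deriv y t)) t :=
    hG.hasFDerivAt.comp_hasDerivAt t hy.hasDerivAt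
  have h2 : ∀ w, HasDerivAt (fun s => G (y s) (deriv y s) w)
      (fderiv ℝ G (y t) (deriv y t) (deriv y t) w + G (y t) a w) t := fun w => by
    have := (h1.clm_apply hy').clm_apply (hasDerivAt_const t w)
    simpa using this
  have h3 : ∀ v w, fderiv ℝ (fun z => G z v v) (y t) w = fderiv ℝ G (y t) w v v := fun v w => by
    have : HasFDerivAt (fun z => G z v v) _ (y t) :=
      (hG.hasFDerivAt.clm_apply (hasFDerivAt_const v _)).clm_apply (hasFDerivAt_const v _)
    rw [this.fderiv]
    simp
  refine forall_congr' fun w => ?_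
  rw [h3]
  constructor
  · intro h
    linarith [(h2 w).unique h]
  · intro h
    exact (h2 w).congr_deriv (by linarith)

/-- The Euler-Lagrange equation does not depend on the coordinates. -/
theorem acceleration_change {G G' : E → E →L[ℝ] E →L[ℝ] ℝ} {ψ : E → E} {z v a : E}
    (hψ : ContDiffAt ℝ 2 ψ z)
    (hG' : DifferentiableAt ℝ G' (ψ z))
    (hsymm : ∀ u w, G' (ψ z) u w = G' (ψ z) w u)
    (h : ∀ᶠ x in 𝓝 z, ∀ u w, G x u w = G' (ψ x) (fderiv ℝ ψ x u) (fderiv ℝ ψ x w))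
    (hG : DifferentiableAt ℝ G z)
    (hsurj : Function.Surjective (fderiv ℝ ψ z))
    (hel : ∀ w, G z a w = 1 / 2 * fderiv ℝ G z w v v - fderiv ℝ G z v v w) (w : E) :
    G' (ψ z) (fderiv ℝ ψ z a + fderiv ℝ (fderiv ℝ ψ) z v v) w =
      1 / 2 * fderiv ℝ G' (ψ z) w (fderiv ℝ ψ z v) (fderiv ℝ ψ z v) -
        fderiv ℝ G' (ψ z) (fderiv ℝ ψ z v) (fderiv ℝ ψ z v) w := by
  have hd : DifferentiableAt ℝ ψ z := hψ.differentiableAt (by simp)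
  have hd2 : DifferentiableAt ℝ (fderiv ℝ ψ) z :=
    (hψ.fderiv_right (m := 1) (by norm_num)).differentiableAt (by simp)
  have hs2 : ∀ u w, fderiv ℝ (fderiv ℝ ψ) z u w = fderiv ℝ (fderiv ℝ ψ) z w u := by
    have := hψ.isSymmSndFDerivAt (by simp)
    exact fun u w => this u w
  -- The derivative of the identity $G=\psi^*G'$, by the product rule.
  have key : ∀ k u w, fderiv ℝ G z k u w =
      fderiv ℝ G' (ψ z) (fderiv ℝ ψ z k) (fderiv ℝ ψ z u) (fderiv ℝ ψ z w) +
      G' (ψ z) (fderiv ℝ (fderiv ℝ ψ) z k u) (fderiv ℝ ψ z w) +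
      G' (ψ z) (fderiv ℝ ψ z u) (fderiv ℝ (fderiv ℝ ψ) z k w) := by
    intro k u w
    have e1 : HasFDerivAt (fun x => G x u w) _ z :=
      (hG.hasFDerivAt.clm_apply (hasFDerivAt_const u _)).clm_apply (hasFDerivAt_const w _)
    have e2 : HasFDerivAt (fun x => G' (ψ x) (fderiv ℝ ψ x u) (fderiv ℝ ψ x w)) _ z :=
      ((hG'.hasFDerivAt.comp z hd.hasFDerivAt).clm_apply
        (hd2.hasFDerivAt.clm_apply (hasFDerivAt_const u _))).clm_apply
        (hd2.hasFDerivAt.clm_apply (hasFDerivAt_const w _))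
    have e3 := e1.unique (e2.congr_of_eventuallyEq (h.mono fun x hx => hx u w))
    have e4 := congr($e3 k)
    simp at e4
    rw [e4]
    ring
  obtain ⟨w, rfl⟩ := hsurj w
  have h0 := h.self_of_nhds
  have e := hel w
  rw [h0, key, key] at e
  rw [map_add, add_apply]
  -- By symmetry of $G'$ and of $D^2\psi$, the terms with $D^2\psi(v,w)$ cancel. What remains is
  -- $G'(D^2\psi(v,v),\cdot)$, the correction of the acceleration.
  have s1 := hsymm (fderiv ℝ ψ z v) (fderiv ℝ (fderiv ℝ ψ) z w v)
  have s2 := hs2 w v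
  rw [s2] at s1 e
  linarith

end EulerLagrange

/-! ### The acceleration of geodesics in a chart -/

section Geodesics

variable {d : ℕ} {M : Type*} [EMetricSpace M] [ChartedSpace (EuclideanSpace ℝ (Fin d)) M]
  [IsManifold (𝓡 d) ∞ M] [RiemannianBundle (fun x : M => TangentSpace (𝓡 d) x)]

/-- The metric in the chart at `x₀` as a bilinear form. -/
def metricOp (x₀ : M) (z : EuclideanSpace ℝ (Fin d)) :
    EuclideanSpace ℝ (Fin d) →L[ℝ] EuclideanSpace ℝ (Fin d) →L[ℝ] ℝ :=
  (LinearMap.mk₂ ℝ (metricInChart x₀ z)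
    (fun u v w => by simp [metricInChart_def, rawInner_add_left])
    (fun c u w => by simp [metricInChart_def, rawInner_smul_left])
    (fun u v w => by
      simp only [metricInChart_def, map_add, rawInner_comm _ (chartBwd d x₀ z u),
        rawInner_add_left])
    (fun c u w => by
      simp only [metricInChart_def, map_smul, rawInner_comm _ (chartBwd d x₀ z u),
        rawInner_smul_left, smul_eq_mul])).toContinuousBilinearMap

omit [IsManifold (𝓡 d) ∞ M] in
theorem metricOp_apply (x₀ : M) (z u w : EuclideanSpace ℝ (Fin d)) :
    metricOp x₀ z u w = metricInChart x₀ z u w := rfl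

omit [IsManifold (𝓡 d) ∞ M] in
theorem metricOp_comm (x₀ : M) (z u w : EuclideanSpace ℝ (Fin d)) :
    metricOp x₀ z u w = metricOp x₀ z w u := by
  rw [metricOp_apply, metricOp_apply, metricInChart_def, rawInner_comm]; rfl

theorem metricOp_injective {x₀ : M} {z : EuclideanSpace ℝ (Fin d)}
    (hz : z ∈ (extChartAt (𝓡 d) x₀).target) : Function.Injective (metricOp x₀ z) := by
  rw [injective_iff_map_eq_zero]
  intro u hu
  by_contra h
  have := metricInChart_pos hz h
  rw [← metricOp_apply, hu] at this
  simp at this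

/-- The metric as an isomorphism with the dual space. -/
def metricEquiv {x₀ : M} {z : EuclideanSpace ℝ (Fin d)}
    (hz : z ∈ (extChartAt (𝓡 d) x₀).target) :
    EuclideanSpace ℝ (Fin d) ≃L[ℝ] (EuclideanSpace ℝ (Fin d) →L[ℝ] ℝ) :=
  (LinearEquiv.ofInjectiveOfFinrankEq ((metricOp x₀ z : EuclideanSpace ℝ (Fin d) →L[ℝ] _) :
    EuclideanSpace ℝ (Fin d) →ₗ[ℝ] (EuclideanSpace ℝ (Fin d) →L[ℝ] ℝ)) (metricOp_injective hz)
    (by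
      rw [← (LinearMap.toContinuousLinearMap (𝕜 := ℝ) (E := EuclideanSpace ℝ (Fin d))
        (F' := ℝ)).finrank_eq, Module.finrank_linearMap_self])).toContinuousLinearEquiv

theorem metricEquiv_coe {x₀ : M} {z : EuclideanSpace ℝ (Fin d)}
    (hz : z ∈ (extChartAt (𝓡 d) x₀).target) :
    (metricEquiv hz : EuclideanSpace ℝ (Fin d) →L[ℝ] (EuclideanSpace ℝ (Fin d) →L[ℝ] ℝ)) =
      metricOp x₀ z := by
  ext u w
  rfl

variable (d) in
/-- The right-hand side of the geodesic equation in the chart at `x₀`. -/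
def geodAcc (x₀ : M) (p : EuclideanSpace ℝ (Fin d) × EuclideanSpace ℝ (Fin d)) :
    EuclideanSpace ℝ (Fin d) :=
  (metricOp x₀ p.1).inverse ((1 / 2 : ℝ) • ((fderiv ℝ (metricOp x₀) p.1).flip p.2).flip p.2 -
    fderiv ℝ (metricOp x₀) p.1 p.2 p.2)

theorem eq_geodAcc_iff {x₀ : M} {z : EuclideanSpace ℝ (Fin d)}
    (hz : z ∈ (extChartAt (𝓡 d) x₀).target) (v a : EuclideanSpace ℝ (Fin d)) :
    a = geodAcc d x₀ (z, v) ↔ ∀ w, metricOp x₀ z a w =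
      1 / 2 * fderiv ℝ (metricOp x₀) z w v v - fderiv ℝ (metricOp x₀) z v v w := by
  rw [geodAcc, ← metricEquiv_coe hz, ContinuousLinearMap.inverse_equiv, eq_comm]
  simp only [ContinuousLinearEquiv.coe_coe]
  rw [ContinuousLinearEquiv.symm_apply_eq, ContinuousLinearMap.ext_iff]
  refine forall_congr' fun w => ?_
  simp
  exact eq_comm

omit [IsManifold (𝓡 d) ∞ M] in
-- Homogeneity of degree two in the velocity. It is behind affine reparametrisation, long existence
-- for small velocities, and the vanishing derivative at zero velocity.
theorem geodAcc_smul (x₀ : M) (z v : EuclideanSpace ℝ (Fin d)) (c : ℝ) :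
    geodAcc d x₀ (z, c • v) = c ^ 2 • geodAcc d x₀ (z, v) := by
  rw [geodAcc, geodAcc, ← map_smul (metricOp x₀ z).inverse (c ^ 2)]
  refine congrArg (metricOp x₀ z).inverse ?_
  ext w
  simp
  ring

variable [IsContMDiffRiemannianBundle (𝓡 d) ∞ (EuclideanSpace ℝ (Fin d))
      (fun x : M => TangentSpace (𝓡 d) x)]

theorem contDiffOn_metricOp (x₀ : M) :
    ContDiffOn ℝ ∞ (metricOp x₀) (extChartAt (𝓡 d) x₀).target := by
  rw [contDiffOn_clm_apply]
  intro u
  rw [contDiffOn_clm_apply]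
  intro w
  exact contDiffOn_metricInChart x₀ u w

theorem contDiffAt_metricOp {x₀ : M} {z : EuclideanSpace ℝ (Fin d)}
    (hz : z ∈ (extChartAt (𝓡 d) x₀).target) : ContDiffAt ℝ ∞ (metricOp x₀) z :=
  (contDiffOn_metricOp x₀).contDiffAt ((isOpen_extChartAt_target x₀).mem_nhds hz)

theorem contDiffAt_geodAcc {x₀ : M} {p : EuclideanSpace ℝ (Fin d) × EuclideanSpace ℝ (Fin d)}
    (hz : p.1 ∈ (extChartAt (𝓡 d) x₀).target) : ContDiffAt ℝ ∞ (geodAcc d x₀) p := by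
  have h1 : ContDiffAt ℝ ∞ (fun p : EuclideanSpace ℝ (Fin d) × EuclideanSpace ℝ (Fin d) =>
      metricOp x₀ p.1) p := (contDiffAt_metricOp hz).comp p contDiffAt_fst
  have h2 : ContDiffAt ℝ ∞ (fun p : EuclideanSpace ℝ (Fin d) × EuclideanSpace ℝ (Fin d) =>
      (metricOp x₀ p.1).inverse) p := by
    have := contDiffAt_map_inverse (n := ∞) (𝕜 := ℝ) (metricEquiv hz)
    rw [metricEquiv_coe] at this
    exact this.comp p h1
  have h3 : ContDiffAt ℝ ∞ (fun p : EuclideanSpace ℝ (Fin d) × EuclideanSpace ℝ (Fin d) =>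
      fderiv ℝ (metricOp x₀) p.1) p :=
    ((contDiffAt_metricOp hz).fderiv_right (m := ∞) (by simp)).comp p contDiffAt_fst
  have h4 : ContDiffAt ℝ ∞ (fun p : EuclideanSpace ℝ (Fin d) × EuclideanSpace ℝ (Fin d) =>
      ((fderiv ℝ (metricOp x₀) p.1).flip p.2).flip p.2) p := by
    have f1 := (ContinuousLinearMap.flipₗᵢ ℝ (EuclideanSpace ℝ (Fin d)) (EuclideanSpace ℝ (Fin d))
      (EuclideanSpace ℝ (Fin d) →L[ℝ] ℝ)).toContinuousLinearEquiv.contDiff.contDiffAt.comp p h3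
    have f2 := (ContinuousLinearMap.flipₗᵢ ℝ (EuclideanSpace ℝ (Fin d)) (EuclideanSpace ℝ (Fin d))
      ℝ).toContinuousLinearEquiv.contDiff.contDiffAt.comp p (f1.clm_apply contDiffAt_snd)
    exact f2.clm_apply contDiffAt_snd
  exact h2.clm_apply ((h4.const_smul (1 / 2 : ℝ)).sub
    ((h3.clm_apply contDiffAt_snd).clm_apply contDiffAt_snd))

end Geodesics

/-! ### Geodesics as solutions of an equation in a fixed chart -/

section GeodesicCurves

variable {d : ℕ} {M : Type*} [EMetricSpace M] [ChartedSpace (EuclideanSpace ℝ (Fin d)) M]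
  [IsManifold (𝓡 d) ∞ M] [RiemannianBundle (fun x : M => TangentSpace (𝓡 d) x)]

variable (d) in
/-- The curve `c` satisfies the geodesic equation at time `t`. -/
def GeodAt (c : ℝ → M) (t : ℝ) : Prop :=
  ContMDiffAt 𝓘(ℝ, ℝ) (𝓡 d) ∞ c t ∧
  ∀ w : EuclideanSpace ℝ (Fin d),
    HasDerivAt (fun s => metricInChart (c t) (extChartAt (𝓡 d) (c t) (c s))
        (deriv (fun s => extChartAt (𝓡 d) (c t) (c s)) s) w)
      (1 / 2 * fderiv ℝ (fun z => metricInChart (c t) z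
        (deriv (fun s => extChartAt (𝓡 d) (c t) (c s)) t)
        (deriv (fun s => extChartAt (𝓡 d) (c t) (c s)) t)) (extChartAt (𝓡 d) (c t) (c t)) w) t

omit [IsManifold (𝓡 d) ∞ M] in
theorem isGeodesic_iff {c : ℝ → M} : IsGeodesic d c ↔ ∀ t, GeodAt d c t := by
  constructor
  · rintro ⟨h1, h2⟩ t
    exact ⟨h1.contMDiffAt, h2 t _ rfl⟩
  · intro h
    refine ⟨fun t => (h t).1, ?_⟩
    rintro t y rfl
    exact (h t).2

/-- The curve `y` solves the geodesic equation in the chart at `x₀` at time `t`. -/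
def ChartSol (x₀ : M) (y : ℝ → EuclideanSpace ℝ (Fin d)) (t : ℝ) : Prop :=
  y t ∈ (extChartAt (𝓡 d) x₀).target ∧ ContDiffAt ℝ ∞ y t ∧
    deriv (deriv y) t = geodAcc d x₀ (y t, deriv y t)

omit [IsManifold (𝓡 d) ∞ M] in
theorem ChartSol.congr {x₀ : M} {y y' : ℝ → EuclideanSpace ℝ (Fin d)} {t : ℝ}
    (h : ChartSol x₀ y t) (he : y =ᶠ[𝓝 t] y') : ChartSol x₀ y' t := by
  refine ⟨he.eq_of_nhds ▸ h.1, h.2.1.congr_of_eventuallyEq he.symm, ?_⟩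
  rw [← he.deriv.deriv_eq, ← he.deriv_eq, ← he.eq_of_nhds]
  exact h.2.2

theorem differentiableAt_deriv_of_smooth {E : Type*} [NormedAddCommGroup E] [NormedSpace ℝ E]
    {y : ℝ → E} {t : ℝ} (h : ContDiffAt ℝ ∞ y t) :
    DifferentiableAt ℝ (deriv y) t := by
  have h1 : ContDiffAt ℝ 1 (fderiv ℝ y) t := h.fderiv_right (m := 1) (by norm_cast)
  have h2 := (h1.differentiableAt (by simp)).clm_apply (differentiableAt_const (1 : ℝ))
  exact h2

variable [IsContMDiffRiemannianBundle (𝓡 d) ∞ (EuclideanSpace ℝ (Fin d))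
      (fun x : M => TangentSpace (𝓡 d) x)]

theorem eulerLagrange_iff_geodAcc {x₀ : M} {y : ℝ → EuclideanSpace ℝ (Fin d)} {t : ℝ}
    (hy : y t ∈ (extChartAt (𝓡 d) x₀).target) (hs : ContDiffAt ℝ ∞ y t) :
    (∀ w, HasDerivAt (fun s => metricInChart x₀ (y s) (deriv y s) w)
      (1 / 2 * fderiv ℝ (fun z => metricInChart x₀ z (deriv y t) (deriv y t)) (y t) w) t) ↔
    deriv (deriv y) t = geodAcc d x₀ (y t, deriv y t) := by
  rw [eq_geodAcc_iff hy]
  exact eulerLagrange_iff (G := metricOp x₀) ((contDiffAt_metricOp hy).differentiableAt (by simp))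
    (hs.differentiableAt (by simp)) (differentiableAt_deriv_of_smooth hs).hasDerivAt

/-- `IsGeodesic` tests the equation in the chart at $c(t)$, which moves with $t$, whereas ODE theory
needs a fixed chart. This lemma moves between the two. -/
theorem ChartSol.change {x₀ x₁ : M} {y : ℝ → EuclideanSpace ℝ (Fin d)} {t : ℝ}
    (h : ChartSol x₀ y t) (hy : y t ∈ chartOverlap d x₀ x₁) :
    ChartSol x₁ (fun s => chartChange d x₀ x₁ (y s)) t := by
  have hopen := isOpen_chartOverlap (d := d) x₀ x₁
  have hψ : ∀ z ∈ chartOverlap d x₀ x₁, ContDiffAt ℝ ∞ (chartChange d x₀ x₁) z := fun z hz =>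
    (contDiffOn_chartChange x₀ x₁).contDiffAt (hopen.mem_nhds hz)
  have hev : ∀ᶠ s in 𝓝 t, y s ∈ chartOverlap d x₀ x₁ :=
    h.2.1.continuousAt.preimage_mem_nhds (hopen.mem_nhds hy)
  have hdiff : ∀ᶠ s in 𝓝 t, DifferentiableAt ℝ y s := by
    have : ContDiffAt ℝ 1 y t := h.2.1.of_le (by norm_cast)
    filter_upwards [this.eventually (by simp)] with s hs using hs.differentiableAt (by simp)
  have hd1 : deriv (fun s => chartChange d x₀ x₁ (y s)) =ᶠ[𝓝 t]
      fun s => fderiv ℝ (chartChange d x₀ x₁) (y s) (deriv y s) := by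
    filter_upwards [hev, hdiff] with s hs hs'
    exact ((hasFDerivAt_chartChange hs).comp_hasDerivAt s hs'.hasDerivAt).deriv
  have hd2 : HasDerivAt (fun s => fderiv ℝ (chartChange d x₀ x₁) (y s) (deriv y s))
      (fderiv ℝ (fderiv ℝ (chartChange d x₀ x₁)) (y t) (deriv y t) (deriv y t) +
        fderiv ℝ (chartChange d x₀ x₁) (y t) (deriv (deriv y) t)) t := by
    have e1 : DifferentiableAt ℝ (fderiv ℝ (chartChange d x₀ x₁)) (y t) :=
      ((hψ _ hy).fderiv_right (m := 1) (by norm_cast)).differentiableAt (by simp)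
    exact (e1.hasFDerivAt.comp_hasDerivAt t hdiff.self_of_nhds.hasDerivAt).clm_apply
      (differentiableAt_deriv_of_smooth h.2.1).hasDerivAt
  have hmem := (chartChange_mem hy).1
  refine ⟨hmem, (hψ _ hy).comp t h.2.1, ?_⟩
  rw [hd1.deriv_eq, hd2.deriv, hd1.eq_of_nhds, add_comm, eq_geodAcc_iff hmem]
  refine acceleration_change (G := metricOp x₀) ((hψ _ hy).of_le (by norm_cast))
    ((contDiffAt_metricOp hmem).differentiableAt (by simp)) (metricOp_comm _ _) ?_
    ((contDiffAt_metricOp hy.1).differentiableAt (by simp)) ?_ ?_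
  · filter_upwards [hopen.mem_nhds hy] with z hz u w
    exact metricInChart_chartChange hz u w
  · intro w
    refine ⟨chartFwd d x₀ ((extChartAt (𝓡 d) x₀).symm (y t))
      (chartBwd d x₁ (chartChange d x₀ x₁ (y t)) w), ?_⟩
    rw [fderiv_chartChange hy, ContinuousLinearMap.comp_apply, chartBwd_chartFwd' hy.1]
    have := chartFwd_chartBwd (chartChange_mem hy).1 w
    rwa [symm_chartChange hy] at this
  · exact (eq_geodAcc_iff hy.1 _ _).1 h.2.2

theorem GeodAt.chartSol {c : ℝ → M} {t : ℝ} {x₀ : M} (h : GeodAt d c t)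
    (hc : c t ∈ (extChartAt (𝓡 d) x₀).source) :
    ChartSol x₀ (fun s => extChartAt (𝓡 d) x₀ (c s)) t := by
  have h0 : ChartSol (c t) (fun s => extChartAt (𝓡 d) (c t) (c s)) t := by
    have hs : ContDiffAt ℝ ∞ (fun s => extChartAt (𝓡 d) (c t) (c s)) t := by
      rw [← contMDiffAt_iff_contDiffAt]
      exact (contMDiffAt_extChartAt (n := ∞)).comp t h.1
    have hm : (fun s => extChartAt (𝓡 d) (c t) (c s)) t ∈ (extChartAt (𝓡 d) (c t)).target :=
      mem_extChartAt_target _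
    have h2 := h.2
    generalize hy : (fun s => extChartAt (𝓡 d) (c t) (c s)) = y at hs hm h2 ⊢
    have hyt : extChartAt (𝓡 d) (c t) (c t) = y t := congrFun hy t
    have hys : ∀ s, extChartAt (𝓡 d) (c t) (c s) = y s := congrFun hy
    simp only [hys] at h2
    exact ⟨hm, hs, (eulerLagrange_iff_geodAcc hm hs).1 h2⟩
  have hov : extChartAt (𝓡 d) (c t) (c t) ∈ chartOverlap d (c t) x₀ := by
    refine ⟨mem_extChartAt_target _, ?_⟩
    rw [mem_preimage, (extChartAt (𝓡 d) (c t)).left_inv (mem_extChartAt_source _)]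
    exact hc
  refine (h0.change hov).congr ?_
  filter_upwards [h.1.continuousAt.preimage_mem_nhds (extChartAt_source_mem_nhds (I := 𝓡 d) (c t))]
    with s hs
  rw [chartChange, (extChartAt (𝓡 d) (c t)).left_inv hs]

theorem ChartSol.geodAt {y : ℝ → EuclideanSpace ℝ (Fin d)} {t : ℝ} {x₀ : M}
    (h : ChartSol x₀ y t) : GeodAt d (fun s => (extChartAt (𝓡 d) x₀).symm (y s)) t := by
  set c : ℝ → M := fun s => (extChartAt (𝓡 d) x₀).symm (y s) with hc
  have hov : y t ∈ chartOverlap d x₀ (c t) := ⟨h.1, mem_extChartAt_source _⟩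
  have h1 := h.change hov
  refine ⟨?_, ?_⟩
  · have := (contMDiffOn_extChartAt_symm (I := 𝓡 d) (n := ∞) x₀).contMDiffAt
      ((isOpen_extChartAt_target x₀).mem_nhds h.1)
    exact this.comp t h.2.1.contMDiffAt
  · exact (eulerLagrange_iff_geodAcc h1.1 h1.2.1).2 h1.2.2

omit [IsManifold (𝓡 d) ∞ M] [IsContMDiffRiemannianBundle (𝓡 d) ∞ (EuclideanSpace ℝ (Fin d))
      (fun x : M => TangentSpace (𝓡 d) x)] in
theorem GeodAt.congr {c c' : ℝ → M} {t : ℝ} (h : GeodAt d c t) (he : c =ᶠ[𝓝 t] c') :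
    GeodAt d c' t := by
  refine ⟨h.1.congr_of_eventuallyEq he.symm, fun w => ?_⟩
  rw [← he.eq_of_nhds]
  have h1 : (fun s => extChartAt (𝓡 d) (c t) (c s)) =ᶠ[𝓝 t]
      fun s => extChartAt (𝓡 d) (c t) (c' s) := he.fun_comp _
  rw [← h1.deriv_eq]
  refine (h.2 w).congr_of_eventuallyEq ?_
  filter_upwards [h1, h1.deriv] with s hs hs'
  rw [hs, hs']

omit [IsManifold (𝓡 d) ∞ M] [IsContMDiffRiemannianBundle (𝓡 d) ∞ (EuclideanSpace ℝ (Fin d))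
      (fun x : M => TangentSpace (𝓡 d) x)] in
/-- Reparametrisation of solutions by affine maps. -/
theorem ChartSol.comp_affine {x₀ : M} {y : ℝ → EuclideanSpace ℝ (Fin d)} (a b : ℝ) {t : ℝ}
    (h : ChartSol x₀ y (a * t + b)) : ChartSol x₀ (fun s => y (a * s + b)) t := by
  have hd : ∀ (f : ℝ → EuclideanSpace ℝ (Fin d)) s, deriv (fun s => f (a * s + b)) s =
      a • deriv f (a * s + b) := fun f s => by
    have := deriv_comp_mul_left a (fun u => f (u + b)) s
    rw [this, deriv_comp_add_const]
  have hd1 : deriv (fun s => y (a * s + b)) = fun s => a • deriv y (a * s + b) :=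
    funext fun s => hd y s
  refine ⟨h.1, ?_, ?_⟩
  · exact ContDiffAt.comp (f := fun s : ℝ => a * s + b) t h.2.1 (by fun_prop)
  · rw [hd1]
    have := hd (fun s => a • deriv y s) t
    rw [this, geodAcc_smul, ← h.2.2, deriv_fun_const_smul _ (differentiableAt_deriv_of_smooth h.2.1),
      smul_smul, sq]

theorem GeodAt.comp_affine {c : ℝ → M} (a b : ℝ) {t : ℝ} (h : GeodAt d c (a * t + b)) :
    GeodAt d (fun s => c (a * s + b)) t := by
  have hsrc := mem_extChartAt_source (I := 𝓡 d) (c (a * t + b))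
  refine ((h.chartSol hsrc).comp_affine a b).geodAt.congr ?_
  have hcont : ContinuousAt (fun s => c (a * s + b)) t :=
    ContinuousAt.comp (f := fun s : ℝ => a * s + b) (x := t) h.1.continuousAt (by fun_prop)
  filter_upwards [hcont.preimage_mem_nhds (extChartAt_source_mem_nhds (I := 𝓡 d) (c (a * t + b)))]
    with s hs
  exact (extChartAt (𝓡 d) (c (a * t + b))).left_inv hs

end GeodesicCurves

/-! ### Existence, uniqueness and constant speed of geodesics -/

section GeodesicFlow

variable {d : ℕ} {M : Type*} [EMetricSpace M] [ChartedSpace (EuclideanSpace ℝ (Fin d)) M]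
  [IsManifold (𝓡 d) ∞ M] [RiemannianBundle (fun x : M => TangentSpace (𝓡 d) x)]

variable (d) in
/-- The geodesic equation in the chart at `x₀` as a first order equation. -/
def geodField (x₀ : M) (p : EuclideanSpace ℝ (Fin d) × EuclideanSpace ℝ (Fin d)) :
    EuclideanSpace ℝ (Fin d) × EuclideanSpace ℝ (Fin d) := (p.2, geodAcc d x₀ p)

omit [IsManifold (𝓡 d) ∞ M] in
theorem ChartSol.hasDerivAt {x₀ : M} {y : ℝ → EuclideanSpace ℝ (Fin d)} {t : ℝ}
    (h : ChartSol x₀ y t) :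
    HasDerivAt (fun s => (y s, deriv y s)) (geodField d x₀ (y t, deriv y t)) t := by
  have h1 := (h.2.1.differentiableAt (by simp)).hasDerivAt
  have h2 := (differentiableAt_deriv_of_smooth h.2.1).hasDerivAt
  rw [h.2.2] at h2
  exact h1.prodMk h2

/-- The velocity of a curve. -/
def velocity (d : ℕ) {M : Type*} [EMetricSpace M] [ChartedSpace (EuclideanSpace ℝ (Fin d)) M]
    (c : ℝ → M) (t : ℝ) : EuclideanSpace ℝ (Fin d) :=
  deriv (fun s => extChartAt (𝓡 d) (c t) (c s)) t

omit [RiemannianBundle (fun x : M => TangentSpace (𝓡 d) x)] in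
theorem deriv_chart_eq {c : ℝ → M} {t : ℝ} {x₀ : M} (h : ContMDiffAt 𝓘(ℝ, ℝ) (𝓡 d) ∞ c t)
    (hc : c t ∈ (extChartAt (𝓡 d) x₀).source) :
    deriv (fun s => extChartAt (𝓡 d) x₀ (c s)) t = chartFwd d x₀ (c t) (velocity d c t) := by
  obtain ⟨u, h1⟩ : ∃ u : EuclideanSpace ℝ (Fin d), ∀ x₁ : M,
      c t ∈ (extChartAt (𝓡 d) x₁).source →
      HasDerivAt (fun s => extChartAt (𝓡 d) x₁ (c s)) (chartFwd d x₁ (c t) u) t := by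
    refine ⟨(mfderiv 𝓘(ℝ, ℝ) (𝓡 d) c t : ℝ →L[ℝ] EuclideanSpace ℝ (Fin d)) 1, fun x₁ h1 => ?_⟩
    have h2 : HasFDerivAt (fun s => extChartAt (𝓡 d) x₁ (c s)) ((chartFwd d x₁ (c t)).comp
      (mfderiv 𝓘(ℝ, ℝ) (𝓡 d) c t : ℝ →L[ℝ] EuclideanSpace ℝ (Fin d))) t :=
      hasMFDerivAt_iff_hasFDerivAt.1 ((hasMFDerivAt_chart (d := d) h1).comp t
        (h.mdifferentiableAt (by simp)).hasMFDerivAt)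
    exact h2.hasDerivAt
  have h3 : ∀ v, chartFwd d (c t) (c t) v = v := fun v => by
    have := mfderiv_extChartAt_self (I := 𝓡 d) (x := c t)
    exact congr($this v)
  rw [(h1 x₀ hc).deriv, velocity, (h1 (c t) (mem_extChartAt_source _)).deriv, h3]

variable [IsContMDiffRiemannianBundle (𝓡 d) ∞ (EuclideanSpace ℝ (Fin d))
      (fun x : M => TangentSpace (𝓡 d) x)]

theorem contDiffAt_geodField {x₀ : M} {p : EuclideanSpace ℝ (Fin d) × EuclideanSpace ℝ (Fin d)}
    (hz : p.1 ∈ (extChartAt (𝓡 d) x₀).target) : ContDiffAt ℝ ∞ (geodField d x₀) p :=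
  contDiffAt_snd.prodMk (contDiffAt_geodAcc hz)

/-- `ChartSol` asks for a smooth curve; a differentiable solution of the first order system is
smooth because the field is. -/
theorem chartSol_of_hasDerivAt {x₀ : M} {a b : ℝ}
    {P : ℝ → EuclideanSpace ℝ (Fin d) × EuclideanSpace ℝ (Fin d)}
    (h : ∀ t ∈ Ioo a b, HasDerivAt P (geodField d x₀ (P t)) t ∧
      (P t).1 ∈ (extChartAt (𝓡 d) x₀).target) {t : ℝ} (ht : t ∈ Ioo a b) :
    ChartSol x₀ (fun s => (P s).1) t ∧ deriv (fun s => (P s).1) t = (P t).2 := by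
  have hd : ∀ s ∈ Ioo a b, HasDerivAt (fun s => (P s).1) (P s).2 s := fun s hs =>
    (hasFDerivAt_fst (𝕜 := ℝ) (p := P s)).comp_hasDerivAt s (h s hs).1
  have hev : deriv (fun s => (P s).1) =ᶠ[𝓝 t] fun s => (P s).2 := by
    filter_upwards [Ioo_mem_nhds ht.1 ht.2] with s hs using (hd s hs).deriv
  refine ⟨⟨(h t ht).2, ?_, ?_⟩, hev.eq_of_nhds⟩
  · obtain ⟨a', ha', ha't⟩ := exists_between ht.1
    obtain ⟨b', hb't, hb'⟩ := exists_between ht.2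
    have hsub : Icc a' b' ⊆ Ioo a b := fun s hs => ⟨ha'.trans_le hs.1, hs.2.trans_lt hb'⟩
    have hf : ContDiffOn ℝ ((⊤ : ℕ∞) : WithTop ℕ∞) (Function.uncurry fun _ : ℝ => geodField d x₀)
        (Icc a' b' ×ˢ ((extChartAt (𝓡 d) x₀).target ×ˢ univ)) := fun p hp =>
      (ContDiffAt.comp p (contDiffAt_geodField hp.2.1) contDiffAt_snd).contDiffWithinAt
    have := ODE.contDiffOn_enat_Icc_of_hasDerivWithinAt hf
      (fun s hs => (h s (hsub hs)).1.hasDerivWithinAt) (fun s hs => ⟨(h s (hsub hs)).2, mem_univ _⟩)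
    exact contDiffAt_fst.comp t (this.contDiffAt (Icc_mem_nhds ha't hb't))
  · rw [hev.deriv_eq, hev.eq_of_nhds]
    exact ((hasFDerivAt_snd (𝕜 := ℝ) (p := P t)).comp_hasDerivAt t (h t ht).1).deriv

theorem geodAt_eventually_eq {c₁ c₂ : ℝ → M} {t : ℝ} (h₁ : ∀ᶠ s in 𝓝 t, GeodAt d c₁ s)
    (h₂ : ∀ᶠ s in 𝓝 t, GeodAt d c₂ s) (heq : c₁ t = c₂ t)
    (hv : velocity d c₁ t = velocity d c₂ t) : c₁ =ᶠ[𝓝 t] c₂ := by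
  set x₀ := c₁ t with hx₀
  have hs₁ : ∀ᶠ s in 𝓝 t, c₁ s ∈ (extChartAt (𝓡 d) x₀).source :=
    h₁.self_of_nhds.1.continuousAt.preimage_mem_nhds (extChartAt_source_mem_nhds x₀)
  have hs₂ : ∀ᶠ s in 𝓝 t, c₂ s ∈ (extChartAt (𝓡 d) x₀).source :=
    h₂.self_of_nhds.1.continuousAt.preimage_mem_nhds (heq ▸ extChartAt_source_mem_nhds x₀)
  have hc : ContDiffAt ℝ 1 (geodField d x₀)
      (extChartAt (𝓡 d) x₀ x₀, velocity d c₁ t) :=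
    (contDiffAt_geodField (mem_extChartAt_target x₀)).of_le (by norm_cast)
  obtain ⟨K, s, hs, hlip⟩ := hc.exists_lipschitzOnWith
  have key : ∀ c : ℝ → M, (∀ᶠ s in 𝓝 t, GeodAt d c s) →
      (∀ᶠ s in 𝓝 t, c s ∈ (extChartAt (𝓡 d) x₀).source) → c t = x₀ →
      velocity d c t = velocity d c₁ t →
      ∀ᶠ u in 𝓝 t, HasDerivAt (fun s => (extChartAt (𝓡 d) x₀ (c s),
        deriv (fun s => extChartAt (𝓡 d) x₀ (c s)) s))
        (geodField d x₀ (extChartAt (𝓡 d) x₀ (c u),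
          deriv (fun s => extChartAt (𝓡 d) x₀ (c s)) u)) u ∧
        (extChartAt (𝓡 d) x₀ (c u), deriv (fun s => extChartAt (𝓡 d) x₀ (c s)) u) ∈ s := by
    intro c hg hsrc h0 hv0
    have hd : ∀ᶠ u in 𝓝 t, HasDerivAt (fun s => (extChartAt (𝓡 d) x₀ (c s),
        deriv (fun s => extChartAt (𝓡 d) x₀ (c s)) s))
        (geodField d x₀ (extChartAt (𝓡 d) x₀ (c u),
          deriv (fun s => extChartAt (𝓡 d) x₀ (c s)) u)) u := by
      filter_upwards [hg, hsrc] with u hu hu'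
      exact (hu.chartSol hu').hasDerivAt
    refine hd.and ?_
    refine hd.self_of_nhds.continuousAt.preimage_mem_nhds ?_
    have h0' := h0
    rw [← h0] at hs ⊢
    rw [← hv0] at hs
    exact hs
  have := ODE_solution_unique_of_eventually (v := fun _ => geodField d x₀) (s := fun _ => s)
    (Eventually.of_forall fun _ => hlip) (key c₁ h₁ hs₁ rfl rfl) (key c₂ h₂ hs₂ heq.symm hv.symm)
    (by
      have e1 := deriv_chart_eq h₁.self_of_nhds.1 hs₁.self_of_nhds
      have e2 := deriv_chart_eq h₂.self_of_nhds.1 hs₂.self_of_nhds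
      rw [e1, e2, hv, ← heq])
  filter_upwards [this, hs₁, hs₂] with u hu h1 h2
  have := congrArg Prod.fst hu
  exact (extChartAt (𝓡 d) x₀).injOn h1 h2 this

/-- Uniqueness of geodesics. -/
theorem geodesic_eqOn {c₁ c₂ : ℝ → M} {a b t₀ : ℝ} (h₁ : ∀ t ∈ Ioo a b, GeodAt d c₁ t)
    (h₂ : ∀ t ∈ Ioo a b, GeodAt d c₂ t) (ht₀ : t₀ ∈ Ioo a b) (heq : c₁ t₀ = c₂ t₀)
    (hv : velocity d c₁ t₀ = velocity d c₂ t₀) : EqOn c₁ c₂ (Ioo a b) := by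
  have hev : ∀ (c : ℝ → M), (∀ t ∈ Ioo a b, GeodAt d c t) → ∀ t ∈ Ioo a b,
      ∀ᶠ s in 𝓝 t, GeodAt d c s := fun c hc t ht => by
    filter_upwards [Ioo_mem_nhds ht.1 ht.2] with s hs using hc s hs
  have hsub : Ioo a b ⊆ {t | c₁ =ᶠ[𝓝 t] c₂} := by
    -- The set of times where the two germs agree is open by definition and closed because position
    -- and velocity pass to the limit, where local uniqueness applies.
    apply isPreconnected_Ioo.subset_of_closure_inter_subset
    · exact isOpen_iff_mem_nhds.2 fun t ht => eventually_eventually_nhds.2 ht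
    · exact ⟨t₀, ht₀, geodAt_eventually_eq (hev _ h₁ _ ht₀) (hev _ h₂ _ ht₀) heq hv⟩
    · rintro t ⟨htc, ht⟩
      have hfr : ∃ᶠ s in 𝓝 t, c₁ =ᶠ[𝓝 s] c₂ := mem_closure_iff_frequently.1 htc
      have g₁ := h₁ t ht
      have g₂ := h₂ t ht
      have e : c₁ t = c₂ t := tendsto_nhds_unique_of_frequently_eq g₁.1.continuousAt
        g₂.1.continuousAt (hfr.mono fun s hs => hs.eq_of_nhds)
      refine geodAt_eventually_eq (hev _ h₁ _ ht) (hev _ h₂ _ ht) e ?_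
      have hsrc₂ : c₂ t ∈ (extChartAt (𝓡 d) (c₁ t)).source := e ▸ mem_extChartAt_source _
      have d₁ := (differentiableAt_deriv_of_smooth
        (g₁.chartSol (mem_extChartAt_source (I := 𝓡 d) (c₁ t))).2.1).continuousAt
      have d₂ := (differentiableAt_deriv_of_smooth (g₂.chartSol hsrc₂).2.1).continuousAt
      have e' := tendsto_nhds_unique_of_frequently_eq d₁ d₂ (hfr.mono fun s hs =>
        (hs.fun_comp (extChartAt (𝓡 d) (c₁ t))).deriv_eq)
      rw [velocity, velocity, e', e]
  exact fun t ht => (hsub ht).eq_of_nhds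

/-- Geodesics have constant speed. -/
theorem geodesic_speed {c : ℝ → M} {a b s t : ℝ} (h : ∀ t ∈ Ioo a b, GeodAt d c t)
    (hs : s ∈ Ioo a b) (ht : t ∈ Ioo a b) :
    rnorm (c s) (velocity d c s) = rnorm (c t) (velocity d c t) := by
  have key : ∀ t ∈ Ioo a b, HasDerivAt (fun s => rawInner (c s) (velocity d c s) (velocity d c s))
      0 t := by
    intro t ht
    set x₀ := c t with hx₀
    set y : ℝ → EuclideanSpace ℝ (Fin d) := fun s => extChartAt (𝓡 d) x₀ (c s) with hy
    have hsol : ChartSol x₀ y t := (h t ht).chartSol (mem_extChartAt_source _)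
    have hev : (fun s => rawInner (c s) (velocity d c s) (velocity d c s)) =ᶠ[𝓝 t]
        fun s => metricOp x₀ (y s) (deriv y s) (deriv y s) := by
      filter_upwards [Ioo_mem_nhds ht.1 ht.2, (h t ht).1.continuousAt.preimage_mem_nhds
        (extChartAt_source_mem_nhds (I := 𝓡 d) (c t))] with s hs hs'
      rw [metricOp_apply, hy, deriv_chart_eq (h s hs).1 hs', metricInChart_self hs']
    refine HasDerivAt.congr_of_eventuallyEq ?_ hev
    have hG := ((contDiffAt_metricOp hsol.1).differentiableAt (by simp)).hasFDerivAt
    have hy1 := (hsol.2.1.differentiableAt (by simp)).hasDerivAt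
    have hy2 := (differentiableAt_deriv_of_smooth hsol.2.1).hasDerivAt
    have := ((hG.comp_hasDerivAt t hy1).clm_apply hy2).clm_apply hy2
    refine this.congr_deriv ?_
    -- Tested against $y'$, the equation says $2g(y'',y')=-(\partial_{y'}g)(y',y')$, which cancels
    -- the derivative of the metric coefficients.
    have e := (eq_geodAcc_iff hsol.1 _ _).1 hsol.2.2 (deriv y t)
    have e' := metricOp_comm x₀ (y t) (deriv y t) (deriv (deriv y) t)
    simp only [add_apply, Function.comp_apply]
    linarith
  have hc : rawInner (c s) (velocity d c s) (velocity d c s) =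
      rawInner (c t) (velocity d c t) (velocity d c t) :=
    isOpen_Ioo.is_const_of_deriv_eq_zero isPreconnected_Ioo
      (fun u hu => (key u hu).differentiableAt.differentiableWithinAt)
      (fun u hu => (key u hu).deriv) hs ht
  rw [rawInner_self, rawInner_self] at hc
  exact (pow_left_inj₀ (rnorm_nonneg _ _) (rnorm_nonneg _ _) two_ne_zero).1 hc

/-- Solutions of the geodesic equation in a chart with small initial velocity. -/
theorem exists_chart_geodesic (x₀ : M) {N : Set (EuclideanSpace ℝ (Fin d) × EuclideanSpace ℝ (Fin d))}
    (hN : N ∈ 𝓝 (extChartAt (𝓡 d) x₀ x₀, (0 : EuclideanSpace ℝ (Fin d)))) :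
    ∃ δ > 0, ∀ p ∈ Metric.ball (extChartAt (𝓡 d) x₀ x₀, (0 : EuclideanSpace ℝ (Fin d))) δ,
      ∃ P : ℝ → EuclideanSpace ℝ (Fin d) × EuclideanSpace ℝ (Fin d), P 0 = p ∧
        ∀ t ∈ Ioo (-3) 3, HasDerivAt P (geodField d x₀ (P t)) t ∧ P t ∈ N := by
  set p₀ : EuclideanSpace ℝ (Fin d) × EuclideanSpace ℝ (Fin d) := (extChartAt (𝓡 d) x₀ x₀, 0)
    with hp₀
  obtain ⟨ρ, hρ, hρN⟩ := Metric.mem_nhds_iff.1 hN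
  have hf : ContDiffAt ℝ 1 (geodField d x₀) p₀ :=
    (contDiffAt_geodField (mem_extChartAt_target x₀)).of_le (by norm_cast)
  obtain ⟨ε, hε, a, r, L, K, hr, hPL⟩ := IsPicardLindelof.of_contDiffAt_one hf
  obtain ⟨α, hα, hαc⟩ :=
    (hPL 0).exists_forall_mem_closedBall_eq_hasDerivWithinAt_continuousOn
  simp only [zero_sub, zero_add] at hα hαc
  have h0 : α (p₀, 0) = p₀ := (hα _ (Metric.mem_closedBall_self r.2)).1
  have hnhds : Metric.closedBall p₀ r ×ˢ Icc (-ε) ε ∈ 𝓝 (p₀, (0 : ℝ)) :=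
    prod_mem_nhds (Metric.closedBall_mem_nhds _ hr) (Icc_mem_nhds (by linarith) hε)
  have hca : ContinuousAt α (p₀, 0) := hαc.continuousAt hnhds
  have hpre : α ⁻¹' Metric.ball p₀ ρ ∩ Metric.closedBall p₀ r ×ˢ Icc (-ε) ε ∈ 𝓝 (p₀, (0 : ℝ)) :=
    inter_mem (hca.preimage_mem_nhds (by rw [h0]; exact Metric.ball_mem_nhds _ hρ)) hnhds
  obtain ⟨e₀, he₀, hball⟩ := Metric.mem_nhds_iff.1 hpre
  -- The local flow exists for a possibly short time `e₀`. Slowing a solution down by the factor `e`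
  -- makes it last for time 3, at the price of an initial velocity smaller by the factor `e`.
  set e := min (e₀ / 6) 1 with he
  have hepos : 0 < e := by positivity
  have he1 : e ≤ 1 := min_le_right _ _
  have he3 : 3 * e < e₀ := by have := min_le_left (e₀ / 6) 1; linarith
  have hin : ∀ p ∈ Metric.ball p₀ e₀, ∀ t ∈ Ioo (-e₀) e₀, α (p, t) ∈ Metric.ball p₀ ρ ∧
      p ∈ Metric.closedBall p₀ r ∧ t ∈ Icc (-ε) ε := fun p hp t ht => by
    have hm : (p, t) ∈ Metric.ball (p₀, (0 : ℝ)) e₀ := by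
      rw [← ball_prod_same]
      exact ⟨hp, by rwa [Real.ball_eq_Ioo, zero_sub, zero_add]⟩
    have := hball hm
    exact ⟨this.1, this.2.1, this.2.2⟩
  have hder : ∀ p ∈ Metric.ball p₀ e₀, ∀ t ∈ Ioo (-e₀) e₀,
      HasDerivAt (fun t => α (p, t)) (geodField d x₀ (α (p, t))) t := fun p hp t ht => by
    have hss : Ioo (-e₀) e₀ ⊆ Icc (-ε) ε := fun s hs => (hin p hp s hs).2.2
    exact ((hα p (hin p hp t ht).2.1).2 t (hss ht)).hasDerivAt
      (mem_of_superset (Ioo_mem_nhds ht.1 ht.2) hss)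
  refine ⟨e₀ * e, by positivity, fun p hp => ?_⟩
  have hq : (p.1, e⁻¹ • p.2) ∈ Metric.ball p₀ e₀ := by
    rw [hp₀, ← ball_prod_same] at hp ⊢
    have h1 := hp.1
    have h2 := hp.2
    rw [Metric.mem_ball] at h1 h2
    refine ⟨?_, ?_⟩
    · rw [Metric.mem_ball]
      exact h1.trans_le (by nlinarith)
    · rw [Metric.mem_ball, dist_zero_right, norm_smul, norm_inv, Real.norm_of_nonneg hepos.le,
        inv_mul_lt_iff₀ hepos, mul_comm]
      rwa [dist_zero_right] at h2
  refine ⟨fun t => ((α ((p.1, e⁻¹ • p.2), e * t)).1, e • (α ((p.1, e⁻¹ • p.2), e * t)).2), ?_,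
    fun t ht => ?_⟩
  · simp only [mul_zero]
    rw [(hα _ (hin _ hq 0 ⟨by linarith, he₀⟩).2.1).1]
    simp [smul_smul, mul_inv_cancel₀ hepos.ne']
  · have het : e * t ∈ Ioo (-e₀) e₀ := ⟨by nlinarith [ht.1], by nlinarith [ht.2]⟩
    have hd := (hder _ hq _ het).scomp t ((hasDerivAt_id t).const_mul e)
    simp only [mul_one] at hd
    constructor
    · have h1 := (hasFDerivAt_fst.comp_hasDerivAt t hd)
      have h2 := (hasFDerivAt_snd.comp_hasDerivAt t hd).const_smul e
      refine (h1.prodMk h2).congr_deriv ?_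
      have h3 := geodAcc_smul x₀ (α ((p.1, e⁻¹ • p.2), e * t)).1
        (α ((p.1, e⁻¹ • p.2), e * t)).2 e
      simp only [geodField, h3]
      simp [smul_smul, sq]
    · apply hρN
      have := (hin _ hq _ het).1
      rw [hp₀, ← ball_prod_same] at this ⊢
      refine ⟨this.1, ?_⟩
      have h2 := this.2
      rw [Metric.mem_ball, dist_zero_right] at h2 ⊢
      rw [norm_smul, Real.norm_of_nonneg hepos.le]
      exact (mul_le_of_le_one_left (norm_nonneg _) he1).trans_lt h2

end GeodesicFlow

/-! ### Completeness for small velocities and the exponential map -/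

section Exponential

variable {d : ℕ} {M : Type*} [EMetricSpace M] [ChartedSpace (EuclideanSpace ℝ (Fin d)) M]
  [IsManifold (𝓡 d) ∞ M] [RiemannianBundle (fun x : M => TangentSpace (𝓡 d) x)]

omit [RiemannianBundle (fun x : M => TangentSpace (𝓡 d) x)] in
theorem velocity_comp_affine {c : ℝ → M} (a b t : ℝ) :
    velocity d (fun s => c (a * s + b)) t = a • velocity d c (a * t + b) := by
  have := deriv_comp_mul_left a (fun u => extChartAt (𝓡 d) (c (a * t + b)) (c (u + b))) t
  rw [velocity, this, deriv_comp_add_const (f := fun u => extChartAt (𝓡 d) (c (a * t + b)) (c u))]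
  rfl

omit [IsManifold (𝓡 d) ∞ M] [RiemannianBundle (fun x : M => TangentSpace (𝓡 d) x)] in
theorem velocity_congr {c c' : ℝ → M} {t : ℝ} (h : c =ᶠ[𝓝 t] c') :
    velocity d c t = velocity d c' t := by
  rw [velocity, velocity, h.eq_of_nhds]
  exact (h.fun_comp (extChartAt (𝓡 d) (c' t))).deriv_eq

variable [IsContMDiffRiemannianBundle (𝓡 d) ∞ (EuclideanSpace ℝ (Fin d))
      (fun x : M => TangentSpace (𝓡 d) x)]

theorem metric_bounds (x₀ : M) : ∃ C : ℝ, 0 < C ∧ ∀ᶠ z in 𝓝 (extChartAt (𝓡 d) x₀ x₀),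
    ∀ u : EuclideanSpace ℝ (Fin d), metricInChart x₀ z u u ≤ C ^ 2 * ‖u‖ ^ 2 ∧
      ‖u‖ ^ 2 ≤ C ^ 2 * metricInChart x₀ z u u := by
  set z₀ := extChartAt (𝓡 d) x₀ x₀
  have hz₀ : z₀ ∈ (extChartAt (𝓡 d) x₀).target := mem_extChartAt_target x₀
  -- At the centre the metric is bounded below on the unit sphere by compactness; an empty sphere
  -- means dimension zero.
  obtain ⟨c, hc, hcb⟩ : ∃ c > 0, ∀ u : EuclideanSpace ℝ (Fin d),
      c * ‖u‖ ^ 2 ≤ metricOp x₀ z₀ u u := by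
    rcases (Metric.sphere (0 : EuclideanSpace ℝ (Fin d)) 1).eq_empty_or_nonempty with he | hne
    · refine ⟨1, one_pos, fun u => ?_⟩
      have : u = 0 := by
        by_contra hu
        have : (‖u‖⁻¹ • u) ∈ Metric.sphere (0 : EuclideanSpace ℝ (Fin d)) 1 := by
          simp [norm_smul, hu]
        rw [he] at this
        exact this
      simp [this]
    · obtain ⟨u₀, hu₀, hmin⟩ := (isCompact_sphere (0 : EuclideanSpace ℝ (Fin d)) 1).exists_isMinOn
        hne (f := fun u => metricOp x₀ z₀ u u) (by fun_prop)
      have hne0 : u₀ ≠ 0 := by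
        rintro rfl
        simp at hu₀
      refine ⟨metricOp x₀ z₀ u₀ u₀, metricInChart_pos hz₀ hne0, fun u => ?_⟩
      rcases eq_or_ne u 0 with rfl | hu
      · simp
      have hpos : 0 < ‖u‖ := norm_pos_iff.2 hu
      have h1 := hmin (a := ‖u‖⁻¹ • u) (by simp [norm_smul, hu])
      simp only [mem_ofPred_eq, map_smul, smul_apply, smul_eq_mul] at h1
      calc metricOp x₀ z₀ u₀ u₀ * ‖u‖ ^ 2
          ≤ ‖u‖⁻¹ * (‖u‖⁻¹ * metricOp x₀ z₀ u u) * ‖u‖ ^ 2 :=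
            mul_le_mul_of_nonneg_right h1 (by positivity)
        _ = _ := by field_simp
  have hcont := (contDiffAt_metricOp hz₀).continuousAt
  have hK : (1 : ℝ) ≤ 1 + 2 / c + 2 * ‖metricOp x₀ z₀‖ + c := by
    have : 0 ≤ 2 / c + 2 * ‖metricOp x₀ z₀‖ + c := by positivity
    linarith
  -- A generous constant: it dominates both $2/c$ and $\|g\|+c$, and being at least 1 it lies below
  -- its square, the form from which square roots are taken later.
  refine ⟨1 + 2 / c + 2 * ‖metricOp x₀ z₀‖ + c, by positivity, ?_⟩
  filter_upwards [Metric.continuousAt_iff'.1 hcont (c / 2) (by positivity)] with z hz u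
  rw [dist_eq_norm] at hz
  have hK2 : (1 + 2 / c + 2 * ‖metricOp x₀ z₀‖ + c) ≤
      (1 + 2 / c + 2 * ‖metricOp x₀ z₀‖ + c) ^ 2 := by nlinarith
  have h1 : |metricOp x₀ z u u - metricOp x₀ z₀ u u| ≤ c / 2 * ‖u‖ ^ 2 := by
    have := (metricOp x₀ z - metricOp x₀ z₀).le_opNorm₂ u u
    simp only [sub_apply, Real.norm_eq_abs] at this
    nlinarith [sq_nonneg ‖u‖]
  have h2 : metricOp x₀ z₀ u u ≤ ‖metricOp x₀ z₀‖ * ‖u‖ ^ 2 := by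
    have := (metricOp x₀ z₀).le_opNorm₂ u u
    rw [Real.norm_eq_abs] at this
    nlinarith [le_abs_self (metricOp x₀ z₀ u u)]
  obtain ⟨h3, h4⟩ := abs_le.1 h1
  have h5 := hcb u
  rw [← metricOp_apply]
  have h0 : 0 ≤ metricOp x₀ z u u := by nlinarith [sq_nonneg ‖u‖]
  have hn := sq_nonneg ‖u‖
  have hcp : 0 < 2 / c := by positivity
  constructor
  · calc metricOp x₀ z u u ≤ (‖metricOp x₀ z₀‖ + c) * ‖u‖ ^ 2 := by nlinarith
      _ ≤ _ := mul_le_mul_of_nonneg_right (by nlinarith [norm_nonneg (metricOp x₀ z₀)]) hn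
  · calc ‖u‖ ^ 2 = 2 / c * (c / 2 * ‖u‖ ^ 2) := by field_simp
      _ ≤ 2 / c * metricOp x₀ z u u := mul_le_mul_of_nonneg_left (by nlinarith) hcp.le
      _ ≤ _ := mul_le_mul_of_nonneg_right (by nlinarith [norm_nonneg (metricOp x₀ z₀)]) h0

/-- Near `x₀`, the Riemannian norm is comparable with the norm in the chart at `x₀`. -/
theorem rnorm_bounds (x₀ : M) : ∃ C : ℝ, 0 < C ∧ ∀ᶠ x in 𝓝 x₀,
    ∀ v : EuclideanSpace ℝ (Fin d), rnorm x v ≤ C * ‖chartFwd d x₀ x v‖ ∧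
      ‖chartFwd d x₀ x v‖ ≤ C * rnorm x v := by
  obtain ⟨C, hC, h⟩ := metric_bounds (d := d) x₀
  refine ⟨C, hC, ?_⟩
  filter_upwards [(continuousAt_extChartAt (I := 𝓡 d) x₀).eventually h,
    extChartAt_source_mem_nhds (I := 𝓡 d) x₀] with x hx hxs v
  obtain ⟨h1, h2⟩ := hx (chartFwd d x₀ x v)
  rw [metricInChart_self hxs, rawInner_self, ← mul_pow] at h1 h2
  have := rnorm_nonneg x v
  exact ⟨(sq_le_sq₀ this (by positivity)).1 h1, (sq_le_sq₀ (by positivity) (by positivity)).1 h2⟩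

theorem chart_geodesic {x₀ x : M} (hx : x ∈ (extChartAt (𝓡 d) x₀).source)
    {v : EuclideanSpace ℝ (Fin d)} {P : ℝ → EuclideanSpace ℝ (Fin d) × EuclideanSpace ℝ (Fin d)}
    (h0 : P 0 = (extChartAt (𝓡 d) x₀ x, chartFwd d x₀ x v))
    (hP : ∀ t ∈ Ioo (-3) 3, HasDerivAt P (geodField d x₀ (P t)) t ∧
      (P t).1 ∈ (extChartAt (𝓡 d) x₀).target) :
    (∀ t ∈ Ioo (-3) 3, GeodAt d (fun t => (extChartAt (𝓡 d) x₀).symm (P t).1) t) ∧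
      (extChartAt (𝓡 d) x₀).symm (P 0).1 = x ∧
      velocity d (fun t => (extChartAt (𝓡 d) x₀).symm (P t).1) 0 = v := by
  have h1 : ∀ t ∈ Ioo (-3) 3, GeodAt d (fun t => (extChartAt (𝓡 d) x₀).symm (P t).1) t :=
    fun t ht => (chartSol_of_hasDerivAt hP ht).1.geodAt
  have h2 : (extChartAt (𝓡 d) x₀).symm (P 0).1 = x := by
    rw [h0]
    exact (extChartAt (𝓡 d) x₀).left_inv hx
  have h00 : (0 : ℝ) ∈ Ioo (-3 : ℝ) 3 := by norm_num
  refine ⟨h1, h2, ?_⟩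
  have h3 := deriv_chart_eq (x₀ := x₀) (h1 0 h00).1 (by rw [h2]; exact hx)
  have h4 : (fun s => extChartAt (𝓡 d) x₀ ((extChartAt (𝓡 d) x₀).symm (P s).1)) =ᶠ[𝓝 0]
      fun s => (P s).1 := by
    filter_upwards [Ioo_mem_nhds h00.1 h00.2] with s hs
      using (extChartAt (𝓡 d) x₀).right_inv (hP s hs).2
  rw [h4.deriv_eq, (chartSol_of_hasDerivAt hP h00).2, h2, h0] at h3
  have h5 := congrArg (chartBwd d x₀ (extChartAt (𝓡 d) x₀ x)) h3
  rw [chartBwd_chartFwd hx, chartBwd_chartFwd hx] at h5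
  exact h5.symm

/-- Gluing of geodesics. -/
theorem geodesic_glue {c₁ c₂ : ℝ → M} {a₁ b₁ a₂ b₂ t₀ : ℝ} (h₁ : ∀ t ∈ Ioo a₁ b₁, GeodAt d c₁ t)
    (h₂ : ∀ t ∈ Ioo a₂ b₂, GeodAt d c₂ t) (ha : a₁ ≤ a₂) (hb : b₁ ≤ b₂) (ht₀ : t₀ ∈ Ioo a₂ b₁)
    (heq : c₁ t₀ = c₂ t₀) (hv : velocity d c₁ t₀ = velocity d c₂ t₀) :
    ∃ c : ℝ → M, (∀ t ∈ Ioo a₁ b₂, GeodAt d c t) ∧ EqOn c c₁ (Ioo a₁ b₁) ∧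
      EqOn c c₂ (Ioo a₂ b₂) := by
  have he : EqOn c₁ c₂ (Ioo a₂ b₁) := geodesic_eqOn (fun t ht => h₁ t ⟨ha.trans_lt ht.1, ht.2⟩)
    (fun t ht => h₂ t ⟨ht.1, ht.2.trans_le hb⟩) ht₀ heq hv
  classical
  let c : ℝ → M := fun t => if t ≤ t₀ then c₁ t else c₂ t
  have e₁ : EqOn c c₁ (Ioo a₁ b₁) := fun t ht => by
    by_cases h : t ≤ t₀
    · simp only [c, if_pos h]
    · simp only [c, if_neg h]
      exact (he ⟨ht₀.1.trans (not_le.1 h), ht.2⟩).symm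
  have e₂ : EqOn c c₂ (Ioo a₂ b₂) := fun t ht => by
    by_cases h : t ≤ t₀
    · simp only [c, if_pos h]
      exact he ⟨ht.1, h.trans_lt ht₀.2⟩
    · simp only [c, if_neg h]
  refine ⟨c, fun t ht => ?_, e₁, e₂⟩
  by_cases h : t < b₁
  · exact (h₁ t ⟨ht.1, h⟩).congr (e₁.symm.eventuallyEq_of_mem (Ioo_mem_nhds ht.1 h))
  · have h' : a₂ < t := (ht₀.1.trans ht₀.2).trans_le (not_lt.1 h)
    exact (h₂ t ⟨h', ht.2⟩).congr (e₂.symm.eventuallyEq_of_mem (Ioo_mem_nhds h' ht.2))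

variable (d M) in
theorem exists_short_geodesic [CompactSpace M] : ∃ δ > 0, ∀ (x : M) (v : EuclideanSpace ℝ (Fin d)),
    rnorm x v ≤ δ → ∃ c : ℝ → M, (∀ t ∈ Ioo (-3) 3, GeodAt d c t) ∧ c 0 = x ∧
      velocity d c 0 = v := by
  have hloc : ∀ x₀ : M, ∃ δ > 0, ∀ᶠ x in 𝓝 x₀, ∀ v : EuclideanSpace ℝ (Fin d),
    rnorm x v ≤ δ → ∃ c : ℝ → M, (∀ t ∈ Ioo (-3) 3, GeodAt d c t) ∧ c 0 = x ∧
      velocity d c 0 = v := by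
    intro x₀
    obtain ⟨C, hC, hb⟩ := rnorm_bounds (d := d) x₀
    obtain ⟨δ, hδ, h⟩ := exists_chart_geodesic (d := d) x₀
      (prod_mem_nhds (extChartAt_target_mem_nhds (I := 𝓡 d) x₀) univ_mem)
    refine ⟨δ / (2 * C), by positivity, ?_⟩
    filter_upwards [hb, extChartAt_source_mem_nhds (I := 𝓡 d) x₀,
      (continuousAt_extChartAt (I := 𝓡 d) x₀).preimage_mem_nhds (Metric.ball_mem_nhds _ hδ)]
      with x hx hxs hxb v hv
    have h1 : ‖chartFwd d x₀ x v‖ < δ := by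
      refine (hx v).2.trans_lt ?_
      rw [le_div_iff₀ (by positivity)] at hv
      nlinarith
    obtain ⟨P, hP0, hP⟩ := h (extChartAt (𝓡 d) x₀ x, chartFwd d x₀ x v) (by
      rw [← ball_prod_same]
      exact ⟨hxb, by simpa using h1⟩)
    have := chart_geodesic hxs hP0 fun t ht => ⟨(hP t ht).1, (hP t ht).2.1⟩
    exact ⟨_, this.1, this.2.1, this.2.2⟩
  choose δ hδ hδ' using hloc
  obtain ⟨t, ht⟩ := CompactSpace.elim_nhds_subcover _ hδ'
  obtain ⟨e, he, het⟩ : ∃ e > 0, ∀ x ∈ t, e ≤ δ x := by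
    clear ht
    induction t using Finset.cons_induction with
    | empty => exact ⟨1, one_pos, by simp⟩
    | cons a s ha ih =>
      obtain ⟨e, he, h⟩ := ih
      refine ⟨min e (δ a), lt_min he (hδ a), fun x hx => ?_⟩
      rcases Finset.mem_cons.1 hx with rfl | hx
      · exact min_le_right _ _
      · exact (min_le_left _ _).trans (h x hx)
  refine ⟨e, he, fun x v hv => ?_⟩
  have : x ∈ ⋃ y ∈ t, {x | ∀ v : EuclideanSpace ℝ (Fin d),
    rnorm x v ≤ δ y → ∃ c : ℝ → M, (∀ t ∈ Ioo (-3) 3, GeodAt d c t) ∧ c 0 = x ∧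
      velocity d c 0 = v} := ht ▸ mem_univ x
  simp only [mem_iUnion] at this
  obtain ⟨y, hy, h⟩ := this
  exact h v (hv.trans (het y hy))

theorem rnorm_neg (x : M) (v : EuclideanSpace ℝ (Fin d)) : rnorm x (-v) = rnorm x v :=
  norm_neg (E := TangentSpace (𝓡 d) x) _

variable (d M) in
-- The radius `δ` works everywhere and the speed is constant, so a geodesic can be restarted with
-- the same `δ` as often as needed. Backward times come from reversing the velocity.
theorem exists_geodesic [CompactSpace M] : ∃ δ > 0, ∀ (x : M) (v : EuclideanSpace ℝ (Fin d)),
    rnorm x v ≤ δ → ∃ c : ℝ → M, IsGeodesic d c ∧ c 0 = x ∧ velocity d c 0 = v := by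
  obtain ⟨δ, hδ, hshort⟩ := exists_short_geodesic d M
  refine ⟨δ, hδ, ?_⟩
  have hright : ∀ (n : ℕ) (x : M) (v : EuclideanSpace ℝ (Fin d)), rnorm x v ≤ δ →
      ∃ c : ℝ → M, (∀ t ∈ Ioo (-3 : ℝ) (3 + n), GeodAt d c t) ∧ c 0 = x ∧ velocity d c 0 = v := by
    intro n
    induction n with
    | zero => simpa using hshort
    | succ n ih =>
      intro x v hv
      obtain ⟨c, hc, hc0, hcv⟩ := hshort x v hv
      -- Restart at time 1, which lies inside both intervals of definition; constant speed keeps the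
      -- norm below `δ`.
      obtain ⟨c', hc', hc'0, hc'v⟩ := ih (c 1) (velocity d c 1) (by
        rw [← geodesic_speed hc (s := 0) (t := 1) (by norm_num) (by norm_num), hcv, hc0]
        exact hv)
      have h2 : ∀ t ∈ Ioo (-2 : ℝ) (3 + (n + 1 : ℕ)), GeodAt d (fun s => c' (1 * s + -1)) t :=
        fun t ht => GeodAt.comp_affine 1 (-1) (hc' _ (by
          push_cast at ht
          constructor <;> linarith [ht.1, ht.2]))
      obtain ⟨g, hg, hgc, -⟩ := geodesic_glue hc h2 (by norm_num)
        (by push_cast; linarith [n.cast_nonneg (α := ℝ)]) (t₀ := 1) (by norm_num)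
        (by norm_num [hc'0]) (by rw [velocity_comp_affine]; norm_num [hc'v])
      refine ⟨g, hg, (hgc (by norm_num)).trans hc0, ?_⟩
      rw [← hcv]
      exact velocity_congr (hgc.eventuallyEq_of_mem (Ioo_mem_nhds (by norm_num) (by norm_num)))
  have hboth : ∀ (n : ℕ) (x : M) (v : EuclideanSpace ℝ (Fin d)), rnorm x v ≤ δ →
      ∃ c : ℝ → M, (∀ t ∈ Ioo (-(3 + n) : ℝ) (3 + n), GeodAt d c t) ∧ c 0 = x ∧
        velocity d c 0 = v := by
    intro n x v hv
    have hn := n.cast_nonneg (α := ℝ)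
    obtain ⟨c, hc, hc0, hcv⟩ := hright n x v hv
    obtain ⟨c', hc', hc'0, hc'v⟩ := hright n x (-v) (by rwa [rnorm_neg])
    have h2 : ∀ t ∈ Ioo (-(3 + n) : ℝ) 3, GeodAt d (fun s => c' (-1 * s + 0)) t :=
      fun t ht => GeodAt.comp_affine (-1) 0 (hc' _ (by
        constructor <;> linarith [ht.1, ht.2]))
    obtain ⟨g, hg, -, hgc⟩ := geodesic_glue h2 hc (by linarith) (by linarith) (t₀ := 0)
      (by norm_num) (by norm_num [hc'0, hc0])
      (by rw [velocity_comp_affine]; norm_num [hc'v, hcv])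
    have h0 : (0 : ℝ) ∈ Ioo (-3 : ℝ) (3 + n) := ⟨by norm_num, by positivity⟩
    refine ⟨g, hg, (hgc h0).trans hc0, ?_⟩
    rw [← hcv]
    exact velocity_congr (hgc.eventuallyEq_of_mem (Ioo_mem_nhds h0.1 h0.2))
  intro x v hv
  choose c hc hc0 hcv using fun n => hboth n x v hv
  have heq : ∀ m n : ℕ, m ≤ n → EqOn (c m) (c n) (Ioo (-(3 + m) : ℝ) (3 + m)) := fun m n hmn => by
    have : (m : ℝ) ≤ n := by exact_mod_cast hmn
    have hm := m.cast_nonneg (α := ℝ)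
    refine geodesic_eqOn (t₀ := 0) (hc m) (fun t ht => hc n t ⟨by linarith [ht.1], by linarith [ht.2]⟩)
      ⟨by linarith, by linarith⟩ (by rw [hc0, hc0]) (by rw [hcv, hcv])
  -- The geodesic with index $n$ lives on $(-(3+n),3+n)$, so index $\lceil|t|\rceil$ covers $t$ with
  -- room to spare.
  let g : ℝ → M := fun t => c ⌈|t|⌉₊ t
  have hg : ∀ (n : ℕ) (t : ℝ), |t| < n → g t = c n t := fun n t ht => by
    have h1 : ⌈|t|⌉₊ ≤ n := Nat.ceil_le.2 ht.le
    refine heq _ _ h1 ?_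
    have h2 := Nat.le_ceil |t|
    have := abs_le.1 h2
    exact ⟨by linarith [this.1], by linarith [this.2]⟩
  have hgev : ∀ (n : ℕ) (t : ℝ), |t| < n → c n =ᶠ[𝓝 t] g := fun n t ht => by
    filter_upwards [continuous_abs.continuousAt.eventually_lt continuousAt_const ht] with s hs
      using (hg n s hs).symm
  refine ⟨g, isGeodesic_iff.2 fun t => ?_, ?_, ?_⟩
  · obtain ⟨n, hn⟩ := exists_nat_gt |t|
    refine (hc n t ?_).congr (hgev n t hn)
    have := abs_lt.1 hn
    exact ⟨by linarith [this.1], by linarith [this.2]⟩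
  · simp [g, hc0]
  · rw [← velocity_congr (hgev 1 0 (by simp)), hcv]

/-- `expMap` picks some geodesic; by uniqueness the choice does not matter. -/
theorem expMap_eq {c : ℝ → M} {x : M} {v : EuclideanSpace ℝ (Fin d)} (hc : IsGeodesic d c)
    (h0 : c 0 = x) (hv : velocity d c 0 = v) : expMap x v = c 1 := by
  have h : ∃ c : ℝ → M, IsGeodesic d c ∧ c 0 = x ∧
      deriv (fun s => extChartAt (𝓡 d) x (c s)) 0 = v := ⟨c, hc, h0, by rw [← h0]; exact hv⟩
  rw [expMap, dif_pos h]
  obtain ⟨h1, h2, h3⟩ := h.choose_spec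
  refine geodesic_eqOn (a := -3) (b := 3) (t₀ := 0) (fun t _ => isGeodesic_iff.1 h1 t)
    (fun t _ => isGeodesic_iff.1 hc t) (by norm_num) (h2.trans h0.symm) ?_ (by norm_num)
  rw [hv, velocity, h2, h3]

end Exponential

/-! ### The exponential map is close to the identity in charts -/

section Exponential

variable {d : ℕ} {M : Type*} [EMetricSpace M] [ChartedSpace (EuclideanSpace ℝ (Fin d)) M]
  [IsManifold (𝓡 d) ∞ M] [RiemannianBundle (fun x : M => TangentSpace (𝓡 d) x)]
  [IsContMDiffRiemannianBundle (𝓡 d) ∞ (EuclideanSpace ℝ (Fin d))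
      (fun x : M => TangentSpace (𝓡 d) x)]

theorem expMap_zero (x : M) : expMap (d := d) x 0 = x := by
  have h : IsGeodesic d (fun _ : ℝ => x) := isGeodesic_iff.2 fun t => by
    have hs : ChartSol x (fun _ => extChartAt (𝓡 d) x x) t := by
      refine ⟨mem_extChartAt_target x, contDiffAt_const, ?_⟩
      have := geodAcc_smul (d := d) x (extChartAt (𝓡 d) x x) 0 0
      rw [smul_zero, zero_pow two_ne_zero, zero_smul] at this
      simp only [deriv_const', deriv_const]
      exact this.symm
    have := hs.geodAt
    rwa [extChartAt_to_inv] at this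
  exact expMap_eq h rfl (by simp [velocity])

theorem hasStrictFDerivAt_geodAcc (x₀ : M) : HasStrictFDerivAt (geodAcc d x₀)
    (0 : EuclideanSpace ℝ (Fin d) × EuclideanSpace ℝ (Fin d) →L[ℝ] EuclideanSpace ℝ (Fin d))
    (extChartAt (𝓡 d) x₀ x₀, 0) := by
  have hc : ∀ v, ContDiffAt ℝ 1 (geodAcc d x₀) (extChartAt (𝓡 d) x₀ x₀, v) := fun v =>
    (contDiffAt_geodAcc (mem_extChartAt_target x₀)).of_le (by norm_cast)
  have hs := (hc 0).hasStrictFDerivAt (by simp)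
  suffices h : fderiv ℝ (geodAcc d x₀) (extChartAt (𝓡 d) x₀ x₀, 0) = 0 by rwa [h] at hs
  refine ContinuousLinearMap.ext fun hk => ?_
  obtain ⟨h, k⟩ := hk
  have hline : HasDerivAt (fun s : ℝ => (extChartAt (𝓡 d) x₀ x₀ + s • h, s • k)) (h, k) 0 := by
    have := (hasDerivAt_id (0 : ℝ)).smul_const h
    have h1 := this.const_add (extChartAt (𝓡 d) x₀ x₀)
    have h2 := (hasDerivAt_id (0 : ℝ)).smul_const k
    simpa using h1.prodMk h2
  have hline' : HasDerivAt (fun s : ℝ => (extChartAt (𝓡 d) x₀ x₀ + s • h, k)) (h, 0) 0 := by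
    have := (hasDerivAt_id (0 : ℝ)).smul_const h
    have h1 := this.const_add (extChartAt (𝓡 d) x₀ x₀)
    simpa using h1.prodMk (hasDerivAt_const (0 : ℝ) k)
  have d1 := HasFDerivAt.comp_hasDerivAt_of_eq (0 : ℝ) hs.hasFDerivAt hline (by simp)
  have d2 := HasFDerivAt.comp_hasDerivAt_of_eq (0 : ℝ)
    ((hc k).differentiableAt (by simp)).hasFDerivAt hline' (by simp)
  have d3 := ((hasDerivAt_id (0 : ℝ)).pow 2).smul d2
  -- Along the line with direction $(h,k)$ the acceleration is $s^2$ times a differentiable function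
  -- of $s$, so its derivative at 0 vanishes.
  have he : (geodAcc d x₀ ∘ fun s : ℝ => (extChartAt (𝓡 d) x₀ x₀ + s • h, s • k)) =
      (id ^ 2 : ℝ → ℝ) • (geodAcc d x₀ ∘ fun s : ℝ => (extChartAt (𝓡 d) x₀ x₀ + s • h, k)) := by
    funext s
    simp [geodAcc_smul]
  rw [he] at d1
  have := d1.unique d3
  simpa using this

/-- By Gronwall with rate 1 the difference of the solutions stays below $e^t\|w\|\le3\|w\|$ on
$[0,1]$. Hence the difference of the velocities stays within $3\eta\|w\|$ of its initial value $w$,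
and integrating once more gives the claim. -/
theorem near_identity_of_lipschitz {E : Type*} [NormedAddCommGroup E] [NormedSpace ℝ E]
    {A : E × E → E} {η : ℝ} (hη : 0 < η) (hη1 : η ≤ 1) {s : Set (E × E)}
    (hA : ∀ p ∈ s, ∀ q ∈ s, ‖A p - A q‖ ≤ η * ‖p - q‖) {P Q : ℝ → E × E}
    (hP : ∀ t ∈ Ioo (-3 : ℝ) 3, HasDerivAt P ((P t).2, A (P t)) t ∧ P t ∈ s)
    (hQ : ∀ t ∈ Ioo (-3 : ℝ) 3, HasDerivAt Q ((Q t).2, A (Q t)) t ∧ Q t ∈ s)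
    (h0 : (P 0).1 = (Q 0).1) :
    ‖(P 1).1 - (Q 1).1 - ((P 0).2 - (Q 0).2)‖ ≤ 3 * η * ‖(P 0).2 - (Q 0).2‖ := by
  set w := (P 0).2 - (Q 0).2 with hw
  have hI : ∀ t ∈ Icc (0 : ℝ) 1, t ∈ Ioo (-3 : ℝ) 3 := fun t ht =>
    ⟨by linarith [ht.1], by linarith [ht.2]⟩
  have hd : ∀ t ∈ Icc (0 : ℝ) 1, HasDerivAt (fun t => P t - Q t)
      ((P t).2 - (Q t).2, A (P t) - A (Q t)) t := fun t ht =>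
    (hP t (hI t ht)).1.sub (hQ t (hI t ht)).1
  have hn0 : ‖P 0 - Q 0‖ = ‖w‖ := by
    rw [Prod.norm_def]
    simp [h0, hw]
  have hg : ∀ t ∈ Icc (0 : ℝ) 1, ‖P t - Q t‖ ≤ 3 * ‖w‖ := by
    intro t ht
    have := norm_le_gronwallBound_of_norm_deriv_right_le (f := fun t => P t - Q t)
      (f' := fun t => ((P t).2 - (Q t).2, A (P t) - A (Q t))) (δ := ‖w‖) (K := 1) (ε := 0)
      (a := 0) (b := 1) (fun t ht => (hd t ht).continuousAt.continuousWithinAt)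
      (fun t ht => (hd t ⟨ht.1, ht.2.le⟩).hasDerivWithinAt) hn0.le (fun t ht => by
        rw [add_zero, one_mul, Prod.norm_def]
        refine max_le (norm_snd_le (P t - Q t)) ?_
        have h' := hI t ⟨ht.1, ht.2.le⟩
        refine (hA _ (hP t h').2 _ (hQ t h').2).trans ?_
        exact mul_le_of_le_one_left (norm_nonneg _) hη1) t ht
    rw [gronwallBound_ε0, sub_zero, one_mul] at this
    refine this.trans ?_
    rw [mul_comm]
    have h3 : Real.exp t ≤ 3 := (Real.exp_le_exp.2 ht.2).trans
      (Real.exp_one_lt_d9.le.trans (by norm_num))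
    exact mul_le_mul_of_nonneg_right h3 (norm_nonneg _)
  have h2 : ∀ t ∈ Icc (0 : ℝ) 1, ‖(P t).2 - (Q t).2 - w‖ ≤ 3 * η * ‖w‖ := by
    intro t ht
    have := norm_image_sub_le_of_norm_deriv_le_segment' (f := fun t => (P t).2 - (Q t).2)
      (f' := fun t => A (P t) - A (Q t)) (C := 3 * η * ‖w‖) (a := 0) (b := 1)
      (fun t ht => by
        have := (hasFDerivAt_snd (𝕜 := ℝ) (p := P t - Q t)).comp_hasDerivAt t (hd t ht)
        exact this.hasDerivWithinAt) (fun t ht => by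
        have ht' : t ∈ Icc (0 : ℝ) 1 := ⟨ht.1, ht.2.le⟩
        refine (hA _ (hP t (hI t ht')).2 _ (hQ t (hI t ht')).2).trans ?_
        nlinarith [hg t ht']) t ht
    refine this.trans ?_
    have : 0 ≤ 3 * η * ‖w‖ := by positivity
    nlinarith [ht.2]
  have h3 := norm_image_sub_le_of_norm_deriv_le_segment_01'
      (f := fun t => (P t).1 - (Q t).1 - t • w) (f' := fun t => (P t).2 - (Q t).2 - w)
      (C := 3 * η * ‖w‖) (fun t ht => by
        have h1 := ((hasFDerivAt_fst (𝕜 := ℝ) (p := P t - Q t)).comp_hasDerivAt t (hd t ht))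
        have h2 := (hasDerivAt_id t).smul_const w
        rw [one_smul] at h2
        exact (h1.sub h2).hasDerivWithinAt) (fun t ht => h2 t ⟨ht.1, ht.2.le⟩)
  simpa [h0] using h3

/-- In the chart at `x₀`, the exponential map at points near `x₀` is near to the identity. -/
theorem expMap_near_identity [CompactSpace M] (x₀ : M) {η : ℝ} (hη : 0 < η) :
    ∃ δ > 0, ∀ x ∈ (extChartAt (𝓡 d) x₀).source,
      ‖extChartAt (𝓡 d) x₀ x - extChartAt (𝓡 d) x₀ x₀‖ < δ →
      ∀ v, ‖chartFwd d x₀ x v‖ < δ → expMap x v ∈ (extChartAt (𝓡 d) x₀).source ∧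
        ∀ w, ‖chartFwd d x₀ x w‖ < δ →
          ‖extChartAt (𝓡 d) x₀ (expMap x v) - extChartAt (𝓡 d) x₀ (expMap x w) -
            (chartFwd d x₀ x v - chartFwd d x₀ x w)‖ ≤
            η * ‖chartFwd d x₀ x v - chartFwd d x₀ x w‖ := by
  -- Division by 3 absorbs the factor of `near_identity_of_lipschitz`; the bound 1 keeps the
  -- Gronwall rate at 1.
  set η' := min (η / 3) 1 with hη'
  have hη'0 : 0 < η' := by positivity
  have hlip := (hasStrictFDerivAt_geodAcc (d := d) x₀).isLittleO.bound hη'0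
  simp only [zero_apply, sub_zero] at hlip
  rw [nhds_prod_eq] at hlip
  obtain ⟨S, hS, hSA⟩ := (Filter.eventually_prod_self_iff
    (r := fun p q => ‖geodAcc d x₀ p - geodAcc d x₀ q‖ ≤ η' * ‖p - q‖)).1 hlip
  obtain ⟨δ₁, hδ₁, hsol⟩ := exists_chart_geodesic (d := d) x₀ (inter_mem hS
    (prod_mem_nhds (extChartAt_target_mem_nhds (I := 𝓡 d) x₀) univ_mem))
  obtain ⟨C, hC, hb⟩ := metric_bounds (d := d) x₀
  obtain ⟨δ₂, hδ₂, hb⟩ := Metric.eventually_nhds_iff.1 hb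
  obtain ⟨δ₃, hδ₃, hgeo⟩ := exists_geodesic d M
  refine ⟨min δ₁ (min δ₂ (δ₃ / C)), by positivity, fun x hx hxd => ?_⟩
  have key : ∀ v, ‖chartFwd d x₀ x v‖ < min δ₁ (min δ₂ (δ₃ / C)) →
      ∃ P : ℝ → EuclideanSpace ℝ (Fin d) × EuclideanSpace ℝ (Fin d),
        P 0 = (extChartAt (𝓡 d) x₀ x, chartFwd d x₀ x v) ∧
        (∀ t ∈ Ioo (-3) 3, HasDerivAt P (geodField d x₀ (P t)) t ∧ P t ∈ S) ∧
        (P 1).1 ∈ (extChartAt (𝓡 d) x₀).target ∧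
        expMap x v = (extChartAt (𝓡 d) x₀).symm (P 1).1 := by
    intro v hv
    obtain ⟨P, hP0, hP⟩ := hsol (extChartAt (𝓡 d) x₀ x, chartFwd d x₀ x v) (by
      rw [← ball_prod_same]
      refine ⟨?_, ?_⟩
      · rw [Metric.mem_ball, dist_eq_norm]
        exact hxd.trans_le (min_le_left _ _)
      · rw [Metric.mem_ball, dist_zero_right]
        exact hv.trans_le (min_le_left _ _))
    obtain ⟨g1, g2, g3⟩ := chart_geodesic hx hP0 fun t ht => ⟨(hP t ht).1, (hP t ht).2.2.1⟩
    refine ⟨P, hP0, fun t ht => ⟨(hP t ht).1, (hP t ht).2.1⟩, (hP 1 (by norm_num)).2.2.1, ?_⟩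
    have hr : rnorm x v ≤ δ₃ := by
      have h1 := (hb (y := extChartAt (𝓡 d) x₀ x) (by
        rw [dist_eq_norm]
        exact hxd.trans_le ((min_le_right _ _).trans (min_le_left _ _))) (chartFwd d x₀ x v)).1
      rw [metricInChart_self hx, rawInner_self, ← mul_pow] at h1
      have h2 := (sq_le_sq₀ (rnorm_nonneg x v) (by positivity)).1 h1
      have h3 := hv.le.trans ((min_le_right _ _).trans (min_le_right _ _))
      rw [le_div_iff₀ hC] at h3
      linarith
    obtain ⟨c, hc, hc0, hcv⟩ := hgeo x v hr
    rw [expMap_eq hc hc0 hcv]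
    exact geodesic_eqOn (t₀ := 0) (fun t _ => isGeodesic_iff.1 hc t) g1 (by norm_num)
      (by rw [hc0, g2]) (by rw [hcv, g3]) (by norm_num)
  intro v hv
  obtain ⟨P, hP0, hP, hPt, hPe⟩ := key v hv
  refine ⟨hPe ▸ (extChartAt (𝓡 d) x₀).map_target hPt, fun w hw => ?_⟩
  obtain ⟨Q, hQ0, hQ, hQt, hQe⟩ := key w hw
  have := near_identity_of_lipschitz hη'0 (min_le_right _ _)
    (fun p hp q hq => hSA (p) hp q hq) hP hQ (by rw [hP0, hQ0])
  rw [hP0, hQ0] at this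
  rw [hPe, hQe, (extChartAt (𝓡 d) x₀).right_inv hPt, (extChartAt (𝓡 d) x₀).right_inv hQt]
  refine this.trans (mul_le_mul_of_nonneg_right ?_ (norm_nonneg _))
  have := min_le_left (η / 3) 1
  linarith

end Exponential

/-! ### Riemannian distance against distance in a chart -/

section Distance

variable {d : ℕ} {M : Type*} [EMetricSpace M] [ChartedSpace (EuclideanSpace ℝ (Fin d)) M]
  [IsManifold (𝓡 d) ∞ M] [RiemannianBundle (fun x : M => TangentSpace (𝓡 d) x)]
  [IsContMDiffRiemannianBundle (𝓡 d) ∞ (EuclideanSpace ℝ (Fin d))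
      (fun x : M => TangentSpace (𝓡 d) x)] [IsRiemannianManifold (𝓡 d) M]

theorem enorm_tangent (x : M) (v : TangentSpace (𝓡 d) x) :
    ‖v‖ₑ = ENNReal.ofReal (rnorm x v) := (ofReal_norm v).symm

/-- Near `x₀`, the distance is bounded by the distance in the chart at `x₀`. -/
theorem edist_le_chart (x₀ : M) : ∃ C : ℝ, 0 < C ∧ ∀ᶠ p in 𝓝 (x₀, x₀), edist p.1 p.2 ≤
    ENNReal.ofReal (C * ‖extChartAt (𝓡 d) x₀ p.1 - extChartAt (𝓡 d) x₀ p.2‖) := by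
  obtain ⟨C, hC, hb⟩ := metric_bounds (d := d) x₀
  obtain ⟨r, hr, hball⟩ := Metric.mem_nhds_iff.1
    (inter_mem hb (extChartAt_target_mem_nhds (I := 𝓡 d) x₀))
  refine ⟨C, hC, ?_⟩
  have hnear : ∀ᶠ x in 𝓝 x₀, x ∈ (extChartAt (𝓡 d) x₀).source ∧
      extChartAt (𝓡 d) x₀ x ∈ Metric.ball (extChartAt (𝓡 d) x₀ x₀) r :=
    inter_mem (extChartAt_source_mem_nhds (I := 𝓡 d) x₀)
      ((continuousAt_extChartAt (I := 𝓡 d) x₀).preimage_mem_nhds (Metric.ball_mem_nhds _ hr))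
  rw [nhds_prod_eq]
  filter_upwards [hnear.prod_mk hnear] with ⟨x, y⟩ ⟨⟨hx, hxb⟩, hy, hyb⟩
  dsimp only at hx hy hxb hyb ⊢
  set z := extChartAt (𝓡 d) x₀ x
  set w := extChartAt (𝓡 d) x₀ y
  set η : ℝ → EuclideanSpace ℝ (Fin d) := fun t => z + t • (w - z) with hη
  have hηm : ∀ t ∈ Icc (0 : ℝ) 1, η t ∈ Metric.ball (extChartAt (𝓡 d) x₀ x₀) r := fun t ht =>
    (convex_ball _ _).add_smul_sub_mem hxb hyb ht
  have hηs : ContDiff ℝ 1 η := by fun_prop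
  set γ : ℝ → M := fun t => (extChartAt (𝓡 d) x₀).symm (η t) with hγ
  have hγs : ContMDiffOn 𝓘(ℝ, ℝ) (𝓡 d) 1 γ (Icc 0 1) :=
    (contMDiffOn_extChartAt_symm (I := 𝓡 d) x₀).comp hηs.contMDiff.contMDiffOn
      fun t ht => (hball (hηm t ht)).2
  -- The straight segment in the chart is an admissible path; its length is at most `C` times its
  -- coordinate length.
  rw [IsRiemannianManifold.out (I := 𝓡 d) x y]
  refine (riemannianEDist_le_pathELength (γ := γ) (a := 0) (b := 1) hγs ?_ ?_ zero_le_one).trans ?_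
  · simp only [hγ, hη, zero_smul, add_zero]
    exact (extChartAt (𝓡 d) x₀).left_inv hx
  · simp only [hγ, hη, one_smul, add_sub_cancel]
    exact (extChartAt (𝓡 d) x₀).left_inv hy
  rw [pathELength_eq_lintegral_mfderiv_Icc]
  calc ∫⁻ t in Icc (0 : ℝ) 1, ‖mfderiv 𝓘(ℝ, ℝ) (𝓡 d) γ t 1‖ₑ
      ≤ ∫⁻ _ in Icc (0 : ℝ) 1, ENNReal.ofReal (C * ‖z - w‖) := by
        refine setLIntegral_mono' measurableSet_Icc fun t ht => ?_
        have ht' := hball (hηm t ht)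
        have h1 : HasDerivAt η (w - z) t := by
          have := (hasDerivAt_id t).smul_const (w - z)
          rw [one_smul] at this
          exact this.const_add z
        have h2 : HasMFDerivAt 𝓘(ℝ, ℝ) (𝓡 d) γ t ((chartBwd d x₀ (η t)).comp
            (ContinuousLinearMap.toSpanSingleton ℝ (w - z))) :=
          (hasMFDerivAt_symm ht'.2).comp t h1.hasFDerivAt.hasMFDerivAt
        have h3 : (mfderiv 𝓘(ℝ, ℝ) (𝓡 d) γ t : ℝ →L[ℝ] EuclideanSpace ℝ (Fin d)) 1 =
            chartBwd d x₀ (η t) (w - z) := by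
          rw [h2.mfderiv]
          exact congrArg (chartBwd d x₀ (η t)) (one_smul ℝ (w - z))
        have h4 := enorm_tangent (d := d) (γ t) (mfderiv 𝓘(ℝ, ℝ) (𝓡 d) γ t 1)
        refine h4.le.trans (ENNReal.ofReal_le_ofReal ?_)
        refine (congrArg (rnorm (γ t)) h3).le.trans ?_
        have h5 := (ht'.1 (w - z)).1
        rw [metricInChart_def, rawInner_self, ← mul_pow] at h5
        rw [norm_sub_rev]
        exact (sq_le_sq₀ (rnorm_nonneg _ _) (by positivity)).1 h5
    _ = ENNReal.ofReal (C * ‖z - w‖) := by simp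

/-- Near `x₀`, the distance in the chart at `x₀` is bounded by the distance. -/
theorem chart_le_edist (x₀ : M) : ∃ C : ℝ, 0 < C ∧ ∀ᶠ p in 𝓝 (x₀, x₀),
    ENNReal.ofReal ‖extChartAt (𝓡 d) x₀ p.1 - extChartAt (𝓡 d) x₀ p.2‖ ≤
      ENNReal.ofReal C * edist p.1 p.2 := by
  obtain ⟨C, hC, hb⟩ := rnorm_bounds (d := d) x₀
  obtain ⟨r, hr, hball⟩ := EMetric.mem_nhds_iff.1
    (inter_mem hb (extChartAt_source_mem_nhds (I := 𝓡 d) x₀))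
  refine ⟨C, hC, ?_⟩
  -- A path shorter than $2r/3$ that starts within $r/3$ of `x₀` never leaves the ball of radius `r`
  -- on which the norms are comparable.
  have hr3 : 0 < r / 3 := ENNReal.div_pos hr.ne' (by simp)
  have hnear : ∀ᶠ x in 𝓝 x₀, edist x x₀ < r / 3 := Metric.eball_mem_nhds x₀ hr3
  rw [nhds_prod_eq]
  filter_upwards [hnear.prod_mk hnear] with ⟨x, y⟩ ⟨hx, hy⟩
  dsimp only at hx hy ⊢
  have hrt : r / 3 + r / 3 + r / 3 = r := ENNReal.add_thirds r
  have hxy : edist x y < r / 3 + r / 3 :=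
    (edist_triangle_right x y x₀).trans_lt (ENNReal.add_lt_add hx hy)
  -- The distance is an infimum of lengths that need not be attained; any `c` above the bound leaves
  -- room for an almost minimal path.
  refine le_of_forall_gt fun c hc => ?_
  have hC0 : ENNReal.ofReal C ≠ 0 := by simpa using hC
  rw [mul_comm, ← ENNReal.lt_div_iff_mul_lt (Or.inl hC0) (Or.inl ENNReal.ofReal_ne_top)] at hc
  have hm : riemannianEDist (𝓡 d) x y < min (c / ENNReal.ofReal C) (r / 3 + r / 3) := by
    rw [← IsRiemannianManifold.out (I := 𝓡 d) x y]
    exact lt_min hc hxy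
  obtain ⟨γ, hγ0, hγ1, hγs, hγl, -, -⟩ :=
    exists_lt_locally_constant_of_riemannianEDist_lt hm zero_lt_one
  have hin : ∀ t ∈ Icc (0 : ℝ) 1, γ t ∈ Metric.eball x₀ r := fun t ht => by
    have h1 : edist x (γ t) < r / 3 + r / 3 := by
      rw [IsRiemannianManifold.out (I := 𝓡 d) x (γ t)]
      refine (riemannianEDist_le_pathELength hγs.contMDiffOn hγ0 rfl ht.1).trans_lt ?_
      exact (pathELength_mono le_rfl ht.2).trans_lt (hγl.trans_le (min_le_right _ _))
    have h2 : edist (γ t) x₀ ≤ edist x (γ t) + edist x x₀ := edist_triangle_left _ _ _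
    exact h2.trans_lt (by rw [← hrt]; exact ENNReal.add_lt_add h1 hx)
  have hd : ∀ t ∈ Icc (0 : ℝ) 1, HasDerivAt (fun t => extChartAt (𝓡 d) x₀ (γ t))
      (chartFwd d x₀ (γ t)
        ((mfderiv 𝓘(ℝ, ℝ) (𝓡 d) γ t : ℝ →L[ℝ] EuclideanSpace ℝ (Fin d)) 1)) t := fun t ht => by
    have h2 : HasFDerivAt (fun s => extChartAt (𝓡 d) x₀ (γ s)) ((chartFwd d x₀ (γ t)).comp
      (mfderiv 𝓘(ℝ, ℝ) (𝓡 d) γ t : ℝ →L[ℝ] EuclideanSpace ℝ (Fin d))) t :=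
      hasMFDerivAt_iff_hasFDerivAt.1 ((hasMFDerivAt_chart (d := d) (hball (hin t ht)).2).comp t
        (hγs.mdifferentiableAt (by simp)).hasMFDerivAt)
    exact h2.hasDerivAt
  have hs : ContDiffOn ℝ 1 (fun t => extChartAt (𝓡 d) x₀ (γ t)) (Icc 0 1) := by
    rw [← contMDiffOn_iff_contDiffOn]
    exact contMDiffOn_extChartAt.comp (t := (chartAt (EuclideanSpace ℝ (Fin d)) x₀).source)
      hγs.contMDiffOn fun t ht => by
        have := (hball (hin t ht)).2
        rwa [extChartAt_source] at this
  have hmain : ENNReal.ofReal ‖extChartAt (𝓡 d) x₀ x - extChartAt (𝓡 d) x₀ y‖ ≤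
      ENNReal.ofReal C * pathELength (𝓡 d) γ 0 1 := by
    rw [norm_sub_rev, ofReal_norm, ← hγ0, ← hγ1, pathELength_eq_lintegral_mfderiv_Icc,
      ← lintegral_const_mul' _ _ ENNReal.ofReal_ne_top]
    refine (enorm_sub_le_lintegral_derivWithin_Icc_of_contDiffOn_Icc hs zero_le_one).trans ?_
    refine setLIntegral_mono' measurableSet_Icc fun t ht => ?_
    rw [(hd t ht).hasDerivWithinAt.derivWithin (uniqueDiffOn_Icc zero_lt_one t ht)]
    have h4 := enorm_tangent (d := d) (γ t) (mfderiv 𝓘(ℝ, ℝ) (𝓡 d) γ t 1)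
    refine le_trans ?_ (mul_le_mul_right h4.ge _)
    rw [← ofReal_norm, ← ENNReal.ofReal_mul hC.le]
    exact ENNReal.ofReal_le_ofReal (((hball (hin t ht)).1 _).2)
  refine hmain.trans_lt ?_
  have := hγl.trans_le (min_le_left _ _)
  rwa [ENNReal.lt_div_iff_mul_lt (Or.inl hC0) (Or.inl ENNReal.ofReal_ne_top), mul_comm] at this

end Distance

/-! ### Linear algebra of hyperbolic maps -/

section LinearFlow

theorem exp_intertwine {V W : Type*} [NormedAddCommGroup V] [NormedSpace ℝ V] [CompleteSpace V]
    [NormedAddCommGroup W] [NormedSpace ℝ W] [CompleteSpace W] (L : V →L[ℝ] W) {B : V →L[ℝ] V}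
    {A : W →L[ℝ] W} (h : ∀ v, L (B v) = A (L v)) (v : V) :
    L (NormedSpace.exp B v) = NormedSpace.exp A (L v) := by
  have hpow : ∀ (n : ℕ) v, L ((B ^ n) v) = (A ^ n) (L v) := by
    intro n
    induction n with
    | zero => intro v; simp
    | succ n ih => intro v; rw [pow_succ, pow_succ, mul_apply_eq_comp,
        mul_apply_eq_comp, ih, h]
  have hB := (NormedSpace.exp_series_hasSum_exp' (𝕂 := ℝ) B).mapL
    (ContinuousLinearMap.apply ℝ V v)
  have hA := (NormedSpace.exp_series_hasSum_exp' (𝕂 := ℝ) A).mapL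
    (ContinuousLinearMap.apply ℝ W (L v))
  have hB' := hB.mapL L
  simp only [ContinuousLinearMap.apply_apply, map_smul, hpow] at hA hB'
  exact hB'.unique hA

theorem exp_add {𝕜 V : Type*} [RCLike 𝕜] [NormedAddCommGroup V] [NormedSpace 𝕜 V]
    [CompleteSpace V] {A B : V →L[𝕜] V} (h : Commute A B) :
    NormedSpace.exp (A + B) = NormedSpace.exp A * NormedSpace.exp B := by
  refine NormedSpace.exp_add_of_commute_of_mem_ball (𝕂 := 𝕜) h ?_ ?_ <;>
  · rw [NormedSpace.expSeries_radius_eq_top]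
    exact Metric.mem_eball.2 (edist_lt_top _ _)

/-- $B=z+N$ with commuting summands, so $e^{tB}=e^{tz}e^{tN}$, and the exponential series of $tN$
stops on `w`. -/
theorem exp_smul_of_nilpotent {V : Type*} [NormedAddCommGroup V] [NormedSpace ℂ V]
    [CompleteSpace V] {B : V →L[ℂ] V} {z : ℂ} {k : ℕ} {w : V}
    (hw : ((B - z • (1 : V →L[ℂ] V)) ^ k) w = 0) (t : ℝ) :
    NormedSpace.exp ((t : ℂ) • B) w = ∑ j ∈ Finset.range k,
      (Complex.exp (t * z) * ((t : ℂ) ^ j * ((j.factorial : ℂ))⁻¹)) •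
        ((B - z • (1 : V →L[ℂ] V)) ^ j) w := by
  set N := B - z • (1 : V →L[ℂ] V) with hN
  have hB : (t : ℂ) • B = (t * z) • (1 : V →L[ℂ] V) + (t : ℂ) • N := by
    rw [hN, smul_sub, smul_smul]
    abel
  have hc : Commute ((t * z) • (1 : V →L[ℂ] V)) ((t : ℂ) • N) := by
    exact (Commute.one_left _).smul_left _
  rw [hB, exp_add hc]
  have h1 : NormedSpace.exp ((t * z) • (1 : V →L[ℂ] V)) = Complex.exp (t * z) • 1 := by
    have := NormedSpace.algebraMap_exp_comm (𝕂 := ℂ) (𝔸 := V →L[ℂ] V) (t * z)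
    rw [Algebra.algebraMap_eq_smul_one, Algebra.algebraMap_eq_smul_one] at this
    rw [← this, Complex.exp_eq_exp_ℂ]
  rw [h1, mul_apply_eq_comp, smul_apply, one_apply_eq_self]
  simp only [mul_smul, ← Finset.smul_sum]
  congr 1
  have hs := (NormedSpace.exp_series_hasSum_exp' (𝕂 := ℂ) ((t : ℂ) • N)).mapL
    (ContinuousLinearMap.apply ℂ V w)
  refine hs.unique ?_
  have hz : ∀ j ∉ Finset.range k, (N ^ j) w = 0 := fun j hj => by
    have : k ≤ j := by simpa using hj
    rw [← Nat.sub_add_cancel this, pow_add, mul_apply_eq_comp, hw, map_zero]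
  convert hasSum_sum_of_ne_finset_zero (s := Finset.range k) ?_ using 1
  · refine Finset.sum_congr rfl fun j _ => ?_
    simp only [ContinuousLinearMap.apply_apply, smul_apply, smul_pow, smul_smul, mul_comm]
  · intro j hj
    simp only [ContinuousLinearMap.apply_apply, smul_apply, smul_pow, hz j hj, smul_zero]
  · infer_instance

theorem tendsto_exp_of_nilpotent {V : Type*} [NormedAddCommGroup V] [NormedSpace ℂ V]
    [CompleteSpace V] {B : V →L[ℂ] V} {z : ℂ} (hz : z.re < 0) {k : ℕ} {w : V}
    (hw : ((B - z • (1 : V →L[ℂ] V)) ^ k) w = 0) :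
    Tendsto (fun t : ℝ => NormedSpace.exp ((t : ℂ) • B) w) atTop (𝓝 0) := by
  simp only [exp_smul_of_nilpotent hw]
  rw [← Finset.sum_const_zero (s := Finset.range k)]
  refine tendsto_finsetSum _ fun j _ => ?_
  rw [← zero_smul ℂ (((B - z • (1 : V →L[ℂ] V)) ^ j) w)]
  refine Tendsto.smul_const ?_ _
  rw [tendsto_zero_iff_norm_tendsto_zero]
  have h1 := (Real.tendsto_pow_mul_exp_neg_atTop_nhds_zero j).comp
    (tendsto_id.const_mul_atTop (neg_pos.2 hz))
  have h2 := h1.const_mul ((-z.re) ^ j * (j.factorial : ℝ))⁻¹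
  rw [mul_zero] at h2
  refine h2.congr' ?_
  filter_upwards [eventually_gt_atTop 0] with t ht
  have hzr : (-z.re) ≠ 0 := by linarith
  simp only [Function.comp_apply, id, norm_mul, Complex.norm_exp, norm_pow, norm_inv,
    Complex.norm_real, Complex.norm_natCast, Real.norm_of_nonneg ht.le, Complex.mul_re,
    Complex.ofReal_re, Complex.ofReal_im, zero_mul, sub_zero, mul_pow]
  rw [show -(-z.re * t) = t * z.re by ring, mul_inv]
  field_simp

variable {d : ℕ}

/-- The matrix of `A`, as a complex operator. -/
def complexOp (A : EuclideanSpace ℝ (Fin d) →L[ℝ] EuclideanSpace ℝ (Fin d)) :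
    (Fin d → ℂ) →L[ℂ] (Fin d → ℂ) :=
  (Matrix.toLin' ((LinearMap.toMatrix (EuclideanSpace.basisFun (Fin d) ℝ).toBasis
    (EuclideanSpace.basisFun (Fin d) ℝ).toBasis (A : EuclideanSpace ℝ (Fin d) →ₗ[ℝ]
      EuclideanSpace ℝ (Fin d))).map (algebraMap ℝ ℂ))).toContinuousLinearMap

/-- The real part of a complex vector. -/
def rePart (d : ℕ) : (Fin d → ℂ) →L[ℝ] EuclideanSpace ℝ (Fin d) :=
  (EuclideanSpace.equiv (Fin d) ℝ).symm.toContinuousLinearMap ∘L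
    ContinuousLinearMap.pi fun i => Complex.reCLM ∘L (ContinuousLinearMap.proj i)

/-- The complex vector with the given real and imaginary part. -/
def toComplex (u v : EuclideanSpace ℝ (Fin d)) : Fin d → ℂ := fun i => u i + v i * Complex.I

theorem rePart_apply (w : Fin d → ℂ) (i : Fin d) : rePart d w i = (w i).re := rfl

theorem coord_apply (A : EuclideanSpace ℝ (Fin d) →L[ℝ] EuclideanSpace ℝ (Fin d))
    (v : EuclideanSpace ℝ (Fin d)) (i : Fin d) : A v i = ∑ j, LinearMap.toMatrix
      (EuclideanSpace.basisFun (Fin d) ℝ).toBasis (EuclideanSpace.basisFun (Fin d) ℝ).toBasis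
      (A : EuclideanSpace ℝ (Fin d) →ₗ[ℝ] EuclideanSpace ℝ (Fin d)) i j * v j := by
  have := congrFun (LinearMap.toMatrix_mulVec_repr (EuclideanSpace.basisFun (Fin d) ℝ).toBasis
    (EuclideanSpace.basisFun (Fin d) ℝ).toBasis
    (A : EuclideanSpace ℝ (Fin d) →ₗ[ℝ] EuclideanSpace ℝ (Fin d)) v) i
  simp only [Matrix.mulVec, dotProduct] at this
  simpa using this.symm

theorem complexOp_toComplex (A : EuclideanSpace ℝ (Fin d) →L[ℝ] EuclideanSpace ℝ (Fin d))
    (u v : EuclideanSpace ℝ (Fin d)) :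
    complexOp A (toComplex u v) = toComplex (A u) (A v) := by
  funext i
  simp only [complexOp, toComplex, LinearMap.coe_toContinuousLinearMap', Matrix.toLin'_apply,
    Matrix.mulVec, dotProduct, Matrix.map_apply, coord_apply, mul_add, Finset.sum_add_distrib,
    Complex.ofReal_sum, Complex.ofReal_mul, Finset.sum_mul, mul_assoc]
  rfl

theorem exists_toComplex (w : Fin d → ℂ) : ∃ v, w = toComplex (rePart d w) v :=
  ⟨WithLp.toLp 2 fun i => (w i).im, funext fun i => (Complex.re_add_im (w i)).symm⟩

theorem rePart_toComplex (u v : EuclideanSpace ℝ (Fin d)) : rePart d (toComplex u v) = u := by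
  ext i
  simp [rePart_apply, toComplex]

theorem rePart_complexOp (A : EuclideanSpace ℝ (Fin d) →L[ℝ] EuclideanSpace ℝ (Fin d))
    (w : Fin d → ℂ) : rePart d (complexOp A w) = A (rePart d w) := by
  obtain ⟨v, hv⟩ := exists_toComplex w
  conv_lhs => rw [hv]
  rw [complexOp_toComplex, rePart_toComplex]

theorem hasEigenvalue_complexOp
    (A : EuclideanSpace ℝ (Fin d) →L[ℝ] EuclideanSpace ℝ (Fin d)) (z : ℂ) :
    Module.End.HasEigenvalue (complexOp A : (Fin d → ℂ) →ₗ[ℂ] (Fin d → ℂ)) z ↔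
    Polynomial.aeval z (A : EuclideanSpace ℝ (Fin d) →ₗ[ℝ] EuclideanSpace ℝ (Fin d)).charpoly
      = 0 := by
  rw [Module.End.hasEigenvalue_iff_isRoot_charpoly]
  have : (complexOp A : (Fin d → ℂ) →ₗ[ℂ] (Fin d → ℂ)).charpoly =
      ((A : EuclideanSpace ℝ (Fin d) →ₗ[ℝ] EuclideanSpace ℝ (Fin d)).charpoly).map
        (algebraMap ℝ ℂ) := by
    rw [complexOp, LinearMap.coe_toContinuousLinearMap, Matrix.charpoly_toLin', Matrix.charpoly_map,
      LinearMap.charpoly_toMatrix]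
  rw [this, Polynomial.IsRoot.def, Polynomial.eval_map_algebraMap]

/-- A real form of the condition. An eigenvector for $iy$ has real and imaginary parts killed by
$A^2+y^2$; conversely, if $A^2v=-y^2v$ then $Av+iyv$ satisfies the eigenvalue equation for $iy$. In
this form conjugation invariance and openness are elementary. -/
theorem isHyperbolicMap_iff (A : EuclideanSpace ℝ (Fin d) →L[ℝ] EuclideanSpace ℝ (Fin d)) :
    IsHyperbolicMap A ↔ ∀ (y : ℝ) v, A (A v) = -(y ^ 2 • v) → v = 0 := by
  constructor
  · intro h y v hv
    have hno : ∀ y : ℝ, ¬ Module.End.HasEigenvalue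
        (complexOp A : (Fin d → ℂ) →ₗ[ℂ] (Fin d → ℂ)) (y * Complex.I) := fun y hy =>
      h _ ((hasEigenvalue_complexOp A _).1 hy) (by simp)
    have hker : ∀ (y : ℝ) u v, A u = -(y • v) → A v = y • u → u = 0 := by
      intro y u v h1 h2
      by_contra hu
      refine hno y (Module.End.hasEigenvalue_of_hasEigenvector (x := toComplex u v) ⟨?_, ?_⟩)
      · rw [Module.End.mem_eigenspace_iff]
        change complexOp A (toComplex u v) = _
        rw [complexOp_toComplex, h1, h2]
        funext i
        simp only [toComplex, PiLp.neg_apply, PiLp.smul_apply, smul_eq_mul, Pi.smul_apply,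
          Complex.ofReal_neg, Complex.ofReal_mul]
        ring_nf
        rw [Complex.I_sq]
        ring
      · intro h0
        exact hu (by rw [← rePart_toComplex u v, h0, map_zero])
    have h1 : A v = 0 := hker y (A v) (y • v) (by rw [hv, smul_smul, sq]) (by rw [map_smul])
    exact hker 0 v 0 (by simp [h1]) (by simp)
  · intro h z hz
    by_contra hre
    obtain ⟨w, hw⟩ := ((hasEigenvalue_complexOp A z).2 hz).exists_hasEigenvector
    have hzi : z = (z.im : ℂ) * Complex.I := by
      apply Complex.ext <;> simp [hre]
    have hw1 : complexOp A w = z • w := Module.End.mem_eigenspace_iff.1 hw.1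
    have key : ∀ w, complexOp A w = z • w → rePart d w = 0 := by
      intro w hw1
      refine h z.im _ ?_
      rw [← rePart_complexOp, ← rePart_complexOp, hw1, map_smul, hw1, smul_smul, hzi]
      ext i
      have : (z.im : ℂ) * Complex.I * (z.im * Complex.I) = ((-(z.im ^ 2) : ℝ) : ℂ) := by
        push_cast
        ring_nf
        rw [Complex.I_sq]
        ring
      simp only [Complex.mul_im, Complex.ofReal_re, Complex.I_im, Complex.ofReal_im, Complex.I_re,
        mul_one, mul_zero, add_zero]
      rw [this, rePart_apply, Pi.smul_apply, smul_eq_mul, Complex.re_ofReal_mul]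
      simp [rePart_apply]
    have h1 := key w hw1
    have h2 := key (Complex.I • w) (by rw [map_smul, hw1, smul_comm])
    refine hw.2 (funext fun i => Complex.ext ?_ ?_)
    · have := congrArg (fun v : EuclideanSpace ℝ (Fin d) => v i) h1
      simpa [rePart_apply] using this
    · have := congrArg (fun v : EuclideanSpace ℝ (Fin d) => v i) h2
      simpa [rePart_apply] using this

theorem IsHyperbolicMap.injective {A : EuclideanSpace ℝ (Fin d) →L[ℝ] EuclideanSpace ℝ (Fin d)}
    (h : IsHyperbolicMap A) : Function.Injective A := by
  rw [isHyperbolicMap_iff] at h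
  refine (injective_iff_map_eq_zero A).2 fun v hv => h 0 v (by simp [hv])

theorem IsHyperbolicMap.of_conj
    {A A' T : EuclideanSpace ℝ (Fin d) →L[ℝ] EuclideanSpace ℝ (Fin d)}
    (hT : Function.Injective T) (hc : ∀ v, T (A v) = A' (T v)) (h : IsHyperbolicMap A') :
    IsHyperbolicMap A := by
  rw [isHyperbolicMap_iff] at h ⊢
  intro y v hv
  refine (injective_iff_map_eq_zero T).1 hT v (h y (T v) ?_)
  rw [← hc, ← hc, hv, map_neg, map_smul]

theorem isHyperbolicMap_eventually {A : EuclideanSpace ℝ (Fin d) →L[ℝ] EuclideanSpace ℝ (Fin d)}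
    (h : IsHyperbolicMap A) : ∀ᶠ B in 𝓝 A, IsHyperbolicMap B := by
  rw [isHyperbolicMap_iff] at h
  -- Frequencies with $y^2>R$ are excluded by the norm of $B^2$; those with $y^2\le R$ by a lower
  -- bound of $A^2+s$, uniform for $s\in[0,R]$ by compactness.
  set R : ℝ := ‖A‖ ^ 2 + 1 with hR
  have hRpos : 0 < R := by positivity
  obtain ⟨m, hm, hmb⟩ : ∃ m > 0, ∀ s ∈ Icc (0 : ℝ) R, ∀ v, m * ‖v‖ ≤ ‖A (A v) + s • v‖ := by
    let K : Set (ℝ × EuclideanSpace ℝ (Fin d)) := Icc 0 R ×ˢ Metric.sphere 0 1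
    have hK : IsCompact K := isCompact_Icc.prod (isCompact_sphere _ _)
    have hpos : ∀ p ∈ K, 0 < ‖A (A p.2) + p.1 • p.2‖ := by
      rintro ⟨s, v⟩ ⟨hs, hv⟩
      rw [norm_pos_iff]
      intro h0
      have := h (Real.sqrt s) v (by rw [Real.sq_sqrt hs.1]; exact eq_neg_of_add_eq_zero_left h0)
      simp [this] at hv
    obtain ⟨m, hm, hmK⟩ : ∃ m > 0, ∀ p ∈ K, m ≤ ‖A (A p.2) + p.1 • p.2‖ := by
      rcases K.eq_empty_or_nonempty with he | hne
      · exact ⟨1, one_pos, by simp [he]⟩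
      · obtain ⟨p, hp, hmin⟩ := hK.exists_isMinOn hne
          (f := fun p : ℝ × EuclideanSpace ℝ (Fin d) => ‖A (A p.2) + p.1 • p.2‖) (by fun_prop)
        exact ⟨_, hpos p hp, fun q hq => hmin hq⟩
    refine ⟨m, hm, fun s hs v => ?_⟩
    rcases eq_or_ne v 0 with rfl | hv
    · simp
    have hvp : 0 < ‖v‖ := norm_pos_iff.2 hv
    have := hmK (s, ‖v‖⁻¹ • v) ⟨hs, by simp [norm_smul, hv]⟩
    simp only [map_smul, smul_comm s, ← smul_add, norm_smul, norm_inv, norm_norm] at this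
    rwa [le_inv_mul_iff₀ hvp, mul_comm] at this
  have hcont : ContinuousAt (fun B : EuclideanSpace ℝ (Fin d) →L[ℝ] EuclideanSpace ℝ (Fin d) =>
      B * B) A := by fun_prop
  have hcont' : ContinuousAt (fun B : EuclideanSpace ℝ (Fin d) →L[ℝ] EuclideanSpace ℝ (Fin d) =>
      ‖B‖ ^ 2) A := by fun_prop
  filter_upwards [Metric.continuousAt_iff'.1 hcont m hm,
    hcont'.eventually_lt_const (show ‖A‖ ^ 2 < R by linarith)] with B hB hB2
  rw [isHyperbolicMap_iff]
  intro y v hv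
  by_contra hv0
  have hvp : 0 < ‖v‖ := norm_pos_iff.2 hv0
  rcases le_or_gt (y ^ 2) R with hy | hy
  · have h1 := hmb (y ^ 2) ⟨sq_nonneg _, hy⟩ v
    rw [dist_eq_norm] at hB
    have h2 : A (A v) + y ^ 2 • v = -((B * B - A * A) v) := by
      simp only [sub_apply, mul_apply_eq_comp, hv]
      abel
    rw [h2, norm_neg] at h1
    have h3 := (B * B - A * A).le_opNorm v
    nlinarith
  · have h1 : ‖B (B v)‖ ≤ ‖B‖ ^ 2 * ‖v‖ := by
      rw [sq, mul_assoc]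
      exact (B.le_opNorm _).trans (mul_le_mul_of_nonneg_left (B.le_opNorm _) (norm_nonneg _))
    rw [hv, norm_neg, norm_smul, Real.norm_of_nonneg (sq_nonneg y)] at h1
    nlinarith

theorem rePart_exp (A : EuclideanSpace ℝ (Fin d) →L[ℝ] EuclideanSpace ℝ (Fin d)) (t : ℝ)
    (w : Fin d → ℂ) : rePart d (NormedSpace.exp ((t : ℂ) • complexOp A) w) =
      NormedSpace.exp (t • A) (rePart d w) := by
  have h1 := exp_intertwine (rePart d) (B := ((t : ℂ) • complexOp A).restrictScalars ℝ)
    (A := t • A) (fun w => by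
      have : ((t : ℂ) • complexOp A) w = t • complexOp A w := rfl
      simp only [ContinuousLinearMap.coe_restrictScalars', this, map_smul, rePart_complexOp,
        smul_apply]) w
  rw [← h1]
  congr 1
  have hs := (NormedSpace.exp_series_hasSum_exp' (𝕂 := ℂ) ((t : ℂ) • complexOp A)).mapL
    (ContinuousLinearMap.apply ℂ _ w)
  have hs' := (NormedSpace.exp_series_hasSum_exp' (𝕂 := ℝ)
    (((t : ℂ) • complexOp A).restrictScalars ℝ)).mapL (ContinuousLinearMap.apply ℝ _ w)
  have hpow : ∀ (n : ℕ) v, ((((t : ℂ) • complexOp A).restrictScalars ℝ) ^ n) v =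
      (((t : ℂ) • complexOp A) ^ n) v := by
    intro n
    induction n with
    | zero => intro v; rfl
    | succ n ih => intro v; rw [pow_succ, pow_succ, mul_apply_eq_comp, mul_apply_eq_comp, ih]; rfl
  refine hs.unique ?_
  convert hs' using 2 with n
  · simp only [ContinuousLinearMap.apply_apply, smul_apply, hpow]
    rw [← Complex.coe_smul]
    push_cast
    rfl
  · rfl

/-- Generalized eigenvectors of the complexification span. The real part of one is stable if its
eigenvalue has negative real part and unstable if positive, and hyperbolicity excludes the rest. -/
theorem stable_sup_unstable {A : EuclideanSpace ℝ (Fin d) →L[ℝ] EuclideanSpace ℝ (Fin d)}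
    (h : IsHyperbolicMap A) (v : EuclideanSpace ℝ (Fin d)) :
    ∃ a ∈ stableSpace A, ∃ b ∈ unstableSpace A, a + b = v := by
  rw [← Submodule.mem_sup]
  have htop := Module.End.iSup_maxGenEigenspace_eq_top
    (complexOp A : (Fin d → ℂ) →ₗ[ℂ] (Fin d → ℂ))
  have hv : toComplex v 0 ∈ ⨆ μ, Module.End.maxGenEigenspace
      (complexOp A : (Fin d → ℂ) →ₗ[ℂ] (Fin d → ℂ)) μ := htop ▸ Submodule.mem_top
  rw [← rePart_toComplex v 0]
  refine Submodule.iSup_induction _ (motive := fun w => rePart d w ∈ stableSpace A ⊔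
    unstableSpace A) hv (fun z w hw => ?_) (by simp) (fun w w' h h' => by
      rw [map_add]
      exact add_mem h h')
  rcases eq_or_ne w 0 with rfl | hw0
  · simp
  obtain ⟨k, hk⟩ := (Module.End.mem_maxGenEigenspace _ _ _).1 hw
  have hkB : ((complexOp A - z • (1 : (Fin d → ℂ) →L[ℂ] (Fin d → ℂ))) ^ k) w = 0 := by
    rw [← hk]
    have : ∀ (C : (Fin d → ℂ) →L[ℂ] (Fin d → ℂ)) (n : ℕ) v, (C ^ n) v =
        ((C : (Fin d → ℂ) →ₗ[ℂ] (Fin d → ℂ)) ^ n) v := by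
      intro C n
      induction n with
      | zero => intro v; rfl
      | succ n ih => intro v; rw [pow_succ, pow_succ, mul_apply_eq_comp, ih]; rfl
    rw [this]
    rfl
  have hev : Module.End.HasEigenvalue (complexOp A : (Fin d → ℂ) →ₗ[ℂ] (Fin d → ℂ)) z := by
    refine Module.End.hasEigenvalue_of_hasGenEigenvalue (k := k) ?_
    intro hb
    apply hw0
    have : w ∈ Module.End.genEigenspace (complexOp A : (Fin d → ℂ) →ₗ[ℂ] (Fin d → ℂ)) z k := by
      rw [Module.End.mem_genEigenspace_nat]
      exact hk
    rw [hb] at this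
    exact this
  have hre := h z ((hasEigenvalue_complexOp A z).1 hev)
  have hcont := (rePart d).continuous.tendsto 0
  rw [map_zero] at hcont
  rcases lt_or_gt_of_ne hre with hneg | hpos
  · refine Submodule.mem_sup_left ?_
    have := hcont.comp (tendsto_exp_of_nilpotent hneg hkB)
    simp only [Function.comp_def, rePart_exp] at this
    exact this
  · refine Submodule.mem_sup_right ?_
    have hB : complexOp (-A) = -complexOp A := by
      refine ContinuousLinearMap.ext fun w => ?_
      obtain ⟨v, hv⟩ := exists_toComplex w
      rw [neg_apply, hv, complexOp_toComplex, complexOp_toComplex]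
      funext i
      simp [toComplex]
      ring
    have hk' : ((complexOp (-A) - (-z) • (1 : (Fin d → ℂ) →L[ℂ] (Fin d → ℂ))) ^ k) w = 0 := by
      have : complexOp (-A) - (-z) • (1 : (Fin d → ℂ) →L[ℂ] (Fin d → ℂ)) =
          -(complexOp A - z • (1 : (Fin d → ℂ) →L[ℂ] (Fin d → ℂ))) := by
        rw [hB]
        module
      have hneg : ∀ (C : (Fin d → ℂ) →L[ℂ] (Fin d → ℂ)) (n : ℕ) v,
          ((-C) ^ n) v = (-1 : ℂ) ^ n • (C ^ n) v := by
        intro C n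
        induction n with
        | zero => intro v; simp
        | succ n ih =>
          intro v
          rw [pow_succ, mul_apply_eq_comp, ih, pow_succ, pow_succ, mul_apply_eq_comp, neg_apply,
            map_neg]
          module
      rw [this, hneg, hkB, smul_zero]
    have := hcont.comp (tendsto_exp_of_nilpotent (by simpa using hpos) hk')
    simp only [Function.comp_def, rePart_exp] at this
    exact this

end LinearFlow

/-! ### Differential inequalities in the unstable cone -/

section Cone

theorem frequently_slope_lt {f : ℝ → ℝ} {t D r : ℝ} (hr : D < r)
    (h : ∀ c > 0, ∀ᶠ s in 𝓝[>] (0 : ℝ), f (t + s) ≤ f t + s * D + c * s) :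
    ∃ᶠ z in 𝓝[>] t, (z - t)⁻¹ * (f z - f t) < r := by
  refine Eventually.frequently ?_
  have h1 := h ((r - D) / 2) (by linarith)
  have h2 : Tendsto (fun z => z - t) (𝓝[>] t) (𝓝[>] 0) := by
    refine tendsto_nhdsWithin_iff.2 ⟨?_, ?_⟩
    · have : ContinuousAt (fun z => z - t) t := by fun_prop
      simpa using this.tendsto.mono_left nhdsWithin_le_nhds
    · filter_upwards [self_mem_nhdsWithin] with z hz using sub_pos.2 (mem_Ioi.1 hz)
  filter_upwards [h2.eventually h1, self_mem_nhdsWithin] with z hz hzt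
  have hpos : 0 < z - t := sub_pos.2 hzt
  rw [add_sub_cancel] at hz
  rw [inv_mul_lt_iff₀ hpos]
  nlinarith

/-- One-sided differential inequalities along a curve near a saddle. -/
structure ConeCurve (lam K ε T : ℝ) (α β : ℝ → ℝ) : Prop where
  contα : ContinuousOn α (Icc 0 T)
  contβ : ContinuousOn β (Icc 0 T)
  nonnegα : ∀ t ∈ Icc 0 T, 0 ≤ α t
  pos : ∀ t ∈ Icc 0 T, 0 < α t + β t
  -- Only right difference quotients with an arbitrary error `c` appear, because norms of components
  -- need not be differentiable.
  derα : ∀ t ∈ Ico 0 T, ∀ c > 0, ∀ᶠ s in 𝓝[>] (0 : ℝ),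
    α (t + s) ≤ α t + s * (-lam * α t + ε * (α t + β t)) + c * s
  derβ : ∀ t ∈ Ico 0 T, ∀ c > 0, ∀ᶠ s in 𝓝[>] (0 : ℝ),
    β t + s * (lam * β t - ε * (α t + β t)) - c * s ≤ β (t + s)
  derβ' : ∀ t ∈ Ico 0 T, ∀ c > 0, ∀ᶠ s in 𝓝[>] (0 : ℝ),
    β (t + s) ≤ β t + s * (K * β t + ε * (α t + β t)) + c * s

variable {lam K ε T : ℝ} {α β : ℝ → ℝ}

/-- $\alpha-\beta$ starts at 0 and has right slope at most
$(-\lambda+2\varepsilon)(\alpha+\beta)\le-\tfrac{\lambda}{2}m$, where $m>0$ is the minimum of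
$\alpha+\beta$. -/
theorem ConeCurve.lt (h : ConeCurve lam K ε T α β) (hε0 : 0 ≤ ε) (hε : 4 * ε ≤ lam)
    (hlam : 0 < lam) (h0 : α 0 = β 0) {t : ℝ} (ht : 0 < t) (htT : t ≤ T) : α t < β t := by
  have hne : (Icc (0 : ℝ) T).Nonempty := ⟨0, le_rfl, ht.le.trans htT⟩
  obtain ⟨t₀, ht₀, hmin⟩ := isCompact_Icc.exists_isMinOn hne (h.contα.add h.contβ)
  set m := α t₀ + β t₀ with hm
  have hmpos : 0 < m := h.pos t₀ ht₀
  have hmin' : ∀ s ∈ Icc 0 T, m ≤ α s + β s := fun s hs => hmin hs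
  have key := image_le_of_liminf_slope_right_le_deriv_boundary (f := fun t => α t - β t)
    (B := fun t => -(lam / 2 * m) * t)
    (B' := fun _ => -(lam / 2 * m)) (a := 0) (b := T) (h.contα.sub h.contβ) (by simp [h0])
    (by fun_prop) (fun t _ => by
      simpa using (((hasDerivAt_id t).const_mul (-(lam / 2 * m))).hasDerivWithinAt (s := Ici t)))
    (fun t ht r hr => by
      have hlt : (-lam + 2 * ε) * (α t + β t) < r := by
        have := hmin' t ⟨ht.1, ht.2.le⟩
        nlinarith
      have := frequently_slope_lt (f := fun t => α t - β t) (t := t) hlt fun c hc => by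
        filter_upwards [h.derα t ht (c / 2) (by linarith), h.derβ t ht (c / 2) (by linarith)]
          with s h1 h2
        linarith
      refine this.mono fun z hz => ?_
      rw [slope_def_field, div_eq_inv_mul]
      exact hz)
  have := key ⟨ht.le, htT⟩
  have : 0 < lam / 2 * m * t := by positivity
  linarith

theorem ConeCurve.le (h : ConeCurve lam K ε T α β) (hε0 : 0 ≤ ε) (hε : 4 * ε ≤ lam)
    (hlam : 0 < lam) (h0 : α 0 = β 0) {t : ℝ} (ht : t ∈ Icc 0 T) : α t ≤ β t := by
  rcases ht.1.eq_or_lt with rfl | h1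
  · exact h0.le
  · exact (h.lt hε0 hε hlam h0 h1 ht.2).le

/-- In the cone $\alpha\le\beta$ the error is at most $2\varepsilon\beta\le\tfrac{\lambda}{2}\beta$,
so $\beta$ grows at least at rate $\lambda/2$. -/
theorem ConeCurve.growth_lower (h : ConeCurve lam K ε T α β) (hε0 : 0 ≤ ε) (hε : 4 * ε ≤ lam)
    (hlam : 0 < lam) (h0 : α 0 = β 0) {s t : ℝ} (hs : 0 ≤ s) (hst : s ≤ t) (ht : t ≤ T) :
    β s * Real.exp (lam / 2 * (t - s)) ≤ β t := by
  have := le_gronwallBound_of_liminf_deriv_right_le (f := fun t => -β t)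
    (f' := fun t => -(lam * β t - ε * (α t + β t))) (δ := -β s) (K := lam / 2) (ε := 0) (a := s)
    (b := t) (h.contβ.neg.mono (Icc_subset_Icc hs ht)) (fun u hu r hr =>
      frequently_slope_lt (f := fun t => -β t) hr fun c hc => by
        filter_upwards [h.derβ u ⟨hs.trans hu.1, hu.2.trans_le ht⟩ c hc] with v hv
        linarith) le_rfl (fun u hu => by
      have := h.le hε0 hε hlam h0 (t := u) ⟨hs.trans hu.1, hu.2.le.trans ht⟩
      have := h.nonnegα u ⟨hs.trans hu.1, hu.2.le.trans ht⟩
      nlinarith) t ⟨hst, le_rfl⟩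
  rw [gronwallBound_ε0] at this
  linarith

theorem ConeCurve.growth_upper (h : ConeCurve lam K ε T α β) (hε0 : 0 ≤ ε) (hε : 4 * ε ≤ lam)
    (hlam : 0 < lam) (h0 : α 0 = β 0) {t : ℝ} (ht : t ∈ Icc 0 T) :
    β t ≤ β 0 * Real.exp ((K + lam) * t) := by
  have := le_gronwallBound_of_liminf_deriv_right_le (f := β)
    (f' := fun t => K * β t + ε * (α t + β t)) (δ := β 0) (K := K + lam) (ε := 0) (a := 0)
    (b := T) h.contβ (fun u hu r hr =>
      frequently_slope_lt (f := β) hr fun c hc => h.derβ' u hu c hc) le_rfl (fun u hu => by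
      have := h.le hε0 hε hlam h0 (t := u) ⟨hu.1, hu.2.le⟩
      have := h.nonnegα u ⟨hu.1, hu.2.le⟩
      nlinarith) t ht
  rwa [gronwallBound_ε0, sub_zero] at this

end Cone

/-! ### The hyperbolic splitting with uniform constants -/

section Splitting

variable {d : ℕ}

/-- The projections to the stable and the unstable space of a hyperbolic map, in a norm which is
contracted on the stable space and expanded on the unstable space. -/
structure IsSplitting (A : EuclideanSpace ℝ (Fin d) →L[ℝ] EuclideanSpace ℝ (Fin d))
    (q : Seminorm ℝ (EuclideanSpace ℝ (Fin d))) (lam K κ : ℝ)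
    (Ps Pu : EuclideanSpace ℝ (Fin d) →L[ℝ] EuclideanSpace ℝ (Fin d)) : Prop where
  add : ∀ v, Ps v + Pu v = v
  mem_s : ∀ v, Ps v ∈ stableSpace A
  mem_u : ∀ v, Pu v ∈ unstableSpace A
  proj_s : ∀ a ∈ stableSpace A, ∀ b ∈ unstableSpace A, Ps (a + b) = a
  proj_u : ∀ a ∈ stableSpace A, ∀ b ∈ unstableSpace A, Pu (a + b) = b
  comm_s : ∀ v, Ps (A v) = A (Ps v)
  comm_u : ∀ v, Pu (A v) = A (Pu v)
  bound_s : ∀ v, q (Ps v) ≤ κ * q v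
  bound_u : ∀ v, q (Pu v) ≤ κ * q v
  bound : ∀ v, q (A v) ≤ K * q v
  cont : Continuous q
  contract : ∀ a ∈ stableSpace A, ∀ t : ℝ, 0 ≤ t →
    q (NormedSpace.exp (t • A) a) ≤ Real.exp (-lam * t) * q a
  expand : ∀ b ∈ unstableSpace A, ∀ t : ℝ, 0 ≤ t →
    Real.exp (lam * t) * q b ≤ q (NormedSpace.exp (t • A) b)

theorem exp_add_smul_apply (A : EuclideanSpace ℝ (Fin d) →L[ℝ] EuclideanSpace ℝ (Fin d))
    (s t : ℝ) (v : EuclideanSpace ℝ (Fin d)) : NormedSpace.exp ((s + t) • A) v =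
      NormedSpace.exp (s • A) (NormedSpace.exp (t • A) v) := by
  rw [show (s + t) • A = s • A + t • A from add_smul s t A, exp_add ?_, mul_apply_eq_comp]
  refine ContinuousLinearMap.ext fun v => ?_
  simp only [mul_apply_eq_comp, smul_apply, map_smul]
  exact smul_comm t s (A (A v))

theorem exp_smul_mem_stable {A : EuclideanSpace ℝ (Fin d) →L[ℝ] EuclideanSpace ℝ (Fin d)}
    {v : EuclideanSpace ℝ (Fin d)} (hv : v ∈ stableSpace A) (s : ℝ) :
    NormedSpace.exp (s • A) v ∈ stableSpace A := by
  have h : Tendsto (fun t : ℝ => NormedSpace.exp (t • A) v) atTop (𝓝 0) := hv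
  have h2 := ((NormedSpace.exp (s • A)).continuous.tendsto 0).comp h
  rw [map_zero] at h2
  refine h2.congr fun t => ?_
  rw [Function.comp_apply, ← exp_add_smul_apply, ← exp_add_smul_apply, add_comm]

theorem exp_smul_mem_unstable {A : EuclideanSpace ℝ (Fin d) →L[ℝ] EuclideanSpace ℝ (Fin d)}
    {v : EuclideanSpace ℝ (Fin d)} (hv : v ∈ unstableSpace A) (s : ℝ) :
    NormedSpace.exp (s • A) v ∈ unstableSpace A := by
  have := exp_smul_mem_stable (A := -A) hv (-s)
  rwa [neg_smul_neg] at this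

theorem map_mem_stable {A : EuclideanSpace ℝ (Fin d) →L[ℝ] EuclideanSpace ℝ (Fin d)}
    {v : EuclideanSpace ℝ (Fin d)} (hv : v ∈ stableSpace A) : A v ∈ stableSpace A := by
  have h : Tendsto (fun t : ℝ => NormedSpace.exp (t • A) v) atTop (𝓝 0) := hv
  have h2 := (A.continuous.tendsto 0).comp h
  rw [map_zero] at h2
  refine h2.congr fun t => ?_
  exact exp_intertwine A (B := t • A) (A := t • A) (fun v => by simp) v

theorem map_mem_unstable {A : EuclideanSpace ℝ (Fin d) →L[ℝ] EuclideanSpace ℝ (Fin d)}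
    {v : EuclideanSpace ℝ (Fin d)} (hv : v ∈ unstableSpace A) : A v ∈ unstableSpace A := by
  have := map_mem_stable (A := -A) hv
  rw [neg_apply] at this
  simpa using (unstableSpace A).neg_mem this

theorem exp_neg_exp (A : EuclideanSpace ℝ (Fin d) →L[ℝ] EuclideanSpace ℝ (Fin d))
    (t : ℝ) (v : EuclideanSpace ℝ (Fin d)) :
    NormedSpace.exp (-t • A) (NormedSpace.exp (t • A) v) = v := by
  rw [← exp_add_smul_apply, neg_add_cancel,
    show (0 : ℝ) • A = 0 from zero_smul ℝ A, NormedSpace.exp_zero, one_apply_eq_self]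

theorem hasDerivAt_exp_smul_zero (A : EuclideanSpace ℝ (Fin d) →L[ℝ] EuclideanSpace ℝ (Fin d))
    (v : EuclideanSpace ℝ (Fin d)) :
    HasDerivAt (fun t : ℝ => NormedSpace.exp (t • A) v) (A v) 0 := by
  have h := hasDerivAt_exp_smul_const (𝕂 := ℝ) A (0 : ℝ)
  have h2 := h.clm_apply (hasDerivAt_const (0 : ℝ) v)
  rw [show (0 : ℝ) • A = 0 from zero_smul ℝ A, NormedSpace.exp_zero] at h2
  simpa using h2

theorem seminorm_exp_le {A : EuclideanSpace ℝ (Fin d) →L[ℝ] EuclideanSpace ℝ (Fin d)}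
    {q : Seminorm ℝ (EuclideanSpace ℝ (Fin d))} {K : ℝ} (hK : 0 ≤ K) (hq : Continuous q)
    (hb : ∀ v, q (A v) ≤ K * q v) (v : EuclideanSpace ℝ (Fin d)) :
    q (NormedSpace.exp A v) ≤ Real.exp K * q v := by
  have hs := (NormedSpace.exp_series_hasSum_exp' (𝕂 := ℝ) A).mapL
    (ContinuousLinearMap.apply ℝ _ v)
  have hr := (NormedSpace.exp_series_hasSum_exp' (𝕂 := ℝ) K).mul_right (q v)
  rw [← Real.exp_eq_exp_ℝ] at hr
  have hpow : ∀ n : ℕ, q ((A ^ n) v) ≤ K ^ n * q v := by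
    intro n
    induction n with
    | zero => simp
    | succ n ih =>
      rw [pow_succ', mul_apply_eq_comp, pow_succ', mul_assoc]
      exact (hb _).trans (mul_le_mul_of_nonneg_left ih hK)
  refine le_of_tendsto_of_tendsto ((hq.tendsto _).comp hs) hr (Eventually.of_forall fun s => ?_)
  refine (Finset.le_sum_of_subadditive q (map_zero q).le (map_add_le_add q) s _).trans
    (Finset.sum_le_sum fun n _ => ?_)
  rw [ContinuousLinearMap.apply_apply, smul_apply, map_smul_eq_mul, Real.norm_of_nonneg (by positivity)]
  calc _ ≤ ((n.factorial : ℝ))⁻¹ * (K ^ n * q v) :=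
        mul_le_mul_of_nonneg_left (hpow n) (by positivity)
    _ = _ := by rw [smul_eq_mul]; ring

/-- The bound of the projections of a splitting. -/
def projBound (lam K : ℝ) : ℝ :=
  1 + (Real.exp K + Real.exp (-lam)) / (Real.exp lam - Real.exp (-lam))

theorem one_le_projBound {lam : ℝ} (hlam : 0 < lam) (K : ℝ) : 1 ≤ projBound lam K := by
  have : 0 < Real.exp lam - Real.exp (-lam) := sub_pos.2 (Real.exp_lt_exp.2 (by linarith))
  have : 0 ≤ (Real.exp K + Real.exp (-lam)) / (Real.exp lam - Real.exp (-lam)) := by positivity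
  rw [projBound]
  linarith

/-- The size of the projections has to be uniform over nearby vector fields and all adapted norms,
so it is derived from `lam` and `K` alone. -/
theorem exists_splitting {A : EuclideanSpace ℝ (Fin d) →L[ℝ] EuclideanSpace ℝ (Fin d)}
    (hA : IsHyperbolicMap A) {q : Seminorm ℝ (EuclideanSpace ℝ (Fin d))} {lam K : ℝ}
    (hlam : 0 < lam) (hK : 0 ≤ K) (hq0 : ∀ v, q v = 0 → v = 0) (hcont : Continuous q)
    (hb : ∀ v, q (A v) ≤ K * q v)
    (hs : ∀ a ∈ stableSpace A, ∀ t : ℝ, 0 ≤ t →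
      q (NormedSpace.exp (t • A) a) ≤ Real.exp (-lam * t) * q a)
    (hu : ∀ b ∈ unstableSpace A, ∀ t : ℝ, 0 ≤ t →
      q (NormedSpace.exp (-t • A) b) ≤ Real.exp (-lam * t) * q b) :
    ∃ Ps Pu : EuclideanSpace ℝ (Fin d) →L[ℝ] EuclideanSpace ℝ (Fin d),
      IsSplitting A q lam K (projBound lam K) Ps Pu := by
  have hexpand : ∀ b ∈ unstableSpace A, ∀ t : ℝ, 0 ≤ t →
      Real.exp (lam * t) * q b ≤ q (NormedSpace.exp (t • A) b) := fun b hb t ht => by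
    have h1 := hu _ (exp_smul_mem_unstable hb t) t ht
    rw [exp_neg_exp] at h1
    calc Real.exp (lam * t) * q b ≤ Real.exp (lam * t) *
          (Real.exp (-lam * t) * q (NormedSpace.exp (t • A) b)) :=
          mul_le_mul_of_nonneg_left h1 (Real.exp_pos _).le
      _ = _ := by rw [← mul_assoc, ← Real.exp_add]; simp
  have hdisj : Disjoint (stableSpace A) (unstableSpace A) := by
    rw [Submodule.disjoint_def]
    intro v h1 h2
    apply hq0
    have e1 := hs v h1 1 zero_le_one
    have e2 := hexpand v h2 1 zero_le_one
    have e3 : Real.exp (-lam * 1) < Real.exp (lam * 1) := Real.exp_lt_exp.2 (by linarith)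
    have e4 := apply_nonneg q v
    nlinarith
  have hcompl : IsCompl (stableSpace A) (unstableSpace A) := by
    refine ⟨hdisj, codisjoint_iff.2 (eq_top_iff.2 fun v _ => ?_)⟩
    obtain ⟨a, ha, b, hb, rfl⟩ := stable_sup_unstable hA v
    exact Submodule.add_mem_sup ha hb
  let ps : EuclideanSpace ℝ (Fin d) →ₗ[ℝ] EuclideanSpace ℝ (Fin d) := Submodule.projection _ _ hcompl
  let pu : EuclideanSpace ℝ (Fin d) →ₗ[ℝ] EuclideanSpace ℝ (Fin d) := Submodule.projection _ _ hcompl.symm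
  have pjs : ∀ a ∈ stableSpace A, ∀ b ∈ unstableSpace A, ps (a + b) = a := fun a ha b hb => by
    simp only [ps]
    rw [map_add, Submodule.projection_apply_of_mem_left hcompl ha,
      Submodule.projection_apply_of_mem_right hcompl hb,
      add_zero]
  have pju : ∀ a ∈ stableSpace A, ∀ b ∈ unstableSpace A, pu (a + b) = b := fun a ha b hb => by
    simp only [pu]
    rw [map_add, Submodule.projection_apply_of_mem_left hcompl.symm hb,
      Submodule.projection_apply_of_mem_right hcompl.symm ha, zero_add]
  have hdec : ∀ v, ∃ a ∈ stableSpace A, ∃ b ∈ unstableSpace A, a + b = v := stable_sup_unstable hA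
  have hgap : 0 < Real.exp lam - Real.exp (-lam) := sub_pos.2 (Real.exp_lt_exp.2 (by linarith))
  -- Apply $e^A$: $e^{\lambda}q(b)\le q(e^Ab)\le e^Kq(a+b)+e^{-\lambda}q(a)$ and $q(a)\le
  -- q(a+b)+q(b)$; solve for $q(b)$.
  have hub : ∀ a ∈ stableSpace A, ∀ b ∈ unstableSpace A,
      q b ≤ (Real.exp K + Real.exp (-lam)) / (Real.exp lam - Real.exp (-lam)) * q (a + b) := by
    intro a ha b hbu
    have e1 := hs a ha 1 zero_le_one
    have e2 := hexpand b hbu 1 zero_le_one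
    have e3 := seminorm_exp_le hK hcont hb (a + b)
    simp only [one_smul, mul_one] at e1 e2
    have e4 : q (NormedSpace.exp A b) ≤ q (NormedSpace.exp A (a + b)) + q (NormedSpace.exp A a) := by
      have : NormedSpace.exp A b = NormedSpace.exp A (a + b) - NormedSpace.exp A a := by
        rw [map_add]
        abel
      rw [this]
      exact map_sub_le_add q _ _
    have e5 : q a ≤ q (a + b) + q b := by
      have : a = a + b - b := by abel
      conv_lhs => rw [this]
      exact map_sub_le_add q _ _
    rw [div_mul_eq_mul_div, le_div_iff₀ hgap]
    have := Real.exp_pos (-lam)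
    nlinarith
  refine ⟨LinearMap.toContinuousLinearMap ps, LinearMap.toContinuousLinearMap pu, ?_⟩
  refine ⟨fun v => ?_, fun v => ?_, fun v => ?_,
    fun a ha b hb => pjs a ha b hb, fun a ha b hb => pju a ha b hb, fun v => ?_, fun v => ?_, fun v => ?_,
    fun v => ?_, hb, hcont, hs, hexpand⟩ <;> obtain ⟨a, ha, b, hbu, rfl⟩ := hdec v <;>
    simp only [LinearMap.coe_toContinuousLinearMap', map_add A]
  · conv_lhs => rw [pjs a ha b hbu, pju a ha b hbu]
  · rwa [pjs a ha b hbu]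
  · rwa [pju a ha b hbu]
  · rw [pjs a ha b hbu, pjs _ (map_mem_stable ha) _ (map_mem_unstable hbu)]
  · rw [pju a ha b hbu, pju _ (map_mem_stable ha) _ (map_mem_unstable hbu)]
  · rw [pjs a ha b hbu]
    have := hub a ha b hbu
    have e5 : q a ≤ q (a + b) + q b := by
      have : a = a + b - b := by abel
      conv_lhs => rw [this]
      exact map_sub_le_add q _ _
    rw [projBound]
    linarith
  · rw [pju a ha b hbu, projBound]
    have := hub a ha b hbu
    have := apply_nonneg q (a + b)
    linarith

variable {A : EuclideanSpace ℝ (Fin d) →L[ℝ] EuclideanSpace ℝ (Fin d)}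
  {q : Seminorm ℝ (EuclideanSpace ℝ (Fin d))} {lam K κ : ℝ}
  {Ps Pu : EuclideanSpace ℝ (Fin d) →L[ℝ] EuclideanSpace ℝ (Fin d)}

theorem eventually_exp_sub_le (hq : Continuous q) (A : EuclideanSpace ℝ (Fin d) →L[ℝ]
    EuclideanSpace ℝ (Fin d)) (v : EuclideanSpace ℝ (Fin d)) {c : ℝ} (hc : 0 < c) :
    ∀ᶠ s in 𝓝[>] (0 : ℝ), q (NormedSpace.exp (s • A) v - (v + s • A v)) ≤ c * s := by
  have h1 := ((hasDerivAt_exp_smul_zero A v).tendsto_slope_zero_right).sub_const (A v)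
  rw [sub_self] at h1
  have h2 := (hq.tendsto 0).comp h1
  rw [map_zero] at h2
  filter_upwards [h2.eventually_lt_const hc, self_mem_nhdsWithin] with s hs hs0
  have hs0' : (0 : ℝ) < s := hs0
  simp only [Function.comp_apply, zero_add, 
    show (0 : ℝ) • A = 0 from zero_smul ℝ A, NormedSpace.exp_zero, one_apply_eq_self] at hs
  have e : NormedSpace.exp (s • A) v - (v + s • A v) =
      s • (s⁻¹ • (NormedSpace.exp (s • A) v - v) - A v) := by
    rw [smul_sub, smul_smul, mul_inv_cancel₀ hs0'.ne', one_smul]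
    abel
  rw [e, map_smul_eq_mul, Real.norm_of_nonneg hs0'.le, mul_comm]
  exact mul_le_mul_of_nonneg_right hs.le hs0'.le

/-- The projections commute with $A$, so each component of `v` follows the linear flow up to an
error $\kappa\varepsilon s\,q(v)$; contraction and expansion of the linear flow give the cone
inequalities. -/
theorem IsSplitting.coneCurve (hS : IsSplitting A q lam K κ Ps Pu) {ε T : ℝ}
    (hq0 : ∀ v, q v = 0 → v = 0) (hκ : 0 ≤ κ) (hε0 : 0 ≤ ε)
    {v : ℝ → EuclideanSpace ℝ (Fin d)} (hv : ContinuousOn v (Icc 0 T))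
    (hne : ∀ t ∈ Icc 0 T, v t ≠ 0) (hder : ∀ t ∈ Ico 0 T, ∀ᶠ s in 𝓝[>] (0 : ℝ),
      q (v (t + s) - v t - s • A (v t)) ≤ ε * s * q (v t)) :
    ConeCurve lam K (κ * ε) T (fun t => q (Ps (v t))) (fun t => q (Pu (v t))) := by
  have hsum : ∀ w, q w ≤ q (Ps w) + q (Pu w) := fun w => by
    conv_lhs => rw [← hS.add w]
    exact map_add_le_add q _ _
  have herr : ∀ (P : EuclideanSpace ℝ (Fin d) →L[ℝ] EuclideanSpace ℝ (Fin d)),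
      (∀ v, q (P v) ≤ κ * q v) → (∀ v, P (A v) = A (P v)) → ∀ t ∈ Ico 0 T,
      ∀ᶠ s in 𝓝[>] (0 : ℝ), q (P (v (t + s)) - (P (v t) + s • A (P (v t)))) ≤
        s * (κ * ε * (q (Ps (v t)) + q (Pu (v t)))) := by
    intro P hP hPA t ht
    filter_upwards [hder t ht, self_mem_nhdsWithin] with s hs hs0
    have hs0' : (0 : ℝ) < s := hs0
    have e : P (v (t + s)) - (P (v t) + s • A (P (v t))) = P (v (t + s) - v t - s • A (v t)) := by
      rw [map_sub, map_sub, map_smul, hPA]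
      abel
    rw [e]
    calc _ ≤ κ * q (v (t + s) - v t - s • A (v t)) := hP _
      _ ≤ κ * (ε * s * q (v t)) := mul_le_mul_of_nonneg_left hs hκ
      _ = s * (κ * ε * q (v t)) := by ring
      _ ≤ _ := by
        have := hsum (v t)
        gcongr
  constructor
  · exact (hS.cont.comp Ps.continuous).comp_continuousOn hv
  · exact (hS.cont.comp Pu.continuous).comp_continuousOn hv
  · exact fun t _ => apply_nonneg q _
  · intro t ht
    refine lt_of_lt_of_le ?_ (hsum (v t))
    exact lt_of_le_of_ne (apply_nonneg q _) fun h => hne t ht (hq0 _ h.symm)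
  · intro t ht c hc
    have hexp : ∀ᶠ s in 𝓝[>] (0 : ℝ), Real.exp (-lam * s) * q (Ps (v t)) ≤
        q (Ps (v t)) + s * (-lam * q (Ps (v t))) + c / 2 * s := by
      have h1 : HasDerivAt (fun s : ℝ => Real.exp (-lam * s) * q (Ps (v t)))
          (-lam * q (Ps (v t))) 0 := by
        have := (((hasDerivAt_id (0 : ℝ)).const_mul (-lam)).exp).mul_const (q (Ps (v t)))
        simpa using this
      have h2 := h1.tendsto_slope_zero_right
      filter_upwards [h2.eventually_lt_const (show -lam * q (Ps (v t)) <
        -lam * q (Ps (v t)) + c / 2 by linarith), self_mem_nhdsWithin] with s hs hs0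
      have hs0' : (0 : ℝ) < s := hs0
      simp only [zero_add, mul_zero, Real.exp_zero, one_mul, smul_eq_mul] at hs
      rw [inv_mul_lt_iff₀ hs0'] at hs
      linarith
    filter_upwards [herr Ps hS.bound_s hS.comm_s t ht, hexp, self_mem_nhdsWithin,
      eventually_exp_sub_le hS.cont A (Ps (v t)) (c := c / 2) (by linarith)] with s h1 h2 h3 h4
    have h5 := hS.contract _ (hS.mem_s (v t)) s (le_of_lt h3)
    have h6 : q (Ps (v (t + s))) ≤ q (Ps (v (t + s)) - (Ps (v t) + s • A (Ps (v t)))) +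
        (q (NormedSpace.exp (s • A) (Ps (v t)) - (Ps (v t) + s • A (Ps (v t)))) +
          q (NormedSpace.exp (s • A) (Ps (v t)))) := by
      have e : Ps (v (t + s)) = (Ps (v (t + s)) - (Ps (v t) + s • A (Ps (v t)))) +
        (-(NormedSpace.exp (s • A) (Ps (v t)) - (Ps (v t) + s • A (Ps (v t)))) +
          NormedSpace.exp (s • A) (Ps (v t))) := by abel
      conv_lhs => rw [e]
      refine (map_add_le_add q _ _).trans (add_le_add_right ((map_add_le_add q _ _).trans ?_) _)
      rw [map_neg_eq_map]
    linarith
  · intro t ht c hc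
    filter_upwards [herr Pu hS.bound_u hS.comm_u t ht, self_mem_nhdsWithin,
      eventually_exp_sub_le hS.cont A (Pu (v t)) hc] with s h1 h3 h4
    have h5 := hS.expand _ (hS.mem_u (v t)) s (le_of_lt h3)
    have h6 : q (NormedSpace.exp (s • A) (Pu (v t))) ≤
        q (NormedSpace.exp (s • A) (Pu (v t)) - (Pu (v t) + s • A (Pu (v t)))) +
        (q (Pu (v (t + s)) - (Pu (v t) + s • A (Pu (v t)))) + q (Pu (v (t + s)))) := by
      have e : NormedSpace.exp (s • A) (Pu (v t)) =
        (NormedSpace.exp (s • A) (Pu (v t)) - (Pu (v t) + s • A (Pu (v t)))) +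
        (-(Pu (v (t + s)) - (Pu (v t) + s • A (Pu (v t)))) + Pu (v (t + s))) := by abel
      conv_lhs => rw [e]
      refine (map_add_le_add q _ _).trans (add_le_add_right ((map_add_le_add q _ _).trans ?_) _)
      rw [map_neg_eq_map]
    have h7 : 1 + lam * s ≤ Real.exp (lam * s) := by linarith [Real.add_one_le_exp (lam * s)]
    have h8 := mul_le_mul_of_nonneg_right h7 (apply_nonneg q (Pu (v t)))
    nlinarith
  · intro t ht c hc
    filter_upwards [herr Pu hS.bound_u hS.comm_u t ht, self_mem_nhdsWithin] with s h1 h3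
    have h3' : (0 : ℝ) < s := h3
    have h6 : q (Pu (v (t + s))) ≤ q (Pu (v (t + s)) - (Pu (v t) + s • A (Pu (v t)))) +
        (q (Pu (v t)) + q (s • A (Pu (v t)))) := by
      have e : Pu (v (t + s)) = (Pu (v (t + s)) - (Pu (v t) + s • A (Pu (v t)))) +
        (Pu (v t) + s • A (Pu (v t))) := by abel
      conv_lhs => rw [e]
      exact (map_add_le_add q _ _).trans (add_le_add_right (map_add_le_add q _ _) _)
    rw [map_smul_eq_mul, Real.norm_of_nonneg h3'.le] at h6
    have := mul_le_mul_of_nonneg_left (hS.bound (Pu (v t))) h3'.le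
    have : 0 < c * s := by positivity
    linarith

end Splitting

/-! ### Exit times from a box -/

section ExitBox

variable {M : Type*} [TopologicalSpace M]

/-- `Φ` is a continuous flow. -/
structure IsFlow (Φ : ℝ → M → M) : Prop where
  cont : Continuous fun p : ℝ × M => Φ p.1 p.2
  zero : ∀ x, Φ 0 x = x
  add : ∀ s t x, Φ (s + t) x = Φ s (Φ t x)

theorem IsFlow.rev {Φ : ℝ → M → M} (h : IsFlow Φ) : IsFlow fun t => Φ (-t) where
  cont := h.cont.comp (f := fun p : ℝ × M => (-p.1, p.2)) (by fun_prop)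
  zero x := by simp [h.zero]
  add s t x := by rw [neg_add, h.add]

theorem IsFlow.cont_time {Φ : ℝ → M → M} (h : IsFlow Φ) (x : M) : Continuous fun t => Φ t x :=
  h.cont.comp (f := fun t : ℝ => (t, x)) (by fun_prop)

/-- The part of `K` where `α` and `β` are less than `r`. -/
def innerBox (K : Set M) (α β : M → ℝ) (r : ℝ) : Set M := {x ∈ K | α x < r ∧ β x < r}

/-- A compact box with a contracting coordinate `α` and an expanding coordinate `β`: orbits that
start at `α = β` leave the box through `β = r`. -/
structure ExitBox (Φ : ℝ → M → M) (K : Set M) (α β : M → ℝ) (r c k : ℝ) : Prop where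
  isCompact : IsCompact K
  contα : ContinuousOn α K
  contβ : ContinuousOn β K
  nonnegα : ∀ x ∈ K, 0 ≤ α x
  leα : ∀ x ∈ K, α x ≤ r
  leβ : ∀ x ∈ K, β x ≤ r
  c_pos : 0 < c
  k_pos : 0 < k
  isOpen : IsOpen (innerBox K α β r)
  lt : ∀ x ∈ K, α x = β x → 0 < β x → ∀ t, 0 < t → (∀ s ∈ Icc 0 t, Φ s x ∈ K) →
    α (Φ t x) < β (Φ t x)
  lower : ∀ x ∈ K, α x = β x → 0 < β x → ∀ s t, 0 ≤ s → s ≤ t → (∀ u ∈ Icc 0 t, Φ u x ∈ K) →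
    β (Φ s x) * Real.exp (c * (t - s)) ≤ β (Φ t x)
  upper : ∀ x ∈ K, α x = β x → 0 < β x → ∀ t, 0 ≤ t → (∀ u ∈ Icc 0 t, Φ u x ∈ K) →
    β (Φ t x) ≤ β x * Real.exp (k * t)

/-- The first positive time at which the orbit of `x` meets the frontier of `B`. -/
def exitTime (Φ : ℝ → M → M) (B : Set M) (x : M) : ℝ := sInf {τ | 0 < τ ∧ Φ τ x ∈ frontier B}

variable [T2Space M] {Φ : ℝ → M → M} {K : Set M} {α β : M → ℝ} {r c k : ℝ}

/-- `τ` is the supremum of the times up to which the orbit stays in `K`. It is finite because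
$\beta$ grows exponentially but is bounded by $r$. If $\beta<r$ at time `τ`, the orbit would be in
the open inner box and could stay longer. -/
theorem ExitBox.exists_exit (hΦ : IsFlow Φ) (h : ExitBox Φ K α β r c k) {x : M} (hx : x ∈ K)
    (hαβ : α x = β x) (h0 : 0 < β x) (hr : β x < r) :
    ∃ τ, 0 < τ ∧ (∀ s ∈ Icc 0 τ, Φ s x ∈ K) ∧ β (Φ τ x) = r ∧
      ∀ s, (∀ u ∈ Icc 0 s, Φ u x ∈ K) → s ≤ τ := by
  set S : Set ℝ := {t | 0 ≤ t ∧ ∀ s ∈ Icc 0 t, Φ s x ∈ K} with hS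
  have hxc := hΦ.cont_time x
  have hKc := h.isCompact.isClosed
  have h0S : (0 : ℝ) ∈ S := by
    refine ⟨le_rfl, fun s hs => ?_⟩
    obtain rfl : s = 0 := le_antisymm hs.2 hs.1
    rwa [hΦ.zero]
  have hbdd : ∀ t ∈ S, t ≤ Real.log (r / β x) / c := by
    rintro t ⟨ht, hK⟩
    have := h.lower x hx hαβ h0 0 t le_rfl ht hK
    rw [hΦ.zero, sub_zero] at this
    have h2 := this.trans (h.leβ _ (hK t ⟨ht, le_rfl⟩))
    rw [le_div_iff₀ h.c_pos, Real.le_log_iff_exp_le (by have := h0.trans hr; positivity),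
      le_div_iff₀ h0]
    rw [mul_comm t c]; linarith
  have hbd : BddAbove S := ⟨_, hbdd⟩
  set τ := sSup S with hτ
  have hτ0 : 0 ≤ τ := le_csSup hbd h0S
  have hKlt : ∀ s ∈ Ico 0 τ, Φ s x ∈ K := by
    intro s hs
    obtain ⟨t, ht, hst⟩ := exists_lt_of_lt_csSup ⟨0, h0S⟩ hs.2
    exact ht.2 s ⟨hs.1, hst.le⟩
  have hKτ : Φ τ x ∈ K := by
    rcases hτ0.eq_or_lt with he | hlt
    · rw [← he, hΦ.zero]; exact hx
    · have : τ ∈ closure (Ico 0 τ) := by rw [closure_Ico hlt.ne]; exact ⟨hτ0, le_rfl⟩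
      have h2 := closure_minimal (s := Ico 0 τ) (t := (fun t => Φ t x) ⁻¹' K)
        (fun s hs => hKlt s hs) (hKc.preimage hxc)
      exact h2 this
  have hK : ∀ s ∈ Icc 0 τ, Φ s x ∈ K := by
    intro s hs
    rcases hs.2.eq_or_lt with he | hlt
    · rw [he]; exact hKτ
    · exact hKlt s ⟨hs.1, hlt⟩
  have hmax : ∀ s, (∀ u ∈ Icc 0 s, Φ u x ∈ K) → s ≤ τ := by
    intro s hs
    rcases le_total s 0 with h1 | h1
    · exact h1.trans hτ0
    · exact le_csSup hbd ⟨h1, hs⟩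
  have hβτ : β (Φ τ x) = r := by
    by_contra hne
    have hlt : β (Φ τ x) < r := lt_of_le_of_ne (h.leβ _ hKτ) hne
    have hα : α (Φ τ x) ≤ β (Φ τ x) := by
      rcases hτ0.eq_or_lt with he | hlt
      · rw [← he, hΦ.zero]; exact hαβ.le
      · exact (h.lt x hx hαβ h0 τ hlt hK).le
    have hin : Φ τ x ∈ innerBox K α β r := ⟨hKτ, hα.trans_lt hlt, hlt⟩
    have hev : ∀ᶠ t in 𝓝 τ, Φ t x ∈ innerBox K α β r :=
      hxc.continuousAt.preimage_mem_nhds (h.isOpen.mem_nhds hin)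
    obtain ⟨ε, hε, hball⟩ := Metric.eventually_nhds_iff.1 hev
    have : τ + ε / 2 ≤ τ := hmax _ fun u hu => by
      rcases le_total u τ with h1 | h1
      · exact hK u ⟨hu.1, h1⟩
      · refine (hball ?_).1
        rw [Real.dist_eq, abs_of_nonneg (by linarith)]
        linarith [hu.2]
    linarith
  refine ⟨τ, lt_of_le_of_ne hτ0 fun he => ?_, hK, hβτ, hmax⟩
  rw [← he, hΦ.zero] at hβτ
  exact hr.ne hβτ

/-- Before `τ` both coordinates are less than $r$, since $\beta$ increases and dominates $\alpha$.
So the orbit is in the open inner box until `τ` and meets its frontier there for the first time. -/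
theorem ExitBox.exitTime_spec (hΦ : IsFlow Φ) (h : ExitBox Φ K α β r c k) {x : M} (hx : x ∈ K)
    (hαβ : α x = β x) (h0 : 0 < β x) (hr : β x < r) :
    0 < exitTime Φ (innerBox K α β r) x ∧
    (∀ s ∈ Icc 0 (exitTime Φ (innerBox K α β r) x), Φ s x ∈ K) ∧
    β (Φ (exitTime Φ (innerBox K α β r) x) x) = r ∧
    ∀ s, (∀ u ∈ Icc 0 s, Φ u x ∈ K) → s ≤ exitTime Φ (innerBox K α β r) x := by
  obtain ⟨τ, hτ0, hK, hβ, hmax⟩ := h.exists_exit hΦ hx hαβ h0 hr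
  have hin : ∀ s, 0 ≤ s → s < τ → Φ s x ∈ innerBox K α β r := by
    intro s hs hsτ
    have hb : β (Φ s x) < r := by
      have h1 := h.lower x hx hαβ h0 s τ hs hsτ.le hK
      have h2 : 0 < β (Φ s x) := by
        have h3 := h.lower x hx hαβ h0 0 s le_rfl hs fun u hu => hK u ⟨hu.1, hu.2.trans hsτ.le⟩
        rw [hΦ.zero] at h3
        exact lt_of_lt_of_le (by positivity) h3
      have h3 : 1 < Real.exp (c * (τ - s)) := by
        rw [Real.one_lt_exp_iff]; exact mul_pos h.c_pos (by linarith)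
      nlinarith
    refine ⟨hK s ⟨hs, hsτ.le⟩, ?_, hb⟩
    rcases hs.eq_or_lt with he | hlt
    · rw [← he, hΦ.zero] at hb ⊢; rwa [hαβ]
    · exact (h.lt x hx hαβ h0 s hlt fun u hu => hK u ⟨hu.1, hu.2.trans hsτ.le⟩).trans hb
  have hfr : Φ τ x ∈ frontier (innerBox K α β r) := by
    rw [h.isOpen.frontier_eq]
    refine ⟨?_, fun hh => hh.2.2.ne hβ⟩
    have : τ ∈ closure (Ico 0 τ) := by rw [closure_Ico hτ0.ne]; exact ⟨hτ0.le, le_rfl⟩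
    have h2 := closure_minimal (s := Ico 0 τ)
      (t := (fun t => Φ t x) ⁻¹' closure (innerBox K α β r))
      (fun s hs => subset_closure (hin s hs.1 hs.2)) (isClosed_closure.preimage (hΦ.cont_time x))
    exact h2 this
  have he : exitTime Φ (innerBox K α β r) x = τ := by
    refine IsLeast.csInf_eq ⟨⟨hτ0, hfr⟩, fun s hs => ?_⟩
    by_contra hlt
    have h1 := hin s hs.1.le (not_le.1 hlt)
    have h2 := hs.2
    rw [h.isOpen.frontier_eq] at h2
    exact h2.2 h1
  rw [he]
  exact ⟨hτ0, hK, hβ, hmax⟩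

/-- A bound on the exit time becomes a condition on the orbit staying in a closed set. This is how
exit times enter measurability arguments. -/
theorem ExitBox.stays_iff (hΦ : IsFlow Φ) (h : ExitBox Φ K α β r c k) {x : M} (hx : x ∈ K)
    (hαβ : α x = β x) (h0 : 0 < β x) (hr : β x < r) {t : ℝ} :
    t ≤ exitTime Φ (innerBox K α β r) x ↔ ∀ u ∈ Icc 0 t, Φ u x ∈ K := by
  obtain ⟨-, hK, -, hmax⟩ := h.exitTime_spec hΦ hx hαβ h0 hr
  exact ⟨fun ht u hu => hK u ⟨hu.1, hu.2.trans ht⟩, hmax t⟩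

theorem ExitBox.exitTime_bounds (hΦ : IsFlow Φ) (h : ExitBox Φ K α β r c k) {x : M} (hx : x ∈ K)
    (hαβ : α x = β x) (h0 : 0 < β x) (hr : β x < r) :
    Real.log (r / β x) ≤ k * exitTime Φ (innerBox K α β r) x ∧
    c * exitTime Φ (innerBox K α β r) x ≤ Real.log (r / β x) := by
  obtain ⟨h1, hK, hβ, -⟩ := h.exitTime_spec hΦ hx hαβ h0 hr
  have hrpos : 0 < r := h0.trans hr
  constructor
  · have := h.upper x hx hαβ h0 _ h1.le hK
    rw [hβ] at this
    rw [Real.log_le_iff_le_exp (by positivity), div_le_iff₀ h0]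
    linarith
  · have := h.lower x hx hαβ h0 0 _ le_rfl h1.le hK
    rw [hβ, hΦ.zero, sub_zero] at this
    rw [Real.le_log_iff_exp_le (by positivity), le_div_iff₀ h0]
    linarith

/-- The set of points of `K` with `α = β` and `e^{-(n+1)} ≤ β < e^{-n}`. -/
def modelLayer (K : Set M) (α β : M → ℝ) (n : ℕ) : Set M :=
  {x ∈ K | α x = β x ∧ Real.exp (-((n : ℝ) + 1)) ≤ β x ∧ β x < Real.exp (-(n : ℝ))}

theorem modelLayer_comm (n : ℕ) : modelLayer K α β n = modelLayer K β α n := by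
  ext x
  simp only [modelLayer, mem_ofPred_eq]
  constructor <;> rintro ⟨h1, h2, h3, h4⟩ <;> exact ⟨h1, h2.symm, h2 ▸ h3, h2 ▸ h4⟩

theorem modelLayer_pos {n : ℕ} {x : M} (hx : x ∈ modelLayer K α β n) : 0 < β x :=
  (Real.exp_pos _).trans_le hx.2.2.1

theorem modelLayer_lt {n n₀ : ℕ} (hn : n₀ ≤ n) (hr : Real.exp (-(n₀ : ℝ)) ≤ r) {x : M}
    (hx : x ∈ modelLayer K α β n) : β x < r :=
  hx.2.2.2.trans_le ((Real.exp_le_exp.2 (by simpa using hn)).trans hr)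

/-- On the layer $n\le-\log\beta\le n+1$, and the assumption on `n` makes $|\log r|+1$ less than
$n/2$. The slack produces the factors 2. -/
theorem ExitBox.exitTime_layer (hΦ : IsFlow Φ) (h : ExitBox Φ K α β r c k) (hr : 0 < r) {n : ℕ}
    (hn : 2 * (1 + |Real.log r|) < n) {x : M} (hx : x ∈ modelLayer K α β n) :
    1 / (2 * k) * n ≤ exitTime Φ (innerBox K α β r) x ∧
      exitTime Φ (innerBox K α β r) x ≤ 2 / c * n := by
  have hk := h.k_pos
  have hc := h.c_pos
  have h0 := modelLayer_pos hx
  have hlog := abs_le.1 (le_refl |Real.log r|)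
  have hexp : Real.exp (-(n : ℝ)) ≤ r := by
    rw [← Real.le_log_iff_exp_le hr]; linarith
  obtain ⟨h1, h2⟩ := h.exitTime_bounds hΦ hx.1 hx.2.1 h0 (modelLayer_lt le_rfl hexp hx)
  rw [Real.log_div hr.ne' h0.ne'] at h1 h2
  have h3 : Real.log (β x) ≤ -n := by
    rw [Real.log_le_iff_le_exp h0]; exact hx.2.2.2.le
  have h4 : -((n : ℝ) + 1) ≤ Real.log (β x) := by
    rw [Real.le_log_iff_exp_le h0]; exact hx.2.2.1
  constructor
  · rw [div_mul_eq_mul_div, div_le_iff₀ (by positivity)]; linarith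
  · rw [div_mul_eq_mul_div, le_div_iff₀ hc]; linarith

end ExitBox

/-! ### Orbits through a saddle cross the section once -/

section Saddle

variable {M : Type*} [TopologicalSpace M]

/-- A box that is an exit box in both time directions. -/
structure SaddleBox (Φ : ℝ → M → M) (K : Set M) (α β : M → ℝ) (r c k : ℝ) : Prop where
  isFlow : IsFlow Φ
  fwd : ExitBox Φ K α β r c k
  bwd : ExitBox (fun t => Φ (-t)) K β α r c k

/-- The time domain of the orbits in the box. -/
def orbitDomain (Φ : ℝ → M → M) (K : Set M) (α β : M → ℝ) (r : ℝ) (D : Set M) : Set (ℝ × M) :=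
  {p | p.2 ∈ D ∧ p.1 ∈ Icc (-exitTime (fun t => Φ (-t)) (innerBox K β α r) p.2)
    (exitTime Φ (innerBox K α β r) p.2)}

variable [T2Space M] {Φ : ℝ → M → M} {K : Set M} {α β : M → ℝ} {r c k : ℝ} {n₀ : ℕ}

/-- Points of the section `α = β` with `0 < β < r`. -/
def sectionPart (K : Set M) (α β : M → ℝ) (r : ℝ) : Set M :=
  {x ∈ K | α x = β x ∧ 0 < β x ∧ β x < r}

theorem modelLayer_subset {n : ℕ} (hn : n₀ ≤ n) (hr : Real.exp (-(n₀ : ℝ)) ≤ r) :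
    modelLayer K α β n ⊆ sectionPart K α β r :=
  fun _ hx => ⟨hx.1, hx.2.1, modelLayer_pos hx, modelLayer_lt hn hr hx⟩

theorem SaddleBox.sign (h : SaddleBox Φ K α β r c k) {p : ℝ × M}
    (hp : p ∈ orbitDomain Φ K α β r (sectionPart K α β r)) :
    Φ p.1 p.2 ∈ K ∧ (0 < p.1 → α (Φ p.1 p.2) < β (Φ p.1 p.2)) ∧
      (p.1 < 0 → β (Φ p.1 p.2) < α (Φ p.1 p.2)) := by
  obtain ⟨⟨hK, he, h0, hr⟩, ht⟩ := hp
  have hf := (h.fwd.stays_iff h.isFlow hK he h0 hr).1 ht.2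
  have hb := (h.bwd.stays_iff h.isFlow.rev hK he.symm (he ▸ h0) (he ▸ hr)).1
    (neg_le.1 ht.1)
  refine ⟨?_, fun hpos => h.fwd.lt _ hK he h0 _ hpos hf, fun hneg => ?_⟩
  · rcases le_total 0 p.1 with h1 | h1
    · exact hf _ ⟨h1, le_rfl⟩
    · simpa using hb (-p.1) ⟨by linarith, le_rfl⟩
  · simpa using h.bwd.lt _ hK he.symm (he ▸ h0) (-p.1) (by linarith) hb

/-- Two representations of one point would place two section points on one orbit segment in the box.
But $\alpha<\beta$ strictly after the section and $\beta<\alpha$ strictly before it. -/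
theorem SaddleBox.injOn (h : SaddleBox Φ K α β r c k) :
    InjOn (fun p : ℝ × M => Φ p.1 p.2) (orbitDomain Φ K α β r (sectionPart K α β r)) := by
  have key : ∀ p q : ℝ × M, p ∈ orbitDomain Φ K α β r (sectionPart K α β r) →
      q ∈ orbitDomain Φ K α β r (sectionPart K α β r) → Φ p.1 p.2 = Φ q.1 q.2 → q.1 ≤ p.1 →
      p = q := by
    rintro ⟨t, x⟩ ⟨s, y⟩ hp hq heq hst
    simp only at heq hst
    have hxy : Φ (t - s) x = y := by
      have : Φ (-s) (Φ t x) = Φ (-s) (Φ s y) := by rw [heq]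
      rw [← h.isFlow.add, ← h.isFlow.add, neg_add_cancel, h.isFlow.zero] at this
      rw [← this]; congr 1; ring
    rcases hst.eq_or_lt with he | hlt
    · subst he
      rw [sub_self, h.isFlow.zero] at hxy
      rw [hxy]
    · exfalso
      have hsp := h.sign hp
      have hsq := h.sign hq
      change s < t at hlt
      obtain ⟨⟨hxK, hxe, hx0, hxr⟩, ht⟩ := hp
      obtain ⟨⟨hyK, hye, hy0, hyr⟩, hs⟩ := hq
      rcases le_or_gt 0 s with h0 | h0
      · have hf := (h.fwd.stays_iff h.isFlow hxK hxe hx0 hxr).1 ht.2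
        have := h.fwd.lt _ hxK hxe hx0 (t - s) (by linarith)
          fun u hu => hf u ⟨hu.1, by linarith [hu.2]⟩
        rw [hxy, hye] at this
        exact lt_irrefl _ this
      · rcases le_or_gt t 0 with h1 | h1
        · have hyx : Φ (-(t - s)) y = x := by
            rw [← hxy, ← h.isFlow.add, neg_add_cancel, h.isFlow.zero]
          have hb := (h.bwd.stays_iff h.isFlow.rev hyK hye.symm (hye ▸ hy0) (hye ▸ hyr)).1
            (neg_le.1 hs.1)
          have := h.bwd.lt _ hyK hye.symm (hye ▸ hy0) (t - s) (by linarith)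
            fun u hu => hb u ⟨hu.1, by linarith [hu.2]⟩
          rw [hyx, hxe] at this
          exact lt_irrefl _ this
        · have a1 := hsp.2.1 h1
          have a2 := hsq.2.2 h0
          rw [heq] at a1
          exact lt_irrefl _ (a1.trans a2)
  intro p hp q hq heq
  change Φ p.1 p.2 = Φ q.1 q.2 at heq
  rcases le_total q.1 p.1 with h1 | h1
  · exact key p q hp hq heq h1
  · exact (key q p hq hp heq.symm h1).symm

end Saddle

/-! ### Measurability of orbit tubes and the tower estimate -/

section Measurable

variable {M : Type*} [TopologicalSpace M] [PolishSpace M] [MeasurableSpace M] [BorelSpace M]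
  {Φ : ℝ → M → M} {K : Set M} {α β : M → ℝ} {r c k : ℝ} {n₀ : ℕ}

theorem measurableSet_of_continuousOn_pair (hK : IsClosed K) (hα : ContinuousOn α K)
    (hβ : ContinuousOn β K) {V : Set (ℝ × ℝ)} (hV : MeasurableSet V) :
    MeasurableSet {x ∈ K | (α x, β x) ∈ V} := by
  have h : {x ∈ K | (α x, β x) ∈ V} =
      Subtype.val '' ((fun x : K => (α x, β x)) ⁻¹' V) := by
    ext x
    simp only [mem_ofPred_eq, mem_image, mem_preimage, Subtype.exists, exists_and_right,
      exists_eq_right, exists_prop]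
  rw [h]
  refine hK.measurableSet.subtype_image ?_
  have : Continuous fun x : K => (α x, β x) :=
    (continuousOn_iff_continuous_domRestrict.1 hα).prodMk (continuousOn_iff_continuous_domRestrict.1 hβ)
  exact this.measurable hV

theorem ExitBox.measurableSet_layer (h : ExitBox Φ K α β r c k) (n : ℕ) :
    MeasurableSet (modelLayer K α β n) := by
  refine measurableSet_of_continuousOn_pair (V := {p | p.1 = p.2 ∧
    Real.exp (-((n : ℝ) + 1)) ≤ p.2 ∧ p.2 < Real.exp (-(n : ℝ))}) h.isCompact.isClosed
    h.contα h.contβ ?_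
  exact (measurableSet_eq_fun measurable_fst measurable_snd).inter
    ((measurableSet_le measurable_const measurable_snd).inter
      (measurableSet_lt measurable_snd measurable_const))

theorem IsFlow.measurableSet_stays (hΦ : IsFlow Φ) (hK : IsClosed K) :
    MeasurableSet {p : ℝ × M | ∀ u ∈ Icc 0 p.1, Φ u p.2 ∈ K} := by
  -- Rescaling the time interval $[0,t]$ to $[0,1]$ turns the condition, for $t\ge0$, into an
  -- intersection of closed sets.
  have h : {p : ℝ × M | ∀ u ∈ Icc 0 p.1, Φ u p.2 ∈ K} =
      {p | p.1 < 0} ∪ ⋂ u ∈ Icc (0 : ℝ) 1, {p | Φ (u * p.1) p.2 ∈ K} := by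
    ext p
    simp only [mem_ofPred_eq, mem_union, mem_iInter]
    constructor
    · intro hp
      rcases lt_or_ge p.1 0 with h0 | h0
      · exact Or.inl h0
      · exact Or.inr fun u hu => hp _ ⟨mul_nonneg hu.1 h0, mul_le_of_le_one_left h0 hu.2⟩
    · rintro (h0 | hp) u hu
      · exact absurd (hu.1.trans hu.2) (not_le.2 h0)
      · rcases (hu.1.trans hu.2).eq_or_lt with h1 | h1
        · have := hp 0 ⟨le_rfl, zero_le_one⟩
          rwa [zero_mul, show (0 : ℝ) = u from le_antisymm hu.1 (h1 ▸ hu.2)] at this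
        · have := hp (u / p.1) ⟨div_nonneg hu.1 h1.le, (div_le_one h1).2 hu.2⟩
          rwa [div_mul_cancel₀ _ h1.ne'] at this
  rw [h]
  refine (measurableSet_lt measurable_fst measurable_const).union (IsClosed.measurableSet ?_)
  refine isClosed_biInter fun u _ => ?_
  exact hK.preimage (hΦ.cont.comp (f := fun p : ℝ × M => (u * p.1, p.2)) (by fun_prop))

theorem SaddleBox.measurableSet_domain (h : SaddleBox Φ K α β r c k) {D : Set M}
    (hD : MeasurableSet D) (hDs : D ⊆ sectionPart K α β r) :
    MeasurableSet (orbitDomain Φ K α β r D) := by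
  have hKc := h.fwd.isCompact.isClosed
  have he : orbitDomain Φ K α β r D = (Prod.snd ⁻¹' D) ∩
      ({p | ∀ u ∈ Icc 0 p.1, Φ u p.2 ∈ K} ∩
        (fun p : ℝ × M => (-p.1, p.2)) ⁻¹' {p | ∀ u ∈ Icc 0 p.1, Φ (-u) p.2 ∈ K}) := by
    ext p
    simp only [orbitDomain, mem_inter_iff, mem_preimage, mem_ofPred_eq, mem_Icc (b := exitTime _ _ _)]
    refine and_congr_right fun hp => ?_
    obtain ⟨hK, he, h0, hr⟩ := hDs hp
    rw [h.fwd.stays_iff h.isFlow hK he h0 hr, neg_le,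
      h.bwd.stays_iff h.isFlow.rev hK he.symm (he ▸ h0) (he ▸ hr), and_comm]
  rw [he]
  refine (measurable_snd hD).inter ((h.isFlow.measurableSet_stays hKc).inter ?_)
  have hm : Measurable fun p : ℝ × M => (-p.1, p.2) := by fun_prop
  exact hm (h.isFlow.rev.measurableSet_stays hKc)

/-- Lusin–Souslin: a Borel set has a Borel image under an injective continuous map between Polish
spaces. -/
theorem SaddleBox.measurableSet_image (h : SaddleBox Φ K α β r c k) {E : Set (ℝ × M)}
    (hE : MeasurableSet E) (hEs : E ⊆ orbitDomain Φ K α β r (sectionPart K α β r)) :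
    MeasurableSet ((fun p : ℝ × M => Φ p.1 p.2) '' E) :=
  hE.image_of_continuousOn_injOn h.isFlow.cont.continuousOn (h.injOn.mono hEs)

theorem orbitDomain_mono {D D' : Set M} (h : D ⊆ D') :
    orbitDomain Φ K α β r D ⊆ orbitDomain Φ K α β r D' := fun _ hp => ⟨h hp.1, hp.2⟩

/-- The orbit segments through `D` in the box. -/
def orbitTube (Φ : ℝ → M → M) (K : Set M) (α β : M → ℝ) (r : ℝ) (D : Set M) : Set M :=
  (fun p : ℝ × M => Φ p.1 p.2) '' orbitDomain Φ K α β r D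

/-- Flow lines through `D` during the time interval `[a, b)`. -/
def flowSlab (Φ : ℝ → M → M) (a b : ℝ) (D : Set M) : Set M :=
  (fun p : ℝ × M => Φ p.1 p.2) '' (Ico a b ×ˢ D)

theorem SaddleBox.slab_subset (h : SaddleBox Φ K α β r c k) {D : Set M}
    (hDs : D ⊆ sectionPart K α β r) {a b : ℝ} (ha : 0 ≤ a)
    (hb : ∀ x ∈ D, b ≤ exitTime Φ (innerBox K α β r) x) :
    Ico a b ×ˢ D ⊆ orbitDomain Φ K α β r D := by
  rintro ⟨t, x⟩ ⟨ht, hx⟩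
  obtain ⟨hK, he, h0, hr⟩ := hDs hx
  have := (h.bwd.exitTime_spec h.isFlow.rev hK he.symm (he ▸ h0) (he ▸ hr)).1
  exact ⟨hx, by have := ht.1; simp only at *; linarith, ht.2.le.trans (hb x hx)⟩

theorem SaddleBox.measurableSet_slab (h : SaddleBox Φ K α β r c k) {D : Set M}
    (hD : MeasurableSet D) (hDs : D ⊆ sectionPart K α β r) {a b : ℝ} (ha : 0 ≤ a)
    (hb : ∀ x ∈ D, b ≤ exitTime Φ (innerBox K α β r) x) : MeasurableSet (flowSlab Φ a b D) :=
  h.measurableSet_image (measurableSet_Ico.prod hD)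
    ((h.slab_subset hDs ha hb).trans (orbitDomain_mono hDs))

theorem SaddleBox.slab_subset_le (h : SaddleBox Φ K α β r c k) {D : Set M}
    (hDs : D ⊆ sectionPart K α β r) {a b : ℝ} (ha : 0 ≤ a)
    (hb : ∀ x ∈ D, b ≤ exitTime Φ (innerBox K α β r) x) {y : M} (hy : y ∈ flowSlab Φ a b D) :
    y ∈ K ∧ α y ≤ β y := by
  obtain ⟨⟨t, x⟩, ⟨ht, hx⟩, rfl⟩ := hy
  have hp := orbitDomain_mono hDs (h.slab_subset hDs ha hb ⟨ht, hx⟩)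
  obtain ⟨h1, h2, -⟩ := h.sign hp
  refine ⟨h1, ?_⟩
  rcases (ha.trans ht.1).eq_or_lt with h0 | h0
  · simp only at h0
    simp only [← h0, h.isFlow.zero]
    exact (hDs hx).2.1.le
  · exact (h2 h0).le

theorem SaddleBox.disjoint_slab (h : SaddleBox Φ K α β r c k) {D D' : Set M}
    (hDs : D ⊆ sectionPart K α β r) (hDs' : D' ⊆ sectionPart K α β r) {a b a' b' : ℝ}
    (ha : 0 ≤ a) (ha' : 0 ≤ a')
    (hb : ∀ x ∈ D, b ≤ exitTime Φ (innerBox K α β r) x)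
    (hb' : ∀ x ∈ D', b' ≤ exitTime Φ (innerBox K α β r) x)
    (hdisj : Disjoint (Ico a b) (Ico a' b') ∨ Disjoint D D') :
    Disjoint (flowSlab Φ a b D) (flowSlab Φ a' b' D') := by
  rw [disjoint_left]
  rintro _ ⟨p, hp, rfl⟩ ⟨q, hq, he⟩
  have := h.injOn (orbitDomain_mono hDs' (h.slab_subset hDs' ha' hb' hq))
    (orbitDomain_mono hDs (h.slab_subset hDs ha hb hp)) he
  subst this
  rcases hdisj with hd | hd
  · exact disjoint_left.1 hd hp.1 hq.1
  · exact disjoint_left.1 hd hp.2 hq.2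

/-- The slab over `D m` is flowed forward by the times $j<w(m)$. The exit time bound keeps all these
slabs in the tube, injectivity of the flow makes them disjoint, and invariance gives them equal
measure. -/
theorem SaddleBox.tower (h : SaddleBox Φ K α β r c k) {μ : Measure M}
    (hμ : ∀ t, MeasurePreserving (Φ t) μ μ) {J : Set ℕ} {D : ℕ → Set M} {w : ℕ → ℕ}
    (hD : ∀ m ∈ J, MeasurableSet (D m)) (hDs : ∀ m ∈ J, D m ⊆ sectionPart K α β r)
    (hdisj : ∀ m ∈ J, ∀ n ∈ J, m ≠ n → Disjoint (D m) (D n))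
    (hw : ∀ m ∈ J, ∀ x ∈ D m, (w m : ℝ) ≤ exitTime Φ (innerBox K α β r) x) {O : Set M}
    (hO : ∀ m ∈ J, orbitTube Φ K α β r (D m) ⊆ O) :
    ∑' m : J, (w m : ℝ≥0∞) * μ (flowSlab Φ 0 1 (D m)) ≤ μ O := by
  set T : (Σ m : J, Fin (w m)) → Set M := fun q =>
    flowSlab Φ ((q.2 : ℕ) : ℝ) ((q.2 : ℕ) + 1) (D q.1) with hT
  have hb : ∀ q : Σ m : J, Fin (w m), ∀ x ∈ D q.1,
      (((q.2 : ℕ) : ℝ) + 1) ≤ exitTime Φ (innerBox K α β r) x := by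
    rintro ⟨⟨m, hm⟩, j⟩ x hx
    refine le_trans ?_ (hw m hm x hx)
    have : ((j : ℕ) + 1 : ℕ) ≤ w m := j.2
    exact_mod_cast this
  have hTm : ∀ q, MeasurableSet (T q) := fun q =>
    h.measurableSet_slab (hD _ q.1.2) (hDs _ q.1.2) (by positivity) (hb q)
  have hTd : Pairwise (Function.onFun Disjoint T) := by
    rintro ⟨m, i⟩ ⟨n, j⟩ hne
    refine h.disjoint_slab (hDs _ m.2) (hDs _ n.2) (by positivity) (by positivity)
      (hb ⟨m, i⟩) (hb ⟨n, j⟩) ?_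
    by_cases hmn : m = n
    · subst hmn
      left
      have hij : (i : ℕ) ≠ j := fun he => hne (by rw [Fin.ext he])
      rw [disjoint_left]
      rintro t ⟨h1, h2⟩ ⟨h3, h4⟩
      simp only at h1 h2 h3 h4
      have a1 : ((i : ℕ) : ℝ) < (j : ℕ) + 1 := h1.trans_lt h4
      have a2 : ((j : ℕ) : ℝ) < (i : ℕ) + 1 := h3.trans_lt h2
      norm_cast at a1 a2
      omega
    · right
      exact hdisj _ m.2 _ n.2 fun he => hmn (Subtype.ext he)
  have hTμ : ∀ q, μ (T q) = μ (flowSlab Φ 0 1 (D q.1)) := by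
    rintro ⟨⟨m, hm⟩, j⟩
    have hinv : T ⟨⟨m, hm⟩, j⟩ = Φ (-((j : ℕ) : ℝ)) ⁻¹' flowSlab Φ 0 1 (D m) := by
      ext y
      constructor
      · rintro ⟨⟨t, x⟩, ⟨ht, hx⟩, rfl⟩
        refine ⟨(-((j : ℕ) : ℝ) + t, x), ⟨⟨?_, ?_⟩, hx⟩, ?_⟩
        · have := ht.1; simp only at *; linarith
        · have := ht.2; simp only at *; linarith
        · exact h.isFlow.add _ _ _
      · rintro ⟨⟨t, x⟩, ⟨ht, hx⟩, he⟩
        refine ⟨(((j : ℕ) : ℝ) + t, x), ⟨⟨?_, ?_⟩, hx⟩, ?_⟩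
        · have := ht.1; simp only at *; linarith
        · have := ht.2; simp only at *; linarith
        · simp only at he ⊢
          rw [h.isFlow.add, he, ← h.isFlow.add, add_neg_cancel, h.isFlow.zero]
    rw [hinv]
    refine (hμ _).measure_preimage (MeasurableSet.nullMeasurableSet ?_)
    have : (1 : ℝ) ≤ w m := by
      have : 1 ≤ w m := (Nat.zero_le _).trans_lt j.2
      exact_mod_cast this
    exact h.measurableSet_slab (hD m hm) (hDs m hm) le_rfl fun x hx => this.trans (hw m hm x hx)
  calc ∑' m : J, (w m : ℝ≥0∞) * μ (flowSlab Φ 0 1 (D m))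
      = ∑' q, μ (T q) := by
        rw [ENNReal.tsum_sigma']
        refine tsum_congr fun m => ?_
        rw [tsum_fintype]
        simp [hTμ]
    _ = μ (⋃ q, T q) := (measure_iUnion hTd hTm).symm
    _ ≤ μ O := by
        refine measure_mono (iUnion_subset fun q => ?_)
        exact (image_mono (h.slab_subset (hDs _ q.1.2) (by positivity) (hb q))).trans
          (hO _ q.1.2)

end Measurable

/-! ### Boxes modelled on a hyperbolic linear map -/

section LinearBox

variable {d : ℕ} {A : EuclideanSpace ℝ (Fin d) →L[ℝ] EuclideanSpace ℝ (Fin d)}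
  {q : Seminorm ℝ (EuclideanSpace ℝ (Fin d))} {lam K κ : ℝ}
  {Ps Pu : EuclideanSpace ℝ (Fin d) →L[ℝ] EuclideanSpace ℝ (Fin d)}

theorem unstableSpace_neg (A : EuclideanSpace ℝ (Fin d) →L[ℝ] EuclideanSpace ℝ (Fin d)) :
    unstableSpace (-A) = stableSpace A := by
  simp [unstableSpace]

theorem exp_exp_neg (A : EuclideanSpace ℝ (Fin d) →L[ℝ] EuclideanSpace ℝ (Fin d))
    (t : ℝ) (v : EuclideanSpace ℝ (Fin d)) :
    NormedSpace.exp (t • A) (NormedSpace.exp (-t • A) v) = v := by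
  simpa using exp_neg_exp A (-t) v

/-- Time reversal exchanges the roles of the two spaces, so backward exit boxes follow from forward
ones. -/
theorem IsSplitting.neg (h : IsSplitting A q lam K κ Ps Pu) :
    IsSplitting (-A) q lam K κ Pu Ps where
  add v := by rw [add_comm]; exact h.add v
  mem_s v := h.mem_u v
  mem_u v := by rw [unstableSpace_neg]; exact h.mem_s v
  proj_s a ha b hb := by
    rw [unstableSpace_neg] at hb
    rw [add_comm]; exact h.proj_u b hb a ha
  proj_u a ha b hb := by
    rw [unstableSpace_neg] at hb
    rw [add_comm]; exact h.proj_s b hb a ha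
  comm_s v := by
    show Pu (-(A v)) = -(A (Pu v))
    rw [map_neg, h.comm_u]
  comm_u v := by
    show Ps (-(A v)) = -(A (Ps v))
    rw [map_neg, h.comm_s]
  bound_s := h.bound_u
  bound_u := h.bound_s
  bound v := by
    show q (-(A v)) ≤ _
    rw [map_neg_eq_map]; exact h.bound v
  cont := h.cont
  contract b hb t ht := by
    have h1 := h.expand _ (exp_smul_mem_unstable (A := A) hb (-t)) t ht
    rw [exp_exp_neg] at h1
    rw [show t • -A = -t • A from (smul_neg t A).trans (neg_smul t A).symm]
    rw [neg_mul, Real.exp_neg, ← div_eq_inv_mul, le_div_iff₀ (Real.exp_pos _)]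
    linarith
  expand a ha t ht := by
    rw [unstableSpace_neg] at ha
    have h1 := h.contract _ (exp_smul_mem_stable (A := A) ha (-t)) t ht
    rw [exp_exp_neg, neg_mul, Real.exp_neg, ← div_eq_inv_mul, le_div_iff₀ (Real.exp_pos _)] at h1
    rw [show t • -A = -t • A from (smul_neg t A).trans (neg_smul t A).symm]
    linarith

/-- The vectors both of whose components have norm at most `r`. -/
def splitBox (q : Seminorm ℝ (EuclideanSpace ℝ (Fin d)))
    (Ps Pu : EuclideanSpace ℝ (Fin d) →L[ℝ] EuclideanSpace ℝ (Fin d)) (r : ℝ) :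
    Set (EuclideanSpace ℝ (Fin d)) := {v | q (Ps v) ≤ r ∧ q (Pu v) ≤ r}

theorem splitBox_comm (r : ℝ) : splitBox q Ps Pu r = splitBox q Pu Ps r := by
  ext v; exact and_comm

theorem IsSplitting.le_of_mem_box (h : IsSplitting A q lam K κ Ps Pu) {r : ℝ}
    {v : EuclideanSpace ℝ (Fin d)} (hv : v ∈ splitBox q Ps Pu r) : q v ≤ 2 * r := by
  have h1 : q v ≤ q (Ps v) + q (Pu v) := by
    conv_lhs => rw [← h.add v]
    exact map_add_le_add q _ _
  linarith [hv.1, hv.2]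

theorem IsSplitting.isCompact_box (h : IsSplitting A q lam K κ Ps Pu) {N : ℝ} (hN : 0 ≤ N)
    (hqn : ∀ v, ‖v‖ ≤ N * q v) (r : ℝ) : IsCompact (splitBox q Ps Pu r) := by
  refine Metric.isCompact_of_isClosed_isBounded ?_ ?_
  · exact (isClosed_le (h.cont.comp Ps.continuous) continuous_const).inter
      (isClosed_le (h.cont.comp Pu.continuous) continuous_const)
  · refine (Metric.isBounded_closedBall (x := (0 : EuclideanSpace ℝ (Fin d)))
      (r := N * (2 * r))).subset fun v hv => ?_
    rw [mem_closedBall_zero_iff]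
    exact (hqn v).trans (mul_le_mul_of_nonneg_left (h.le_of_mem_box hv) hN)

variable {M : Type*} [TopologicalSpace M]

/-- An exit box modelled on a hyperbolic linear map. -/
theorem IsSplitting.exitBox (h : IsSplitting A q lam K κ Ps Pu) {N : ℝ} (hN : 0 ≤ N)
    (hqn : ∀ v, ‖v‖ ≤ N * q v) (hlam : 0 < lam) (hK : 0 ≤ K) (hκ : 0 ≤ κ) {ε : ℝ} (hε0 : 0 ≤ ε)
    (hε : 4 * (κ * ε) ≤ lam) {Φ : ℝ → M → M} (hΦ : IsFlow Φ)
    (e : OpenPartialHomeomorph (EuclideanSpace ℝ (Fin d)) M) {r : ℝ}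
    (he0 : 0 ∈ e.source) (hσ : ∀ t, Φ t (e 0) = e 0)
    (hder : ∀ x ∈ e.target, x ≠ e 0 → ∀ᶠ s in 𝓝[>] (0 : ℝ),
      q (e.symm (Φ s x) - e.symm x - s • A (e.symm x)) ≤ ε * s * q (e.symm x))
    (hsub : splitBox q Ps Pu r ⊆ e.source) :
    ExitBox Φ (e '' splitBox q Ps Pu r) (fun x => q (Ps (e.symm x))) (fun x => q (Pu (e.symm x)))
      r (lam / 2) (K + lam) := by
  have hq0 : ∀ v, q v = 0 → v = 0 := fun v hv => by
    have := hqn v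
    rw [hv, mul_zero] at this
    exact norm_le_zero_iff.1 this
  have hKt : e '' splitBox q Ps Pu r ⊆ e.target := by
    rintro _ ⟨v, hv, rfl⟩
    exact e.map_source (hsub hv)
  have hmem : ∀ x ∈ e '' splitBox q Ps Pu r, e.symm x ∈ splitBox q Ps Pu r := by
    rintro _ ⟨v, hv, rfl⟩
    rwa [e.left_inv (hsub hv)]
  have hcone : ∀ x ∈ e '' splitBox q Ps Pu r, 0 < q (Pu (e.symm x)) → ∀ T, 0 ≤ T →
      (∀ s ∈ Icc 0 T, Φ s x ∈ e '' splitBox q Ps Pu r) →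
      ConeCurve lam K (κ * ε) T (fun t => q (Ps (e.symm (Φ t x))))
        (fun t => q (Pu (e.symm (Φ t x)))) := by
    intro x hx h0 T hT hK
    -- A positive unstable coordinate excludes the singularity, and the fixed point property then
    -- excludes it along the whole orbit.
    have hxσ : x ≠ e 0 := by
      rintro rfl
      rw [e.left_inv he0] at h0
      simp at h0
    have hflow : ∀ t, Φ t x ≠ e 0 := by
      intro t ht
      apply hxσ
      have := hσ (-t)
      rw [← ht, ← hΦ.add, neg_add_cancel, hΦ.zero] at this
      rw [this, ht]
    refine h.coneCurve (v := fun t => e.symm (Φ t x)) hq0 hκ hε0 ?_ ?_ ?_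
    · exact e.continuousOn_symm.comp (hΦ.cont_time x).continuousOn fun t ht => hKt (hK t ht)
    · intro t ht h1
      apply hflow t
      rw [← e.right_inv (hKt (hK t ht))]
      exact congrArg e h1
    · intro t ht
      have := hder (Φ t x) (hKt (hK t ⟨ht.1, ht.2.le⟩)) (hflow t)
      filter_upwards [this] with s hs
      rwa [← hΦ.add, add_comm s t] at hs
  have hε0' : 0 ≤ κ * ε := mul_nonneg hκ hε0
  refine ⟨(h.isCompact_box hN hqn r).image_of_continuousOn (e.continuousOn.mono hsub),
    (h.cont.comp Ps.continuous).comp_continuousOn (e.continuousOn_symm.mono hKt),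
    (h.cont.comp Pu.continuous).comp_continuousOn (e.continuousOn_symm.mono hKt),
    fun x _ => apply_nonneg q _, fun x hx => (hmem x hx).1, fun x hx => (hmem x hx).2,
    by linarith, by linarith, ?_, ?_, ?_, ?_⟩
  · have h1 : innerBox (e '' splitBox q Ps Pu r) (fun x => q (Ps (e.symm x)))
        (fun x => q (Pu (e.symm x))) r = e '' {v | q (Ps v) < r ∧ q (Pu v) < r} := by
      ext x
      constructor
      · rintro ⟨⟨v, hv, rfl⟩, h2, h3⟩
        simp only [e.left_inv (hsub hv)] at h2 h3
        exact ⟨v, ⟨h2, h3⟩, rfl⟩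
      · rintro ⟨v, ⟨h2, h3⟩, rfl⟩
        have hv : v ∈ splitBox q Ps Pu r := ⟨h2.le, h3.le⟩
        refine ⟨⟨v, hv, rfl⟩, ?_, ?_⟩ <;> simp only [e.left_inv (hsub hv)] <;> assumption
    rw [h1]
    refine e.isOpen_image_of_subset_source ?_ fun v hv => hsub ⟨hv.1.le, hv.2.le⟩
    exact (isOpen_lt (h.cont.comp Ps.continuous) continuous_const).inter
      (isOpen_lt (h.cont.comp Pu.continuous) continuous_const)
  · intro x hx hxe h0 t ht hKt
    exact (hcone x hx h0 t ht.le hKt).lt hε0' hε hlam (by simpa [hΦ.zero] using hxe) ht le_rfl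
  · intro x hx hxe h0 s t hs hst hKt
    exact (hcone x hx h0 t (hs.trans hst) hKt).growth_lower hε0' hε hlam
      (by simpa [hΦ.zero] using hxe) hs hst le_rfl
  · intro x hx hxe h0 t ht hKt
    have := (hcone x hx h0 t ht hKt).growth_upper hε0' hε hlam
      (by simpa [hΦ.zero] using hxe) ⟨ht, le_rfl⟩
    simpa [hΦ.zero] using this

/-- A small perturbation of an orbit of a vector field that is almost linear is an almost linear
orbit. -/
theorem eventually_quasiOrbit {E : Type*} [NormedAddCommGroup E] [NormedSpace ℝ E] {A : E →L[ℝ] E}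
    {z w : ℝ → E} {z₀ D : E} {η a : ℝ} (hη : 0 < η) (hη1 : η ≤ 1 / 8) (ha : ‖A‖ ≤ a)
    (hz : HasDerivAt z D 0) (hD : ‖D - A (z 0 - z₀)‖ ≤ η * ‖z 0 - z₀‖)
    (hw0 : w 0 ≠ 0) (hzw : ‖z 0 - z₀ - w 0‖ ≤ η * ‖w 0‖)
    (hev : ∀ᶠ h in 𝓝[>] (0 : ℝ), ‖z h - z 0 - (w h - w 0)‖ ≤ η * ‖w h - w 0‖) :
    ∀ᶠ h in 𝓝[>] (0 : ℝ), ‖w h - w 0 - h • A (w 0)‖ ≤ η * (5 * a + 8) * h * ‖w 0‖ := by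
  have hwp : 0 < ‖w 0‖ := norm_pos_iff.2 hw0
  have ha0 : 0 ≤ a := (norm_nonneg _).trans ha
  have h1 : ∀ᶠ h in 𝓝[>] (0 : ℝ), ‖z h - z 0 - h • D‖ ≤ η * ‖w 0‖ * h := by
    have h2 := (hasDerivAt_iff_isLittleO.1 hz).def (c := η * ‖w 0‖) (by positivity)
    filter_upwards [nhdsWithin_le_nhds h2, self_mem_nhdsWithin] with h h3 h4
    simpa [abs_of_pos (show (0 : ℝ) < h from h4)] using h3
  have hzn : ‖z 0 - z₀‖ ≤ (1 + η) * ‖w 0‖ := by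
    have := norm_add_le (z 0 - z₀ - w 0) (w 0)
    rw [sub_add_cancel] at this
    linarith
  have hDn : ‖D - A (w 0)‖ ≤ (η * (1 + η) + a * η) * ‖w 0‖ := by
    have e1 : D - A (w 0) = (D - A (z 0 - z₀)) + A (z 0 - z₀ - w 0) := by
      rw [map_sub A (z 0 - z₀)]; abel
    rw [e1]
    refine (norm_add_le _ _).trans ?_
    have e2 : ‖A (z 0 - z₀ - w 0)‖ ≤ a * (η * ‖w 0‖) :=
      (A.le_opNorm _).trans (mul_le_mul ha hzw (norm_nonneg _) ha0)
    have e3 := mul_le_mul_of_nonneg_left hzn hη.le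
    linarith
  have hDw : ‖D‖ ≤ (a + η * (1 + η) + a * η) * ‖w 0‖ := by
    have e1 := norm_add_le (D - A (w 0)) (A (w 0))
    rw [sub_add_cancel] at e1
    have e2 : ‖A (w 0)‖ ≤ a * ‖w 0‖ :=
      (A.le_opNorm _).trans (mul_le_mul_of_nonneg_right ha (norm_nonneg _))
    linarith
  filter_upwards [h1, hev, self_mem_nhdsWithin] with h h2 h3 h4
  have hh : (0 : ℝ) < h := h4
  have e1 : ‖z h - z 0‖ ≤ h * ‖D‖ + η * ‖w 0‖ * h := by
    have := norm_add_le (z h - z 0 - h • D) (h • D)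
    rw [sub_add_cancel, norm_smul, Real.norm_eq_abs, abs_of_pos hh] at this
    linarith
  have e2 : ‖w h - w 0‖ ≤ 2 * ‖z h - z 0‖ := by
    have := norm_sub_le (z h - z 0) (z h - z 0 - (w h - w 0))
    rw [sub_sub_cancel] at this
    nlinarith [norm_nonneg (w h - w 0)]
  have e3 : w h - w 0 - h • A (w 0) = -(z h - z 0 - (w h - w 0)) + (z h - z 0 - h • D)
      + h • (D - A (w 0)) := by
    rw [smul_sub]; abel
  rw [e3]
  refine (norm_add_le _ _).trans ((add_le_add_left (norm_add_le _ _) _).trans ?_)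
  rw [norm_neg, norm_smul, Real.norm_eq_abs, abs_of_pos hh]
  have f1 := mul_le_mul_of_nonneg_left (e2.trans (mul_le_mul_of_nonneg_left e1 zero_le_two)) hη.le
  have f2 := mul_le_mul_of_nonneg_left hDn hh.le
  have f3 := mul_le_mul_of_nonneg_left hDw (mul_nonneg hη.le hh.le)
  have f4 : 0 ≤ h * ‖w 0‖ := by positivity
  -- All error terms collected; the assumption $\eta\le1/8$ bounds their sum by the round constant
  -- $5a+8$.
  have f5 : η * (2 * (a + η * (1 + η) + a * η) + 2 * η + 1 + (1 + η) + a) ≤ η * (5 * a + 8) := by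
    refine mul_le_mul_of_nonneg_left ?_ hη.le
    nlinarith
  have f6 := mul_le_mul_of_nonneg_right f5 f4
  nlinarith

end LinearBox

/-! ### The exponential map as a coordinate system -/

section ExpChart

variable {d : ℕ} {M : Type*} [EMetricSpace M] [ChartedSpace (EuclideanSpace ℝ (Fin d)) M]
  [IsManifold (𝓡 d) ∞ M]

/-- The differential of a chart as a linear equivalence. -/
def chartEquiv {x₀ x : M} (hx : x ∈ (extChartAt (𝓡 d) x₀).source) :
    EuclideanSpace ℝ (Fin d) ≃L[ℝ] EuclideanSpace ℝ (Fin d) :=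
  ContinuousLinearEquiv.equivOfInverse (chartFwd d x₀ x) (chartBwd d x₀ (extChartAt (𝓡 d) x₀ x))
    (chartBwd_chartFwd hx) fun v => by
      have := chartFwd_chartBwd ((extChartAt (𝓡 d) x₀).map_source hx) v
      rwa [(extChartAt (𝓡 d) x₀).left_inv hx] at this

/-- The derivative of a vector field at a singularity does not depend on the chart, up to
conjugation. -/
theorem chartFwd_linearPart (Y : VField d M) {x₀ σ : M} (hσ : σ ∈ (extChartAt (𝓡 d) x₀).source)
    (hs : σ ∈ sing Y) (v : EuclideanSpace ℝ (Fin d)) :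
    chartFwd d x₀ σ (linearPart Y σ v) =
      fderiv ℝ (inChart Y x₀) (extChartAt (𝓡 d) x₀ σ) (chartFwd d x₀ σ v) := by
  set z := extChartAt (𝓡 d) σ σ with hz
  have hzs : (extChartAt (𝓡 d) σ).symm z = σ := extChartAt_to_inv σ
  have hzo : z ∈ chartOverlap d σ x₀ := by
    refine ⟨mem_extChartAt_target σ, ?_⟩
    rw [mem_preimage, hzs]; exact hσ
  have hψz : chartChange d σ x₀ z = extChartAt (𝓡 d) x₀ σ := by
    show extChartAt (𝓡 d) x₀ ((extChartAt (𝓡 d) σ).symm z) = _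
    rw [hzs]
  have hF : HasFDerivAt (inChart Y σ) (linearPart Y σ) z := by
    refine DifferentiableAt.hasFDerivAt ?_
    exact ((contDiffOn_inChart Y σ).differentiableOn one_ne_zero).differentiableAt
      ((isOpen_extChartAt_target σ).mem_nhds (mem_extChartAt_target σ))
  have hF0 : HasFDerivAt (inChart Y x₀) (fderiv ℝ (inChart Y x₀) (extChartAt (𝓡 d) x₀ σ))
      (chartChange d σ x₀ z) := by
    rw [hψz]
    refine DifferentiableAt.hasFDerivAt ?_
    exact ((contDiffOn_inChart Y x₀).differentiableOn one_ne_zero).differentiableAt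
      ((isOpen_extChartAt_target x₀).mem_nhds ((extChartAt (𝓡 d) x₀).map_source hσ))
  have hψ := hasFDerivAt_chartChange hzo
  have h0 : inChart Y σ z = 0 := by
    rw [inChart_eq_zero_iff Y (mem_extChartAt_target σ), hzs]; exact hs
  have hD : ∀ v, fderiv ℝ (chartChange d σ x₀) z v = chartFwd d x₀ σ v := by
    intro v
    rw [fderiv_chartChange hzo, hzs]
    show chartFwd d x₀ σ (chartBwd d σ z v) = _
    rw [hz, chartBwd_self]
  have h1 := hF0.comp z hψ
  -- The second derivative of the coordinate change is multiplied by the field, which vanishes at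
  -- the singularity; so the linear part transforms by conjugation only.
  have h2 : HasFDerivAt (fun y => fderiv ℝ (chartChange d σ x₀) y (inChart Y σ y))
      ((fderiv ℝ (chartChange d σ x₀) z).comp (linearPart Y σ)) z := by
    have hd : HasFDerivAt (fderiv ℝ (chartChange d σ x₀))
        (fderiv ℝ (fderiv ℝ (chartChange d σ x₀)) z) z := by
      refine DifferentiableAt.hasFDerivAt ?_
      refine DifferentiableOn.differentiableAt (s := chartOverlap d σ x₀) ?_
        ((isOpen_chartOverlap σ x₀).mem_nhds hzo)
      exact ((contDiffOn_chartChange σ x₀).fderiv_of_isOpen (m := 1) (isOpen_chartOverlap σ x₀)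
        (by norm_cast)).differentiableOn one_ne_zero
    have h3 := hd.clm_apply hF
    rw [h0] at h3
    simpa using h3
  have heq : inChart Y x₀ ∘ chartChange d σ x₀ =ᶠ[𝓝 z]
      fun y => fderiv ℝ (chartChange d σ x₀) y (inChart Y σ y) := by
    filter_upwards [(isOpen_chartOverlap σ x₀).mem_nhds hzo] with y hy
    exact inChart_chartChange Y hy
  have h3 := (h2.congr_of_eventuallyEq heq).unique h1
  have h4 := DFunLike.congr_fun h3 v
  have h5 : fderiv ℝ (chartChange d σ x₀) z (linearPart Y σ v) =
    fderiv ℝ (inChart Y x₀) (extChartAt (𝓡 d) x₀ σ) (fderiv ℝ (chartChange d σ x₀) z v) := h4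
  rwa [hD, hD] at h5

variable [RiemannianBundle (fun x : M => TangentSpace (𝓡 d) x)]
  [IsContMDiffRiemannianBundle (𝓡 d) ∞ (EuclideanSpace ℝ (Fin d))
      (fun x : M => TangentSpace (𝓡 d) x)]

/-- The exponential map at points near `x₀` as a partial homeomorphism whose expression in the
chart at `x₀` is close to the identity. -/
theorem exists_expHomeo [CompactSpace M] (x₀ : M) {η : ℝ} (hη : 0 < η) (hη1 : η < 1) :
    ∃ δ₀ > 0, ∀ δ ≤ δ₀, ∀ x ∈ (extChartAt (𝓡 d) x₀).source,
      ‖extChartAt (𝓡 d) x₀ x - extChartAt (𝓡 d) x₀ x₀‖ < δ₀ →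
      ∃ e : OpenPartialHomeomorph (EuclideanSpace ℝ (Fin d)) M,
        e.source = {v | ‖chartFwd d x₀ x v‖ < δ} ∧ (∀ v ∈ e.source, e v = expMap x v) ∧
        e.target ⊆ (extChartAt (𝓡 d) x₀).source ∧
        ∀ v ∈ e.source, ∀ w ∈ e.source,
          ‖extChartAt (𝓡 d) x₀ (e v) - extChartAt (𝓡 d) x₀ (e w) -
            (chartFwd d x₀ x v - chartFwd d x₀ x w)‖ ≤
            η * ‖chartFwd d x₀ x v - chartFwd d x₀ x w‖ := by
  obtain ⟨η, rfl⟩ : ∃ η' : NNReal, (η' : ℝ) = η := ⟨⟨η, hη.le⟩, rfl⟩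
  obtain ⟨δ₀, hδ₀, H₀⟩ := expMap_near_identity (d := d) x₀ hη
  refine ⟨δ₀, hδ₀, fun δ hδδ₀ x hx hxδ => ?_⟩
  have H : ∀ v, ‖chartFwd d x₀ x v‖ < δ → expMap x v ∈ (extChartAt (𝓡 d) x₀).source ∧
      ∀ w, ‖chartFwd d x₀ x w‖ < δ →
        ‖extChartAt (𝓡 d) x₀ (expMap x v) - extChartAt (𝓡 d) x₀ (expMap x w) -
          (chartFwd d x₀ x v - chartFwd d x₀ x w)‖ ≤
          η * ‖chartFwd d x₀ x v - chartFwd d x₀ x w‖ := fun v hv =>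
    ⟨(H₀ x hx hxδ v (hv.trans_le hδδ₀)).1, fun w hw =>
      (H₀ x hx hxδ v (hv.trans_le hδδ₀)).2 w (hw.trans_le hδδ₀)⟩
  set T := chartEquiv hx with hT
  set φ := extChartAt (𝓡 d) x₀ with hφ
  have hTs : ∀ w, chartFwd d x₀ x (T.symm w) = w := fun w => T.apply_symm_apply w
  set B : Set (EuclideanSpace ℝ (Fin d)) := Metric.ball 0 δ with hB
  have hBT : ∀ w ∈ B, ‖chartFwd d x₀ x (T.symm w)‖ < δ := fun w hw => by
    rw [hTs]; exact mem_ball_zero_iff.1 hw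
  -- After composition with the inverse of the chart differential the map differs from the identity
  -- by an $\eta$-Lipschitz map, so the quantitative inverse function theorem applies on the whole
  -- ball.
  have happ : ApproximatesLinearOn (fun w => φ (expMap x (T.symm w)))
      (ContinuousLinearEquiv.refl ℝ (EuclideanSpace ℝ (Fin d)) :
        EuclideanSpace ℝ (Fin d) →L[ℝ] EuclideanSpace ℝ (Fin d)) B η := by
    intro v hv w hw
    have := (H _ (hBT v hv)).2 _ (hBT w hw)
    rw [hTs, hTs] at this
    exact this
  have hc : Subsingleton (EuclideanSpace ℝ (Fin d)) ∨ η <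
      ‖((ContinuousLinearEquiv.refl ℝ (EuclideanSpace ℝ (Fin d))).symm :
        EuclideanSpace ℝ (Fin d) →L[ℝ] EuclideanSpace ℝ (Fin d))‖₊⁻¹ := by
    rcases subsingleton_or_nontrivial (EuclideanSpace ℝ (Fin d)) with h | h
    · exact Or.inl h
    · right
      have h1 : ‖((ContinuousLinearEquiv.refl ℝ (EuclideanSpace ℝ (Fin d))).symm :
        EuclideanSpace ℝ (Fin d) →L[ℝ] EuclideanSpace ℝ (Fin d))‖₊ = 1 := by
        ext
        exact ContinuousLinearMap.norm_id
      rw [h1, inv_one]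
      exact_mod_cast hη1
  set e₀ := happ.toOpenPartialHomeomorph _ _ hc Metric.isOpen_ball with he₀
  have hφc : ∀ y, φ y = chartAt (EuclideanSpace ℝ (Fin d)) x₀ y := fun y => by
    simp [hφ, mfld_simps]
  have hφs : φ.source = (chartAt (EuclideanSpace ℝ (Fin d)) x₀).source := by
    simp [hφ]
  set e := (T.toHomeomorph.toOpenPartialHomeomorph).trans
    (e₀.trans (chartAt (EuclideanSpace ℝ (Fin d)) x₀).symm) with he
  have hmem : ∀ v, ‖chartFwd d x₀ x v‖ < δ → expMap x v ∈ φ.source := fun v hv => (H v hv).1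
  have hes : e.source = {v | ‖chartFwd d x₀ x v‖ < δ} := by
    ext v
    have h1 : v ∈ e.source ↔ chartFwd d x₀ x v ∈ B ∧
        φ (expMap x (T.symm (T v))) ∈ (chartAt (EuclideanSpace ℝ (Fin d)) x₀).target := by
      rw [he, OpenPartialHomeomorph.trans_source, OpenPartialHomeomorph.trans_source]
      simp only [Homeomorph.toOpenPartialHomeomorph_source, univ_inter]
      exact Iff.rfl
    rw [h1, T.symm_apply_apply, hφc]
    constructor
    · rintro ⟨h2, -⟩; exact mem_ball_zero_iff.1 h2
    · intro h2
      refine ⟨mem_ball_zero_iff.2 h2, ?_⟩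
      exact (chartAt (EuclideanSpace ℝ (Fin d)) x₀).map_source (hφs ▸ hmem v h2)
  have hev : ∀ v ∈ e.source, e v = expMap x v := by
    intro v hv
    rw [hes] at hv
    show (chartAt (EuclideanSpace ℝ (Fin d)) x₀).symm (φ (expMap x (T.symm (T v)))) = _
    rw [T.symm_apply_apply, hφc]
    exact (chartAt (EuclideanSpace ℝ (Fin d)) x₀).left_inv (hφs ▸ hmem v hv)
  refine ⟨e, hes, hev, ?_, ?_⟩
  · intro y hy
    have h1 := e.map_target hy
    rw [← e.right_inv hy, hev _ h1]
    rw [hes] at h1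
    exact hmem _ h1
  · intro v hv w hw
    rw [hev v hv, hev w hw]
    rw [hes] at hv hw
    exact (H v hv).2 w hw

end ExpChart

/-! ### Nearby vector fields near a hyperbolic singularity -/

section FieldNear

variable {d : ℕ} {M : Type*} [EMetricSpace M] [ChartedSpace (EuclideanSpace ℝ (Fin d)) M]
  [IsManifold (𝓡 d) ∞ M]

/-- Half of `η` comes from continuity of the derivative of `X`, half from $C^1$ closeness. The
radius stays free below `ρ₀` because later choices shrink it. -/
theorem fderiv_inChart_near (X : VField d M) (x₀ : M) {η : ℝ} (hη : 0 < η) :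
    ∃ ρ₀ > 0, ∀ ρ, 0 < ρ → ρ ≤ ρ₀ →
      Metric.closedBall (extChartAt (𝓡 d) x₀ x₀) ρ ⊆ (extChartAt (𝓡 d) x₀).target ∧
      ∀ Y ∈ c1Nhd X x₀ (Metric.closedBall (extChartAt (𝓡 d) x₀ x₀) ρ) (η / 2),
      ∀ z ∈ Metric.closedBall (extChartAt (𝓡 d) x₀ x₀) ρ,
        ‖fderiv ℝ (inChart Y x₀) z - linearPart X x₀‖ ≤ η := by
  have ho := isOpen_extChartAt_target (I := 𝓡 d) x₀
  have hm := mem_extChartAt_target (I := 𝓡 d) x₀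
  have hc : ContinuousAt (fderiv ℝ (inChart X x₀)) (extChartAt (𝓡 d) x₀ x₀) :=
    ((contDiffOn_inChart X x₀).continuousOn_fderiv_of_isOpen ho le_rfl).continuousAt
      (ho.mem_nhds hm)
  obtain ⟨r, hr, hr'⟩ := Metric.eventually_nhds_iff.1
    ((hc.eventually (Metric.ball_mem_nhds _ (half_pos hη))).and (ho.mem_nhds hm))
  refine ⟨r / 2, half_pos hr, fun ρ hρ hρr => ⟨fun z hz => (hr' ?_).2, fun Y hY z hz => ?_⟩⟩
  · exact (Metric.mem_closedBall.1 hz).trans_lt (by linarith)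
  · have h1 := (hr' ((Metric.mem_closedBall.1 hz).trans_lt (by linarith))).1
    rw [dist_eq_norm] at h1
    have h2 := (hY z hz).2
    have h3 := norm_add_le (fderiv ℝ (inChart Y x₀) z - fderiv ℝ (inChart X x₀) z)
      (fderiv ℝ (inChart X x₀) z - linearPart X x₀)
    rw [sub_add_sub_cancel] at h3
    have h4 : ‖fderiv ℝ (inChart X x₀) z - linearPart X x₀‖ < η / 2 := h1
    linarith

/-- In the chart ball of radius `ρ` the derivative of `Y` is `η`-close to `A`. -/
structure FieldNear (Y : VField d M) (x₀ : M)
    (A : EuclideanSpace ℝ (Fin d) →L[ℝ] EuclideanSpace ℝ (Fin d)) (ρ η : ℝ) : Prop where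
  sub : Metric.closedBall (extChartAt (𝓡 d) x₀ x₀) ρ ⊆ (extChartAt (𝓡 d) x₀).target
  near : ∀ z ∈ Metric.closedBall (extChartAt (𝓡 d) x₀ x₀) ρ,
    ‖fderiv ℝ (inChart Y x₀) z - A‖ ≤ η

variable {Y : VField d M} {x₀ : M}
  {A : EuclideanSpace ℝ (Fin d) →L[ℝ] EuclideanSpace ℝ (Fin d)} {ρ η : ℝ}

/-- Mean value inequality on the convex ball. `B` is free so that the estimate can be centred at the
derivative of `Y` at its own singularity. -/
theorem FieldNear.approx (h : FieldNear Y x₀ A ρ η)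
    {B : EuclideanSpace ℝ (Fin d) →L[ℝ] EuclideanSpace ℝ (Fin d)} {θ : ℝ} (hB : ‖A - B‖ ≤ θ)
    {z w : EuclideanSpace ℝ (Fin d)} (hz : z ∈ Metric.closedBall (extChartAt (𝓡 d) x₀ x₀) ρ)
    (hw : w ∈ Metric.closedBall (extChartAt (𝓡 d) x₀ x₀) ρ) :
    ‖inChart Y x₀ z - inChart Y x₀ w - B (z - w)‖ ≤ (η + θ) * ‖z - w‖ := by
  refine (convex_closedBall (extChartAt (𝓡 d) x₀ x₀) ρ).norm_image_sub_le_of_norm_fderiv_le'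
    (𝕜 := ℝ) (fun u hu => ?_) (fun u hu => ?_) hw hz
  · exact ((contDiffOn_inChart Y x₀).differentiableOn one_ne_zero).differentiableAt
      ((isOpen_extChartAt_target x₀).mem_nhds (h.sub hu))
  · have := norm_add_le (fderiv ℝ (inChart Y x₀) u - A) (A - B)
    rw [sub_add_sub_cancel] at this
    linarith [h.near u hu]

theorem inChart_sing {σ : M} (hσ : σ ∈ sing Y) (hs : σ ∈ (extChartAt (𝓡 d) x₀).source) :
    inChart Y x₀ (extChartAt (𝓡 d) x₀ σ) = 0 := by
  rw [inChart_eq_zero_iff Y ((extChartAt (𝓡 d) x₀).map_source hs),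
    (extChartAt (𝓡 d) x₀).left_inv hs]
  exact hσ

theorem FieldNear.lower (h : FieldNear Y x₀ A ρ η) {m : ℝ} (hm : ∀ v, m * ‖v‖ ≤ ‖A v‖)
    {σ : M} (hσ : σ ∈ sing Y) (hs : σ ∈ (extChartAt (𝓡 d) x₀).source)
    (hσρ : extChartAt (𝓡 d) x₀ σ ∈ Metric.closedBall (extChartAt (𝓡 d) x₀ x₀) ρ)
    {z : EuclideanSpace ℝ (Fin d)} (hz : z ∈ Metric.closedBall (extChartAt (𝓡 d) x₀ x₀) ρ) :
    (m - η) * ‖z - extChartAt (𝓡 d) x₀ σ‖ ≤ ‖inChart Y x₀ z‖ ∧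
      ‖inChart Y x₀ z‖ ≤ (‖A‖ + η) * ‖z - extChartAt (𝓡 d) x₀ σ‖ := by
  have h1 := h.approx (B := A) (θ := 0) (by simp) hz hσρ
  rw [inChart_sing hσ hs, sub_zero, add_zero] at h1
  have h2 := hm (z - extChartAt (𝓡 d) x₀ σ)
  have h3 := A.le_opNorm (z - extChartAt (𝓡 d) x₀ σ)
  have h4 := abs_le.1 ((abs_norm_sub_norm_le _ _).trans h1)
  constructor <;> linarith [h4.1, h4.2]

theorem FieldNear.unique (h : FieldNear Y x₀ A ρ η) {m : ℝ} (hm : ∀ v, m * ‖v‖ ≤ ‖A v‖)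
    (hηm : η < m) {σ τ : M} (hσ : σ ∈ sing Y) (hs : σ ∈ (extChartAt (𝓡 d) x₀).source)
    (hσρ : extChartAt (𝓡 d) x₀ σ ∈ Metric.closedBall (extChartAt (𝓡 d) x₀ x₀) ρ)
    (hτ : τ ∈ sing Y) (ht : τ ∈ (extChartAt (𝓡 d) x₀).source)
    (hτρ : extChartAt (𝓡 d) x₀ τ ∈ Metric.closedBall (extChartAt (𝓡 d) x₀ x₀) ρ) : σ = τ := by
  have h1 := (h.lower hm hσ hs hσρ hτρ).1
  rw [inChart_sing hτ ht, norm_zero] at h1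
  have h2 : ‖extChartAt (𝓡 d) x₀ τ - extChartAt (𝓡 d) x₀ σ‖ = 0 := by
    have := norm_nonneg (extChartAt (𝓡 d) x₀ τ - extChartAt (𝓡 d) x₀ σ)
    nlinarith
  exact ((extChartAt (𝓡 d) x₀).injOn ht hs (sub_eq_zero.1 (norm_eq_zero.1 h2))).symm

theorem exists_lower_bound {A : EuclideanSpace ℝ (Fin d) →L[ℝ] EuclideanSpace ℝ (Fin d)}
    (hA : Function.Injective A) : ∃ m > 0, ∀ v, m * ‖v‖ ≤ ‖A v‖ := by
  obtain ⟨K, hK, h⟩ := (A : EuclideanSpace ℝ (Fin d) →ₗ[ℝ] EuclideanSpace ℝ (Fin d)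
    ).exists_antilipschitzWith (LinearMap.ker_eq_bot.2 hA)
  refine ⟨(K : ℝ)⁻¹, by positivity, fun v => ?_⟩
  have := h.le_mul_dist v 0
  rw [map_zero, dist_zero_right, dist_zero_right] at this
  rw [inv_mul_le_iff₀ (by positivity)]
  exact this

end FieldNear

/-! ### Orbits in exponential coordinates -/

section QuasiOrbit

variable {d : ℕ} {M : Type*} [EMetricSpace M] [ChartedSpace (EuclideanSpace ℝ (Fin d)) M]
  [IsManifold (𝓡 d) ∞ M]

/-- Orbits near a singularity are almost linear in exponential coordinates. -/
theorem eventually_expHomeo_quasiOrbit {x₀ σ x : M} (hσ : σ ∈ (extChartAt (𝓡 d) x₀).source)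
    {e : OpenPartialHomeomorph (EuclideanSpace ℝ (Fin d)) M} {η a : ℝ} (hη : 0 < η)
    (hη1 : η ≤ 1 / 8) (he0 : 0 ∈ e.source) (heσ : e 0 = σ)
    (he : ∀ v ∈ e.source, ∀ w ∈ e.source,
      ‖extChartAt (𝓡 d) x₀ (e v) - extChartAt (𝓡 d) x₀ (e w) -
        (chartFwd d x₀ σ v - chartFwd d x₀ σ w)‖ ≤ η * ‖chartFwd d x₀ σ v - chartFwd d x₀ σ w‖)
    {A A' : EuclideanSpace ℝ (Fin d) →L[ℝ] EuclideanSpace ℝ (Fin d)}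
    (hA : ∀ v, chartFwd d x₀ σ (A v) = A' (chartFwd d x₀ σ v)) (ha : ‖A'‖ ≤ a)
    {q : Seminorm ℝ (EuclideanSpace ℝ (Fin d))} {Cq : ℝ} (hCq : 0 ≤ Cq)
    (hq : ∀ v, q v ≤ Cq * ‖chartFwd d x₀ σ v‖ ∧ ‖chartFwd d x₀ σ v‖ ≤ Cq * q v)
    (hx : x ∈ e.target) (hxσ : x ≠ e 0) {γ : ℝ → M} (hγ0 : γ 0 = x) (hγ : ContinuousAt γ 0)
    {D : EuclideanSpace ℝ (Fin d)}
    (hD : HasDerivAt (fun t => extChartAt (𝓡 d) x₀ (γ t)) D 0)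
    (hDA : ‖D - A' (extChartAt (𝓡 d) x₀ x - extChartAt (𝓡 d) x₀ σ)‖ ≤
      η * ‖extChartAt (𝓡 d) x₀ x - extChartAt (𝓡 d) x₀ σ‖) :
    ∀ᶠ s in 𝓝[>] (0 : ℝ), q (e.symm (γ s) - e.symm x - s • A (e.symm x)) ≤
      Cq ^ 2 * (η * (5 * a + 8)) * s * q (e.symm x) := by
  have hsx := e.map_target hx
  have hev : ∀ᶠ s in 𝓝[>] (0 : ℝ), γ s ∈ e.target := by
    have h1 : e.target ∈ 𝓝 (γ 0) := by rw [hγ0]; exact e.open_target.mem_nhds hx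
    exact nhdsWithin_le_nhds (hγ.preimage_mem_nhds h1)
  have hinj : ∀ v, chartFwd d x₀ σ v = 0 → v = 0 := fun v hv => by
    have := chartBwd_chartFwd hσ v
    rw [hv, map_zero] at this
    exact this.symm
  have hne : e.symm x ≠ 0 := fun h => hxσ (by rw [← h, e.right_inv hx])
  have key := eventually_quasiOrbit (A := A') (z := fun t => extChartAt (𝓡 d) x₀ (γ t))
    (w := fun t => chartFwd d x₀ σ (e.symm (γ t))) (z₀ := extChartAt (𝓡 d) x₀ σ) (D := D)
    hη hη1 ha hD (by simpa only [hγ0] using hDA)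
    (by rw [hγ0]; exact fun h => hne (hinj _ h))
    (by
      have := he _ hsx 0 he0
      rw [heσ, e.right_inv hx, map_zero, sub_zero] at this
      simpa only [hγ0] using this)
    (by
      filter_upwards [hev] with s hs
      have := he _ (e.map_target hs) _ hsx
      rw [e.right_inv hs, e.right_inv hx] at this
      simpa only [hγ0] using this)
  have ha0 : 0 ≤ a := (norm_nonneg _).trans ha
  filter_upwards [key, self_mem_nhdsWithin] with s hs hs0
  have hs0 : (0 : ℝ) < s := hs0
  rw [hγ0] at hs
  have h1 := (hq (e.symm (γ s) - e.symm x - s • A (e.symm x))).1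
  rw [map_sub (chartFwd d x₀ σ), map_sub (chartFwd d x₀ σ), map_smul (chartFwd d x₀ σ), hA] at h1
  have h2 := (hq (e.symm x)).2
  calc q (e.symm (γ s) - e.symm x - s • A (e.symm x))
      ≤ Cq * (η * (5 * a + 8) * s * ‖chartFwd d x₀ σ (e.symm x)‖) :=
        h1.trans (mul_le_mul_of_nonneg_left hs hCq)
    _ ≤ Cq * (η * (5 * a + 8) * s * (Cq * q (e.symm x))) := by
        refine mul_le_mul_of_nonneg_left (mul_le_mul_of_nonneg_left h2 (by positivity)) hCq
    _ = _ := by ring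

end QuasiOrbit

/-! ### Cardinality of separated sets -/

section Packing

variable {d : ℕ}

/-- The balls of radius $\rho/2$ about the points are disjoint and lie in a ball of radius
$1+\rho/2$; compare volumes. -/
theorem card_le_of_separated (s : Finset (EuclideanSpace ℝ (Fin d)))
    {z₀ : EuclideanSpace ℝ (Fin d)} {ρ : ℝ} (hρ : 0 < ρ)
    (hs : ∀ x ∈ s, x ∈ Metric.closedBall z₀ 1)
    (h : ∀ x ∈ s, ∀ y ∈ s, x ≠ y → ρ ≤ ‖x - y‖) : (s.card : ℝ) ≤ (1 + 2 / ρ) ^ d := by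
  let μ : Measure (EuclideanSpace ℝ (Fin d)) := volume
  have hδ : 0 < ρ / 2 := half_pos hρ
  set S := ⋃ x ∈ s, Metric.ball x (ρ / 2) with hS
  have D : Set.Pairwise (s : Set (EuclideanSpace ℝ (Fin d)))
      (Function.onFun Disjoint fun x => Metric.ball x (ρ / 2)) := by
    rintro x hx y hy hxy
    apply Metric.ball_disjoint_ball
    rw [dist_eq_norm]
    linarith [h x hx y hy hxy]
  have hsub : S ⊆ Metric.ball z₀ (1 + ρ) := by
    refine iUnion₂_subset fun x hx => ?_
    apply Metric.ball_subset_ball'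
    have := Metric.mem_closedBall.1 (hs x hx)
    linarith
  have hsub' : S ⊆ Metric.closedBall z₀ (1 + ρ / 2) := by
    refine iUnion₂_subset fun x hx => ?_
    refine Metric.ball_subset_closedBall.trans (Metric.closedBall_subset_closedBall' ?_)
    have := Metric.mem_closedBall.1 (hs x hx)
    linarith
  have I : (s.card : ℝ≥0∞) * ENNReal.ofReal ((ρ / 2) ^ d) * μ (Metric.ball 0 1) ≤
      ENNReal.ofReal ((1 + ρ / 2) ^ d) * μ (Metric.ball 0 1) :=
    calc
      (s.card : ℝ≥0∞) * ENNReal.ofReal ((ρ / 2) ^ d) * μ (Metric.ball 0 1) = μ S := by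
        rw [hS, measure_biUnion_finset D fun c _ => measurableSet_ball]
        simp only [μ.addHaar_ball_of_pos _ hδ, finrank_euclideanSpace, Fintype.card_fin,
          Finset.sum_const, nsmul_eq_mul, mul_assoc]
      _ ≤ μ (Metric.closedBall z₀ (1 + ρ / 2)) := measure_mono hsub'
      _ = ENNReal.ofReal ((1 + ρ / 2) ^ d) * μ (Metric.ball 0 1) := by
        rw [μ.addHaar_closedBall z₀ (by positivity), finrank_euclideanSpace, Fintype.card_fin]
  have J : (s.card : ℝ≥0∞) * ENNReal.ofReal ((ρ / 2) ^ d) ≤ ENNReal.ofReal ((1 + ρ / 2) ^ d) :=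
    (ENNReal.mul_le_mul_iff_left (Metric.measure_ball_pos _ _ zero_lt_one).ne'
      measure_ball_lt_top.ne).1 I
  have J' : (s.card : ℝ) * (ρ / 2) ^ d ≤ (1 + ρ / 2) ^ d := by
    rw [← ENNReal.ofReal_natCast, ← ENNReal.ofReal_mul (by positivity)] at J
    exact (ENNReal.ofReal_le_ofReal_iff (by positivity)).1 J
  have : (1 + 2 / ρ) ^ d = (1 + ρ / 2) ^ d / (ρ / 2) ^ d := by
    rw [← div_pow]; congr 1; field_simp; ring
  rw [this, le_div_iff₀ (by positivity)]
  exact J'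

end Packing

/-! ### The interface between local dynamics and partitions -/

section LocalModel

variable {d : ℕ} {M : Type*} [EMetricSpace M] [ChartedSpace (EuclideanSpace ℝ (Fin d)) M]
  [IsManifold (𝓡 d) ∞ M] [RiemannianBundle (fun x : M => TangentSpace (𝓡 d) x)]

/-- Quantitative description of the flow of `Y` near a hyperbolic singularity `σ` in exponential
coordinates. -/
structure LocalModel (Y : VField d M) (σ : M) (q : Seminorm ℝ (EuclideanSpace ℝ (Fin d)))
    (c k r₁ L₀ L₁ P : ℝ) (e : OpenPartialHomeomorph (EuclideanSpace ℝ (Fin d)) M)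
    (Ps Pu : EuclideanSpace ℝ (Fin d) →L[ℝ] EuclideanSpace ℝ (Fin d)) : Prop where
  splitting : ∃ lam K κ, IsSplitting (linearPart Y σ) q lam K κ Ps Pu
  sub : splitBox q Ps Pu r₁ ⊆ e.source
  exp : ∀ v ∈ e.source, e v = expMap σ v
  saddle : ∀ r, 0 < r → r ≤ r₁ → SaddleBox (flow Y) (e '' splitBox q Ps Pu r)
    (fun x => q (Ps (e.symm x))) (fun x => q (Pu (e.symm x))) r c k
  speed : ∀ x ∈ e '' splitBox q Ps Pu r₁, L₀ * (edist x σ).toReal ≤ speed Y x ∧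
    speed Y x ≤ L₁ * (edist x σ).toReal
  pack : ∀ ρ, 0 < ρ → ∀ F : Finset M, (F : Set M) ⊆ e '' splitBox q Ps Pu r₁ → IsSep ρ F →
    (F.card : ℝ) ≤ (1 + P / ρ) ^ d

theorem ExitBox.mono {M : Type*} [TopologicalSpace M] {Φ : ℝ → M → M} {K : Set M} {α β : M → ℝ}
    {r c k k' : ℝ} (h : ExitBox Φ K α β r c k) (hk : k ≤ k') (hβ : ∀ x ∈ K, 0 ≤ β x) :
    ExitBox Φ K α β r c k' :=
  { h with
    k_pos := h.k_pos.trans_le hk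
    upper := fun x hx he h0 t ht hK => (h.upper x hx he h0 t ht hK).trans
      (mul_le_mul_of_nonneg_left (Real.exp_le_exp.2 (mul_le_mul_of_nonneg_right hk ht))
        (hβ x hx)) }

theorem splitBox_mono {q : Seminorm ℝ (EuclideanSpace ℝ (Fin d))}
    {Ps Pu : EuclideanSpace ℝ (Fin d) →L[ℝ] EuclideanSpace ℝ (Fin d)} {r r' : ℝ} (h : r ≤ r') :
    splitBox q Ps Pu r ⊆ splitBox q Ps Pu r' := fun _ hv => ⟨hv.1.trans h, hv.2.trans h⟩

theorem LocalModel.mono {Y : VField d M} {σ : M} {q : Seminorm ℝ (EuclideanSpace ℝ (Fin d))}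
    {c k r₁ L₀ L₁ P k' r₁' L₀' L₁' P' : ℝ}
    {e : OpenPartialHomeomorph (EuclideanSpace ℝ (Fin d)) M}
    {Ps Pu : EuclideanSpace ℝ (Fin d) →L[ℝ] EuclideanSpace ℝ (Fin d)}
    (h : LocalModel Y σ q c k r₁ L₀ L₁ P e Ps Pu) (hk : k ≤ k') (hr : r₁' ≤ r₁) (h0 : L₀' ≤ L₀)
    (h1 : L₁ ≤ L₁') (hP0 : 0 ≤ P) (hP : P ≤ P') :
    LocalModel Y σ q c k' r₁' L₀' L₁' P' e Ps Pu where
  splitting := h.splitting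
  sub := (splitBox_mono hr).trans h.sub
  exp := h.exp
  saddle r hr0 hr1 :=
    have hs := h.saddle r hr0 (hr1.trans hr)
    ⟨hs.isFlow, hs.fwd.mono hk fun _ _ => apply_nonneg q _,
      hs.bwd.mono hk fun _ _ => apply_nonneg q _⟩
  speed x hx := by
    have hs := h.speed x (image_mono (splitBox_mono hr) hx)
    exact ⟨(mul_le_mul_of_nonneg_right h0 ENNReal.toReal_nonneg).trans hs.1,
      hs.2.trans (mul_le_mul_of_nonneg_right h1 ENNReal.toReal_nonneg)⟩
  pack ρ hρ F hF hs := by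
    refine (h.pack ρ hρ F (hF.trans (image_mono (splitBox_mono hr))) hs).trans ?_
    gcongr

end LocalModel

/-! ### Construction of the local model, uniformly in the vector field -/

section ExistsLocalModel

variable {d : ℕ} {M : Type*} [EMetricSpace M] [ChartedSpace (EuclideanSpace ℝ (Fin d)) M]
  [IsManifold (𝓡 d) ∞ M] [RiemannianBundle (fun x : M => TangentSpace (𝓡 d) x)]

theorem c1Nhd_mem_nhds (X : VField d M) (x₀ : M) {K : Set (EuclideanSpace ℝ (Fin d))}
    (hK : IsCompact K) (hKt : K ⊆ (extChartAt (𝓡 d) x₀).target) {ε : ℝ} (hε : 0 < ε) :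
    c1Nhd X x₀ K ε ∈ 𝓝 X := by
  refine IsOpen.mem_nhds (TopologicalSpace.isOpen_generateFrom_of_mem
    ⟨X, x₀, K, ε, hK, hKt, hε, rfl⟩) fun z _ => ?_
  simp [hε]

theorem seminorm_continuous_of_le {q : Seminorm ℝ (EuclideanSpace ℝ (Fin d))}
    {T : EuclideanSpace ℝ (Fin d) →L[ℝ] EuclideanSpace ℝ (Fin d)} {C : ℝ}
    (h : ∀ v, q v ≤ C * ‖T v‖) : Continuous q := by
  refine Seminorm.continuous_of_continuousAt_zero ?_
  rw [ContinuousAt, map_zero]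
  refine squeeze_zero (fun v => apply_nonneg q v) h ?_
  have : Continuous fun v => C * ‖T v‖ := by fun_prop
  simpa using this.tendsto 0

theorem isSep_card_le [CompactSpace M] {x₀ : M} {S : Set M} {Cd : ℝ} (hCd : 0 < Cd)
    (hS : S ⊆ (extChartAt (𝓡 d) x₀).source)
    (hball : ∀ x ∈ S, extChartAt (𝓡 d) x₀ x ∈ Metric.closedBall (extChartAt (𝓡 d) x₀ x₀) 1)
    (hd : ∀ x ∈ S, ∀ y ∈ S, edist x y ≤
      ENNReal.ofReal (Cd * ‖extChartAt (𝓡 d) x₀ x - extChartAt (𝓡 d) x₀ y‖)) {ρ : ℝ} (hρ : 0 < ρ)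
    {F : Finset M} (hF : (F : Set M) ⊆ S) (hsep : IsSep ρ F) :
    (F.card : ℝ) ≤ (1 + 2 * Cd / ρ) ^ d := by
  classical
  have hinj : InjOn (extChartAt (𝓡 d) x₀) F := (extChartAt (𝓡 d) x₀).injOn.mono (hF.trans hS)
  have h := card_le_of_separated (F.image (extChartAt (𝓡 d) x₀)) (z₀ := extChartAt (𝓡 d) x₀ x₀)
    (ρ := ρ / Cd) (by positivity) (by
      intro z hz
      obtain ⟨x, hx, rfl⟩ := Finset.mem_image.1 hz
      exact hball x (hF hx)) (by
      intro z hz w hw hzw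
      obtain ⟨x, hx, rfl⟩ := Finset.mem_image.1 hz
      obtain ⟨y, hy, rfl⟩ := Finset.mem_image.1 hw
      have h1 := (hsep x hx y hy fun h => hzw (by rw [h])).trans_le (hd x (hF hx) y (hF hy))
      rw [div_le_iff₀ hCd, mul_comm]
      exact (ENNReal.ofReal_lt_ofReal_iff_of_nonneg hρ.le).1 h1 |>.le)
  rw [Finset.card_image_of_injOn hinj] at h
  refine h.trans (le_of_eq ?_)
  congr 2
  field_simp

variable [IsContMDiffRiemannianBundle (𝓡 d) ∞ (EuclideanSpace ℝ (Fin d))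
      (fun x : M => TangentSpace (𝓡 d) x)] [IsRiemannianManifold (𝓡 d) M]

/-- A chart ball on which the metric and the distance are comparable with the Euclidean ones. -/
theorem exists_comparison_ball (x₀ : M) : ∃ Cm > 0, ∃ Cd > 0, ∃ ρ₀ > 0, ∀ x ∈ (extChartAt (𝓡 d) x₀).source,
    extChartAt (𝓡 d) x₀ x ∈ Metric.closedBall (extChartAt (𝓡 d) x₀ x₀) ρ₀ →
    (∀ v, rnorm x v ≤ Cm * ‖chartFwd d x₀ x v‖ ∧ ‖chartFwd d x₀ x v‖ ≤ Cm * rnorm x v) ∧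
    ∀ y ∈ (extChartAt (𝓡 d) x₀).source,
      extChartAt (𝓡 d) x₀ y ∈ Metric.closedBall (extChartAt (𝓡 d) x₀ x₀) ρ₀ →
      edist x y ≤ ENNReal.ofReal (Cd * ‖extChartAt (𝓡 d) x₀ x - extChartAt (𝓡 d) x₀ y‖) ∧
      ‖extChartAt (𝓡 d) x₀ x - extChartAt (𝓡 d) x₀ y‖ ≤ Cd * (edist x y).toReal := by
  obtain ⟨Cm, hCm, h1⟩ := rnorm_bounds (d := d) x₀
  obtain ⟨C₁, hC₁, h2⟩ := edist_le_chart (d := d) x₀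
  obtain ⟨C₂, hC₂, h3⟩ := chart_le_edist (d := d) x₀
  rw [nhds_prod_eq] at h2 h3
  obtain ⟨p, hp, h23⟩ := Filter.mem_prod_self_iff.1 (h2.and h3)
  have h4 : ∀ᶠ z in 𝓝 (extChartAt (𝓡 d) x₀ x₀),
      (extChartAt (𝓡 d) x₀).symm z ∈ {x | (∀ v : EuclideanSpace ℝ (Fin d),
        rnorm x v ≤ Cm * ‖chartFwd d x₀ x v‖ ∧ ‖chartFwd d x₀ x v‖ ≤ Cm * rnorm x v) ∧ x ∈ p} := by
    have hc := continuousAt_extChartAt_symm (I := 𝓡 d) x₀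
    refine hc.preimage_mem_nhds ?_
    rw [extChartAt_to_inv]
    exact h1.and hp
  obtain ⟨r, hr, h5⟩ := Metric.eventually_nhds_iff.1 h4
  have h6 : ∀ x ∈ (extChartAt (𝓡 d) x₀).source,
      extChartAt (𝓡 d) x₀ x ∈ Metric.closedBall (extChartAt (𝓡 d) x₀ x₀) (r / 2) →
      (∀ v : EuclideanSpace ℝ (Fin d),
        rnorm x v ≤ Cm * ‖chartFwd d x₀ x v‖ ∧ ‖chartFwd d x₀ x v‖ ≤ Cm * rnorm x v) ∧ x ∈ p := by
    intro x hx hxr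
    have := h5 ((Metric.mem_closedBall.1 hxr).trans_lt (by linarith))
    rwa [(extChartAt (𝓡 d) x₀).left_inv hx] at this
  refine ⟨Cm, hCm, max C₁ C₂, lt_max_of_lt_left hC₁, r / 2, half_pos hr, fun x hx hxr =>
    ⟨(h6 x hx hxr).1, fun y hy hyr => ?_⟩⟩
  have h7 : edist x y ≤ _ ∧ _ ≤ _ := h23 (mk_mem_prod (h6 x hx hxr).2 (h6 y hy hyr).2)
  refine ⟨h7.1.trans (ENNReal.ofReal_le_ofReal ?_), ?_⟩
  · exact mul_le_mul_of_nonneg_right (le_max_left _ _) (norm_nonneg _)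
  · have hfin : edist x y ≠ ⊤ := (h7.1.trans_lt ENNReal.ofReal_lt_top).ne
    have h8 := ENNReal.toReal_mono (ENNReal.mul_ne_top ENNReal.ofReal_ne_top hfin) h7.2
    rw [ENNReal.toReal_ofReal (norm_nonneg _), ENNReal.toReal_mul,
      ENNReal.toReal_ofReal hC₂.le] at h8
    exact h8.trans (mul_le_mul_of_nonneg_right (le_max_right _ _) ENNReal.toReal_nonneg)

theorem isFlow_flow [CompactSpace M] (Y : VField d M) : IsFlow (flow Y) :=
  ⟨continuous_flow Y, flow_zero Y, flow_add Y⟩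

/-- Every constant is fixed from `X`, the chart at `σ₀`, `C` and `lam` before `Y`, its singularity
and the adapted norm are given. That order of choices is the uniformity claimed in the theorem. -/
theorem exists_localModel [CompactSpace M] (X : VField d M) {σ₀ : M}
    (hyp : IsHyperbolicMap (linearPart X σ₀)) {C lam : ℝ} (hC : 0 < C) (hlam : 0 < lam) :
    ∃ W, IsOpen W ∧ σ₀ ∈ W ∧ ∃ V ∈ 𝓝 X, ∃ k r₁ L₀ L₁ P : ℝ, 0 < r₁ ∧ 0 < L₀ ∧ 0 ≤ P ∧
      ∀ Y ∈ V, (∀ σ ∈ sing Y, σ ∈ W → ∀ τ ∈ sing Y, τ ∈ W → σ = τ) ∧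
      ∀ σ ∈ sing Y, σ ∈ W → IsHyperbolicMap (linearPart Y σ) ∧
        ∀ q, IsAdapted C lam Y σ q →
          ∃ e Ps Pu, LocalModel Y σ q (lam / 2) k r₁ L₀ L₁ P e Ps Pu := by
  set φ := extChartAt (𝓡 d) σ₀ with hφ
  set z₀ := φ σ₀ with hz₀
  set A₀ := linearPart X σ₀ with hA₀
  obtain ⟨Cm, hCm, Cd, hCd, ρ₁, hρ₁, Hcmp⟩ := exists_comparison_ball (d := d) σ₀
  obtain ⟨m, hm, Hm⟩ := exists_lower_bound hyp.injective
  obtain ⟨η₁, hη₁, Hη₁⟩ := Metric.eventually_nhds_iff.1 (isHyperbolicMap_eventually hyp)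
  set a := ‖A₀‖ + 1 with ha
  have ha0 : 0 < a := by positivity
  -- `Cq` compares an adapted norm with the chart norm, through the Riemannian norm. Hence `K`
  -- bounds the linear part of `Y` in any adapted norm, and `κ` its projections.
  set Cq := C * Cm with hCq
  have hCq0 : 0 < Cq := by positivity
  set K := Cq ^ 2 * a with hK
  have hK0 : 0 ≤ K := by positivity
  set κ := projBound lam K with hκ
  have hκ1 : 1 ≤ κ := one_le_projBound hlam K
  set G := 4 * (κ * (Cq ^ 2 * (5 * a + 8))) with hG
  have hG0 : 0 < G := by positivity
  -- The requirements on `η` in order: the perturbation lemma, uniqueness of the singularity and the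
  -- lower speed bound, hyperbolicity of the nearby derivative, and the cone condition
  -- $4\kappa\varepsilon\le\lambda$.
  obtain ⟨η, hη, hη8, hηm, hηη₁, hηG⟩ : ∃ η > 0, η ≤ 1 / 8 ∧ η ≤ m ∧ η < η₁ ∧ η ≤ lam / G :=
    ⟨min (1 / 8) (min m (min (η₁ / 2) (lam / G))), by positivity, min_le_left _ _,
      (min_le_right _ _).trans (min_le_left _ _),
      ((min_le_right _ _).trans ((min_le_right _ _).trans (min_le_left _ _))).trans_lt
        (by linarith),
      (min_le_right _ _).trans ((min_le_right _ _).trans (min_le_right _ _))⟩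
  obtain ⟨δ, hδ, Hδ⟩ := exists_expHomeo (d := d) σ₀ hη (by linarith)
  obtain ⟨ρ₂, hρ₂, Hρ₂⟩ := fderiv_inChart_near X σ₀ (half_pos hη)
  -- Radius 1 is for the packing bound, `ρ₁` for the metric comparison, `δ / 2` for the exponential
  -- map, `ρ₂` for the derivative of `Y`.
  set ρ := min (min 1 ρ₁) (min (δ / 2) ρ₂) with hρ
  have hρ0 : 0 < ρ := by positivity
  obtain ⟨Hsub, Hnear⟩ := Hρ₂ ρ hρ0 ((min_le_right _ _).trans (min_le_right _ _))
  -- Singularities in `W` lie within $\rho/4$ of the centre and the exponential chart adds at most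
  -- $(1+\eta)\rho/4$, so its image stays in the $\rho$-ball.
  set δ' := min δ (ρ / 4) with hδ'
  have hδ'0 : 0 < δ' := by positivity
  set W := φ.source ∩ φ ⁻¹' Metric.ball z₀ (ρ / 4) with hW
  have hWo : IsOpen W := (continuousOn_extChartAt (I := 𝓡 d) σ₀).isOpen_inter_preimage
    (isOpen_extChartAt_source σ₀) Metric.isOpen_ball
  refine ⟨W, hWo, ⟨mem_extChartAt_source σ₀, Metric.mem_ball_self (by positivity)⟩,
    c1Nhd X σ₀ (Metric.closedBall z₀ ρ) (η / 2 / 2),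
    c1Nhd_mem_nhds X σ₀ (isCompact_closedBall _ _) Hsub (by positivity),
    -- The box of size $r$ has $q\le2r$, so $r_1=\delta'/(4C_q)$ keeps it at chart norm $\delta'/2$.
    -- The factor $m/2$ in the lower speed constant is what is left of $m-\eta/2$.
    K + lam, δ' / (4 * Cq), m / (2 * Cm * Cd), Cm * a * Cd, 2 * Cd, by positivity, by positivity,
    by positivity, fun Y hY => ?_⟩
  have hFN : FieldNear Y σ₀ A₀ ρ (η / 2) := ⟨Hsub, Hnear Y hY⟩
  have hWb : ∀ σ ∈ W, φ σ ∈ Metric.closedBall z₀ ρ := fun σ hσ => by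
    have := Metric.mem_ball.1 hσ.2
    rw [Metric.mem_closedBall]; linarith
  refine ⟨fun σ hσ hσW τ hτ hτW => hFN.unique Hm (by linarith) hσ hσW.1 (hWb σ hσW) hτ hτW.1
    (hWb τ hτW), fun σ hσ hσW => ?_⟩
  set T := chartFwd d σ₀ σ with hT
  set A := linearPart Y σ with hA
  set A' := fderiv ℝ (inChart Y σ₀) (φ σ) with hA'
  have hconj : ∀ v, T (A v) = A' (T v) := chartFwd_linearPart Y hσW.1 hσ
  have hA'A₀ : ‖A' - A₀‖ ≤ η / 2 := hFN.near _ (hWb σ hσW)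
  have hA'a : ‖A'‖ ≤ a := by
    have := norm_add_le (A' - A₀) A₀
    rw [sub_add_cancel] at this
    linarith
  have hA'h : IsHyperbolicMap A' := Hη₁ (by rw [dist_eq_norm]; linarith)
  have hTinj : Function.Injective T := (chartEquiv hσW.1).injective
  have hAh : IsHyperbolicMap A := IsHyperbolicMap.of_conj hTinj hconj hA'h
  refine ⟨hAh, fun q hq => ?_⟩
  have hcl : ∀ ρ' , ρ' ≤ ρ → ∀ x, φ x ∈ Metric.closedBall z₀ ρ' →
      φ x ∈ Metric.closedBall z₀ ρ₁ := fun ρ' hρ' x hx =>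
    Metric.closedBall_subset_closedBall
      (hρ'.trans ((min_le_left _ _).trans (min_le_right _ _))) hx
  have hqT : ∀ v, q v ≤ Cq * ‖T v‖ ∧ ‖T v‖ ≤ Cq * q v := by
    intro v
    have h1 := (Hcmp σ hσW.1 (hcl ρ le_rfl σ (hWb σ hσW))).1 v
    have h2 := hq.1 v
    constructor
    · calc q v ≤ C * rnorm σ v := h2.1
        _ ≤ C * (Cm * ‖T v‖) := mul_le_mul_of_nonneg_left h1.1 hC.le
        _ = _ := by rw [hCq]; ring
    · calc ‖T v‖ ≤ Cm * rnorm σ v := h1.2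
        _ ≤ Cm * (C * q v) := mul_le_mul_of_nonneg_left h2.2 hCm.le
        _ = _ := by rw [hCq]; ring
  have hqc : Continuous q := seminorm_continuous_of_le fun v => (hqT v).1
  set N := ‖((chartEquiv hσW.1).symm : EuclideanSpace ℝ (Fin d) →L[ℝ] EuclideanSpace ℝ (Fin d))‖
    * Cq with hN
  have hN0 : 0 ≤ N := by positivity
  have hqn : ∀ v, ‖v‖ ≤ N * q v := by
    intro v
    have h1 := ((chartEquiv hσW.1).symm :
      EuclideanSpace ℝ (Fin d) →L[ℝ] EuclideanSpace ℝ (Fin d)).le_opNorm (T v)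
    have h2 : ((chartEquiv hσW.1).symm :
      EuclideanSpace ℝ (Fin d) →L[ℝ] EuclideanSpace ℝ (Fin d)) (T v) = v :=
      (chartEquiv hσW.1).symm_apply_apply v
    rw [h2] at h1
    refine h1.trans ?_
    rw [hN, mul_assoc]
    exact mul_le_mul_of_nonneg_left (hqT v).2 (norm_nonneg _)
  have hq0 : ∀ v, q v = 0 → v = 0 := fun v hv => by
    have := hqn v
    rw [hv, mul_zero] at this
    exact norm_le_zero_iff.1 this
  have hbA : ∀ v, q (A v) ≤ K * q v := by
    intro v
    calc q (A v) ≤ Cq * ‖A' (T v)‖ := by rw [← hconj]; exact (hqT _).1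
      _ ≤ Cq * (a * (Cq * q v)) := by
        refine mul_le_mul_of_nonneg_left ((A'.le_opNorm _).trans ?_) hCq0.le
        exact mul_le_mul hA'a (hqT v).2 (norm_nonneg _) ha0.le
      _ = _ := by rw [hK]; ring
  obtain ⟨Ps, Pu, hS⟩ := exists_splitting hAh hlam hK0 hq0 hqc hbA hq.2.1 hq.2.2
  have hσδ : ‖φ σ - z₀‖ < δ := by
    have h1 := Metric.mem_closedBall.1 (hWb σ hσW)
    have h2 : ρ ≤ δ / 2 := (min_le_right _ _).trans (min_le_left _ _)
    rw [dist_eq_norm] at h1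
    linarith
  obtain ⟨e, hes, hexp, het, hee⟩ := Hδ δ' (min_le_left _ _) σ hσW.1 hσδ
  have he0 : (0 : EuclideanSpace ℝ (Fin d)) ∈ e.source := by
    rw [hes]; show ‖T 0‖ < δ'; rw [map_zero, norm_zero]; exact hδ'0
  have heσ : e 0 = σ := by rw [hexp 0 he0, expMap_zero]
  have hetb : ∀ x ∈ e.target, φ x ∈ Metric.closedBall z₀ ρ := by
    intro x hx
    have h1 := hee _ (e.map_target hx) 0 he0
    have h2 : ‖T (e.symm x)‖ < δ' := by
      have := e.map_target hx
      rwa [hes] at this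
    rw [e.right_inv hx, heσ, map_zero, sub_zero] at h1
    have h3 := norm_add_le (φ x - φ σ - T (e.symm x)) (T (e.symm x))
    rw [sub_add_cancel] at h3
    have h4 := Metric.mem_ball.1 hσW.2
    have h5 : δ' ≤ ρ / 4 := min_le_right _ _
    have h6 := dist_triangle (φ x) (φ σ) z₀
    rw [dist_eq_norm (φ x) (φ σ)] at h6
    have h7 : η * ‖T (e.symm x)‖ ≤ 1 * ‖T (e.symm x)‖ :=
      mul_le_mul_of_nonneg_right (by linarith) (norm_nonneg _)
    have h8 : ‖φ x - φ σ - T (e.symm x)‖ ≤ η * ‖T (e.symm x)‖ := h1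
    rw [Metric.mem_closedBall]
    linarith
  have hsub : splitBox q Ps Pu (δ' / (4 * Cq)) ⊆ e.source := by
    intro v hv
    rw [hes]
    have h1 := hS.le_of_mem_box hv
    have h2 := (hqT v).2.trans (mul_le_mul_of_nonneg_left h1 hCq0.le)
    have h3 : Cq * (2 * (δ' / (4 * Cq))) = δ' / 2 := by field_simp; ring
    show ‖T v‖ < δ'
    linarith
  have hKt : e '' splitBox q Ps Pu (δ' / (4 * Cq)) ⊆ e.target := by
    rintro _ ⟨v, hv, rfl⟩
    exact e.map_source (hsub hv)
  have hlin : ∀ x ∈ e.target, ‖inChart Y σ₀ (φ x) - A' (φ x - φ σ)‖ ≤ η * ‖φ x - φ σ‖ := by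
    intro x hx
    have h1 := hFN.approx (B := A') (θ := η / 2) (by rw [norm_sub_rev]; exact hA'A₀)
      (hetb x hx) (hWb σ hσW)
    rw [inChart_sing hσ hσW.1, sub_zero, add_halves] at h1
    exact h1
  have hchart : ∀ x ∈ e.target, HasDerivAt (fun t => φ (flow Y t x)) (inChart Y σ₀ (φ x)) 0 := by
    intro x hx
    have h1 := hasDerivAt_chart (x₀ := σ₀) (flow_isMIntegralCurve Y x 0)
      (by rw [flow_zero]; exact het hx)
    rw [flow_zero] at h1
    exact h1
  have hεG : 4 * (κ * (Cq ^ 2 * (η * (5 * a + 8)))) ≤ lam := by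
    have := (le_div_iff₀ hG0).1 hηG
    rw [hG] at this
    linarith
  have hflow := isFlow_flow Y
  have hfix : ∀ t, flow Y t (e 0) = e 0 := fun t => by rw [heσ]; exact flow_sing Y hσ t
  refine ⟨e, Ps, Pu, ⟨lam, K, κ, hS⟩, hsub, hexp, fun r hr0 hr1 => ⟨hflow, ?_, ?_⟩, ?_, ?_⟩
  · refine hS.exitBox hN0 hqn hlam hK0 (by linarith) (ε := Cq ^ 2 * (η * (5 * a + 8)))
      (by positivity) hεG hflow e he0 hfix (fun x hx hxσ => ?_) ((splitBox_mono hr1).trans hsub)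
    exact eventually_expHomeo_quasiOrbit hσW.1 hη hη8 he0 heσ hee hconj hA'a hCq0.le hqT hx hxσ
      (γ := fun t => flow Y t x) (flow_zero Y x) (continuous_flow_time Y x).continuousAt
      (hchart x hx) (hlin x hx)
  -- Backward time: the reversed flow is generated by $-Y$, with linear part $-A$ and the
  -- projections exchanged.
  · rw [splitBox_comm]
    refine hS.neg.exitBox hN0 hqn hlam hK0 (by linarith) (ε := Cq ^ 2 * (η * (5 * a + 8)))
      (by positivity) hεG hflow.rev e he0 (fun t => hfix (-t)) (fun x hx hxσ => ?_) (by
        rw [splitBox_comm]; exact (splitBox_mono hr1).trans hsub)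
    refine eventually_expHomeo_quasiOrbit (A' := -A') hσW.1 hη hη8 he0 heσ hee
      (fun v => ?_) (by rw [norm_neg]; exact hA'a) hCq0.le hqT hx hxσ
      (γ := fun t => flow Y (-t) x) (D := -inChart Y σ₀ (φ x)) ?_ ?_ ?_ ?_
    · show T (-(A v)) = -(A' (T v))
      rw [map_neg, hconj]
    · simp only [neg_zero]; exact flow_zero Y x
    · exact ((continuous_flow_time Y x).comp continuous_neg).continuousAt
    · have h1 := HasDerivAt.scomp (h := fun t : ℝ => -t) (h' := -1) 0
        (g₁ := fun t => φ (flow Y t x)) (by simpa using hchart x hx) (hasDerivAt_neg 0)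
      have h2 : (-1 : ℝ) • inChart Y σ₀ (φ x) = -inChart Y σ₀ (φ x) := neg_one_smul ℝ _
      rw [← h2]
      exact h1
    · show ‖-inChart Y σ₀ (φ x) - -(A' (φ x - φ σ))‖ ≤ _
      rw [← neg_sub', norm_neg]
      exact hlin x hx
  · intro x hx
    have hxt := hKt hx
    have hxb := hetb x hxt
    obtain ⟨h1, h2⟩ := hFN.lower Hm hσ hσW.1 (hWb σ hσW) hxb
    obtain ⟨h3, h4⟩ := Hcmp x (het hxt) (hcl ρ le_rfl x hxb)
    obtain ⟨h5, h6⟩ := h4 σ hσW.1 (hcl ρ le_rfl σ (hWb σ hσW))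
    have h7 := h3 (rawField Y x)
    rw [← speed_eq] at h7
    have h8 : chartFwd d σ₀ x (rawField Y x) = inChart Y σ₀ (φ x) := by
      rw [inChart_def, φ.left_inv (het hxt)]
    rw [h8] at h7
    have h9 : (edist x σ).toReal ≤ Cd * ‖φ x - φ σ‖ := by
      refine ENNReal.toReal_le_of_le_ofReal (by positivity) h5
    constructor
    · rw [div_mul_eq_mul_div, div_le_iff₀ (by positivity)]
      have e1 : m / 2 * ‖φ x - φ σ‖ ≤ Cm * speed Y x := by
        refine le_trans ?_ (h1.trans h7.2)
        exact mul_le_mul_of_nonneg_right (by linarith) (norm_nonneg _)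
      have e2 := mul_le_mul_of_nonneg_left h9 hm.le
      have e3 := mul_le_mul_of_nonneg_left e1 hCd.le
      linarith
    · have e1 : (‖A₀‖ + η / 2) * ‖φ x - φ σ‖ ≤ a * (Cd * (edist x σ).toReal) :=
        mul_le_mul (by linarith) h6 (norm_nonneg _) ha0.le
      have e2 := mul_le_mul_of_nonneg_left (h2.trans e1) hCm.le
      linarith [h7.1]
  · intro s hs F hF hsep
    refine isSep_card_le hCd (hKt.trans het) (fun x hx => ?_) (fun x hx y hy => ?_) hs hF hsep
    · exact Metric.closedBall_subset_closedBall ((min_le_left _ _).trans (min_le_left _ _))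
        (hetb x (hKt hx))
    · exact ((Hcmp x (het (hKt hx)) (hcl ρ le_rfl x (hetb x (hKt hx)))).2 y (het (hKt hy))
        (hcl ρ le_rfl y (hetb y (hKt hy)))).1

end ExistsLocalModel

/-! ### From local to global by compactness -/

section GlobalModel

theorem exists_pos_lower {ι : Type*} (t : Finset ι) {f : ι → ℝ} (hf : ∀ i ∈ t, 0 < f i) :
    ∃ c > 0, ∀ i ∈ t, c ≤ f i := by
  induction t using Finset.cons_induction with
  | empty => exact ⟨1, one_pos, by simp⟩
  | cons a s ha ih =>
    obtain ⟨c, hc, h⟩ := ih fun i hi => hf i (Finset.mem_cons_of_mem hi)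
    refine ⟨min c (f a), lt_min hc (hf a (Finset.mem_cons_self a s)), fun i hi => ?_⟩
    rcases Finset.mem_cons.1 hi with rfl | hi
    · exact min_le_right _ _
    · exact (min_le_left _ _).trans (h i hi)

theorem exists_upper {ι : Type*} (t : Finset ι) (f : ι → ℝ) : ∃ c > 0, ∀ i ∈ t, f i ≤ c := by
  induction t using Finset.cons_induction with
  | empty => exact ⟨1, one_pos, by simp⟩
  | cons a s ha ih =>
    obtain ⟨c, hc, h⟩ := ih
    refine ⟨max c (f a), lt_max_of_lt_left hc, fun i hi => ?_⟩
    rcases Finset.mem_cons.1 hi with rfl | hi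
    · exact le_max_right _ _
    · exact (h i hi).trans (le_max_left _ _)

variable {d : ℕ} {M : Type*} [EMetricSpace M] [ChartedSpace (EuclideanSpace ℝ (Fin d)) M]
  [IsManifold (𝓡 d) ∞ M] [RiemannianBundle (fun x : M => TangentSpace (𝓡 d) x)]

/-- Away from the singularities of `X` nearby fields have none, so the cover in `exists_globalModel`
also takes care of regular points. -/
theorem exists_nonsingular_nhd (X : VField d M) {x₀ : M} (h : x₀ ∉ sing X) :
    ∃ W, IsOpen W ∧ x₀ ∈ W ∧ ∃ V ∈ 𝓝 X, ∀ Y ∈ V, ∀ σ ∈ sing Y, σ ∉ W := by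
  have hm := mem_extChartAt_target (I := 𝓡 d) x₀
  have ho := isOpen_extChartAt_target (I := 𝓡 d) x₀
  set φ := extChartAt (𝓡 d) x₀ with hφ
  have h0 : inChart X x₀ (φ x₀) ≠ 0 := by
    rw [Ne, inChart_eq_zero_iff X hm, hφ, extChartAt_to_inv]
    exact h
  have hε : 0 < ‖inChart X x₀ (φ x₀)‖ / 2 := half_pos (norm_pos_iff.2 h0)
  have hc : ContinuousAt (inChart X x₀) (φ x₀) :=
    (contDiffOn_inChart X x₀).continuousOn.continuousAt (ho.mem_nhds hm)
  obtain ⟨r, hr, hr'⟩ := Metric.eventually_nhds_iff.1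
    ((hc.norm.eventually_const_lt (half_lt_self (norm_pos_iff.2 h0))).and (ho.mem_nhds hm))
  have hb : ∀ z ∈ Metric.closedBall (φ x₀) (r / 2), dist z (φ x₀) < r := fun z hz =>
    (Metric.mem_closedBall.1 hz).trans_lt (by linarith)
  refine ⟨φ.source ∩ φ ⁻¹' Metric.ball (φ x₀) (r / 2),
    (continuousOn_extChartAt (I := 𝓡 d) x₀).isOpen_inter_preimage
    (isOpen_extChartAt_source x₀) Metric.isOpen_ball,
    ⟨mem_extChartAt_source x₀, Metric.mem_ball_self (half_pos hr)⟩,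
    c1Nhd X x₀ (Metric.closedBall (φ x₀) (r / 2)) (‖inChart X x₀ (φ x₀)‖ / 2),
    c1Nhd_mem_nhds X x₀ (isCompact_closedBall _ _) (fun z hz => (hr' (hb z hz)).2) hε,
    fun Y hY σ hσ hσW => ?_⟩
  have hz := Metric.ball_subset_closedBall hσW.2
  have h1 := (hY _ hz).1
  rw [inChart_sing hσ hσW.1, zero_sub, norm_neg] at h1
  exact lt_asymm h1 (hr' (hb _ hz)).1

variable [IsContMDiffRiemannianBundle (𝓡 d) ∞ (EuclideanSpace ℝ (Fin d))
      (fun x : M => TangentSpace (𝓡 d) x)] [IsRiemannianManifold (𝓡 d) M]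

/-- A finite subcover makes the constants uniform. Each of its sets contains at most one singularity
of `Y`, so their number is bounded independently of `Y`; this bound enters $u(N)$. -/
theorem exists_globalModel [CompactSpace M] (X : VField d M) (hX : AllHyperbolic X)
    {C lam : ℝ} (hC : 0 < C) (hlam : 0 < lam) :
    ∃ V ∈ 𝓝 X, ∃ k r₁ L₀ L₁ P : ℝ, ∃ m : ℕ, 0 < k ∧ 0 < r₁ ∧ 0 < L₀ ∧ L₀ < L₁ ∧ 0 < P ∧
      ∀ Y ∈ V, AllHyperbolic Y ∧ (sing Y).Finite ∧ (sing Y).ncard ≤ m ∧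
        ∀ σ ∈ sing Y, ∀ q, IsAdapted C lam Y σ q →
          ∃ e Ps Pu, LocalModel Y σ q (lam / 2) k r₁ L₀ L₁ P e Ps Pu := by
  have hloc : ∀ x : M, ∃ W, IsOpen W ∧ x ∈ W ∧ ∃ V ∈ 𝓝 X, ∃ k r₁ L₀ L₁ P : ℝ,
      0 < r₁ ∧ 0 < L₀ ∧ 0 ≤ P ∧
      ∀ Y ∈ V, (∀ σ ∈ sing Y, σ ∈ W → ∀ τ ∈ sing Y, τ ∈ W → σ = τ) ∧
      ∀ σ ∈ sing Y, σ ∈ W → IsHyperbolicMap (linearPart Y σ) ∧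
        ∀ q, IsAdapted C lam Y σ q →
          ∃ e Ps Pu, LocalModel Y σ q (lam / 2) k r₁ L₀ L₁ P e Ps Pu := by
    intro x
    by_cases hx : x ∈ sing X
    · exact exists_localModel X (hX x hx) hC hlam
    · obtain ⟨W, hW, hxW, V, hV, h⟩ := exists_nonsingular_nhd X hx
      exact ⟨W, hW, hxW, V, hV, 1, 1, 1, 1, 1, one_pos, one_pos, zero_le_one, fun Y hY =>
        ⟨fun σ hσ hσW => absurd hσW (h Y hY σ hσ), fun σ hσ hσW => absurd hσW (h Y hY σ hσ)⟩⟩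
  choose W hWo hxW V hV k r₁ L₀ L₁ P hr₁ hL₀ hP H using hloc
  obtain ⟨t, ht⟩ := isCompact_univ.elim_finite_subcover W hWo
    fun x _ => mem_iUnion.2 ⟨x, hxW x⟩
  obtain ⟨kk, hkk, hk⟩ := exists_upper t k
  obtain ⟨rr, hrr, hr⟩ := exists_pos_lower t fun i _ => hr₁ i
  obtain ⟨l0, hl0, h0⟩ := exists_pos_lower t fun i _ => hL₀ i
  obtain ⟨l1, hl1, h1⟩ := exists_upper t L₁
  obtain ⟨pp, hpp, hp⟩ := exists_upper t P
  have hcov : ∀ σ : M, ∃ x ∈ t, σ ∈ W x := fun σ => by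
    have := ht (mem_univ σ)
    simp only [mem_iUnion, exists_prop] at this
    exact this
  choose ι hιt hιW using hcov
  refine ⟨⋂ x ∈ t, V x, (biInter_finset_mem t).2 fun x _ => hV x, kk, rr, l0, l0 + l1, pp, t.card,
    hkk, hrr, hl0, by linarith, hpp, fun Y hY => ?_⟩
  have hYV : ∀ x ∈ t, Y ∈ V x := fun x hx => mem_iInter₂.1 hY x hx
  have hinj : InjOn ι (sing Y) := by
    intro σ hσ τ hτ he
    refine (H (ι σ) Y (hYV _ (hιt σ))).1 σ hσ (hιW σ) τ hτ ?_
    rw [he]; exact hιW τ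
  have hmaps : MapsTo ι (sing Y) (t : Set M) := fun σ _ => hιt σ
  have hfin : (sing Y).Finite := Finite.of_injOn hmaps hinj t.finite_toSet
  refine ⟨fun σ hσ => ((H (ι σ) Y (hYV _ (hιt σ))).2 σ hσ (hιW σ)).1, hfin, ?_,
    fun σ hσ q hq => ?_⟩
  · rw [← ncard_coe_finset t]
    exact ncard_le_ncard_of_injOn ι hmaps hinj t.finite_toSet
  · obtain ⟨e, Ps, Pu, h⟩ := ((H (ι σ) Y (hYV _ (hιt σ))).2 σ hσ (hιW σ)).2 q hq
    exact ⟨e, Ps, Pu, h.mono (hk _ (hιt σ)) (hr _ (hιt σ)) (h0 _ (hιt σ))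
      ((h1 _ (hιt σ)).trans (by linarith)) (hP _) (hp _ (hιt σ))⟩

end GlobalModel

/-! ### The sets of the construction in terms of the model -/

section Identification

variable {d : ℕ} {M : Type*} [EMetricSpace M] [ChartedSpace (EuclideanSpace ℝ (Fin d)) M]
  [IsManifold (𝓡 d) ∞ M] [RiemannianBundle (fun x : M => TangentSpace (𝓡 d) x)]
  {Y : VField d M} {σ : M} {q : Seminorm ℝ (EuclideanSpace ℝ (Fin d))} {c k r₁ L₀ L₁ P r : ℝ}
  {e : OpenPartialHomeomorph (EuclideanSpace ℝ (Fin d)) M}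
  {Ps Pu : EuclideanSpace ℝ (Fin d) →L[ℝ] EuclideanSpace ℝ (Fin d)}

/-- `expMap` need not be injective on the whole tangent space, but `hQ` confines the vectors to the
box, where it coincides with the injective chart `e`. So membership can be read off coordinates. -/
theorem LocalModel.mem_expSet (h : LocalModel Y σ q c k r₁ L₀ L₁ P e Ps Pu) (hr : r ≤ r₁)
    {Q : ℝ → ℝ → Prop} (hQ : ∀ a b, Q a b → a ≤ r ∧ b ≤ r) {x : M} :
    (x ∈ expSet Y σ fun a b => Q (q a) (q b)) ↔
      x ∈ e '' splitBox q Ps Pu r ∧ Q (q (Ps (e.symm x))) (q (Pu (e.symm x))) := by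
  obtain ⟨lam, K, κ, hS⟩ := h.splitting
  have hsub := (splitBox_mono hr).trans h.sub
  constructor
  · rintro ⟨a, ha, b, hb, hab, rfl⟩
    have h1 : Ps (a + b) = a := hS.proj_s a ha b hb
    have h2 : Pu (a + b) = b := hS.proj_u a ha b hb
    have hv : a + b ∈ splitBox q Ps Pu r := by
      show q (Ps (a + b)) ≤ r ∧ q (Pu (a + b)) ≤ r
      rw [h1, h2]
      exact hQ _ _ hab
    rw [← h.exp _ (hsub hv), e.left_inv (hsub hv), h1, h2]
    exact ⟨⟨_, hv, rfl⟩, hab⟩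
  · rintro ⟨⟨v, hv, rfl⟩, hab⟩
    rw [e.left_inv (hsub hv)] at hab
    exact ⟨Ps v, hS.mem_s v, Pu v, hS.mem_u v, hab, by rw [hS.add, h.exp v (hsub hv)]⟩

theorem LocalModel.mem_box (h : LocalModel Y σ q c k r₁ L₀ L₁ P e Ps Pu) (hr : r ≤ r₁) {s : ℝ}
    (hs : s ≤ r) {x : M} : x ∈ box Y σ q s ↔ x ∈ e '' splitBox q Ps Pu r ∧
      q (Ps (e.symm x)) < s ∧ q (Pu (e.symm x)) < s := by
  rw [← max_lt_iff]
  exact h.mem_expSet hr (Q := fun a b => max a b < s) fun a b hab =>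
    ⟨(le_max_left _ _).trans (hab.le.trans hs), (le_max_right _ _).trans (hab.le.trans hs)⟩

theorem LocalModel.mem_crossSection (h : LocalModel Y σ q c k r₁ L₀ L₁ P e Ps Pu) (hr : r ≤ r₁)
    {x : M} : x ∈ crossSection Y σ q r ↔ x ∈ e '' splitBox q Ps Pu r ∧
      q (Ps (e.symm x)) = q (Pu (e.symm x)) := by
  refine (h.mem_expSet hr (Q := fun a b => max a b ≤ r ∧ a = b) fun a b hab =>
    max_le_iff.1 hab.1).trans (and_congr_right fun hx => and_iff_right ?_)
  obtain ⟨v, hv, rfl⟩ := hx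
  rw [e.left_inv (h.sub (splitBox_mono hr hv))]
  exact max_le hv.1 hv.2

theorem LocalModel.mem_before (h : LocalModel Y σ q c k r₁ L₀ L₁ P e Ps Pu) (hr : r ≤ r₁)
    {x : M} : (x ∈ expSet Y σ fun a b => max (q a) (q b) ≤ r ∧ q b < q a) ↔
      x ∈ e '' splitBox q Ps Pu r ∧ q (Pu (e.symm x)) < q (Ps (e.symm x)) := by
  refine (h.mem_expSet hr (Q := fun a b => max a b ≤ r ∧ b < a) fun a b hab =>
    max_le_iff.1 hab.1).trans (and_congr_right fun hx => and_iff_right ?_)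
  obtain ⟨v, hv, rfl⟩ := hx
  rw [e.left_inv (h.sub (splitBox_mono hr hv))]
  exact max_le hv.1 hv.2

theorem LocalModel.box_eq (h : LocalModel Y σ q c k r₁ L₀ L₁ P e Ps Pu) (hr : r ≤ r₁) :
    box Y σ q r = innerBox (e '' splitBox q Ps Pu r) (fun x => q (Ps (e.symm x)))
      (fun x => q (Pu (e.symm x))) r := by
  ext x
  exact h.mem_box hr le_rfl

theorem LocalModel.layer_eq (h : LocalModel Y σ q c k r₁ L₀ L₁ P e Ps Pu) (hr : r ≤ r₁) {n : ℕ}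
    (hn : Real.exp (-(n : ℝ)) ≤ r) : layer Y σ q r n = modelLayer (e '' splitBox q Ps Pu r)
      (fun x => q (Ps (e.symm x))) (fun x => q (Pu (e.symm x))) n := by
  have hn' : Real.exp (-((n : ℝ) + 1)) ≤ r := (Real.exp_le_exp.2 (by linarith)).trans hn
  ext x
  rw [layer, mem_inter_iff, Set.mem_sdiff, h.mem_crossSection hr, h.mem_box hr hn, h.mem_box hr hn']
  constructor
  · rintro ⟨⟨h1, h2⟩, ⟨-, -, h3⟩, h4⟩
    refine ⟨h1, h2, not_lt.1 fun h5 => h4 ⟨h1, ?_, h5⟩, h3⟩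
    rwa [h2]
  · rintro ⟨h1, h2, h3, h4⟩
    exact ⟨⟨h1, h2⟩, ⟨h1, lt_of_eq_of_lt h2 h4, h4⟩, fun h5 => not_lt.2 h3 h5.2.2⟩

theorem LocalModel.tPlus_eq (h : LocalModel Y σ q c k r₁ L₀ L₁ P e Ps Pu) (hr : r ≤ r₁) (x : M) :
    tPlus Y σ q r x = exitTime (flow Y) (innerBox (e '' splitBox q Ps Pu r)
      (fun x => q (Ps (e.symm x))) (fun x => q (Pu (e.symm x))) r) x := by
  rw [tPlus, h.box_eq hr, exitTime]

theorem innerBox_comm {K : Set M} {α β : M → ℝ} (r : ℝ) : innerBox K α β r = innerBox K β α r := by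
  ext x
  exact and_congr_right fun _ => and_comm

theorem LocalModel.tMinus_eq (h : LocalModel Y σ q c k r₁ L₀ L₁ P e Ps Pu) (hr : r ≤ r₁) (x : M) :
    tMinus Y σ q r x = exitTime (fun t => flow Y (-t)) (innerBox (e '' splitBox q Ps Pu r)
      (fun x => q (Pu (e.symm x))) (fun x => q (Ps (e.symm x))) r) x := by
  rw [tMinus, h.box_eq hr, exitTime, innerBox_comm]

theorem LocalModel.orbitRegion_eq (h : LocalModel Y σ q c k r₁ L₀ L₁ P e Ps Pu) (hr : r ≤ r₁)
    {N : ℕ} : orbitRegion Y σ q r N =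
      orbitTube (flow Y) (e '' splitBox q Ps Pu r) (fun x => q (Ps (e.symm x)))
        (fun x => q (Pu (e.symm x))) r (⋃ n > N, layer Y σ q r n) := by
  ext y
  simp only [orbitRegion, mem_iUnion, exists_prop, orbitTube, orbitDomain, mem_image,
    mem_ofPred_eq, Prod.exists, h.tPlus_eq hr, h.tMinus_eq hr]
  constructor
  · rintro ⟨n, hn, x, hx, t, ht, rfl⟩
    exact ⟨t, x, ⟨⟨n, hn, hx⟩, ht⟩, rfl⟩
  · rintro ⟨t, x, ⟨⟨n, hn, hx⟩, ht⟩, rfl⟩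
    exact ⟨n, hn, x, hx, t, ht, rfl⟩

theorem flowOut_eq_flowSlab (B : Set M) : flowOut Y B = flowSlab (flow Y) 0 1 B := by
  rw [flowOut, flowSlab, ← image_uncurry_prod]
  rfl

end Identification

/-! ### Exit times, measurability and tower estimate for the actual cells -/

section Tower

variable {d : ℕ} {M : Type*} [EMetricSpace M] [ChartedSpace (EuclideanSpace ℝ (Fin d)) M]
  [IsManifold (𝓡 d) ∞ M] [RiemannianBundle (fun x : M => TangentSpace (𝓡 d) x)]
  {Y : VField d M} {σ : M} {q : Seminorm ℝ (EuclideanSpace ℝ (Fin d))} {c k r₁ L₀ L₁ P r : ℝ}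
  {e : OpenPartialHomeomorph (EuclideanSpace ℝ (Fin d)) M}
  {Ps Pu : EuclideanSpace ℝ (Fin d) →L[ℝ] EuclideanSpace ℝ (Fin d)} {n₀ : ℕ}

theorem exp_neg_le_of_large (hr0 : 0 < r) {n : ℝ} (hn : 2 * (1 + |Real.log r|) ≤ n) :
    Real.exp (-n) ≤ r := by
  have hlog := abs_le.1 (le_refl |Real.log r|)
  rw [← Real.le_log_iff_exp_le hr0]; linarith

theorem LocalModel.times [CompactSpace M] (h : LocalModel Y σ q c k r₁ L₀ L₁ P e Ps Pu) (hr0 : 0 < r)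
    (hr : r ≤ r₁) {n : ℕ} (hn : 2 * (1 + |Real.log r|) < n) {x : M} (hx : x ∈ layer Y σ q r n) :
    tPlus Y σ q r x ∈ Icc (1 / (2 * k) * n) (2 / c * n) ∧
      tMinus Y σ q r x ∈ Icc (1 / (2 * k) * n) (2 / c * n) := by
  have hs := h.saddle r hr0 hr
  rw [h.layer_eq hr (exp_neg_le_of_large hr0 hn.le)] at hx
  rw [h.tPlus_eq hr, h.tMinus_eq hr]
  refine ⟨hs.fwd.exitTime_layer hs.isFlow hr0 hn hx, ?_⟩
  rw [modelLayer_comm] at hx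
  exact hs.bwd.exitTime_layer hs.isFlow.rev hr0 hn hx

variable [MeasurableSpace M]

/-- Measurability and disjointness properties of the cells at a singularity. -/
structure TowerFacts (Y : VField d M) (σ : M) (q : Seminorm ℝ (EuclideanSpace ℝ (Fin d)))
    (r K₀ : ℝ) (n₀ : ℕ) : Prop where
  measurable_region : MeasurableSet (orbitRegion Y σ q r n₀)
  measurable_minus : MeasurableSet (regionMinus Y σ q r n₀)
  measurable_layer : ∀ n > n₀, MeasurableSet (layer Y σ q r n)
  layer_disjoint : ∀ n > n₀, ∀ m > n₀, n ≠ m → Disjoint (layer Y σ q r n) (layer Y σ q r m)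
  measurable_flowOut : ∀ n > n₀, ∀ B ⊆ layer Y σ q r n, MeasurableSet B →
    MeasurableSet (flowOut Y B)
  flowOut_disjoint : ∀ n > n₀, ∀ m > n₀, ∀ B ⊆ layer Y σ q r n, ∀ B' ⊆ layer Y σ q r m,
    Disjoint B B' → Disjoint (flowOut Y B) (flowOut Y B')
  cell_subset : ∀ n > n₀, cell Y σ q r n ⊆ orbitRegion Y σ q r n₀
  cell_minus : ∀ n > n₀, Disjoint (cell Y σ q r n) (regionMinus Y σ q r n₀)
  tower : ∀ μ : Measure M, IsInvariant Y μ → ∀ N ≥ n₀,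
    ∑' m : Ioi N, (⌊K₀ * m⌋₊ : ℝ≥0∞) * μ (cell Y σ q r m) ≤ μ (orbitRegion Y σ q r N)

/-- The term in $|\log r|$ puts the layers into the box of size $r$. The term $2k$ makes the exit
time at least 1, so that the cells $\phi_{[0,1)}(D_n)$ do not leave it. -/
theorem LocalModel.towerFacts [CompactSpace M] [BorelSpace M]
    (h : LocalModel Y σ q c k r₁ L₀ L₁ P e Ps Pu)
    (hr0 : 0 < r) (hr : r ≤ r₁) (hn₀ : 2 * (1 + |Real.log r|) + 2 * k ≤ n₀) :
    TowerFacts Y σ q r (1 / (2 * k)) n₀ := by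
  have hs := h.saddle r hr0 hr
  have hk : 0 < k := hs.fwd.k_pos
  set Φ := flow Y with hΦ
  set α : M → ℝ := fun x => q (Ps (e.symm x)) with hα
  set β : M → ℝ := fun x => q (Pu (e.symm x)) with hβ
  set Kr := e '' splitBox q Ps Pu r with hKr
  have hexp : Real.exp (-(n₀ : ℝ)) ≤ r := exp_neg_le_of_large hr0 (by linarith)
  have hlog := abs_nonneg (Real.log r)
  have hle : ∀ n > n₀, layer Y σ q r n = modelLayer Kr α β n := fun n hn => by
    refine h.layer_eq hr ((Real.exp_le_exp.2 ?_).trans hexp)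
    have : (n₀ : ℝ) ≤ n := by exact_mod_cast (le_of_lt hn)
    linarith
  have hlm : ∀ n > n₀, MeasurableSet (layer Y σ q r n) := fun n hn => by
    rw [hle n hn]; exact hs.fwd.measurableSet_layer n
  have hls : ∀ n > n₀, layer Y σ q r n ⊆ sectionPart Kr α β r := fun n hn => by
    rw [hle n hn]; exact modelLayer_subset (le_of_lt hn) hexp
  have hnr : ∀ n > n₀, (n₀ : ℝ) < n := fun n hn => by exact_mod_cast hn
  have htime : ∀ n > n₀, ∀ x ∈ layer Y σ q r n,
      1 / (2 * k) * n ≤ exitTime Φ (innerBox Kr α β r) x := fun n hn x hx => by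
    rw [hle n hn] at hx
    exact (hs.fwd.exitTime_layer hs.isFlow hr0 (by linarith [hnr n hn]) hx).1
  have h1 : ∀ n > n₀, ∀ x ∈ layer Y σ q r n, (1 : ℝ) ≤ exitTime Φ (innerBox Kr α β r) x :=
    fun n hn x hx => by
      refine le_trans ?_ (htime n hn x hx)
      rw [div_mul_eq_mul_div, one_mul, le_div_iff₀ (by positivity)]
      linarith [hnr n hn]
  have hdis : ∀ n > n₀, ∀ m > n₀, n ≠ m →
      Disjoint (layer Y σ q r n) (layer Y σ q r m) := by
    have key : ∀ n m : ℕ, n < m → Disjoint (modelLayer Kr α β n) (modelLayer Kr α β m) := by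
      intro n m hnm
      rw [disjoint_left]
      intro x hx hx'
      have a1 := hx.2.2.1.trans_lt hx'.2.2.2
      rw [Real.exp_lt_exp] at a1
      have a2 : (n : ℝ) + 1 ≤ m := by exact_mod_cast hnm
      linarith
    intro n hn m hm hne
    rw [hle n hn, hle m hm]
    rcases lt_or_gt_of_ne hne with h' | h'
    · exact key n m h'
    · exact (key m n h').symm
  have hOs : ∀ N ≥ n₀, (⋃ n > N, layer Y σ q r n) ⊆ sectionPart Kr α β r := fun N hN =>
    iUnion₂_subset fun n hn => hls n (lt_of_le_of_lt hN hn)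
  have hO : MeasurableSet (orbitRegion Y σ q r n₀) := by
    rw [h.orbitRegion_eq hr]
    refine hs.measurableSet_image (hs.measurableSet_domain ?_ (hOs n₀ le_rfl))
      (orbitDomain_mono (hOs n₀ le_rfl))
    exact MeasurableSet.iUnion fun n => MeasurableSet.iUnion fun hn => hlm n hn
  have hbefore : (expSet Y σ fun a b => max (q a) (q b) ≤ r ∧ q b < q a) =
      {x ∈ Kr | (α x, β x) ∈ {p : ℝ × ℝ | p.2 < p.1}} := by
    ext x
    exact h.mem_before hr
  have hcell : ∀ n > n₀, ∀ x ∈ cell Y σ q r n, x ∈ Kr ∧ α x ≤ β x := fun n hn x hx => by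
    rw [cell, flowOut_eq_flowSlab] at hx
    exact hs.slab_subset_le (hls n hn) le_rfl (h1 n hn) hx
  refine ⟨hO, ?_, hlm, hdis, ?_, ?_, ?_, ?_, ?_⟩
  · refine hO.inter ?_
    rw [hbefore]
    exact measurableSet_of_continuousOn_pair hs.fwd.isCompact.isClosed hs.fwd.contα hs.fwd.contβ
      (measurableSet_lt measurable_snd measurable_fst)
  · intro n hn B hB hBm
    rw [flowOut_eq_flowSlab]
    exact hs.measurableSet_slab hBm (hB.trans (hls n hn)) le_rfl fun x hx => h1 n hn x (hB hx)
  · intro n hn m hm B hB B' hB' hd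
    rw [flowOut_eq_flowSlab, flowOut_eq_flowSlab]
    exact hs.disjoint_slab (hB.trans (hls n hn)) (hB'.trans (hls m hm)) le_rfl le_rfl
      (fun x hx => h1 n hn x (hB hx)) (fun x hx => h1 m hm x (hB' hx)) (Or.inr hd)
  · intro n hn
    rw [cell, flowOut_eq_flowSlab, h.orbitRegion_eq hr]
    refine image_mono ((hs.slab_subset (hls n hn) le_rfl (h1 n hn)).trans (orbitDomain_mono ?_))
    exact subset_biUnion_of_mem (u := fun n => layer Y σ q r n) hn
  · intro n hn
    rw [disjoint_left]
    intro x hx hx'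
    have h2 : x ∈ {x ∈ Kr | (α x, β x) ∈ {p : ℝ × ℝ | p.2 < p.1}} := hbefore ▸ hx'.2
    exact not_lt.2 (hcell n hn x hx).2 h2.2
  · intro μ hμ N hN
    have := hs.tower (μ := μ) hμ (J := Ioi N) (D := fun m => layer Y σ q r m)
      (w := fun m => ⌊1 / (2 * k) * m⌋₊)
      (fun m hm => hlm m (lt_of_le_of_lt hN hm)) (fun m hm => hls m (lt_of_le_of_lt hN hm))
      (fun m hm n hn => hdis m (lt_of_le_of_lt hN hm) n (lt_of_le_of_lt hN hn))
      (fun m hm x hx => (Nat.floor_le (by positivity)).trans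
        (htime m (lt_of_le_of_lt hN hm) x hx))
      (O := orbitRegion Y σ q r N) (fun m hm => by
        rw [h.orbitRegion_eq hr]
        exact image_mono (orbitDomain_mono
          (subset_biUnion_of_mem (u := fun n => layer Y σ q r n) hm)))
    simpa only [cell, flowOut_eq_flowSlab] using this

end Tower

/-! ### Finiteness of joins -/

section Finite

variable {M : Type*}

theorem finite_joinFamily {ι : Type*} {S : Set ι} (hS : S.Finite) {P : ι → Set (Set M)}
    (hP : ∀ i ∈ S, (P i).Finite) : (joinFamily S P).Finite := by
  have : Finite S := hS
  refine ((Set.Finite.pi' fun i : S => hP i i.2).image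
    fun g : S → Set M => ⋂ i, g i).subset ?_
  rintro A ⟨f, hf, rfl⟩
  refine ⟨fun i => f i, fun i => hf i i.2, ?_⟩
  simp [iInter_subtype]

theorem finite_joinTwo {P Q : Set (Set M)} (hP : P.Finite) (hQ : Q.Finite) :
    (joinTwo P Q).Finite := hP.image2 _ hQ

end Finite

/-! ### The partition at a singularity and its merged tail -/

section LocalPartition

variable {d : ℕ} {M : Type*} [EMetricSpace M] [ChartedSpace (EuclideanSpace ℝ (Fin d)) M]
  [IsManifold (𝓡 d) ∞ M] [RiemannianBundle (fun x : M => TangentSpace (𝓡 d) x)]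
  [MeasurableSpace M] {Y : VField d M} {p : M → Seminorm ℝ (EuclideanSpace ℝ (Fin d))}
  {c : Params} {K₀ : ℝ} {σ : M}

theorem sUnion_flowOut_image (𝒮 : Set (Set M)) :
    ⋃₀ (flowOut Y '' 𝒮) = flowOut Y (⋃₀ 𝒮) := by
  ext x
  simp only [flowOut, mem_sUnion, mem_image, exists_exists_and_eq_and, mem_image2]
  constructor
  · rintro ⟨B, hB, t, ht, y, hy, rfl⟩
    exact ⟨t, ht, y, ⟨B, hB, hy⟩, rfl⟩
  · rintro ⟨t, ht, y, ⟨B, hB, hy⟩, rfl⟩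
    exact ⟨B, hB, t, ht, y, hy, rfl⟩

theorem Choices.sUnion_cells (S : Choices Y p c) (hσ : σ ∈ sing Y) {n : ℕ} (hn : n > c.n₀) :
    ⋃₀ S.cells σ n = cell Y σ (p σ) c.r n := by
  rw [Choices.cells, sUnion_flowOut_image, (S.slab_part σ hσ n hn).2.2.2, cell]

theorem Choices.finite_cells (S : Choices Y p c) (hσ : σ ∈ sing Y) {n : ℕ} (hn : n > c.n₀) :
    (S.cells σ n).Finite := (S.slab_part σ hσ n hn).1.image _

theorem Choices.slab_subset (S : Choices Y p c) (hσ : σ ∈ sing Y) {n : ℕ} (hn : n > c.n₀)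
    {B : Set M} (hB : B ∈ S.slab σ n) : B ⊆ layer Y σ (p σ) c.r n := by
  rw [← (S.slab_part σ hσ n hn).2.2.2]
  exact subset_sUnion_of_mem hB

theorem Choices.cells_subset (S : Choices Y p c) (hσ : σ ∈ sing Y) {n : ℕ} (hn : n > c.n₀)
    {A : Set M} (hA : A ∈ S.cells σ n) : A ⊆ cell Y σ (p σ) c.r n := by
  rw [← S.sUnion_cells hσ hn]
  exact subset_sUnion_of_mem hA

theorem Choices.cells_disjoint (S : Choices Y p c) (hσ : σ ∈ sing Y)
    (hT : TowerFacts Y σ (p σ) c.r K₀ c.n₀) {n m : ℕ} (hn : n > c.n₀) (hm : m > c.n₀)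
    (hnm : n ≠ m) {A A' : Set M} (hA : A ∈ S.cells σ n) (hA' : A' ∈ S.cells σ m) :
    Disjoint A A' := by
  obtain ⟨B, hB, rfl⟩ := hA
  obtain ⟨B', hB', rfl⟩ := hA'
  have h1 := S.slab_subset hσ hn hB
  have h2 := S.slab_subset hσ hm hB'
  exact hT.flowOut_disjoint n hn m hm B h1 B' h2
    ((hT.layer_disjoint n hn m hm hnm).mono h1 h2)

theorem Choices.cells_pairwise (S : Choices Y p c) (hσ : σ ∈ sing Y)
    (hT : TowerFacts Y σ (p σ) c.r K₀ c.n₀) {n : ℕ} (hn : n > c.n₀) :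
    (S.cells σ n).PairwiseDisjoint id := by
  rintro _ ⟨B, hB, rfl⟩ _ ⟨B', hB', rfl⟩ hne
  exact hT.flowOut_disjoint n hn n hn B (S.slab_subset hσ hn hB) B' (S.slab_subset hσ hn hB')
    ((S.slab_part σ hσ n hn).2.2.1 hB hB' fun h => hne (by rw [h]))

theorem Choices.measurableSet_cells (S : Choices Y p c) (hσ : σ ∈ sing Y)
    (hT : TowerFacts Y σ (p σ) c.r K₀ c.n₀) {n : ℕ} (hn : n > c.n₀) {A : Set M}
    (hA : A ∈ S.cells σ n) : MeasurableSet A := by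
  obtain ⟨B, hB, rfl⟩ := hA
  exact hT.measurable_flowOut n hn B (S.slab_subset hσ hn hB) ((S.slab_part σ hσ n hn).2.1 B hB)

theorem Choices.outer_disjoint (S : Choices Y p c) (hσ : σ ∈ sing Y)
    (hT : TowerFacts Y σ (p σ) c.r K₀ c.n₀) {n : ℕ} (hn : n > c.n₀) {A A' : Set M}
    (hA : A ∈ outerCells Y p c σ) (hA' : A' ∈ S.cells σ n) : Disjoint A A' := by
  have h1 := S.cells_subset hσ hn hA'
  rcases hA with rfl | rfl | rfl
  · exact ((hT.cell_minus n hn).mono_left h1).symm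
  · rw [disjoint_left]
    rintro x ⟨-, hx⟩ hx'
    exact hx (Or.inr (mem_iUnion₂.2 ⟨n, hn, h1 hx'⟩))
  · rw [disjoint_left]
    intro x hx hx'
    exact hx (hT.cell_subset n hn (h1 hx'))

theorem TowerFacts.measurableSet_cell (hT : TowerFacts Y σ (p σ) c.r K₀ c.n₀) {n : ℕ}
    (hn : n > c.n₀) : MeasurableSet (cell Y σ (p σ) c.r n) :=
  hT.measurable_flowOut n hn _ Subset.rfl (hT.measurable_layer n hn)

theorem Choices.isCountablePartition_localPart (S : Choices Y p c) (hσ : σ ∈ sing Y)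
    (hT : TowerFacts Y σ (p σ) c.r K₀ c.n₀) : IsCountablePartition (S.localPart σ) where
  countable := by
    refine Countable.union ?_ (by simp [outerCells])
    exact countable_iUnion fun n => countable_iUnion fun hn => (S.finite_cells hσ hn).countable
  measurable := by
    have hplus : MeasurableSet (regionPlus Y σ (p σ) c.r c.n₀) :=
      hT.measurable_region.diff (hT.measurable_minus.union
        (MeasurableSet.iUnion fun n => MeasurableSet.iUnion fun hn => hT.measurableSet_cell hn))
    rintro A (hA | rfl | rfl | rfl)
    · obtain ⟨n, hn, hA⟩ := mem_iUnion₂.1 hA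
      exact S.measurableSet_cells hσ hT hn hA
    · exact hT.measurable_minus
    · exact hplus
    · exact hT.measurable_region.compl
  disjoint := by
    have hmp : Disjoint (regionMinus Y σ (p σ) c.r c.n₀) (regionPlus Y σ (p σ) c.r c.n₀) :=
      disjoint_left.2 fun x hx hx' => hx'.2 (Or.inl hx)
    have hmo : Disjoint (regionMinus Y σ (p σ) c.r c.n₀) (orbitRegion Y σ (p σ) c.r c.n₀)ᶜ :=
      disjoint_left.2 fun x hx hx' => hx' hx.1
    have hpo : Disjoint (regionPlus Y σ (p σ) c.r c.n₀) (orbitRegion Y σ (p σ) c.r c.n₀)ᶜ :=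
      disjoint_left.2 fun x hx hx' => hx' hx.1
    rintro A (hA | hA) A' (hA' | hA') hne
    · obtain ⟨n, hn, hA⟩ := mem_iUnion₂.1 hA
      obtain ⟨m, hm, hA'⟩ := mem_iUnion₂.1 hA'
      by_cases hnm : n = m
      · subst hnm
        exact S.cells_pairwise hσ hT hn hA hA' hne
      · exact S.cells_disjoint hσ hT hn hm hnm hA hA'
    · obtain ⟨n, hn, hA⟩ := mem_iUnion₂.1 hA
      exact (S.outer_disjoint hσ hT hn hA' hA).symm
    · obtain ⟨n, hn, hA'⟩ := mem_iUnion₂.1 hA'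
      exact S.outer_disjoint hσ hT hn hA hA'
    · rcases hA with rfl | rfl | rfl <;> rcases hA' with rfl | rfl | rfl
      · exact absurd rfl hne
      · exact hmp
      · exact hmo
      · exact hmp.symm
      · exact absurd rfl hne
      · exact hpo
      · exact hmo.symm
      · exact hpo.symm
      · exact absurd rfl hne
  sUnion := by
    refine eq_univ_of_forall fun x => ?_
    have ho : ∀ A ∈ outerCells Y p c σ, x ∈ A → x ∈ ⋃₀ S.localPart σ := fun A hA hx =>
      ⟨A, Or.inr hA, hx⟩
    by_cases hx : x ∈ orbitRegion Y σ (p σ) c.r c.n₀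
    · by_cases hm : x ∈ regionMinus Y σ (p σ) c.r c.n₀
      · exact ho _ (Or.inl rfl) hm
      · by_cases hc : x ∈ ⋃ n > c.n₀, cell Y σ (p σ) c.r n
        · obtain ⟨n, hn, hxn⟩ := mem_iUnion₂.1 hc
          rw [← S.sUnion_cells hσ hn] at hxn
          obtain ⟨A, hA, hxA⟩ := hxn
          exact ⟨A, Or.inl (mem_iUnion₂.2 ⟨n, hn, hA⟩), hxA⟩
        · exact ho _ (Or.inr (Or.inl rfl)) ⟨hx, fun h => h.elim hm hc⟩
    · exact ho _ (Or.inr (Or.inr rfl)) hx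

/-- The elements of the local partition that are not merged. -/
def Choices.head (S : Choices Y p c) (N : ℕ) (σ : M) : Set (Set M) :=
  (⋃ n ∈ Ioc c.n₀ N, S.cells σ n) ∪ outerCells Y p c σ

/-- The elements of the local partition that are merged. -/
def Choices.tail (S : Choices Y p c) (N : ℕ) (σ : M) : Set (Set M) := ⋃ n ∈ Ioi N, S.cells σ n

theorem Choices.head_union_tail (S : Choices Y p c) {N : ℕ} (hN : c.n₀ < N) (σ : M) :
    S.head N σ ∪ S.tail N σ = S.localPart σ := by
  ext A
  simp only [Choices.head, Choices.tail, Choices.localPart, mem_union, mem_iUnion, mem_Ioc, mem_Ioi,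
    exists_prop]
  constructor
  · rintro ((⟨n, hn, hA⟩ | hA) | ⟨n, hn, hA⟩)
    · exact Or.inl ⟨n, hn.1, hA⟩
    · exact Or.inr hA
    · exact Or.inl ⟨n, hN.trans hn, hA⟩
  · rintro (⟨n, hn, hA⟩ | hA)
    · rcases le_or_gt n N with h | h
      · exact Or.inl (Or.inl ⟨n, ⟨hn, h⟩, hA⟩)
      · exact Or.inr ⟨n, h, hA⟩
    · exact Or.inl (Or.inr hA)

theorem Choices.sUnion_tail (S : Choices Y p c) {N : ℕ} (hN : c.n₀ < N) (hσ : σ ∈ sing Y) :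
    ⋃₀ S.tail N σ = ⋃ m > N, cell Y σ (p σ) c.r m := by
  rw [Choices.tail, sUnion_iUnion]
  refine iUnion_congr fun n => ?_
  rw [sUnion_iUnion]
  exact iUnion_congr fun hn => S.sUnion_cells hσ (hN.trans hn)

theorem Choices.finite_head (S : Choices Y p c) {N : ℕ} (hσ : σ ∈ sing Y) :
    (S.head N σ).Finite := by
  refine Finite.union ?_ (by simp [outerCells])
  exact (finite_Ioc _ _).biUnion fun n hn => S.finite_cells hσ hn.1

theorem Choices.head_disjoint_tail (S : Choices Y p c) {N : ℕ} (hN : c.n₀ < N) (hσ : σ ∈ sing Y)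
    (hT : TowerFacts Y σ (p σ) c.r K₀ c.n₀) {A B : Set M} (hA : A ∈ S.head N σ)
    (hB : B ∈ S.tail N σ) : Disjoint A B := by
  obtain ⟨m, hm, hB⟩ := mem_iUnion₂.1 hB
  rcases hA with hA | hA
  · obtain ⟨n, hn, hA⟩ := mem_iUnion₂.1 hA
    exact S.cells_disjoint hσ hT hn.1 (hN.trans hm) (hn.2.trans_lt hm).ne hA hB
  · exact S.outer_disjoint hσ hT (hN.trans hm) hA hB

theorem Choices.localPartN_eq (S : Choices Y p c) {N : ℕ} (hN : c.n₀ < N) (hσ : σ ∈ sing Y) :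
    S.localPartN N σ = S.head N σ ∪ {⋃₀ S.tail N σ} := by
  rw [S.sUnion_tail hN hσ]; rfl

theorem Choices.isCountablePartition_regPart [BorelSpace M] (S : Choices Y p c) :
    IsCountablePartition S.regPart where
  countable := (S.reg_part.1.insert _).countable
  measurable := by
    rintro A (rfl | hA)
    · exact isClosed_closure.measurableSet.compl
    · exact S.reg_part.2.1 A hA
  disjoint := by
    have h : ∀ A ∈ S.reg, Disjoint A (Creg Y p c)ᶜ := fun A hA => by
      rw [disjoint_compl_right_iff_subset]
      conv_rhs => rw [← S.reg_part.2.2.2]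
      exact subset_sUnion_of_mem hA
    rintro A (rfl | hA) A' (rfl | hA') hne
    · exact absurd rfl hne
    · exact (h A' hA').symm
    · exact h A hA
    · exact S.reg_part.2.2.1 hA hA' hne
  sUnion := by
    rw [Choices.regPart, sUnion_insert, S.reg_part.2.2.2, compl_union_self]

/-- Sending a slab to its centre is injective: the centre is in the closure of the layer, so its
half-radius ball contains a point of the layer, which belongs to every slab with that centre. -/
theorem Choices.ncard_slab_le (S : Choices Y p c) (hσ : σ ∈ sing Y) {n : ℕ} (hn : n > c.n₀)
    (hr : 0 < c.radius n) : (S.slab σ n).ncard ≤ (S.net σ n).card := by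
  have h : ∀ B : Set M, ∃ x, B ∈ S.slab σ n → x ∈ S.net σ n ∧
      {y | edist y x < ENNReal.ofReal (c.radius n / 2)} ∩ layer Y σ (p σ) c.r n ⊆ B := by
    intro B
    by_cases hB : B ∈ S.slab σ n
    · obtain ⟨x, hx, h1, -⟩ := S.slab_ball σ hσ n hn B hB
      exact ⟨x, fun _ => ⟨hx, h1⟩⟩
    · exact ⟨σ, fun h => absurd h hB⟩
  choose g hg using h
  rw [← ncard_coe_finset]
  refine ncard_le_ncard_of_injOn g (fun B hB => (hg B hB).1) ?_ (S.net σ n).finite_toSet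
  intro B hB B' hB' he
  have h1 := (S.net_max σ hσ n hn).1 (hg B hB).1
  obtain ⟨y, hy, hy'⟩ := EMetric.mem_closure_iff.1 h1 (ENNReal.ofReal (c.radius n / 2))
    (ENNReal.ofReal_pos.2 (half_pos hr))
  rw [edist_comm] at hy'
  by_contra hne
  exact disjoint_left.1 ((S.slab_part σ hσ n hn).2.2.1 hB hB' hne) ((hg B hB).2 ⟨hy', hy⟩)
    ((hg B' hB').2 ⟨he ▸ hy', hy⟩)

/-- The tangent line to the concave function $-x\log x$ at $x=e^{-a-1}$. The free slope `a` lets the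
additive error beat the number of cells. -/
theorem negMulLog_le_affine {x : ℝ} (hx : 0 ≤ x) (a : ℝ) :
    Real.negMulLog x ≤ a * x + Real.exp (-a - 1) := by
  rcases hx.eq_or_lt with rfl | hx
  · simp [Real.exp_nonneg]
  · have h1 := Real.add_one_le_exp (-a - 1 - Real.log x)
    rw [Real.exp_sub, Real.exp_log hx, le_div_iff₀ hx] at h1
    rw [Real.negMulLog]
    linarith

theorem Choices.tsum_cells_le (S : Choices Y p c) (hσ : σ ∈ sing Y)
    (hT : TowerFacts Y σ (p σ) c.r K₀ c.n₀) {μ : Measure M} [IsFiniteMeasure μ] {n : ℕ}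
    (hn : n > c.n₀) {b : ℝ} (hb : 0 ≤ b) (hcard : ((S.slab σ n).ncard : ℝ) ≤ Real.exp b) :
    ∑' A : S.cells σ n, ENNReal.ofReal (Real.negMulLog (μ.real (A : Set M))) ≤
      ENNReal.ofReal (b + n) * μ (cell Y σ (p σ) c.r n) + ENNReal.ofReal (Real.exp (-n - 1)) := by
  have hfin := S.finite_cells hσ hn
  have : Fintype (S.cells σ n) := hfin.fintype
  have h1 : ∀ A : S.cells σ n, ENNReal.ofReal (Real.negMulLog (μ.real (A : Set M))) ≤
      ENNReal.ofReal (b + n) * μ A + ENNReal.ofReal (Real.exp (-(b + n) - 1)) := by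
    intro A
    -- Slope $b+n$: at most $e^b$ cells, each with error $e^{-(b+n)-1}$, leave the summable total
    -- $e^{-n-1}$.
    have h2 := negMulLog_le_affine (measureReal_nonneg (μ := μ) (s := (A : Set M))) (b + n)
    refine (ENNReal.ofReal_le_ofReal h2).trans ?_
    rw [ENNReal.ofReal_add (mul_nonneg (by positivity) measureReal_nonneg) (Real.exp_nonneg _),
      ENNReal.ofReal_mul (by positivity), ofReal_measureReal]
  have hμ : ∑' A : S.cells σ n, μ (A : Set M) = μ (cell Y σ (p σ) c.r n) := by
    rw [← S.sUnion_cells hσ hn]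
    exact (measure_sUnion hfin.countable (S.cells_pairwise hσ hT hn)
      fun A hA => S.measurableSet_cells hσ hT hn hA).symm
  refine (ENNReal.tsum_le_tsum h1).trans ?_
  rw [ENNReal.tsum_add, ENNReal.tsum_mul_left, hμ]
  refine add_le_add le_rfl ?_
  rw [tsum_fintype, Finset.sum_const, nsmul_eq_mul, Finset.card_univ, ← ENNReal.ofReal_natCast,
    ← ENNReal.ofReal_mul (by positivity)]
  refine ENNReal.ofReal_le_ofReal ?_
  have h2 : (Fintype.card (S.cells σ n) : ℝ) ≤ Real.exp b := by
    refine le_trans ?_ hcard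
    rw [← Nat.card_eq_fintype_card, Nat.card_coe_set_eq]
    exact_mod_cast ncard_image_le (S.slab_part σ hσ n hn).1
  calc _ ≤ Real.exp b * Real.exp (-(b + n) - 1) :=
        mul_le_mul_of_nonneg_right h2 (Real.exp_nonneg _)
    _ = Real.exp (-n - 1) := by rw [← Real.exp_add]; congr 1; ring

end LocalPartition

/-! ### Entropy of the tail and the final estimate -/

section TailEntropy

/-- The error term of the tail estimate. -/
def tailError (K₀ A₀ : ℝ) (N : ℕ) : ℝ :=
  2 / K₀ * (A₀ / N) + Real.exp (-(N / 2 : ℝ)) * (1 - Real.exp (-(1 / 2)))⁻¹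

theorem tendsto_tailError (K₀ A₀ : ℝ) : Tendsto (tailError K₀ A₀) atTop (𝓝 0) := by
  have h1 : Tendsto (fun N : ℕ => 2 / K₀ * (A₀ / N)) atTop (𝓝 (2 / K₀ * 0)) :=
    (tendsto_const_div_atTop_nhds_zero_nat A₀).const_mul _
  have h2 : Tendsto (fun N : ℕ => Real.exp (-(N / 2 : ℝ)) * (1 - Real.exp (-(1 / 2)))⁻¹) atTop
      (𝓝 (0 * (1 - Real.exp (-(1 / 2)))⁻¹)) := by
    refine Tendsto.mul_const _ (Real.tendsto_exp_neg_atTop_nhds_zero.comp ?_)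
    exact tendsto_natCast_atTop_atTop.atTop_div_const two_pos
  have h := h1.add h2
  rw [mul_zero, zero_mul, add_zero] at h
  exact h

theorem exp_neg_half_lt_one : Real.exp (-(1 / 2)) < 1 := by
  rw [Real.exp_lt_one_iff]; norm_num

theorem tailError_nonneg {K₀ A₀ : ℝ} (hK₀ : 0 < K₀) (hA₀ : 0 ≤ A₀) (N : ℕ) :
    0 ≤ tailError K₀ A₀ N := by
  have h : 0 < 1 - Real.exp (-(1 / 2)) := sub_pos.2 exp_neg_half_lt_one
  unfold tailError
  positivity

theorem tsum_exp_tail_le (N : ℕ) : ∑' m : Ioi N, ENNReal.ofReal (Real.exp (-(m : ℕ) - 1)) ≤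
    ENNReal.ofReal (Real.exp (-(N / 2 : ℝ)) * (1 - Real.exp (-(1 / 2)))⁻¹) := by
  have h0 : 0 ≤ Real.exp (-(1 / 2)) := Real.exp_nonneg _
  -- For $m>N$ half of the exponent gives $e^{-N/2}$, the other half a geometric series.
  have h1 : ∀ m : Ioi N, ENNReal.ofReal (Real.exp (-(m : ℕ) - 1)) ≤
      ENNReal.ofReal (Real.exp (-(N / 2 : ℝ))) * ENNReal.ofReal (Real.exp (-(1 / 2)) ^ (m : ℕ)) := by
    rintro ⟨m, hm⟩
    rw [← ENNReal.ofReal_mul (Real.exp_nonneg _), ← Real.exp_nat_mul, ← Real.exp_add]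
    refine ENNReal.ofReal_le_ofReal (Real.exp_le_exp.2 ?_)
    have : (N : ℝ) < m := by exact_mod_cast hm
    simp only
    linarith
  refine (ENNReal.tsum_le_tsum h1).trans ?_
  rw [ENNReal.tsum_mul_left, ENNReal.ofReal_mul (Real.exp_nonneg _)]
  refine mul_le_mul_right ?_ _
  refine (ENNReal.tsum_comp_le_tsum_of_injective Subtype.val_injective
    fun m : ℕ => ENNReal.ofReal (Real.exp (-(1 / 2)) ^ m)).trans ?_
  rw [← ENNReal.ofReal_tsum_of_nonneg (fun m => pow_nonneg h0 m)
    (summable_geometric_of_lt_one h0 exp_neg_half_lt_one),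
    tsum_geometric_of_lt_one h0 exp_neg_half_lt_one]

/-- $\lfloor x\rfloor\ge x/2$ for $x\ge1$, and $A_0\le(A_0/N)m$. The second inequality moves `A₀`,
hence `β`, out of the leading constant and into a term that vanishes as $N\to\infty$. -/
theorem affine_le_floor {K₀ A₀ A₁ : ℝ} (hK₀ : 0 < K₀) (hA₀ : 0 ≤ A₀) (hA₁ : 0 ≤ A₁) {N m : ℕ}
    (hN : 0 < N) (hm : N < m) (h1 : 1 ≤ K₀ * m) :
    A₁ * m + A₀ + m ≤ (2 / K₀ * (A₁ + 1) + 2 / K₀ * (A₀ / N)) * ⌊K₀ * m⌋₊ := by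
  have hN' : (0 : ℝ) < N := by exact_mod_cast hN
  have hm' : (N : ℝ) ≤ m := by exact_mod_cast hm.le
  have hf : K₀ * m ≤ 2 * ⌊K₀ * m⌋₊ := by
    have h2 := Nat.lt_floor_add_one (K₀ * m)
    have h3 : (1 : ℝ) ≤ ⌊K₀ * m⌋₊ := by exact_mod_cast (Nat.one_le_floor_iff _).2 h1
    linarith
  have h4 : (m : ℝ) ≤ 2 / K₀ * ⌊K₀ * m⌋₊ := by
    rw [div_mul_eq_mul_div, le_div_iff₀ hK₀]; linarith
  have h5 : A₀ ≤ A₀ / N * m := by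
    rw [div_mul_eq_mul_div, le_div_iff₀ hN']
    exact mul_le_mul_of_nonneg_left hm' hA₀
  calc A₁ * m + A₀ + m ≤ (A₁ + 1 + A₀ / N) * m := by linarith
    _ ≤ (A₁ + 1 + A₀ / N) * (2 / K₀ * ⌊K₀ * m⌋₊) :=
        mul_le_mul_of_nonneg_left h4 (by positivity)
    _ = _ := by ring

variable {d : ℕ} {M : Type*} [EMetricSpace M] [ChartedSpace (EuclideanSpace ℝ (Fin d)) M]
  [IsManifold (𝓡 d) ∞ M] [RiemannianBundle (fun x : M => TangentSpace (𝓡 d) x)]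
  [MeasurableSpace M] {Y : VField d M} {p : M → Seminorm ℝ (EuclideanSpace ℝ (Fin d))}
  {c : Params} {K₀ : ℝ} {σ : M}

/-- The slope in the tangent line bound is affine in $m$, hence a multiple of the tower height
$\lfloor K_0m\rfloor$. The tower estimate then sums the products with $\mu(C_m)$ to a multiple of
$\mu(O^N)$. -/
theorem Choices.tail_entropy_le (S : Choices Y p c) (hσ : σ ∈ sing Y)
    (hT : TowerFacts Y σ (p σ) c.r K₀ c.n₀) (hK₀ : 0 < K₀) {A₀ A₁ : ℝ} (hA₀ : 0 ≤ A₀)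
    (hA₁ : 0 ≤ A₁) {N : ℕ} (hN : c.n₀ < N) (h1 : ∀ m > c.n₀, 1 ≤ K₀ * m)
    (hcard : ∀ m > c.n₀, ((S.slab σ m).ncard : ℝ) ≤ Real.exp (A₁ * m + A₀)) (μ : Measure M)
    [IsProbabilityMeasure μ] (hμ : IsInvariant Y μ) :
    ∑' A : S.tail N σ, ENNReal.ofReal (Real.negMulLog (μ.real (A : Set M))) ≤
      ENNReal.ofReal (2 / K₀ * (A₁ + 1) * μ.real (orbitRegion Y σ (p σ) c.r N) +
        tailError K₀ A₀ N) := by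
  set O := orbitRegion Y σ (p σ) c.r N with hO
  have hN0 : 0 < N := (Nat.zero_le _).trans_lt hN
  set B := 2 / K₀ * (A₁ + 1) + 2 / K₀ * (A₀ / N) with hB
  have hB0 : 0 ≤ B := by positivity
  have hterm : ∀ m : Ioi N,
      ∑' A : S.cells σ m, ENNReal.ofReal (Real.negMulLog (μ.real (A : Set M))) ≤
      ENNReal.ofReal B * ((⌊K₀ * (m : ℕ)⌋₊ : ℝ≥0∞) * μ (cell Y σ (p σ) c.r m)) +
        ENNReal.ofReal (Real.exp (-(m : ℕ) - 1)) := by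
    rintro ⟨m, hm⟩
    have hm0 : m > c.n₀ := hN.trans hm
    refine (S.tsum_cells_le hσ hT (μ := μ) hm0 (by positivity) (hcard m hm0)).trans ?_
    refine add_le_add ?_ le_rfl
    rw [← mul_assoc]
    refine mul_le_mul_left ?_ _
    rw [← ENNReal.ofReal_natCast, ← ENNReal.ofReal_mul hB0]
    exact ENNReal.ofReal_le_ofReal (affine_le_floor hK₀ hA₀ hA₁ hN0 hm (h1 m hm0))
  have hsum : ∑' A : S.tail N σ, ENNReal.ofReal (Real.negMulLog (μ.real (A : Set M))) ≤
      ENNReal.ofReal B * μ O +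
        ENNReal.ofReal (Real.exp (-(N / 2 : ℝ)) * (1 - Real.exp (-(1 / 2)))⁻¹) := by
    refine (ENNReal.tsum_biUnion_le_tsum
      (fun A : Set M => ENNReal.ofReal (Real.negMulLog (μ.real A))) (Ioi N)
      (S.cells σ)).trans ((ENNReal.tsum_le_tsum hterm).trans ?_)
    rw [ENNReal.tsum_add, ENNReal.tsum_mul_left]
    refine add_le_add (mul_le_mul_right (hT.tower μ hμ N hN.le) _) (tsum_exp_tail_le N)
  refine hsum.trans ?_
  have h0 : 0 < 1 - Real.exp (-(1 / 2)) := sub_pos.2 exp_neg_half_lt_one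
  rw [← ofReal_measureReal (μ := μ) (s := O), ← ENNReal.ofReal_mul hB0,
    ← ENNReal.ofReal_add (by positivity) (by positivity)]
  refine ENNReal.ofReal_le_ofReal ?_
  have h2 : 2 / K₀ * (A₀ / N) * μ.real O ≤ 2 / K₀ * (A₀ / N) :=
    mul_le_of_le_one_right (by positivity) measureReal_le_one
  rw [hB, tailError, add_mul]
  linarith

/-- The exponent separates into a part linear in $n$, which depends only on `K₁` and `L`, and a
constant that contains `β`; only the former enters $L_2$. -/
theorem one_add_div_radius_le (hL₀ : 0 < c.L₀) (hL : 1 < c.L) (hβ : 0 < c.β) (hK₁ : 0 ≤ c.K₁)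
    {P : ℝ} (hP : 0 ≤ P) (n : ℕ) : 1 + P / c.radius n ≤
      Real.exp ((c.K₁ * Real.log c.L + 1) * n + (Real.log (1 + P / (c.β * c.L₀)) + 1)) := by
  have hlog : 0 < Real.log c.L := Real.log_pos hL
  set E := Real.exp ((c.K₁ * Real.log c.L + 1) * n + 1) with hE
  have hE1 : 1 ≤ E := Real.one_le_exp (by positivity)
  have hr : c.radius n = c.β * c.L₀ * E⁻¹ := by
    rw [Params.radius, Real.rpow_def_of_pos (by linarith), hE, ← Real.exp_neg]
    have : -((c.K₁ * Real.log c.L + 1) * n + 1) =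
      Real.log c.L * -(c.K₁ * n) + -((n : ℝ) + 1) := by ring
    rw [this, Real.exp_add]
    ring
  have hQ : 0 ≤ P / (c.β * c.L₀) := by positivity
  have h1 : P / c.radius n = P / (c.β * c.L₀) * E := by
    rw [hr]; field_simp
  rw [h1, show (c.K₁ * Real.log c.L + 1) * n + (Real.log (1 + P / (c.β * c.L₀)) + 1) =
    Real.log (1 + P / (c.β * c.L₀)) + ((c.K₁ * Real.log c.L + 1) * n + 1) by ring, Real.exp_add,
    Real.exp_log (by positivity), add_mul, one_mul]
  linarith

theorem radius_pos (hL₀ : 0 < c.L₀) (hL : 1 < c.L) (hβ : 0 < c.β) (n : ℕ) : 0 < c.radius n := by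
  have : 0 < c.L := by linarith
  unfold Params.radius
  positivity

theorem joinFamily_congr {ι : Type*} {s : Set ι} {F G : ι → Set (Set M)}
    (h : ∀ i ∈ s, F i = G i) : joinFamily s F = joinFamily s G := by
  ext A
  constructor <;> rintro ⟨f, hf, rfl⟩
  · exact ⟨f, fun i hi => h i hi ▸ hf i hi, rfl⟩
  · exact ⟨f, fun i hi => (h i hi).symm ▸ hf i hi, rfl⟩

theorem Choices.ncard_slab_le_exp [CompactSpace M] (S : Choices Y p c) (hσ : σ ∈ sing Y)
    {cc k r₁ l₀ l₁ P : ℝ} {e : OpenPartialHomeomorph (EuclideanSpace ℝ (Fin d)) M}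
    {Ps Pu : EuclideanSpace ℝ (Fin d) →L[ℝ] EuclideanSpace ℝ (Fin d)}
    (h : LocalModel Y σ (p σ) cc k r₁ l₀ l₁ P e Ps Pu) (hr0 : 0 < c.r) (hr : c.r ≤ r₁)
    (hL₀ : 0 < c.L₀) (hL : 1 < c.L) (hβ : 0 < c.β) (hK₁ : 0 ≤ c.K₁) (hP : 0 ≤ P) {n : ℕ}
    (hn : n > c.n₀) :
    ((S.slab σ n).ncard : ℝ) ≤ Real.exp (d * (c.K₁ * Real.log c.L + 1) * n +
      d * (Real.log (1 + P / (c.β * c.L₀)) + 1)) := by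
  have hs := h.saddle c.r hr0 hr
  have hnet : (S.net σ n : Set M) ⊆ e '' splitBox (p σ) Ps Pu r₁ := by
    refine (S.net_max σ hσ n hn).1.trans (Subset.trans ?_ (image_mono (splitBox_mono hr)))
    -- The net lies in the closure of the layer only, but the box is compact, so the net lies in it
    -- and the packing bound applies.
    refine closure_minimal (fun x hx => ?_) hs.fwd.isCompact.isClosed
    exact ((h.mem_crossSection hr).1 hx.1).1
  have h1 := h.pack _ (radius_pos hL₀ hL hβ n) _ hnet (S.net_max σ hσ n hn).2.1
  have h2 : ((S.slab σ n).ncard : ℝ) ≤ (S.net σ n).card := by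
    exact_mod_cast S.ncard_slab_le hσ hn (radius_pos hL₀ hL hβ n)
  refine h2.trans (h1.trans ?_)
  have h3 := one_add_div_radius_le hL₀ hL hβ hK₁ hP n
  have h4 : 0 ≤ 1 + P / c.radius n := by have := radius_pos hL₀ hL hβ n; positivity
  refine (pow_le_pow_left₀ h4 h3 d).trans (le_of_eq ?_)
  rw [← Real.exp_nat_mul]
  congr 1
  ring

theorem Choices.entropy_estimate [CompactSpace M] [BorelSpace M] (S : Choices Y p c)
    (hfin : (sing Y).Finite) (hT : ∀ σ ∈ sing Y, TowerFacts Y σ (p σ) c.r K₀ c.n₀)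
    (hK₀ : 0 < K₀) {A₀ A₁ : ℝ} (hA₀ : 0 ≤ A₀)
    (hA₁ : 0 ≤ A₁) {N : ℕ} (hN : c.n₀ < N) (h1 : ∀ m > c.n₀, 1 ≤ K₀ * m)
    (hcard : ∀ σ ∈ sing Y, ∀ m > c.n₀, ((S.slab σ m).ncard : ℝ) ≤ Real.exp (A₁ * m + A₀))
    {n : ℕ} (hn : (sing Y).ncard ≤ n) (μ : Measure M)
    [IsProbabilityMeasure μ] (hμ : IsInvariant Y μ) :
    (S.partN N).Finite ∧ dynEntropy μ (flow Y 1) S.part ≠ ⊤ ∧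
      (dynEntropy μ (flow Y 1) S.part).toReal
        - 2 / K₀ * (A₁ + 1) * ∑ᶠ σ ∈ sing Y, μ.real (orbitRegion Y σ (p σ) c.r N)
        - n * tailError K₀ A₀ N ≤ (dynEntropy μ (flow Y 1) (S.partN N)).toReal ∧
      dynEntropy μ (flow Y 1) (S.partN N) ≤ dynEntropy μ (flow Y 1) S.part := by
  have hpart : S.part = joinTwo S.regPart
      (joinFamily (sing Y) fun s => S.head N s ∪ S.tail N s) := by
    rw [Choices.part]
    congr 2
    funext s
    exact (S.head_union_tail hN s).symm
  have hpartN : S.partN N = joinTwo S.regPart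
      (joinFamily (sing Y) fun s => S.head N s ∪ {⋃₀ S.tail N s}) := by
    rw [Choices.partN]
    congr 1
    exact joinFamily_congr fun σ hσ => S.localPartN_eq hN hσ
  have hregf : S.regPart.Finite := S.reg_part.1.insert _
  obtain ⟨hb, hba, hab⟩ := dynEntropy_merge (hμ 1) hfin S.isCountablePartition_regPart hregf
    (F := S.head N) (T := S.tail N) (fun σ hσ => S.finite_head hσ)
    (fun σ hσ => by
      rw [S.head_union_tail hN]; exact S.isCountablePartition_localPart hσ (hT σ hσ))
    (fun σ hσ A hA B hB => S.head_disjoint_tail hN hσ (hT σ hσ) hA hB)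
  rw [← hpartN] at hb hba hab
  rw [← hpart] at hba hab
  set R : M → ℝ := fun σ => 2 / K₀ * (A₁ + 1) * μ.real (orbitRegion Y σ (p σ) c.r N) +
    tailError K₀ A₀ N with hR
  have hR0 : ∀ σ, 0 ≤ R σ := fun σ =>
    add_nonneg (mul_nonneg (by positivity) measureReal_nonneg) (tailError_nonneg hK₀ hA₀ N)
  have hsum : dynEntropy μ (flow Y 1) S.part ≤ dynEntropy μ (flow Y 1) (S.partN N) +
      ENNReal.ofReal (∑ σ ∈ hfin.toFinset, R σ) := by
    refine hab.trans (add_le_add le_rfl ?_)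
    rw [ENNReal.ofReal_sum_of_nonneg fun σ _ => hR0 σ]
    refine Finset.sum_le_sum fun σ hσ => ?_
    have hσ := hfin.mem_toFinset.1 hσ
    exact S.tail_entropy_le hσ (hT σ hσ) hK₀ hA₀ hA₁ hN h1 (hcard σ hσ) μ hμ
  have hfinite : dynEntropy μ (flow Y 1) (S.partN N) +
      ENNReal.ofReal (∑ σ ∈ hfin.toFinset, R σ) ≠ ⊤ :=
    ENNReal.add_ne_top.2 ⟨hb, ENNReal.ofReal_ne_top⟩
  refine ⟨?_, ne_top_of_le_ne_top hfinite hsum, ?_, hba⟩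
  · rw [hpartN]
    refine finite_joinTwo hregf (finite_joinFamily hfin fun σ hσ => ?_)
    exact (S.finite_head hσ).union (finite_singleton _)
  · have h2 := ENNReal.toReal_mono hfinite hsum
    rw [ENNReal.toReal_add hb ENNReal.ofReal_ne_top,
      ENNReal.toReal_ofReal (Finset.sum_nonneg fun σ _ => hR0 σ)] at h2
    rw [finsum_mem_eq_finite_toFinset_sum _ hfin]
    rw [hR, Finset.sum_add_distrib, ← Finset.mul_sum, Finset.sum_const, nsmul_eq_mul,
      ← ncard_eq_toFinset_card _ hfin] at h2
    have h3 : ((sing Y).ncard : ℝ) * tailError K₀ A₀ N ≤ n * tailError K₀ A₀ N :=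
      mul_le_mul_of_nonneg_right (by exact_mod_cast hn) (tailError_nonneg hK₀ hA₀ N)
    linarith

end TailEntropy

end SingularFlow

end

/-! ### Assembly of the constants -/

theorem theorem8p1 {d : ℕ} {M : Type*} [EMetricSpace M] [CompactSpace M]
    [ChartedSpace (EuclideanSpace ℝ (Fin d)) M] [IsManifold (𝓡 d) ∞ M]
    [RiemannianBundle (fun x : M => TangentSpace (𝓡 d) x)]
    [IsContMDiffRiemannianBundle (𝓡 d) ∞ (EuclideanSpace ℝ (Fin d))
      (fun x : M => TangentSpace (𝓡 d) x)]
    [IsRiemannianManifold (𝓡 d) M] [MeasurableSpace M] [BorelSpace M]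
    (X : SingularFlow.VField d M) (hX : SingularFlow.AllHyperbolic X)
    (C lam : ℝ) (hC : 0 < C) (hlam : 0 < lam) :
    ∃ U ∈ 𝓝 X, ∃ r₁ L₀ L₁ K₀ K₁ : ℝ, ∃ nmin : ℝ → ℕ,
      0 < r₁ ∧ 0 < L₀ ∧ L₀ < L₁ ∧ 0 < K₀ ∧ K₀ < K₁ ∧
      -- the singularities stay hyperbolic, and finite in number, near `X`
      (∀ Y ∈ U, SingularFlow.AllHyperbolic Y ∧ (SingularFlow.sing Y).Finite) ∧
      -- the meaning of the constants `L₀`, `L₁`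
      (∀ Y ∈ U, ∀ σ ∈ SingularFlow.sing Y, ∀ q, SingularFlow.IsAdapted C lam Y σ q →
        ∀ x ∈ closure (SingularFlow.box Y σ q r₁),
          L₀ * (edist x σ).toReal ≤ SingularFlow.speed Y x ∧
          SingularFlow.speed Y x ≤ L₁ * (edist x σ).toReal) ∧
      -- the meaning of the constants `K₀`, `K₁`
      (∀ r, 0 < r → r ≤ r₁ →
        ∀ Y ∈ U, ∀ σ ∈ SingularFlow.sing Y, ∀ q, SingularFlow.IsAdapted C lam Y σ q →
        ∀ n > nmin r, ∀ x ∈ SingularFlow.layer Y σ q r n,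
          SingularFlow.tPlus Y σ q r x ∈ Icc (K₀ * n) (K₁ * n) ∧
          SingularFlow.tMinus Y σ q r x ∈ Icc (K₀ * n) (K₁ * n)) ∧
      -- the entropy estimate
      ∀ L : ℝ, 1 < L → ∃ L₂ : ℝ, 0 < L₂ ∧
        ∀ r, 0 < r → r ≤ r₁ → ∀ n₀ ≥ nmin r, ∀ β : ℝ, 0 < β →
          ∃ u : ℕ → ℝ, Tendsto u atTop (𝓝 0) ∧
            ∀ Y ∈ U, ∀ p : M → Seminorm ℝ (EuclideanSpace ℝ (Fin d)),
              (∀ σ ∈ SingularFlow.sing Y, SingularFlow.IsAdapted C lam Y σ (p σ)) →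
              ∀ S : SingularFlow.Choices Y p ⟨r, n₀, L₀, K₁, L, β⟩,
              ∀ μ : Measure M, IsProbabilityMeasure μ → SingularFlow.IsInvariant Y μ →
              ∀ N > n₀,
                (S.partN N).Finite ∧
                SingularFlow.dynEntropy μ (SingularFlow.flow Y 1) S.part ≠ ⊤ ∧
                (SingularFlow.dynEntropy μ (SingularFlow.flow Y 1) S.part).toReal
                    - L₂ * ∑ᶠ σ ∈ SingularFlow.sing Y,
                        μ.real (SingularFlow.orbitRegion Y σ (p σ) r N)
                    - u N
                  ≤ (SingularFlow.dynEntropy μ (SingularFlow.flow Y 1) (S.partN N)).toReal ∧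
                SingularFlow.dynEntropy μ (SingularFlow.flow Y 1) (S.partN N)
                  ≤ SingularFlow.dynEntropy μ (SingularFlow.flow Y 1) S.part := by
  obtain ⟨U, hU, k, r₁, L₀, L₁, P, m, hk, hr₁, hL₀, hL₀₁, hP, H⟩ :=
    SingularFlow.exists_globalModel X hX hC hlam
  set K₀ : ℝ := 1 / (2 * k) with hK₀
  -- The exit time bound is $2/c$ with $c=\lambda/2$; adding `K₀` only serves to make `K₀ < K₁`
  -- strict.
  set K₁ : ℝ := 2 / (lam / 2) + K₀ with hK₁
  have hK₀0 : 0 < K₀ := by positivity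
  have hK₀₁ : K₀ < K₁ := by
    have : 0 < 2 / (lam / 2) := by positivity
    linarith
  -- The threshold of `towerFacts`; its term $2k$ is $1/K_0$, so that $K_0n\ge1$ beyond it.
  set nmin : ℝ → ℕ := fun r => ⌈2 * (1 + |Real.log r|) + 2 * k⌉₊ with hnmin
  have hmin : ∀ r, ∀ n ≥ nmin r, 2 * (1 + |Real.log r|) + 2 * k ≤ (n : ℝ) := fun r n hn =>
    (Nat.le_ceil _).trans (by exact_mod_cast hn)
  refine ⟨U, hU, r₁, L₀, L₁, K₀, K₁, nmin, hr₁, hL₀, hL₀₁, hK₀0, hK₀₁,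
    fun Y hY => ⟨(H Y hY).1, (H Y hY).2.1⟩, ?_, ?_, ?_⟩
  · intro Y hY σ hσ q hq x hx
    obtain ⟨e, Ps, Pu, h⟩ := (H Y hY).2.2.2 σ hσ q hq
    refine h.speed x (closure_minimal (fun y hy => ?_)
      (h.saddle r₁ hr₁ le_rfl).fwd.isCompact.isClosed hx)
    exact ((h.mem_box le_rfl le_rfl).1 hy).1
  · intro r hr0 hr Y hY σ hσ q hq n hn x hx
    obtain ⟨e, Ps, Pu, h⟩ := (H Y hY).2.2.2 σ hσ q hq
    have h1 := hmin r n (le_of_lt hn)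
    obtain ⟨h2, h3⟩ := h.times hr0 hr (by linarith) hx
    have h4 : 2 / (lam / 2) * n ≤ K₁ * n :=
      mul_le_mul_of_nonneg_right (by linarith) (Nat.cast_nonneg n)
    exact ⟨⟨h2.1, h2.2.trans h4⟩, ⟨h3.1, h3.2.trans h4⟩⟩
  · intro L hL
    have hlog := Real.log_pos hL
    set A₁ : ℝ := d * (K₁ * Real.log L + 1) with hA₁
    have hK₁0 : 0 < K₁ := hK₀0.trans hK₀₁
    have hA₁0 : 0 ≤ A₁ := by positivity
    -- `A₁` involves only `d`, `K₁` and `L`, so $L_2$ is fixed before $r$, $n_0$ and $\beta$; these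
    -- may influence only `u`.
    refine ⟨2 / K₀ * (A₁ + 1), by positivity, fun r hr0 hr n₀ hn₀ β hβ => ?_⟩
    set A₀ : ℝ := d * (Real.log (1 + P / (β * L₀)) + 1) with hA₀
    have hA₀0 : 0 ≤ A₀ := by
      have : 0 ≤ Real.log (1 + P / (β * L₀)) :=
        Real.log_nonneg (le_add_of_nonneg_right (by positivity))
      positivity
    refine ⟨fun N => m * SingularFlow.tailError K₀ A₀ N, ?_, ?_⟩
    · simpa using (SingularFlow.tendsto_tailError K₀ A₀).const_mul (m : ℝ)
    intro Y hY p hp S μ hμ hinv N hN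
    obtain ⟨-, hfin, hm, hloc⟩ := H Y hY
    refine S.entropy_estimate hfin (fun σ hσ => ?_) hK₀0 hA₀0 hA₁0 hN (fun n hn => ?_)
      (fun σ hσ n hn => ?_) hm μ hinv
    · obtain ⟨e, Ps, Pu, h⟩ := hloc σ hσ (p σ) (hp σ hσ)
      exact h.towerFacts hr0 hr (hmin r n₀ hn₀)
    · have h1 := hmin r n ((show nmin r ≤ n₀ from hn₀).trans (le_of_lt hn))
      have h2 := abs_nonneg (Real.log r)
      rw [hK₀, div_mul_eq_mul_div, one_mul, le_div_iff₀ (by positivity)]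
      linarith
    · obtain ⟨e, Ps, Pu, h⟩ := hloc σ hσ (p σ) (hp σ hσ)
      exact S.ncard_slab_le_exp hσ h hr0 hr hL₀ hL hβ hK₁0.le hP.le hn
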